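/- Let $k\ge 2$ and let $V\subset(\mathbb C^{2k-1},0)$ be the germ at $0$ of the image of the minimal cross cap mapping of multiplicity $k$, $$\varphi_k:(\mathbb C^{2k-2},0)\to(\mathbb C^{2k-1},0),\qquad \varphi_k(u_1,\dots,u_{k-2},v_1,\dots,v_{k-1},y)=\Bigl(u_1,\dots,u_{k-2},v_1,\dots,v_{k-1},\,y^k+\sum_{i=1}^{k-2}u_iy^i,\ \sum_{i=1}^{k-1}v_iy^i\Bigr),$$ and write $U_1,\dots,U_{k-2},V_1,\dots,V_{k-1},W_1,W_2$ for the coordinates of the target. For a complex analytic map germ $h:(\mathbb C^{p},0)\to(\mathbb C^q,0)$, $p=2k-1$, let $\theta(h)\cong\mathcal O_p^{\,q}$ be the module of vector fields along $h$, let $\Theta_V$ be the module of analytic vector field germs on $(\mathbb C^p,0)$ that integrate to biholomorphisms of $(\mathbb C^p,0)$ preserving $V$, and define the ${}_V\mathcal K_e$-codimension of $h$ as $$\dim_{\mathbb C}\ \theta(h)\big/\bigl(\{\xi(h)\mid \xi\in\Theta_V\}+h^*(\mathfrak m_q)\theta(h)\bigr).$$ Two germs $h,\tilde h:(\mathbb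 C^p,0)\to(\mathbb C^q,0)$ are ${}_V\mathcal K$-equivalent if there are germs of biholomorphisms $\Psi$ of $(\mathbb C^p\times\mathbb C^q,0)$ and $\psi$ of $(\mathbb C^p,0)$ such that $\Psi$ lies over $\psi$, $\Psi(x,0)=(\psi(x),0)$, $\Psi(\operatorname{graph} h)=\operatorname{graph}\tilde h$ and $\psi(V)=V$. A germ $h$ is $r$-${}_V\mathcal K$-determined if every analytic germ with the same $r$-jet at $0$ is ${}_V\mathcal K$-equivalent to $h$. Suppose that $h:(\mathbb C^{2k-1},0)\to(\mathbb C^q,0)$ has ${}_V\mathcal K_e$-codimension $2$. Then $q\le 2$. (a) If $q=1$, then $h$ is ${}_V\mathcal K$-equivalent to one of the following functions, all of which are $2$-${}_V\mathcal K$-determined: (i) $U_{k-2}+V_{k-1}^2$, $k\ge 3$; (ii) $V_{k-1}+U_{k-3}+U_{k-2}^2$, $k\ge 4$; (iii) $V_2+W_1$, $k=3$; (iv) $V_1+W_1^2$, $k=2$; (v) $W_1+V_1^2$, $k=2$. (b) If $q=2$, then $h$ is ${}_V\mathcal K$-equivalent to one of the following maps, all of which are $2$-${}_V\mathcal K$-determined: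 (i) $(V_1,W_1)$, $k=2$; (ii) $(U_1,V_2+W_1)$, $k=3$; (iii) $(U_2,\,U_1+V_3+W_1)$, $k=4$. In particular, no such $h$ with $q=2$ exists for $k\ge 5$. -/

import Mathlib

open Filter Topology

noncomputable section

namespace CrossCap

/-! ### Analytic germs at the origin -/

section Germs

variable (E : Type*) [NormedAddCommGroup E] [NormedSpace ℂ E]

/-- The algebra of functions on `E` that are analytic at `0`: the representatives of germs. -/
def AnalyticFun : Subalgebra ℂ (E → ℂ) where
  carrier := {f | AnalyticAt ℂ f 0}
  mul_mem' hf hg := AnalyticAt.mul hf hg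
  add_mem' hf hg := AnalyticAt.add hf hg
  algebraMap_mem' _ := analyticAt_const

/-- The functions whose germ at `0` is zero. -/
def nullIdeal : Ideal (AnalyticFun E) where
  carrier := {f | ∀ᶠ x in 𝓝 (0 : E), f.1 x = 0}
  zero_mem' := Eventually.of_forall fun _ => rfl
  add_mem' := by
    intro a b ha hb
    filter_upwards [ha, hb] with x h1 h2
    change a.1 x + b.1 x = 0
    rw [h1, h2, add_zero]
  smul_mem' := by
    intro c a ha
    filter_upwards [ha] with x h1
    change c.1 x * a.1 x = 0
    rw [h1, mul_zero]

/-- The local ring of germs at `0` of analytic functions on `E`. -/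
def AnGerm : Type _ := AnalyticFun E ⧸ nullIdeal E

instance : CommRing (AnGerm E) := inferInstanceAs (CommRing (AnalyticFun E ⧸ nullIdeal E))

instance : Algebra ℂ (AnGerm E) := inferInstanceAs (Algebra ℂ (AnalyticFun E ⧸ nullIdeal E))

variable {E}

/-- The germ at `0` of an analytic function. -/
def germ (f : E → ℂ) (hf : AnalyticAt ℂ f 0) : AnGerm E :=
  Ideal.Quotient.mk (nullIdeal E) ⟨f, hf⟩

/-- The germ at `0` of an analytic `ℂ^q`-valued map, as an element of the free module of rank `q`
over the ring of germs. For a map `h` into `ℂ^q`, this free module is `θ(h)`, the module of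
vector fields along `h`. -/
def vecGerm {q : ℕ} (w : E → Fin q → ℂ) (hw : AnalyticAt ℂ w 0) : Fin q → AnGerm E :=
  fun j => germ (fun x => w x j) (analyticAt_pi_iff.1 hw j)

/-- The derivative `ξ(h)` of an analytic map along an analytic vector field is analytic. -/
theorem analyticAt_fderiv_apply {q : ℕ} {h : E → Fin q → ℂ} (hh : AnalyticAt ℂ h 0)
    {ξ : E → E} (hξ : AnalyticAt ℂ ξ 0) :
    AnalyticAt ℂ (fun x => fderiv ℂ h x (ξ x)) 0 :=
  ((ContinuousLinearMap.id ℂ (E →L[ℂ] Fin q → ℂ)).analyticAt_bilinear (fderiv ℂ h 0, ξ 0)).comp₂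
    hh.fderiv hξ

/-- `F` is the germ of a biholomorphism `(E, 0) → (E, 0)`. -/
def IsBiholGerm (F : E → E) : Prop :=
  AnalyticAt ℂ F 0 ∧ F 0 = 0 ∧
    ∃ G : E → E, AnalyticAt ℂ G 0 ∧ G 0 = 0 ∧
      (∀ᶠ x in 𝓝 (0 : E), G (F x) = x) ∧ ∀ᶠ x in 𝓝 (0 : E), F (G x) = x

/-- For a biholomorphic germ `F`, this says `F(A) = B` as germs of sets at `0`. -/
def MapsSetGerm (F : E → E) (A B : Set E) : Prop :=
  ∀ᶠ x in 𝓝 (0 : E), x ∈ A ↔ F x ∈ B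

/-- Two maps have the same `r`-jet at `0`. -/
def SameJet {F : Type*} [NormedAddCommGroup F] [NormedSpace ℂ F] (r : ℕ) (f g : E → F) : Prop :=
  ∀ i ≤ r, iteratedFDeriv ℂ i f 0 = iteratedFDeriv ℂ i g 0

/-! ### `K`-equivalences preserving a set germ -/

/-- `Ψ` is a contact equivalence between `h` and `h'`, with `ψ` the biholomorphic germ of the
source that it determines: `Ψ` is a biholomorphic germ of the product that lies over `ψ`,
preserves the zero section, and maps the graph of `h` to the graph of `h'`. -/
def IsKEquivalence {F : Type*} [NormedAddCommGroup F] [NormedSpace ℂ F]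
    (Ψ : E × F → E × F) (ψ : E → E) (h h' : E → F) : Prop :=
  IsBiholGerm Ψ ∧ IsBiholGerm ψ ∧
    (∀ᶠ z in 𝓝 (0 : E × F), (Ψ z).1 = ψ z.1) ∧
    (∀ᶠ x in 𝓝 (0 : E), Ψ (x, 0) = (ψ x, 0)) ∧
    MapsSetGerm Ψ {z | z.2 = h z.1} {z | z.2 = h' z.1}

/-- `_V K`-equivalence: contact equivalence whose source biholomorphism preserves the germ of
`V` at `0`. -/
def VKEquiv {F : Type*} [NormedAddCommGroup F] [NormedSpace ℂ F]
    (V : Set E) (h h' : E → F) : Prop :=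
  ∃ (Ψ : E × F → E × F) (ψ : E → E), IsKEquivalence Ψ ψ h h' ∧ MapsSetGerm ψ V V

/-- `h` is `r`-`_V K`-determined: every analytic map germ with the same `r`-jet is
`_V K`-equivalent to it. -/
def VKDetermined {F : Type*} [NormedAddCommGroup F] [NormedSpace ℂ F]
    (V : Set E) (r : ℕ) (h : E → F) : Prop :=
  ∀ g : E → F, AnalyticAt ℂ g 0 → SameJet r h g → VKEquiv V h g

/-! ### Vector fields preserving a set germ, tangent space and codimension -/

/-- `ξ ∈ Θ_V`: the analytic vector field germ `ξ` integrates to a local flow `Φ` of biholomorphic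
germs of `(E, 0)` that preserves the germ of `V`. -/
def IsThetaV (V : Set E) (ξ : E → E) : Prop :=
  AnalyticAt ℂ ξ 0 ∧
    ∃ Φ : ℂ × E → E, AnalyticAt ℂ Φ 0 ∧
      (∀ᶠ x in 𝓝 (0 : E), Φ (0, x) = x) ∧
      (∀ᶠ z in 𝓝 (0 : ℂ × E), HasDerivAt (fun t => Φ (t, z.2)) (ξ (Φ z)) z.1) ∧
      (∀ᶠ t in 𝓝 (0 : ℂ), Φ (t, 0) = 0) ∧
      ∀ᶠ z in 𝓝 (0 : ℂ × E), z.2 ∈ V ↔ Φ z ∈ V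

/-- The ideal `h^*(m_q)`, generated by the germs `g ∘ h` with `g` in the maximal ideal. -/
def pullbackMax {q : ℕ} (h : E → Fin q → ℂ) : Ideal (AnGerm E) :=
  Ideal.span {a | ∃ g : (Fin q → ℂ) → ℂ, AnalyticAt ℂ g 0 ∧ g 0 = 0 ∧
    ∃ hgh : AnalyticAt ℂ (fun x => g (h x)) 0, a = germ (fun x => g (h x)) hgh}

/-- The extended tangent space `T_V K_e(h) = {ξ(h) | ξ ∈ Θ_V} + h^*(m_q) θ(h)`. (`Θ_V` is a module
over the ring of germs for analytic `V`, so the span only records the module structure.) -/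
def tangentVKe (V : Set E) {q : ℕ} (h : E → Fin q → ℂ) (hh : AnalyticAt ℂ h 0) :
    Submodule (AnGerm E) (Fin q → AnGerm E) :=
  Submodule.span (AnGerm E)
      {ν | ∃ (ξ : E → E) (hξ : IsThetaV V ξ),
        ν = vecGerm (fun x => fderiv ℂ h x (ξ x)) (analyticAt_fderiv_apply hh hξ.1)} ⊔
    pullbackMax h • (⊤ : Submodule (AnGerm E) (Fin q → AnGerm E))

/-- The `_V K_e`-codimension `dim_ℂ θ(h) / T_V K_e(h)`, as a cardinal. -/
def codimVKe (V : Set E) {q : ℕ} (h : E → Fin q → ℂ) (hh : AnalyticAt ℂ h 0) : Cardinal :=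
  Module.rank ℂ ((Fin q → AnGerm E) ⧸ tangentVKe V h hh)

end Germs

/-! ### The minimal cross cap -/

/-- The source `ℂ^(2k-2)` (for `k ≥ 2`), with coordinates `u_1, …, u_(k-2)`,
`v_1, …, v_(k-1)` and `y`. -/
abbrev Source (k : ℕ) : Type := Fin (k - 2) ⊕ Fin (k - 1) ⊕ Fin 1 → ℂ

/-- The target `ℂ^(2k-1)` (for `k ≥ 2`), with coordinates `U_1, …, U_(k-2)`,
`V_1, …, V_(k-1)` and `W_1, W_2`. -/
abbrev Target (k : ℕ) : Type := Fin (k - 2) ⊕ Fin (k - 1) ⊕ Fin 2 → ℂ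

/-- The minimal cross cap mapping `φ_k` of multiplicity `k`. The coordinate `u_i` is stored at
index `i - 1`, and similarly for `v_i`. -/
def phi (k : ℕ) (x : Source k) : Target k :=
  let u : Fin (k - 2) → ℂ := fun i => x (Sum.inl i)
  let v : Fin (k - 1) → ℂ := fun i => x (Sum.inr (Sum.inl i))
  let y : ℂ := x (Sum.inr (Sum.inr 0))
  Sum.elim u (Sum.elim v
    ![y ^ k + ∑ i, u i * y ^ (i.val + 1), ∑ i, v i * y ^ (i.val + 1)])

/-- The image of the minimal cross cap mapping (only its germ at `0` matters). -/
def image (k : ℕ) : Set (Target k) := Set.range (phi k)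

/-- The coordinate `U_i`, `1 ≤ i ≤ k - 2` (and `0` for other `i`). -/
def U {k : ℕ} (i : ℕ) (X : Target k) : ℂ :=
  if hi : 1 ≤ i ∧ i ≤ k - 2 then X (Sum.inl ⟨i - 1, by omega⟩) else 0

/-- The coordinate `V_i`, `1 ≤ i ≤ k - 1` (and `0` for other `i`). -/
def V {k : ℕ} (i : ℕ) (X : Target k) : ℂ :=
  if hi : 1 ≤ i ∧ i ≤ k - 1 then X (Sum.inr (Sum.inl ⟨i - 1, by omega⟩)) else 0

/-- The coordinate `W_1`. -/
def W₁ {k : ℕ} (X : Target k) : ℂ := X (Sum.inr (Sum.inr 0))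

/-- The list of normal forms for `q = 1`. -/
def IsNormalFormOne (k : ℕ) (g : Target k → Fin 1 → ℂ) : Prop :=
  (3 ≤ k ∧ g = fun X => ![U (k - 2) X + V (k - 1) X ^ 2]) ∨
  (4 ≤ k ∧ g = fun X => ![V (k - 1) X + U (k - 3) X + U (k - 2) X ^ 2]) ∨
  (k = 3 ∧ g = fun X => ![V 2 X + W₁ X]) ∨
  (k = 2 ∧ g = fun X => ![V 1 X + W₁ X ^ 2]) ∨
  (k = 2 ∧ g = fun X => ![W₁ X + V 1 X ^ 2])

/-- The list of normal forms for `q = 2`. -/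
def IsNormalFormTwo (k : ℕ) (g : Target k → Fin 2 → ℂ) : Prop :=
  (k = 2 ∧ g = fun X => ![V 1 X, W₁ X]) ∨
  (k = 3 ∧ g = fun X => ![U 1 X, V 2 X + W₁ X]) ∨
  (k = 4 ∧ g = fun X => ![U 2 X, U 1 X + V 3 X + W₁ X])

end CrossCap

end

set_option linter.unusedSectionVars false

open Finset ContinuousLinearMap Asymptotics

namespace CrossCap

noncomputable section

local notation "Hol" => AnalyticAt ℂ
local notation "𝒟" => fderiv ℂ

variable {k : ℕ} {E F : Type*} [NormedAddCommGroup E] [NormedSpace ℂ E] [NormedAddCommGroup F]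
  [NormedSpace ℂ F] {ξ : Target k → Target k} {h g κ : Target k → ℂ}

/-- The power series of the divided difference of the function with power series `p`. -/
def divDiffSeries (p : FormalMultilinearSeries ℂ E F) :
    FormalMultilinearSeries ℂ (E × E) (E →L[ℂ] F) := fun n =>
  ∑ i : Fin (n + 1), ((p (n + 1)).curryMid i).flipMultilinear.compContinuousLinearMap
    fun j : Fin n => if (j : ℕ) < i then fst ℂ E E
      else snd ℂ E E

theorem norm_divDiffSeries_le (p : FormalMultilinearSeries ℂ E F) (n : ℕ) :
    ‖divDiffSeries p n‖ ≤ (n + 1) * ‖p (n + 1)‖ := by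
  have hsum : ∀ f : Fin (n + 1) → ContinuousMultilinearMap ℂ (fun _ : Fin n => E × E) (E →L[ℂ] F),
      (∀ i, ‖f i‖ ≤ ‖p (n + 1)‖) → ‖∑ i, f i‖ ≤ (n + 1) * ‖p (n + 1)‖ := by
    intro f hf
    refine ContinuousMultilinearMap.opNorm_le_bound (by positivity) fun m => ?_
    rw [_root_.sum_apply]
    refine (norm_sum_le _ _).trans ?_
    refine (sum_le_card_nsmul _ _ (‖p (n + 1)‖ * ∏ i, ‖m i‖) fun i _ => ?_).trans
      (by simp [mul_assoc])
    exact ((f i).le_opNorm m).trans (by gcongr; exact hf i)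
  refine hsum _ fun i => ?_
  refine (ContinuousMultilinearMap.norm_compContinuousLinearMap_le _ _).trans ?_
  have h1 : ‖((p (n + 1)).curryMid i).flipMultilinear‖ ≤ ‖p (n + 1)‖ := by
    refine ContinuousMultilinearMap.opNorm_le_bound (norm_nonneg _) fun m => ?_
    refine opNorm_le_bound _ (by positivity) fun x => ?_
    simp only [flipMultilinear_apply_apply]
    have := ((p (n + 1)).curryMid i x).le_opNorm m
    refine this.trans ?_
    have h2 := ((p (n + 1)).curryMid i).le_opNorm x
    rw [ContinuousMultilinearMap.norm_curryMid] at h2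
    calc _ ≤ (‖p (n + 1)‖ * ‖x‖) * ∏ i, ‖m i‖ := by gcongr
      _ = _ := by ring
  have h2 : ∏ j : Fin n, ‖(if (j : ℕ) < i then fst ℂ E E
      else snd ℂ E E)‖ ≤ 1 := by
    refine prod_le_one (fun _ _ => norm_nonneg _) fun j _ => ?_
    split_ifs
    · exact ContinuousLinearMap.norm_fst_le ℂ E E
    · exact ContinuousLinearMap.norm_snd_le ℂ E E
  calc _ ≤ ‖p (n + 1)‖ * 1 := by gcongr
    _ = _ := mul_one _

theorem divDiffSeries_apply (p : FormalMultilinearSeries ℂ E F) (n : ℕ) (x y : E) :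
    divDiffSeries p n (fun _ => (x, y)) (x - y) =
      p (n + 1) (fun _ => x) - p (n + 1) (fun _ => y) := by
  let m : ℕ → Fin (n + 1) → E := fun i j => if (j : ℕ) < i then x else y
  have key : ∀ i : Fin (n + 1), (((p (n + 1)).curryMid i).flipMultilinear.compContinuousLinearMap
      (fun j : Fin n => if (j : ℕ) < i then fst ℂ E E
      else snd ℂ E E)) (fun _ => (x, y)) (x - y) =
      p (n + 1) (m (i + 1)) - p (n + 1) (m i) := by
    intro i
    have e1 : m (i + 1) = Function.update (m i) i x := by
      funext j
      rcases eq_or_ne j i with rfl | hj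
      · simp [m]
      · have : (j : ℕ) ≠ i := fun h => hj (Fin.ext h)
        rw [Function.update_of_ne hj]
        simp only [m]
        congr 1
        simp; omega
    have e2 : m i = Function.update (m i) i y := by
      funext j
      rcases eq_or_ne j i with rfl | hj
      · simp [m]
      · rw [Function.update_of_ne hj]
    rw [e1]
    conv_rhs => rw [e2]
    rw [Function.update_idem, ← ContinuousMultilinearMap.map_update_sub]
    simp only [ContinuousMultilinearMap.compContinuousLinearMap_apply,
      flipMultilinear_apply_apply, ContinuousMultilinearMap.curryMid_apply]
    congr 1
    funext j
    refine Fin.succAboveCases i ?_ (fun j => ?_) j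
    · simp
    · rw [Fin.insertNth_apply_succAbove, Function.update_of_ne (Fin.succAbove_ne i j)]
      simp only [m]
      by_cases hj : (j : ℕ) < i
      · rw [Fin.succAbove_of_castSucc_lt _ _ (by simpa [Fin.lt_def] using hj)]
        simp [hj]
      · rw [Fin.succAbove_of_le_castSucc _ _ (by simpa [Fin.le_def] using hj)]
        have : ¬ ((j : ℕ) + 1 < i) := by omega
        simp [hj, this]
  simp only [divDiffSeries, _root_.sum_apply, key]
  rw [Fin.sum_univ_eq_sum_range (fun i => p (n + 1) (m (i + 1)) - p (n + 1) (m i)) (n + 1),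
    sum_range_sub (fun i => p (n + 1) (m i))]
  congr 2
  funext j
  simp only [m, j.2, if_true]

theorem radius_divDiffSeries_pos {p : FormalMultilinearSeries ℂ E F} (hp : 0 < p.radius) :
    0 < (divDiffSeries p).radius := by
  obtain ⟨r, hr0, hr⟩ := ENNReal.lt_iff_exists_nnreal_btwn.1 hp
  have hr0' : 0 < r := by exact_mod_cast hr0
  obtain ⟨C, hC, hb⟩ := p.norm_mul_pow_le_of_lt_radius hr
  have : ((r / 2 : NNReal) : ENNReal) ≤ (divDiffSeries p).radius := by
    refine FormalMultilinearSeries.le_radius_of_bound _ (C / r) fun n => ?_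
    have h1 := norm_divDiffSeries_le p n
    have h2 := hb (n + 1)
    have h3 : ((n : ℝ) + 1) ≤ 2 ^ n := by
      have := Nat.lt_two_pow_self (n := n)
      exact_mod_cast this
    have hr0'' : (0 : ℝ) < r := hr0'
    rw [NNReal.coe_div, NNReal.coe_ofNat, div_pow]
    rw [le_div_iff₀ hr0'']
    calc ‖divDiffSeries p n‖ * ((r : ℝ) ^ n / 2 ^ n) * r
        ≤ ((n + 1) * ‖p (n + 1)‖) * ((r : ℝ) ^ n / 2 ^ n) * r := by gcongr
      _ ≤ (2 ^ n * ‖p (n + 1)‖) * ((r : ℝ) ^ n / 2 ^ n) * r := by gcongr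
      _ = ‖p (n + 1)‖ * (r : ℝ) ^ (n + 1) := by field_simp; ring
      _ ≤ C := h2
  refine lt_of_lt_of_le ?_ this
  have : 0 < r / 2 := by positivity
  exact_mod_cast this

/-- Hadamard's lemma: `f x - f y = K (x, y) (x - y)` with `K` analytic. -/
theorem exists_divDiff [CompleteSpace F] {f : E → F} {a : E} (hf : Hol f a) :
    ∃ K : E × E → E →L[ℂ] F, Hol K (a, a) ∧ ∀ᶠ z in 𝓝 (a, a), f z.1 - f z.2 = K z (z.1 - z.2) := by
  obtain ⟨p, r, hp⟩ := hf
  have hpr : 0 < p.radius := hp.r_pos.trans_le hp.r_le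
  have hq := (divDiffSeries p).hasFPowerSeriesOnBall (radius_divDiffSeries_pos hpr)
  refine ⟨fun z => (divDiffSeries p).sum (z - (a, a)), ?_, ?_⟩
  · have h1 : Hol (divDiffSeries p).sum ((a, a) - (a, a) : E × E) := by
      rw [sub_self]; exact hq.analyticAt
    exact h1.comp (f := fun z : E × E => z - (a, a)) (analyticAt_id.sub analyticAt_const)
  · have m1 : ∀ᶠ z in 𝓝 ((a, a) : E × E), z.1 ∈ Metric.eball a r :=
      (continuous_fst.tendsto (a, a)).eventually (Metric.eball_mem_nhds a hp.r_pos)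
    have m2 : ∀ᶠ z in 𝓝 ((a, a) : E × E), z.2 ∈ Metric.eball a r :=
      (continuous_snd.tendsto (a, a)).eventually (Metric.eball_mem_nhds a hp.r_pos)
    have m3 : ∀ᶠ z in 𝓝 ((a, a) : E × E), z - (a, a) ∈
        Metric.eball (0 : E × E) (divDiffSeries p).radius := by
      have : Tendsto (fun z : E × E => z - (a, a)) (𝓝 (a, a)) (𝓝 0) := by
        have h : Continuous fun z : E × E => z - (a, a) := by fun_prop
        simpa using h.tendsto (a, a)
      exact this.eventually (Metric.eball_mem_nhds 0 hq.r_pos)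
    filter_upwards [m1, m2, m3] with z h1 h2 h3
    obtain ⟨x, y⟩ := z
    have s1 := hp.hasSum_sub (y := x) h1
    have s2 := hp.hasSum_sub (y := y) h2
    have s3 := s1.sub s2
    have s4 := (hasSum_nat_add_iff' 1).2 s3
    have s5 := hq.hasSum (y := (x, y) - (a, a)) h3
    have s6 : HasSum (fun n => divDiffSeries p n (fun _ => (x, y) - (a, a)) (x - y))
        ((divDiffSeries p).sum (0 + ((x, y) - (a, a))) (x - y)) :=
      (apply ℂ F (x - y)).hasSum s5
    have e : ∀ n, divDiffSeries p n (fun _ => (x, y) - (a, a)) (x - y) =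
        p (n + 1) (fun _ => x - a) - p (n + 1) (fun _ => y - a) := by
      intro n
      rw [← divDiffSeries_apply]
      simp
    simp only [e] at s6
    have := s4.unique s6
    simp only [range_one, sum_singleton, zero_add] at this
    rw [← this]
    have z0 : (p 0 fun _ => x - a) = p 0 fun _ => y - a := congrArg _ (Subsingleton.elim _ _)
    rw [z0]; simp

section Matrices

variable {a : E}
  {n : Type*}

/-- Componentwise analyticity of a family of functions. -/
abbrev PiAnalyticAt {ι : Type*} (f : E → ι → ℂ) (a : E) : Prop := ∀ i, Hol (fun x => f x i) a

/-- Entrywise analyticity of a matrix-valued function. -/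
def MatAnalyticAt {m n : Type*} (A : E → Matrix m n ℂ) (a : E) : Prop :=
  ∀ i j, Hol (fun x => A x i j) a

/-- The coordinate functions. -/
abbrev prj {ι : Type*} (l : ι) : (ι → ℂ) →L[ℂ] ℂ := proj l

theorem analyticAt_finset_sum {ι : Type*}
    {f : ι → E → F} (s : Finset ι) (h : ∀ i ∈ s, Hol (f i) a) :
    Hol (fun x => ∑ i ∈ s, f i x) a := by
  have := analyticAt_sum s h
  convert! this using 1
  funext x
  simp

theorem analyticAt_finset_prod {ι : Type*} {f : ι → E → ℂ} (s : Finset ι)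
    (h : ∀ i ∈ s, Hol (f i) a) : Hol (fun x => ∏ i ∈ s, f i x) a := by
  have := analyticAt_prod s h
  convert! this using 1
  funext x
  simp

theorem MatAnalyticAt.mul [Fintype n] {A B : E → Matrix n n ℂ} (hA : MatAnalyticAt A a)
    (hB : MatAnalyticAt B a) : MatAnalyticAt (fun x => A x * B x) a := by
  intro i j
  simp only [Matrix.mul_apply]
  exact analyticAt_finset_sum _ fun l _ => (hA i l).mul (hB l j)

theorem MatAnalyticAt.sub {A B : E → Matrix n n ℂ} (hA : MatAnalyticAt A a)
    (hB : MatAnalyticAt B a) : MatAnalyticAt (fun x => A x - B x) a := by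
  intro i j
  simp only [Matrix.sub_apply]
  exact (hA i j).sub (hB i j)

theorem MatAnalyticAt.smul {c : E → ℂ} {B : E → Matrix n n ℂ} (hc : Hol c a)
    (hB : MatAnalyticAt B a) : MatAnalyticAt (fun x => c x • B x) a := by
  intro i j
  simp only [Matrix.smul_apply, smul_eq_mul]
  exact hc.mul (hB i j)

theorem MatAnalyticAt.const (B : Matrix n n ℂ) : MatAnalyticAt (fun _ : E => B) a :=
  fun _ _ => analyticAt_const

theorem MatAnalyticAt.sum {ι : Type*} (s : Finset ι) {B : ι → E → Matrix n n ℂ}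
    (hB : ∀ i ∈ s, MatAnalyticAt (B i) a) : MatAnalyticAt (fun x => ∑ i ∈ s, B i x) a := by
  intro i j
  simp only [Matrix.sum_apply]
  exact analyticAt_finset_sum _ fun l hl => hB l hl i j

variable [Fintype n]

theorem MatAnalyticAt.mulVec {A : E → Matrix n n ℂ} {v : E → n → ℂ} (hA : MatAnalyticAt A a)
    (hv : PiAnalyticAt v a) (i : n) : Hol (fun x => (A x).mulVec (v x) i) a := by
  simp only [Matrix.mulVec, dotProduct]
  exact analyticAt_finset_sum _ fun l _ => (hA i l).mul (hv l)

theorem MatAnalyticAt.trace {A : E → Matrix n n ℂ} (hA : MatAnalyticAt A a) :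
    Hol (fun x => (A x).trace) a := by
  simp only [Matrix.trace, Matrix.diag]
  exact analyticAt_finset_sum _ fun l _ => hA l l

variable [DecidableEq n]

theorem MatAnalyticAt.pow {A : E → Matrix n n ℂ} (hA : MatAnalyticAt A a) (m : ℕ) :
    MatAnalyticAt (fun x => A x ^ m) a := by
  induction m with
  | zero => simpa using MatAnalyticAt.const (1 : Matrix n n ℂ)
  | succ m ih => simpa only [pow_succ] using ih.mul hA

theorem MatAnalyticAt.det {A : E → Matrix n n ℂ} (hA : MatAnalyticAt A a) :
    Hol (fun x => (A x).det) a := by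
  simp only [Matrix.det_apply']
  exact analyticAt_finset_sum _ fun σ _ =>
    analyticAt_const.mul (analyticAt_finset_prod _ fun i _ => hA _ _)

theorem MatAnalyticAt.adjugate {A : E → Matrix n n ℂ} (hA : MatAnalyticAt A a) :
    MatAnalyticAt (fun x => (A x).adjugate) a := by
  intro i j
  simp only [Matrix.adjugate_apply]
  refine MatAnalyticAt.det fun i' j' => ?_
  by_cases h : i' = j
  · subst h
    simp only [Matrix.updateRow_self]
    exact analyticAt_const
  · simp only [Matrix.updateRow_ne h]
    exact hA i' j'

theorem MatAnalyticAt.inv {A : E → Matrix n n ℂ} (hA : MatAnalyticAt A a)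
    (h : (A a).det ≠ 0) : MatAnalyticAt (fun x => (A x)⁻¹) a := by
  simp only [Matrix.inv_def, Ring.inverse_eq_inv']
  exact MatAnalyticAt.smul (hA.det.inv h) hA.adjugate

theorem MatAnalyticAt.charpoly_coeff {A : E → Matrix n n ℂ} (hA : MatAnalyticAt A a) (m : ℕ) :
    Hol (fun x => (A x).charpoly.coeff m) a := by
  have h : ∀ x, (A x).charpoly.coeff m =
      MvPolynomial.aeval (fun ij : n × n => A x ij.1 ij.2)
        ((Matrix.charpoly.univ ℂ n).coeff m) := by
    intro x
    have := Matrix.charpoly.univ_coeff_eval₂Hom n (algebraMap ℂ ℂ)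
      (fun ij : n × n => A x ij.1 ij.2) m
    rw [MvPolynomial.aeval_def, ← MvPolynomial.coe_eval₂Hom]
    exact this.symm
  generalize (Matrix.charpoly.univ ℂ n).coeff m = P at h
  exact (AnalyticAt.aeval_mvPolynomial (f := fun x (ij : n × n) => A x ij.1 ij.2)
    (fun ij => hA ij.1 ij.2) P).congr (.of_forall fun x => (h x).symm)

end Matrices

theorem exists_analytic_localInverse [CompleteSpace E] {f : E → F} {a : E} {e : E ≃L[ℂ] F}
    (hf : Hol f a) (he : 𝒟 f a = e) :
    ∃ g : F → E, Hol g (f a) ∧ g (f a) = a ∧ (∀ᶠ x in 𝓝 a, g (f x) = x) ∧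
      ∀ᶠ y in 𝓝 (f a), f (g y) = y := by
  have hs : HasStrictFDerivAt f (e : E →L[ℂ] F) a := he ▸ hf.hasStrictFDerivAt
  refine ⟨hs.localInverse f e a, ?_, hs.localInverse_apply_image, hs.eventually_left_inverse,
    hs.eventually_right_inverse⟩
  exact (hs.toOpenPartialHomeomorph f).analyticAt_symm' (i := e)
    hs.mem_toOpenPartialHomeomorph_source hf he

theorem exists_analytic_localInverse_of_injective [FiniteDimensional ℂ E] {f : E → E} {a : E}
    (hf : Hol f a) (he : ∀ v, 𝒟 f a v = 0 → v = 0) :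
    ∃ g : E → E, Hol g (f a) ∧ g (f a) = a ∧ (∀ᶠ x in 𝓝 a, g (f x) = x) ∧
      ∀ᶠ y in 𝓝 (f a), f (g y) = y := by
  have : CompleteSpace E := FiniteDimensional.complete ℂ E
  have hinj : Function.Injective (𝒟 f a : E →ₗ[ℂ] E) := (injective_iff_map_eq_zero _).2 he
  let e := (LinearEquiv.ofInjectiveEndo (𝒟 f a : E →ₗ[ℂ] E) hinj).toContinuousLinearEquiv
  exact exists_analytic_localInverse (e := e) hf (by ext v; rfl)

theorem isBiholGerm_of_injective [FiniteDimensional ℂ E] {f : E → E}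
    (hf : Hol f 0) (h0 : f 0 = 0) (he : ∀ v, 𝒟 f 0 v = 0 → v = 0) : IsBiholGerm f := by
  obtain ⟨g, h1, h2, h3, h4⟩ := exists_analytic_localInverse_of_injective hf he
  rw [h0] at h1 h2 h4
  exact ⟨hf, h0, g, h1, h2, h3, h4⟩

/-- Solving `G (x, s) = η` for `s`, uniformly in a small right-hand side. -/
theorem exists_implicit [FiniteDimensional ℂ E] [FiniteDimensional ℂ F] {G : E × F → F}
    {s₀ : F} (hG : Hol G (0, s₀))
    (hinj : ∀ δ, 𝒟 G (0, s₀) (0, δ) = 0 → δ = 0) {O : Set F} (hO : O ∈ 𝓝 s₀) :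
    ∃ N ∈ 𝓝 (G (0, s₀)), ∀ H : E → F, Hol H 0 → H 0 ∈ N →
      ∃ s : E → F, Hol s 0 ∧ s 0 ∈ O ∧ (H 0 = G (0, s₀) → s 0 = s₀) ∧
        ∀ᶠ x in 𝓝 0, G (x, s x) = H x := by
  let f : E × F → E × F := fun z => (z.1, G z)
  have hf : Hol f (0, s₀) := analyticAt_fst.prod hG
  have hder : 𝒟 f (0, s₀) = (fst ℂ E F).prod (𝒟 G (0, s₀)) :=
    (hasFDerivAt_fst.prodMk hG.differentiableAt.hasFDerivAt).fderiv
  obtain ⟨g, g1, g2, -, g4⟩ := exists_analytic_localInverse_of_injective hf (by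
    rintro ⟨v, δ⟩ hv
    rw [hder] at hv
    simp only [ContinuousLinearMap.prod_apply, coe_fst', Prod.mk_eq_zero] at hv
    obtain ⟨rfl, hv⟩ := hv
    rw [hinj δ hv]; rfl)
  have hfa : f (0, s₀) = (0, G (0, s₀)) := rfl
  rw [hfa] at g1 g2 g4
  have e1 : ∀ᶠ z in 𝓝 ((0 : E), G (0, s₀)), Hol g z := g1.eventually_analyticAt
  have e2 : ∀ᶠ z in 𝓝 ((0 : E), G (0, s₀)), (g z).2 ∈ O := by
    have : Tendsto (fun z => (g z).2) (𝓝 ((0 : E), G (0, s₀))) (𝓝 s₀) := by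
      have := (continuous_snd.tendsto (g (0, G (0, s₀)))).comp g1.continuousAt
      rw [g2] at this
      exact this
    exact this hO
  have e3 := ((e1.and e2).and (eventually_eventually_nhds.2 g4))
  have e4 : Tendsto (fun η : F => ((0 : E), η)) (𝓝 (G (0, s₀))) (𝓝 (0, G (0, s₀))) :=
    (Continuous.prodMk_right (0 : E)).tendsto _
  refine ⟨_, e4.eventually e3, fun H hH hH0 => ?_⟩
  obtain ⟨⟨k1, k2⟩, k3⟩ := hH0
  have hc : Hol (fun x => (x, H x)) (0 : E) := analyticAt_id.prod hH
  refine ⟨fun x => (g (x, H x)).2, ?_, k2, fun h => ?_, ?_⟩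
  · have k4 : Hol (fun x => g (x, H x)) 0 := k1.comp (f := fun x => (x, H x)) hc
    exact (analyticAt_snd (p := g (0, H 0))).comp (f := fun x => g (x, H x)) k4
  · simp only [h, g2]
  · have := hc.continuousAt.tendsto.eventually k3
    filter_upwards [this] with x hx
    have h1 : (g (x, H x)).1 = x := congrArg Prod.fst hx
    have h2 : G (g (x, H x)) = H x := congrArg Prod.snd hx
    have h3 : (x, (g (x, H x)).2) = g (x, H x) := Prod.ext h1.symm rfl
    rw [h3, h2]

section Coefficients

variable {S : Type*} [NormedAddCommGroup S]
  [NormedSpace ℂ S]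

/-- A function vanishing on `{0} × S` is linear in the first variable with analytic coefficients. -/
theorem exists_linear_coeff {F : E × S → ℂ} {s₀ : S} (hF : Hol F (0, s₀))
    (h0 : ∀ᶠ s in 𝓝 s₀, F (0, s) = 0) :
    ∃ K : E × S → E →L[ℂ] ℂ, Hol K (0, s₀) ∧ ∀ᶠ z in 𝓝 (0, s₀), F z = K z z.1 := by
  obtain ⟨K, hK, hKe⟩ := exists_divDiff hF
  have hg : Hol (fun z : E × S => (z, ((0 : E), z.2))) (0, s₀) :=
    analyticAt_id.prod (analyticAt_const.prod analyticAt_snd)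
  have hK' : Hol (fun z : E × S => K (z, ((0 : E), z.2))) (0, s₀) :=
    hK.comp (f := fun z : E × S => (z, ((0 : E), z.2))) hg
  refine ⟨fun z => (K (z, ((0 : E), z.2))).comp (inl ℂ E S), ?_, ?_⟩
  · exact (((compL ℂ E (E × S) ℂ).flip (inl ℂ E S)).analyticAt _).comp hK'
  · have h1 := hg.continuousAt.tendsto.eventually hKe
    have h2 := (continuous_snd.tendsto ((0 : E), s₀)).eventually h0
    filter_upwards [h1, h2] with z hz1 hz2
    simp only [hz2, sub_zero] at hz1
    rw [hz1]
    simp only [ContinuousLinearMap.comp_apply, inl_apply]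
    congr 1
    ext <;> simp

theorem hasDerivAt_zero_of_eq_mul {f g : ℂ → ℂ} (hg : ContinuousAt g 0)
    (h : ∀ᶠ t in 𝓝 0, f t = t * g t) : HasDerivAt f (g 0) 0 := by
  have h0 : f 0 = 0 := by simpa using h.self_of_nhds
  rw [hasDerivAt_iff_tendsto_slope_zero]
  have h1 : Tendsto g (𝓝[≠] 0) (𝓝 (g 0)) := hg.tendsto.mono_left nhdsWithin_le_nhds
  refine h1.congr' ?_
  filter_upwards [h.filter_mono nhdsWithin_le_nhds, self_mem_nhdsWithin] with t ht ht0
  have ht0 : t ≠ 0 := ht0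
  simp [ht, h0, ht0]

variable {ι : Type*} [Fintype ι] [DecidableEq ι]

theorem clm_apply_eq_sum (K : (ι → ℂ) →L[ℂ] ℂ) (x : ι → ℂ) :
    K x = ∑ l, x l * K (Pi.single l 1) := by
  conv_lhs => rw [pi_eq_sum_univ' x, map_sum]
  refine sum_congr rfl fun l _ => ?_
  rw [map_smul, smul_eq_mul]

/-- The monomials `X_l` for `l ≠ w`, and `X_w ^ 2`. -/
def sqAt (w : ι) (X : ι → ℂ) : ι → ℂ := Function.update X w (X w ^ 2)

theorem sqAt_single (w : ι) (t : ℂ) : sqAt w (Pi.single w t) = Pi.single w (t ^ 2) := by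
  ext j
  rcases eq_or_ne j w with rfl | hj
  · simp [sqAt]
  · simp [sqAt, hj]

theorem sqAt_single_of_ne {w l : ι} (h : l ≠ w) (t : ℂ) :
    sqAt w (Pi.single l t) = Pi.single l t := by
  ext j
  rcases eq_or_ne j w with rfl | hj
  · simp [sqAt, h.symm]
  · simp [sqAt, hj]

theorem exists_coordinate_coeff {F : (ι → ℂ) × S → ℂ} {s₀ : S} (hF : Hol F (0, s₀))
    (h0 : ∀ᶠ s in 𝓝 s₀, F (0, s) = 0) : ∃ G : (ι → ℂ) × S → ι → ℂ, Hol G (0, s₀) ∧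
      ∀ᶠ z in 𝓝 (0, s₀), F z = ∑ l, z.1 l * G z l := by
  classical
  obtain ⟨K, hK, hKe⟩ := exists_linear_coeff hF h0
  refine ⟨fun z l => K z (Pi.single l 1), ?_, ?_⟩
  · rw [analyticAt_pi_iff]
    intro l
    exact ((apply ℂ ℂ (Pi.single l 1 : ι → ℂ)).analyticAt _).comp hK
  · filter_upwards [hKe] with z hz
    rw [hz, clm_apply_eq_sum]

/-- The tendency of the coordinate slices of `F` determines the coefficients at `0`. -/
theorem hasDerivAt_single_of_coeff {F : (ι → ℂ) × S → ℂ} {G : (ι → ℂ) × S → ι → ℂ} {s : S}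
    (hG : ContinuousAt G (0, s)) (h : ∀ᶠ z in 𝓝 (0, s), F z = ∑ l, z.1 l * G z l) (l : ι) :
    HasDerivAt (fun t => F (Pi.single l t, s)) (G (0, s) l) 0 := by
  have hc : ContinuousAt (fun t : ℂ => ((Pi.single l t : ι → ℂ), s)) 0 :=
    ((continuous_single l).prodMk continuous_const).continuousAt
  have e0 : ((Pi.single l (0 : ℂ) : ι → ℂ), s) = (0, s) := by simp
  have hg : ContinuousAt (fun t : ℂ => G ((Pi.single l t : ι → ℂ), s) l) 0 := by
    have h1 : ContinuousAt (fun z => G z l) ((Pi.single l (0 : ℂ) : ι → ℂ), s) := by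
      rw [e0]; exact (continuous_apply l).continuousAt.comp hG
    exact ContinuousAt.comp (f := fun t : ℂ => ((Pi.single l t : ι → ℂ), s)) h1 hc
  have := hasDerivAt_zero_of_eq_mul (f := fun t => F (Pi.single l t, s)) hg (by
    have h2 : Tendsto (fun t : ℂ => ((Pi.single l t : ι → ℂ), s)) (𝓝 0) (𝓝 (0, s)) := by
      rw [← e0]; exact hc
    filter_upwards [h2.eventually h] with t ht
    rw [ht, sum_eq_single l]
    · simp
    · intro j _ hj
      simp [hj]
    · simp)
  simpa only [e0] using this

theorem exists_sq_coeff (w : ι) {F : (ι → ℂ) × S → ℂ} {s₀ : S} (hF : Hol F (0, s₀))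
    (h0 : ∀ᶠ s in 𝓝 s₀, F (0, s) = 0)
    (hw : ∀ᶠ s in 𝓝 s₀, HasDerivAt (fun t => F (Pi.single w t, s)) 0 0) :
    ∃ G : (ι → ℂ) × S → ι → ℂ, Hol G (0, s₀) ∧
      ∀ᶠ z in 𝓝 (0, s₀), F z = ∑ l, sqAt w z.1 l * G z l := by
  obtain ⟨G, hG, hGe⟩ := exists_coordinate_coeff hF h0
  have hG' := fun l => (analyticAt_pi_iff.1 hG) l
  have t1 : Tendsto (fun s : S => ((0 : ι → ℂ), s)) (𝓝 s₀) (𝓝 (0, s₀)) :=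
    (Continuous.prodMk_right _).tendsto _
  have hGw : ∀ᶠ s in 𝓝 s₀, G (0, s) w = 0 := by
    filter_upwards [hw, t1.eventually hGe.eventually_nhds,
      t1.eventually hG.eventually_analyticAt] with s h1 h2 h3
    exact (hasDerivAt_single_of_coeff h3.continuousAt h2 w).unique h1
  obtain ⟨K, hK, hKe⟩ := exists_coordinate_coeff (hG' w) hGw
  have hK' := fun l => (analyticAt_pi_iff.1 hK) l
  have hz1 : ∀ l, Hol (fun z : (ι → ℂ) × S => z.1 l) (0, s₀) := 
    analyticAt_pi_iff.1 analyticAt_fst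
  refine ⟨fun z l => if l = w then K z w else G z l + z.1 w * K z l, ?_, ?_⟩
  · rw [analyticAt_pi_iff]
    intro l
    by_cases hl : l = w
    · simpa [hl] using hK' w
    · simp only [hl, if_false]
      exact (hG' l).add ((hz1 w).mul (hK' l))
  · filter_upwards [hGe, hKe] with z h1 h2
    rw [h1, ← add_sum_erase _ _ (mem_univ w),
      ← add_sum_erase _ (fun l => sqAt w z.1 l * _) (mem_univ w), h2,
      ← add_sum_erase _ _ (mem_univ w)]
    have e : ∑ l ∈ univ.erase w, sqAt w z.1 l *
          (if l = w then K z w else G z l + z.1 w * K z l) =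
        ∑ l ∈ univ.erase w, z.1 l * G z l +
          z.1 w * ∑ l ∈ univ.erase w, z.1 l * K z l := by
      rw [mul_sum, ← sum_add_distrib]
      refine sum_congr rfl fun l hl => ?_
      have hl : l ≠ w := ne_of_mem_erase hl
      simp only [sqAt, Function.update_of_ne hl, if_neg hl]
      ring
    rw [e]
    simp [sqAt]
    ring

theorem hasDerivAt_single_of_sq_coeff {w : ι} {F : (ι → ℂ) × S → ℂ} {G : (ι → ℂ) × S → ι → ℂ}
    {s : S} (hG : ContinuousAt G (0, s))
    (h : ∀ᶠ z in 𝓝 (0, s), F z = ∑ l, sqAt w z.1 l * G z l) {l : ι} (hl : l ≠ w) :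
    HasDerivAt (fun t => F (Pi.single l t, s)) (G (0, s) l) 0 := by
  have hc : ContinuousAt (fun t : ℂ => ((Pi.single l t : ι → ℂ), s)) 0 :=
    ((continuous_single l).prodMk continuous_const).continuousAt
  have e0 : ((Pi.single l (0 : ℂ) : ι → ℂ), s) = (0, s) := by simp
  have hg : ContinuousAt (fun t : ℂ => G ((Pi.single l t : ι → ℂ), s) l) 0 := by
    have h1 : ContinuousAt (fun z => G z l) ((Pi.single l (0 : ℂ) : ι → ℂ), s) := by
      rw [e0]; exact (continuous_apply l).continuousAt.comp hG
    exact ContinuousAt.comp (f := fun t : ℂ => ((Pi.single l t : ι → ℂ), s)) h1 hc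
  have := hasDerivAt_zero_of_eq_mul (f := fun t => F (Pi.single l t, s)) hg (by
    have h2 : Tendsto (fun t : ℂ => ((Pi.single l t : ι → ℂ), s)) (𝓝 0) (𝓝 (0, s)) := by
      rw [← e0]; exact hc
    filter_upwards [h2.eventually h] with t ht
    rw [ht, sum_eq_single l]
    · simp [sqAt_single_of_ne hl]
    · intro j _ hj
      simp [sqAt_single_of_ne hl, hj]
    · simp)
  simpa only [e0] using this

theorem tendsto_single_of_sq_coeff {w : ι} {F : (ι → ℂ) × S → ℂ} {G : (ι → ℂ) × S → ι → ℂ}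
    {s : S} (hG : ContinuousAt G (0, s)) (h : ∀ᶠ z in 𝓝 (0, s), F z = ∑ l, sqAt w z.1 l * G z l) :
    Tendsto (fun t => F (Pi.single w t, s) / t ^ 2) (𝓝[≠] 0) (𝓝 (G (0, s) w)) := by
  have hc : ContinuousAt (fun t : ℂ => ((Pi.single w t : ι → ℂ), s)) 0 :=
    ((continuous_single w).prodMk continuous_const).continuousAt
  have e0 : ((Pi.single w (0 : ℂ) : ι → ℂ), s) = (0, s) := by simp
  have h2 : Tendsto (fun t : ℂ => ((Pi.single w t : ι → ℂ), s)) (𝓝 0) (𝓝 (0, s)) := by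
    rw [← e0]; exact hc
  have hg : Tendsto (fun t : ℂ => G ((Pi.single w t : ι → ℂ), s) w) (𝓝 0) (𝓝 (G (0, s) w)) :=
    (((continuous_apply w).continuousAt.comp hG).tendsto).comp h2
  refine (hg.mono_left nhdsWithin_le_nhds).congr' ?_
  filter_upwards [(h2.eventually h).filter_mono nhdsWithin_le_nhds, self_mem_nhdsWithin]
    with t ht ht0
  have ht0 : t ≠ 0 := ht0
  rw [ht, sum_eq_single w]
  · simp [sqAt_single, ht0]
  · intro j _ hj
    simp [sqAt_single, hj]
  · simp

end Coefficients

section StrongEquivalence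

theorem tendsto_zero_of_analyticAt
    {f : E → F} (hf : Hol f 0) (h0 : f 0 = 0) : Tendsto f (𝓝 0) (𝓝 0) := by
  simpa [h0] using hf.continuousAt.tendsto

theorem IsBiholGerm.tendsto {f : E → E} (hf : IsBiholGerm f) : Tendsto f (𝓝 0) (𝓝 0) :=
  tendsto_zero_of_analyticAt hf.1 hf.2.1

theorem analyticAt_comp_zero {G : Type*}
    [NormedAddCommGroup G] [NormedSpace ℂ G] {f : E → F} {g : F → G} (hg : Hol g 0)
    (hf : Hol f 0) (h0 : f 0 = 0) : Hol (fun x => g (f x)) 0 := by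
  rw [← h0] at hg
  exact hg.comp (f := f) hf

theorem isBiholGerm_id : IsBiholGerm (fun x : E => x) :=
  ⟨analyticAt_id, rfl, fun x => x, analyticAt_id, rfl, .of_forall fun _ => rfl,
    .of_forall fun _ => rfl⟩

theorem IsBiholGerm.comp {f g : E → E} (hg : IsBiholGerm g) (hf : IsBiholGerm f) :
    IsBiholGerm fun x => g (f x) := by
  have tf := hf.tendsto
  obtain ⟨f1, f2, f', f3, f4, f5, f6⟩ := hf
  obtain ⟨g1, g2, g', g3, g4, g5, g6⟩ := hg
  refine ⟨analyticAt_comp_zero g1 f1 f2, by simp only [f2, g2], fun x => f' (g' x),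
    analyticAt_comp_zero f3 g3 g4, by simp only [g4, f4], ?_, ?_⟩
  · filter_upwards [f5, tf.eventually g5] with x h1 h2
    rw [h2, h1]
  · filter_upwards [g6, (tendsto_zero_of_analyticAt g3 g4).eventually f6] with x h1 h2
    rw [h2, h1]

theorem MapsSetGerm.comp {f g : E → E} {A B C : Set E} (hg : MapsSetGerm g B C)
    (hf : MapsSetGerm f A B) (tf : Tendsto f (𝓝 0) (𝓝 0)) : MapsSetGerm (fun x => g (f x)) A C := by
  filter_upwards [hf, tf.eventually hg] with x h1 h2
  rw [h1, h2]

/-- The germ of `f` at `0` has inverse the germ of `g`. -/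
theorem IsBiholGerm.exists_inverse {f : E → E} (hf : IsBiholGerm f) :
    ∃ g, IsBiholGerm g ∧ (∀ᶠ x in 𝓝 0, g (f x) = x) ∧ (∀ᶠ x in 𝓝 0, f (g x) = x) ∧
      ∀ V, MapsSetGerm f V V → MapsSetGerm g V V := by
  obtain ⟨f1, f2, g, g1, g2, g3, g4⟩ := hf
  refine ⟨g, ⟨g1, g2, f, f1, f2, g4, g3⟩, g3, g4, fun V hV => ?_⟩
  filter_upwards [g4, (tendsto_zero_of_analyticAt g1 g2).eventually hV] with x h1 h2
  rw [h2, h1]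

open Matrix

/-- `h = A · (g ∘ ψ)` for a biholomorphic germ `ψ` preserving `V` and an invertible matrix `A`. -/
def StrongEquiv (V : Set E) {q : ℕ} (h g : E → Fin q → ℂ) : Prop :=
  ∃ ψ : E → E, IsBiholGerm ψ ∧ MapsSetGerm ψ V V ∧
    ∃ A : E → Matrix (Fin q) (Fin q) ℂ, MatAnalyticAt A 0 ∧ (A 0).det ≠ 0 ∧
      ∀ᶠ x in 𝓝 0, h x = A x *ᵥ g (ψ x)

variable {V : Set E} {q : ℕ} {h g f : E → Fin q → ℂ}

theorem StrongEquiv.trans (h1 : StrongEquiv V h g) (h2 : StrongEquiv V g f) :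
    StrongEquiv V h f := by
  obtain ⟨ψ, a1, a2, A, a3, a4, a5⟩ := h1
  obtain ⟨φ, b1, b2, B, b3, b4, b5⟩ := h2
  have t := a1.tendsto
  refine ⟨_, b1.comp a1, b2.comp a2 t, fun x => A x * B (ψ x), ?_, ?_, ?_⟩
  · exact a3.mul fun i j => analyticAt_comp_zero (b3 i j) a1.1 a1.2.1
  · simp only [a1.2.1, det_mul]; exact mul_ne_zero a4 b4
  · filter_upwards [a5, t.eventually b5] with x h1 h2
    rw [h1, h2, mulVec_mulVec]

theorem eventually_det_ne_zero {A : E → Matrix (Fin q) (Fin q) ℂ} (hA : MatAnalyticAt A 0)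
    (h : (A 0).det ≠ 0) : ∀ᶠ x in 𝓝 0, (A x).det ≠ 0 :=
  hA.det.continuousAt.eventually_ne h

theorem StrongEquiv.symm (h1 : StrongEquiv V h g) : StrongEquiv V g h := by
  obtain ⟨ψ, a1, a2, A, a3, a4, a5⟩ := h1
  obtain ⟨φ, b1, b2, b3, b4⟩ := a1.exists_inverse
  have t := b1.tendsto
  refine ⟨φ, b1, b4 V a2, fun x => (A (φ x))⁻¹, ?_, ?_, ?_⟩
  · exact fun i j => analyticAt_comp_zero (a3.inv a4 i j) b1.1 b1.2.1
  · simp only [b1.2.1]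
    exact (isUnit_nonsing_inv_det _ (isUnit_iff_ne_zero.2 a4)).ne_zero
  · filter_upwards [b3, t.eventually a5, t.eventually (eventually_det_ne_zero a3 a4)]
      with x h1 h2 h3
    rw [h2, h1, mulVec_mulVec, nonsing_inv_mul _ (isUnit_iff_ne_zero.2 h3), one_mulVec]

theorem StrongEquiv.analyticAt (h1 : StrongEquiv V h g) (hg : Hol g 0) : Hol h 0 := by
  obtain ⟨ψ, a1, a2, A, a3, a4, a5⟩ := h1
  have hg' := analyticAt_comp_zero hg a1.1 a1.2.1
  refine AnalyticAt.congr (f := fun x => A x *ᵥ g (ψ x)) ?_ (a5.mono fun x hx => hx.symm)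
  rw [analyticAt_pi_iff]
  exact a3.mulVec (analyticAt_pi_iff.1 hg')

theorem StrongEquiv.vkEquiv (h1 : StrongEquiv V h g) : VKEquiv V h g := by
  obtain ⟨ψ, a1, a2, A, a3, a4, a5⟩ := h1
  obtain ⟨φ, b1, b2, b3, -⟩ := a1.exists_inverse
  have tf : Tendsto (fun z : E × (Fin q → ℂ) => z.1) (𝓝 0) (𝓝 0) := continuous_fst.tendsto 0
  have af : Hol (fun z : E × (Fin q → ℂ) => z.1) 0 := analyticAt_fst
  have as : ∀ i, Hol (fun z : E × (Fin q → ℂ) => z.2 i) 0 := 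
    analyticAt_pi_iff.1 analyticAt_snd
  have hne := eventually_det_ne_zero a3 a4
  have hdet : ∀ᶠ z in 𝓝 (0 : E × (Fin q → ℂ)), IsUnit (A z.1).det :=
    (tf.eventually hne).mono fun z hz => isUnit_iff_ne_zero.2 hz
  refine ⟨fun z => (ψ z.1, (A z.1)⁻¹ *ᵥ z.2), ψ, ⟨⟨?_, ?_, fun z => (φ z.1, A (φ z.1) *ᵥ z.2),
    ?_, ?_, ?_, ?_⟩, a1, ?_, ?_, ?_⟩, a2⟩
  · refine (analyticAt_comp_zero a1.1 af rfl).prod ?_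
    rw [analyticAt_pi_iff]
    exact MatAnalyticAt.mulVec (fun i j => analyticAt_comp_zero (a3.inv a4 i j) af rfl) as
  · ext <;> simp [a1.2.1]
  · refine (analyticAt_comp_zero b1.1 af rfl).prod ?_
    rw [analyticAt_pi_iff]
    exact MatAnalyticAt.mulVec (fun i j => analyticAt_comp_zero
      (analyticAt_comp_zero (a3 i j) b1.1 b1.2.1) af rfl) as
  · ext <;> simp [b1.2.1]
  · filter_upwards [tf.eventually b2, hdet] with z h1 h2
    simp only [h1, mulVec_mulVec, mul_nonsing_inv _ h2, one_mulVec]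
  · filter_upwards [tf.eventually b3,
      (tf.eventually (b1.tendsto.eventually hne)).mono fun z hz => isUnit_iff_ne_zero.2 hz]
      with z h1 h2
    simp only [h1, mulVec_mulVec, nonsing_inv_mul _ h2, one_mulVec]
  · exact .of_forall fun z => rfl
  · exact .of_forall fun x => by simp
  · filter_upwards [hdet, tf.eventually a5] with z h1 h2
    constructor
    · intro hz
      rw [hz, h2, mulVec_mulVec, nonsing_inv_mul _ h1, one_mulVec]
    · intro hz
      rw [h2, ← hz, mulVec_mulVec, mul_nonsing_inv _ h1, one_mulVec]

end StrongEquivalence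

section GermAlgebra

theorem germ_eq_germ_iff {f g : E → ℂ} {hf : Hol f 0} {hg : Hol g 0} :
    germ f hf = germ g hg ↔ ∀ᶠ x in 𝓝 0, f x = g x := by
  unfold germ
  refine (Ideal.Quotient.eq (I := nullIdeal E)).trans ?_
  change (∀ᶠ x in 𝓝 (0 : E), f x - g x = 0) ↔ _
  simp only [sub_eq_zero]

theorem exists_germ (a : AnGerm E) : ∃ f : E → ℂ, ∃ hf : Hol f 0, germ f hf = a := by
  obtain ⟨⟨f, hf⟩, rfl⟩ := Ideal.Quotient.mk_surjective (I := nullIdeal E) a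
  exact ⟨f, hf, rfl⟩

theorem germ_add {f g : E → ℂ} (hf : Hol f 0) (hg : Hol g 0) :
    germ f hf + germ g hg = germ (fun x => f x + g x) (hf.add hg) := rfl

theorem germ_mul {f g : E → ℂ} (hf : Hol f 0) (hg : Hol g 0) :
    germ f hf * germ g hg = germ (fun x => f x * g x) (hf.mul hg) := rfl

theorem germ_sum {ι : Type*} {f : ι → E → ℂ} (hf : ∀ i, Hol (f i) 0) (s : Finset ι) :
    ∑ i ∈ s, germ (f i) (hf i) =
      germ (fun x => ∑ i ∈ s, f i x) (analyticAt_finset_sum s fun i _ => hf i) := by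
  classical
  induction s using Finset.induction_on with
  | empty => simp; rfl
  | insert a s ha ih =>
    rw [sum_insert ha, ih, germ_add]
    exact germ_eq_germ_iff.2 (.of_forall fun x => by rw [sum_insert ha])

/-- A representative of a germ. -/
def rep (a : AnGerm E) : E → ℂ := (exists_germ a).choose

theorem rep_analyticAt (a : AnGerm E) : Hol (rep a) 0 := (exists_germ a).choose_spec.choose

theorem germ_rep (a : AnGerm E) : germ (rep a) (rep_analyticAt a) = a :=
  (exists_germ a).choose_spec.choose_spec

variable {q : ℕ}

theorem vecGerm_eq_vecGerm_iff {f g : E → Fin q → ℂ} {hf : Hol f 0}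
    {hg : Hol g 0} : vecGerm f hf = vecGerm g hg ↔ ∀ᶠ x in 𝓝 0, f x = g x := by
  simp only [vecGerm, funext_iff, germ_eq_germ_iff]
  rw [eventually_all]

theorem exists_vecGerm (a : Fin q → AnGerm E) :
    ∃ f : E → Fin q → ℂ, ∃ hf : Hol f 0, vecGerm f hf = a := by
  refine ⟨fun x j => rep (a j) x, analyticAt_pi_iff.2 fun j => rep_analyticAt (a j), ?_⟩
  funext j
  exact germ_rep (a j)

theorem vecGerm_add {f g : E → Fin q → ℂ} (hf : Hol f 0) (hg : Hol g 0) :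
    vecGerm f hf + vecGerm g hg = vecGerm (fun x => f x + g x) (hf.add hg) := rfl

theorem germ_smul_vecGerm {f : E → ℂ} {ν : E → Fin q → ℂ} (hf : Hol f 0) (hν : Hol ν 0) :
    germ f hf • vecGerm ν hν = vecGerm (fun x => f x • ν x) (hf.smul hν) := rfl

theorem smul_vecGerm {ν : E → Fin q → ℂ} (c : ℂ) (hν : Hol ν 0) :
    c • vecGerm ν hν = vecGerm (fun x => c • ν x)  ((analyticAt_const (v := c)).smul hν) := rfl

theorem vecGerm_zero : (0 : Fin q → AnGerm E) = vecGerm (fun _ => 0) analyticAt_const := rfl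

end GermAlgebra

section Tangent

variable {V : Set E} {q : ℕ}
  {h : E → Fin q → ℂ}

theorem IsThetaV.zero {ξ : E → E} (hξ : IsThetaV V ξ) : ξ 0 = 0 := by
  obtain ⟨-, Φ, -, h1, h2, h3, -⟩ := hξ
  have a := h2.self_of_nhds
  have b : Φ 0 = 0 := h1.self_of_nhds
  simp only [b] at a
  have c : HasDerivAt (fun t => Φ (t, (0 : E))) 0 0 :=
    (hasDerivAt_const (0 : ℂ) (0 : E)).congr_of_eventuallyEq h3
  exact a.unique c

/-- The transport of a vector field preserving `V` by a biholomorphic germ preserving `V`. -/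
theorem IsThetaV.push {ξ : E → E} [CompleteSpace E] (hξ : IsThetaV V ξ) {φ ψ : E → E}
    (hφ : IsBiholGerm φ) (hψ : IsBiholGerm ψ) (h1 : ∀ᶠ x in 𝓝 0, ψ (φ x) = x)
    (h2 : ∀ᶠ x in 𝓝 0, φ (ψ x) = x) (hVφ : MapsSetGerm φ V V) (hVψ : MapsSetGerm ψ V V) :
    IsThetaV V (fun x => 𝒟 φ (ψ x) (ξ (ψ x))) := by
  obtain ⟨a0, Φ, a1, a2, a3, a4, a5⟩ := hξ
  have tφ := hφ.tendsto
  have tψ := hψ.tendsto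
  have hΦ0 : Φ 0 = 0 := a2.self_of_nhds
  have tΦ : Tendsto Φ (𝓝 0) (𝓝 0) := tendsto_zero_of_analyticAt a1 hΦ0
  let σ : ℂ × E → ℂ × E := fun z => (z.1, ψ z.2)
  have aσ : Hol σ 0 := analyticAt_fst.prod (analyticAt_comp_zero hψ.1 analyticAt_snd rfl)
  have σ0 : σ 0 = 0 := by simp [σ, hψ.2.1]
  have tσ : Tendsto σ (𝓝 0) (𝓝 0) := tendsto_zero_of_analyticAt aσ σ0
  have ts : Tendsto (fun z : ℂ × E => z.2) (𝓝 0) (𝓝 0) := continuous_snd.tendsto 0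
  refine ⟨?_, fun z => φ (Φ (σ z)), ?_, ?_, ?_, ?_, ?_⟩
  · have b1 := analyticAt_comp_zero hφ.1.fderiv hψ.1 hψ.2.1
    have b2 := analyticAt_comp_zero a0 hψ.1 hψ.2.1
    exact ((ContinuousLinearMap.id ℂ (E →L[ℂ] E)).analyticAt_bilinear (_, _)).comp₂ b1 b2
  · exact analyticAt_comp_zero hφ.1 (analyticAt_comp_zero a1 aσ σ0) (by simp only [σ0, hΦ0])
  · filter_upwards [h2, tψ.eventually a2] with x k1 k2
    simp only [σ, k2, k1]
  · have e1 := tσ.eventually a3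
    have e2 := (tΦ.comp tσ).eventually h1
    have e3 := (tΦ.comp tσ).eventually hφ.1.eventually_analyticAt
    filter_upwards [e1, e2, e3] with z k1 k2 k3
    simp only [Function.comp_apply] at k2 k3
    rw [k2]
    exact HasFDerivAt.comp_hasDerivAt z.1
      (f := fun t => Φ (t, ψ z.2)) k3.differentiableAt.hasFDerivAt k1
  · filter_upwards [a4] with t k
    simp only [σ, hψ.2.1, k, hφ.2.1]
  · filter_upwards [ts.eventually hVψ, tσ.eventually a5, (tΦ.comp tσ).eventually hVφ]
      with z k1 k2 k3
    simp only [Function.comp_apply] at k3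
    rw [k1, ← k3]
    exact k2

theorem germ_mem_pullbackMax (hh : Hol h 0) (j : Fin q) :
    germ (fun x => h x j) (analyticAt_pi_iff.1 hh j) ∈ pullbackMax h :=
  Ideal.subset_span ⟨fun y => y j,
    (prj j).analyticAt _, rfl,
    analyticAt_pi_iff.1 hh j, rfl⟩

theorem pullbackMax_le (hh : Hol h 0) (h0 : h 0 = 0) {I : Ideal (AnGerm E)}
    (hI : ∀ j, germ (fun x => h x j) (analyticAt_pi_iff.1 hh j) ∈ I) : pullbackMax h ≤ I := by
  refine Ideal.span_le.2 ?_
  rintro a ⟨g, hg, hg0, hgh, rfl⟩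
  obtain ⟨G, hG, hGe⟩ := exists_coordinate_coeff (S := ℂ) (s₀ := 0)
    (F := fun z : (Fin q → ℂ) × ℂ => g z.1)
    (analyticAt_comp_zero hg analyticAt_fst rfl) (by simp [hg0])
  let G' : Fin q → E → ℂ := fun j x => G (h x, 0) j
  have hG' : ∀ j, Hol (G' j) 0 := fun j =>
    analyticAt_comp_zero (analyticAt_pi_iff.1 hG j) (hh.prod analyticAt_const) (by simp [h0])
  have key : germ (fun x => g (h x)) hgh =
      ∑ j, germ (G' j) (hG' j) * germ (fun x => h x j) (analyticAt_pi_iff.1 hh j) := by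
    simp only [germ_mul]
    rw [germ_sum, germ_eq_germ_iff]
    have ht : Tendsto (fun x => (h x, (0 : ℂ))) (𝓝 0) (𝓝 (0, 0)) :=
      tendsto_zero_of_analyticAt (hh.prod analyticAt_const) (by simp [h0])
    filter_upwards [ht.eventually hGe] with x hx
    rw [hx]
    exact sum_congr rfl fun j _ => mul_comm _ _
  rw [key]
  exact Ideal.sum_mem _ fun j _ => I.mul_mem_left _ (hI j)

theorem tangent_induction {hh : Hol h 0} (h0 : h 0 = 0) {P : (E → Fin q → ℂ) → Prop}
    (congr : ∀ ν ν', Hol ν' 0 → (∀ᶠ x in 𝓝 0, ν x = ν' x) → P ν → P ν') (zero : P fun _ => 0)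
    (add : ∀ ν ν', Hol ν 0 → Hol ν' 0 → P ν → P ν' → P fun x => ν x + ν' x)
    (smul : ∀ (f : E → ℂ) ν, Hol f 0 → Hol ν 0 → P ν → P fun x => f x • ν x)
    (field : ∀ ξ, IsThetaV V ξ → P fun x => 𝒟 h x (ξ x))
    (pull : ∀ j ν, Hol ν 0 → P fun x => h x j • ν x)
    {ν : E → Fin q → ℂ} {hν : Hol ν 0} (hT : vecGerm ν hν ∈ tangentVKe V h hh) : P ν := by
  let N : Submodule (AnGerm E) (Fin q → AnGerm E) :=
    { carrier := {x | ∃ ν, ∃ hν : Hol ν 0, x = vecGerm ν hν ∧ P ν}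
      zero_mem' := ⟨fun _ => 0, analyticAt_const, rfl, zero⟩
      add_mem' := by
        rintro _ _ ⟨ν, hν, rfl, p1⟩ ⟨ν', hν', rfl, p2⟩
        exact ⟨_, _, vecGerm_add hν hν', add ν ν' hν hν' p1 p2⟩
      smul_mem' := by
        rintro a _ ⟨ν, hν, rfl, p1⟩
        obtain ⟨f, hf, rfl⟩ := exists_germ a
        exact ⟨_, _, germ_smul_vecGerm hf hν, smul f ν hf hν p1⟩ }
  have hle : tangentVKe V h hh ≤ N := by
    refine sup_le (Submodule.span_le.2 ?_) ?_
    · rintro _ ⟨ξ, hξ, rfl⟩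
      exact ⟨_, _, rfl, field ξ hξ⟩
    · have hI : pullbackMax h ≤ N.colon (⊤ : Set (Fin q → AnGerm E)) := by
        refine pullbackMax_le hh h0 fun j => ?_
        rw [Submodule.mem_colon]
        intro x _
        obtain ⟨ν, hν, rfl⟩ := exists_vecGerm x
        exact ⟨_, _, germ_smul_vecGerm _ hν, pull j ν hν⟩
      refine Submodule.smul_le.2 fun r hr n _ => ?_
      exact Submodule.mem_colon.1 (hI hr) n trivial
  obtain ⟨ν', hν', h1, h2⟩ := hle hT
  exact congr ν' ν hν ((vecGerm_eq_vecGerm_iff.1 h1).mono fun x hx => hx.symm) h2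

theorem field_mem_tangent (hh : Hol h 0) {ξ : E → E} (hξ : IsThetaV V ξ) :
    vecGerm (fun x => 𝒟 h x (ξ x)) (analyticAt_fderiv_apply hh hξ.1) ∈ tangentVKe V h hh :=
  Submodule.mem_sup_left (Submodule.subset_span ⟨ξ, hξ, rfl⟩)

theorem pull_mem_tangent (hh : Hol h 0) (j : Fin q) {ν : E → Fin q → ℂ} (hν : Hol ν 0) :
    vecGerm (fun x => h x j • ν x) ((analyticAt_pi_iff.1 hh j).smul hν) ∈ tangentVKe V h hh :=
  Submodule.mem_sup_right (Submodule.smul_mem_smul (germ_mem_pullbackMax hh j)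
    (Submodule.mem_top (x := vecGerm ν hν)))

theorem tangent_congr {hh : Hol h 0} {ν ν' : E → Fin q → ℂ} {hν : Hol ν 0}
    (hT : vecGerm ν hν ∈ tangentVKe V h hh) (hν' : Hol ν' 0)
    (he : ∀ᶠ x in 𝓝 0, ν x = ν' x) : vecGerm ν' hν' ∈ tangentVKe V h hh := by
  rwa [← vecGerm_eq_vecGerm_iff.2 he]

/-- Elements of the tangent space vanish at the origin. -/
theorem tangent_zero {hh : Hol h 0} (h0 : h 0 = 0) {ν : E → Fin q → ℂ}
    {hν : Hol ν 0} (hT : vecGerm ν hν ∈ tangentVKe V h hh) : ν 0 = 0 := by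
  refine tangent_induction (P := fun ν => ν 0 = 0) h0 ?_ rfl ?_ ?_ ?_ ?_ hT
  · exact fun ν ν' _ he h1 => by rw [← he.self_of_nhds, h1]
  · exact fun ν ν' _ _ h1 h2 => by simp [h1, h2]
  · exact fun f ν _ _ h1 => by simp [h1]
  · exact fun ξ hξ => by simp [hξ.zero]
  · exact fun j ν _ => by simp [h0]

theorem le_codim_of_independent {n : ℕ} {hh : Hol h 0} (x : Fin n → Fin q → AnGerm E)
    (hx : ∀ c : Fin n → ℂ, ∑ i, c i • x i ∈ tangentVKe V h hh → c = 0) :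
    (n : Cardinal) ≤ codimVKe V h hh := by
  have hli : LinearIndependent ℂ
      (fun i => (Submodule.Quotient.mk (x i) : (Fin q → AnGerm E) ⧸ tangentVKe V h hh)) := by
    rw [Fintype.linearIndependent_iff]
    intro c hc
    have : (Submodule.Quotient.mk (∑ i, c i • x i) :
        (Fin q → AnGerm E) ⧸ tangentVKe V h hh) = 0 := by
      rw [← hc]
      refine (map_sum ((tangentVKe V h hh).mkQ.restrictScalars ℂ)
        (fun i => c i • x i) univ).trans (sum_congr rfl fun i _ => ?_)
      exact map_smul ((tangentVKe V h hh).mkQ.restrictScalars ℂ) (c i) (x i)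
    rw [Submodule.Quotient.mk_eq_zero] at this
    exact congrFun (hx c this)
  simpa [codimVKe] using hli.cardinal_lift_le_rank

theorem exists_relation_of_codim_lt {n : ℕ} {hh : Hol h 0}
    (hlt : codimVKe V h hh < n) (x : Fin n → Fin q → AnGerm E) :
    ∃ c : Fin n → ℂ, c ≠ 0 ∧ ∑ i, c i • x i ∈ tangentVKe V h hh := by
  by_contra! hcon
  exact (le_codim_of_independent x fun c hc => of_not_not fun h1 => hcon c h1 hc).not_gt hlt

variable [CompleteSpace E]

open Matrix in
theorem analyticAt_mulVec_comp {A : E → Matrix (Fin q) (Fin q) ℂ} {ψ : E → E} {ν : E → Fin q → ℂ}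
    (hA : MatAnalyticAt A 0) (hψ : IsBiholGerm ψ) (hν : Hol ν 0) :
    Hol (fun x => A x *ᵥ ν (ψ x)) 0 :=
  analyticAt_pi_iff.2 (hA.mulVec (analyticAt_pi_iff.1 (analyticAt_comp_zero hν hψ.1 hψ.2.1)))

open Matrix in
theorem hasFDerivAt_mulVec_comp {A : E → Matrix (Fin q) (Fin q) ℂ} {ψ : E → E} {g : E → Fin q → ℂ}
    {x : E} (hA : MatAnalyticAt A x) (hψ : Hol ψ x) (hg : Hol g (ψ x)) (v : E)
    (i : Fin q) : 𝒟 (fun x => A x *ᵥ g (ψ x)) x v i = ∑ j, 𝒟 (fun x => A x i j) x v * g (ψ x) j +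
        (A x *ᵥ (𝒟 g (ψ x) (𝒟 ψ x v))) i := by
  have hgd := hg.differentiableAt.hasFDerivAt.comp x hψ.differentiableAt.hasFDerivAt
  have h2 : ∀ i, HasFDerivAt (fun x => (A x *ᵥ g (ψ x)) i)
      (∑ j, (A x i j • ((prj j).comp
        ((𝒟 g (ψ x)).comp (𝒟 ψ x))) + g (ψ x) j • 𝒟 (fun x => A x i j) x)) x := by
    intro i
    simp only [mulVec, dotProduct]
    exact HasFDerivAt.fun_sum fun j _ =>
      (hA i j).differentiableAt.hasFDerivAt.mul (hasFDerivAt_pi'.1 hgd j)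
  have h3 : HasFDerivAt (fun x => A x *ᵥ g (ψ x)) (ContinuousLinearMap.pi _) x := hasFDerivAt_pi.2 h2
  rw [h3.fderiv, pi_apply]
  simp only [_root_.sum_apply, mulVec, dotProduct]
  rw [← sum_add_distrib]
  refine sum_congr rfl fun j _ => ?_
  simp
  ring

open Matrix in
/-- Pulling back the tangent space along a strong equivalence. -/
theorem mulVec_comp_mem_tangent {h g : E → Fin q → ℂ} {hh : Hol h 0}
    {hg : Hol g 0} (g0 : g 0 = 0) {ψ : E → E} (hψ : IsBiholGerm ψ)
    (hV : MapsSetGerm ψ V V) {A : E → Matrix (Fin q) (Fin q) ℂ} (hA : MatAnalyticAt A 0)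
    (hA0 : (A 0).det ≠ 0) (he : ∀ᶠ x in 𝓝 0, h x = A x *ᵥ g (ψ x))
    {ν : E → Fin q → ℂ} {hν : Hol ν 0} (hT : vecGerm ν hν ∈ tangentVKe V g hg)
    (hν' : Hol (fun x => A x *ᵥ ν (ψ x)) 0) :
    vecGerm (fun x => A x *ᵥ ν (ψ x)) hν' ∈ tangentVKe V h hh := by
  have tψ := hψ.tendsto
  have hAne := eventually_det_ne_zero hA hA0
  have hgψ : ∀ᶠ x in 𝓝 0, g (ψ x) = (A x)⁻¹ *ᵥ h x := by
    filter_upwards [he, hAne] with x h1 h2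
    rw [h1, mulVec_mulVec, nonsing_inv_mul _ (isUnit_iff_ne_zero.2 h2), one_mulVec]
  have hideal : ∀ (B : E → Matrix (Fin q) (Fin q) ℂ) (hB : MatAnalyticAt B 0)
      (hk : Hol (fun x => B x *ᵥ h x) 0),
      vecGerm (fun x => B x *ᵥ h x) hk ∈ tangentVKe V h hh := by
    intro B hB hk
    have hc : ∀ j, Hol (fun x i => B x i j) 0 := fun j =>
      analyticAt_pi_iff.2 fun i => hB i j
    have := Submodule.sum_mem (tangentVKe V h hh) (t := univ) fun j _ =>
      pull_mem_tangent (V := V) hh j (hc j)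
    convert this using 1
    funext i
    rw [Finset.sum_apply]
    refine Eq.trans ?_ (germ_sum (fun j => (analyticAt_pi_iff.1 hh j).mul (hB i j)) univ).symm
    exact germ_eq_germ_iff.2 (.of_forall fun x => by simp [mulVec, dotProduct, mul_comm])
  revert hν'
  refine tangent_induction (P := fun ν => ∀ hν' : Hol (fun x => A x *ᵥ ν (ψ x)) 0,
    vecGerm (fun x => A x *ᵥ ν (ψ x)) hν' ∈ tangentVKe V h hh) g0 ?_ ?_ ?_ ?_ ?_ ?_ hT
  · intro ν ν' hν' hee h1 h2
    have e : ∀ᶠ x in 𝓝 0, A x *ᵥ ν' (ψ x) = A x *ᵥ ν (ψ x) :=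
      (tψ.eventually hee).mono fun x hx => by rw [hx]
    exact tangent_congr (h1 (h2.congr e)) h2 (e.mono fun x hx => hx.symm)
  · intro h1
    have : vecGerm (fun x => A x *ᵥ (0 : Fin q → ℂ)) h1 = 0 := by
      rw [vecGerm_zero, vecGerm_eq_vecGerm_iff]
      simp
    rw [this]; exact Submodule.zero_mem _
  · intro ν ν' a b h1 h2 h3
    have := Submodule.add_mem _ (h1 (analyticAt_mulVec_comp hA hψ a))
      (h2 (analyticAt_mulVec_comp hA hψ b))
    rw [vecGerm_add] at this
    exact tangent_congr this h3 (.of_forall fun x => (mulVec_add _ _ _).symm)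
  · intro f ν a b h1 h3
    have := Submodule.smul_mem _ (germ _ (analyticAt_comp_zero a hψ.1 hψ.2.1))
      (h1 (analyticAt_mulVec_comp hA hψ b))
    rw [germ_smul_vecGerm] at this
    exact tangent_congr this h3 (.of_forall fun x => (mulVec_smul _ _ _).symm)
  · intro ξ hξ h3
    obtain ⟨φ, hφ, h1, h2, h4⟩ := hψ.exists_inverse
    have hξ' := hξ.push hφ hψ h2 h1 (h4 V hV) hV
    let B : E → Matrix (Fin q) (Fin q) ℂ := fun x =>
      (Matrix.of fun i j => 𝒟 (fun x => A x i j) x (𝒟 φ (ψ x) (ξ (ψ x)))) * (A x)⁻¹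
    have hB : MatAnalyticAt B 0 := by
      refine MatAnalyticAt.mul (fun i j => ?_) (hA.inv hA0)
      exact ((ContinuousLinearMap.id ℂ (E →L[ℂ] ℂ)).analyticAt_bilinear (_, _)).comp₂
        (hA i j).fderiv hξ'.1
    have hBh : Hol (fun x => B x *ᵥ h x) 0 :=
      analyticAt_pi_iff.2 (hB.mulVec (analyticAt_pi_iff.1 hh))
    refine tangent_congr (hν := (analyticAt_fderiv_apply hh hξ'.1).sub hBh)
      (Submodule.sub_mem _ (field_mem_tangent hh hξ') (hideal B hB hBh)) h3 ?_
    have hAe : ∀ᶠ x in 𝓝 0, MatAnalyticAt A x := by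
      simp only [MatAnalyticAt, eventually_all]
      exact fun i j => (hA i j).eventually_analyticAt
    have hinv : ∀ᶠ x in 𝓝 0, ∀ v, 𝒟 ψ x (𝒟 φ (ψ x) v) = v := by
      filter_upwards [(tψ.eventually (h2.eventually_nhds)), h1,
        hψ.1.eventually_analyticAt, tψ.eventually hφ.1.eventually_analyticAt]
        with x a1 a2 a3 a4 v
      have b1 : HasFDerivAt (fun y => ψ (φ y)) ((𝒟 ψ x).comp (𝒟 φ (ψ x))) (ψ x) := by
        have : HasFDerivAt ψ (𝒟 ψ x) (φ (ψ x)) := by rw [a2]; exact a3.differentiableAt.hasFDerivAt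
        exact this.comp (ψ x) a4.differentiableAt.hasFDerivAt
      have b2 : HasFDerivAt (fun y => ψ (φ y)) (ContinuousLinearMap.id ℂ E) (ψ x) :=
        (hasFDerivAt_id (ψ x)).congr_of_eventuallyEq a1
      exact congrArg (fun L : E →L[ℂ] E => L v) (b1.unique b2)
    filter_upwards [he.eventually_nhds, hgψ, hAe, hinv, hψ.1.eventually_analyticAt,
      tψ.eventually hg.eventually_analyticAt] with x a1 a2 a3 a4 a5 a6
    have e1 : 𝒟 h x = 𝒟 (fun x => A x *ᵥ g (ψ x)) x := EventuallyEq.fderiv_eq a1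
    funext i
    change 𝒟 h x _ i - (B x *ᵥ h x) i = _
    rw [e1, hasFDerivAt_mulVec_comp a3 a5 a6, a4]
    have : (B x *ᵥ h x) i = ∑ j, 𝒟 (fun x => A x i j) x
        (𝒟 φ (ψ x) (ξ (ψ x))) * g (ψ x) j := by
      simp only [B]
      rw [← mulVec_mulVec, ← a2]
      rfl
    rw [this]; ring
  · intro j ν a h3
    let B : E → Matrix (Fin q) (Fin q) ℂ := fun x =>
      Matrix.of fun i l => (A x *ᵥ ν (ψ x)) i * (A x)⁻¹ j l
    have hB : MatAnalyticAt B 0 := fun i l =>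
      (analyticAt_pi_iff.1 (analyticAt_mulVec_comp hA hψ a) i).mul (hA.inv hA0 j l)
    have hBh : Hol (fun x => B x *ᵥ h x) 0 :=
      analyticAt_pi_iff.2 (hB.mulVec (analyticAt_pi_iff.1 hh))
    refine tangent_congr (hideal B hB hBh) h3 ?_
    filter_upwards [hgψ] with x hx
    rw [mulVec_smul, hx]
    funext i
    simp only [B, mulVec, dotProduct, Matrix.of_apply, Pi.smul_apply, smul_eq_mul, mul_assoc]
    rw [← mul_sum, mul_comm]

end Tangent

section Consequences

variable {V : Set E} {q : ℕ}
  {h : E → Fin q → ℂ}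

/-- First order obstruction to belonging to the tangent space. -/
theorem tangent_linear [CompleteSpace E] {hh : Hol h 0} (h0 : h 0 = 0) (e : Fin q → E)
    (hpull : ∀ i m, 𝒟 h 0 (e m) i = 0) (hfield : ∀ ξ, IsThetaV V ξ → ∑ m, 𝒟 h 0 (𝒟 ξ 0 (e m)) m = 0)
    {ν : E → Fin q → ℂ} {hν : Hol ν 0} (hT : vecGerm ν hν ∈ tangentVKe V h hh) :
    ∑ m, 𝒟 ν 0 (e m) m = 0 := by
  refine (tangent_induction (P := fun ν => ν 0 = 0 ∧ ∑ m, 𝒟 ν 0 (e m) m = 0)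
    h0 ?_ ?_ ?_ ?_ ?_ ?_ hT).2
  · rintro ν ν' _ he ⟨h1, h2⟩
    refine ⟨by rw [← he.self_of_nhds, h1], ?_⟩
    rw [← EventuallyEq.fderiv_eq he]
    exact h2
  · simp
  · rintro ν ν' a b ⟨h1, h2⟩ ⟨h3, h4⟩
    refine ⟨by simp [h1, h3], ?_⟩
    rw [fderiv_fun_add a.differentiableAt b.differentiableAt]
    simp only [_root_.add_apply, Pi.add_apply, sum_add_distrib, h2, h4, add_zero]
  · rintro f ν a b ⟨h1, h2⟩
    refine ⟨by simp [h1], ?_⟩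
    rw [fderiv_fun_smul a.differentiableAt b.differentiableAt]
    simp only [h1, _root_.add_apply, _root_.smul_apply,
      smulRight_apply, smul_zero, add_zero, Pi.smul_apply, smul_eq_mul]
    rw [← mul_sum, h2, mul_zero]
  · intro ξ hξ
    refine ⟨by simp [hξ.zero], ?_⟩
    rw [← hfield ξ hξ]
    refine sum_congr rfl fun m _ => ?_
    rw [fderiv_clm_apply hh.fderiv.differentiableAt hξ.1.differentiableAt]
    simp [hξ.zero]
  · intro j ν a
    refine ⟨by simp [h0], ?_⟩
    have hj := analyticAt_pi_iff.1 hh j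
    rw [fderiv_fun_smul hj.differentiableAt a.differentiableAt]
    have : ∀ m, 𝒟 (fun x => h x j) 0 (e m) = 0 := fun m => by
      rw [← hpull j m, fderiv_apply hh.differentiableAt]
      rfl
    simp [h0, this]

/-- Higher order obstruction along a curve, for functions. -/
theorem tangent_isBigO {h : E → Fin 1 → ℂ} {hh : Hol h 0} (h0 : h 0 = 0) {γ : ℂ → E}
    (hγ : ContinuousAt γ 0) (hγ0 : γ 0 = 0) (n : ℕ)
    (hpull : (fun t => h (γ t) 0) =O[𝓝 0] fun t => t ^ n) (hfield : ∀ ξ, IsThetaV V ξ →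
      (fun t => 𝒟 h (γ t) (ξ (γ t)) 0) =O[𝓝 0] fun t => t ^ n)
    {ν : E → Fin 1 → ℂ} {hν : Hol ν 0} (hT : vecGerm ν hν ∈ tangentVKe V h hh) :
    (fun t => ν (γ t) 0) =O[𝓝 0] fun t => t ^ n := by
  have tγ : Tendsto γ (𝓝 0) (𝓝 0) := by
    have := hγ.tendsto
    rwa [hγ0] at this
  have bd : ∀ f : E → ℂ, Hol f 0 → (fun t => f (γ t)) =O[𝓝 0] fun _ => (1 : ℂ) :=
    fun f hf => (hf.continuousAt.tendsto.comp tγ).isBigO_one ℂ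
  refine tangent_induction (P := fun ν => (fun t => ν (γ t) 0) =O[𝓝 0] fun t => t ^ n)
    h0 ?_ ?_ ?_ ?_ ?_ ?_ hT
  · intro ν ν' _ he h1
    exact h1.congr' ((tγ.eventually he).mono fun t ht => by
      change ν (γ t) 0 = ν' (γ t) 0
      rw [ht]) EventuallyEq.rfl
  · exact isBigO_zero _ _
  · intro ν ν' _ _ h1 h2
    exact h1.add h2
  · intro f ν a b h1
    simpa using (bd f a).mul h1
  · exact hfield
  · intro j ν a
    obtain rfl := Subsingleton.elim j 0
    simpa using hpull.mul (bd _ (analyticAt_pi_iff.1 a 0))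

theorem smul_mem_tangent {hh : Hol h 0} {f : E → ℂ} {ν : E → Fin q → ℂ}
    (hf : Hol f 0) {hν : Hol ν 0} (hT : vecGerm ν hν ∈ tangentVKe V h hh) :
    vecGerm (fun x => f x • ν x) (hf.smul hν) ∈ tangentVKe V h hh := by
  rw [← germ_smul_vecGerm hf hν]
  exact Submodule.smul_mem _ _ hT

theorem sum_smul_single (c : Fin q → ℂ) :
    ∑ i, c i • vecGerm (E := E) (fun _ => (Pi.single i 1 : Fin q → ℂ)) analyticAt_const =
      vecGerm (fun _ => c) analyticAt_const := by
  funext j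
  rw [Finset.sum_apply]
  exact (germ_sum (fun i => analyticAt_const (v := c i * (Pi.single i 1 : Fin q → ℂ) j)) univ).trans
    (germ_eq_germ_iff.2 (.of_forall fun x => by simp [Pi.single_apply]))

theorem le_of_codim {n : ℕ} {hh : Hol h 0} (h0 : h 0 = 0) (hc : codimVKe V h hh = n) : q ≤ n := by
  have := le_codim_of_independent (V := V) (hh := hh) (n := q)
    (fun i => vecGerm (fun _ => Pi.single i 1) analyticAt_const) (fun c hc => ?_)
  · rw [hc] at this
    exact_mod_cast this
  · rw [sum_smul_single] at hc
    exact tangent_zero h0 hc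

/-- In the extremal case every germ vanishing at the origin is tangent. -/
theorem mem_tangent_of_codim_eq {hh : Hol h 0} (h0 : h 0 = 0)
    (hc : codimVKe V h hh = q) {ν : E → Fin q → ℂ} (hν : Hol ν 0) (ν0 : ν 0 = 0) :
    vecGerm ν hν ∈ tangentVKe V h hh := by
  obtain ⟨c, hc0, hcT⟩ := exists_relation_of_codim_lt (V := V) (hh := hh) (n := q + 1)
    (by rw [hc]; exact_mod_cast Nat.lt_succ_self q)
    (Fin.cons (vecGerm ν hν) fun i => vecGerm (fun _ => Pi.single i 1) analyticAt_const)
  rw [Fin.sum_univ_succ] at hcT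
  simp only [Fin.cons_zero, Fin.cons_succ] at hcT
  rw [sum_smul_single fun i => c i.succ, smul_vecGerm, vecGerm_add] at hcT
  have hz := tangent_zero h0 hcT
  simp only [ν0, smul_zero, zero_add] at hz
  have hcs : ∀ i, c (Fin.succ i) = 0 := fun i => congrFun hz i
  have hc1 : c 0 ≠ 0 := fun h1 => hc0 (funext fun i => Fin.cases h1 hcs i)
  refine tangent_congr (smul_mem_tangent (analyticAt_const (v := (c 0)⁻¹)) hcT) hν
    (.of_forall fun x => ?_)
  simp [hz, smul_smul, hc1]

theorem analyticAt_fun_const {f : E → ℂ} (hf : Hol f 0) :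
    Hol (fun x => (fun _ => f x : Fin 1 → ℂ)) 0 := analyticAt_pi_iff.2 fun _ => hf

/-- For functions of codimension two the square of the maximal ideal is tangent. -/
theorem sq_mem_tangent {h : E → Fin 1 → ℂ} {hh : Hol h 0} (h0 : h 0 = 0)
    (hc : codimVKe V h hh = 2) {f : E → ℂ} (hf : Hol f 0) (f0 : f 0 = 0)
    (hν : Hol (fun x => (fun _ => f x * f x : Fin 1 → ℂ)) 0) :
    vecGerm (fun x => (fun _ => f x * f x : Fin 1 → ℂ)) hν ∈ tangentVKe V h hh := by
  obtain ⟨c, hc0, hcT⟩ := exists_relation_of_codim_lt (V := V) (hh := hh) (n := 3)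
    (by rw [hc]; exact_mod_cast Nat.lt_succ_self 2)
    ![vecGerm (fun _ => (fun _ => 1)) analyticAt_const, vecGerm _ (analyticAt_fun_const hf), vecGerm _ hν]
  rw [Fin.sum_univ_three] at hcT
  simp only [Matrix.cons_val] at hcT
  rw [smul_vecGerm, smul_vecGerm, smul_vecGerm, vecGerm_add, vecGerm_add] at hcT
  have hz := congrFun (tangent_zero h0 hcT) 0
  simp [f0] at hz
  by_cases hc1 : c 1 = 0
  · have hc2 : c 2 ≠ 0 := fun h2 => hc0 (by funext i; fin_cases i <;> simp [hz, hc1, h2])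
    refine tangent_congr (smul_mem_tangent (analyticAt_const (v := (c 2)⁻¹)) hcT) hν
      (.of_forall fun x => ?_)
    funext j
    simp [hz, hc1, hc2]
  · have hu : Hol (fun x => c 1 + c 2 * f x) 0 :=
      analyticAt_const.add (analyticAt_const.mul hf)
    have hu0 : c 1 + c 2 * f 0 ≠ 0 := by simpa [f0] using hc1
    have hv : Hol (fun x => f x * (c 1 + c 2 * f x)⁻¹) 0 := hf.mul (hu.inv hu0)
    refine tangent_congr (smul_mem_tangent hv hcT) hν ?_
    filter_upwards [hu.continuousAt.eventually_ne hu0] with x hx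
    funext j
    simp only [Pi.smul_apply, Pi.add_apply, smul_eq_mul, hz]
    have : f x * (c 1 + c 2 * f x)⁻¹ * (0 * 1 + c 1 * f x + c 2 * (f x * f x)) =
        f x * f x * ((c 1 + c 2 * f x)⁻¹ * (c 1 + c 2 * f x)) := by ring
    rw [this, inv_mul_cancel₀ hx, mul_one]

/-- The square of the maximal ideal is contained in the tangent space. -/
def SqTangent (V : Set E) (h : E → Fin 1 → ℂ) : Prop :=
  ∃ hh : Hol h 0, ∀ f g : E → ℂ, Hol f 0 → Hol g 0 → f 0 = 0 → g 0 = 0 →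
    ∀ hν : Hol (fun x => (fun _ => f x * g x : Fin 1 → ℂ)) 0,
    vecGerm (fun x => (fun _ => f x * g x : Fin 1 → ℂ)) hν ∈ tangentVKe V h hh

/-- Every germ vanishing at the origin is tangent. -/
def MaxTangent (V : Set E) (h : E → Fin q → ℂ) : Prop :=
  ∃ hh : Hol h 0, ∀ ν : E → Fin q → ℂ, ∀ hν : Hol ν 0, ν 0 = 0 →
    vecGerm ν hν ∈ tangentVKe V h hh

theorem sqTangent_of_codim {h : E → Fin 1 → ℂ} {hh : Hol h 0} (h0 : h 0 = 0)
    (hc : codimVKe V h hh = 2) : SqTangent V h := by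
  refine ⟨hh, fun f g hf hg f0 g0 hν => ?_⟩
  have a1 := smul_mem_tangent (analyticAt_const (v := (4 : ℂ)⁻¹))
    (sq_mem_tangent h0 hc (hf.add hg) (by simp [f0, g0]) (analyticAt_fun_const ((hf.add hg).mul (hf.add hg))))
  have a2 := smul_mem_tangent (analyticAt_const (v := -(4 : ℂ)⁻¹))
    (sq_mem_tangent h0 hc (hf.sub hg) (by simp [f0, g0]) (analyticAt_fun_const ((hf.sub hg).mul (hf.sub hg))))
  have a3 := Submodule.add_mem _ a1 a2
  rw [vecGerm_add] at a3
  refine tangent_congr a3 hν (.of_forall fun x => ?_)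
  funext j
  simp
  ring

theorem maxTangent_of_codim {hh : Hol h 0} (h0 : h 0 = 0)
    (hc : codimVKe V h hh = q) : MaxTangent V h :=
  ⟨hh, fun _ hν ν0 => mem_tangent_of_codim_eq h0 hc hν ν0⟩

variable [CompleteSpace E]

open Matrix in
theorem StrongEquiv.mem_tangent {h g : E → Fin q → ℂ} (hs : StrongEquiv V h g)
    {hh : Hol h 0} {hg : Hol g 0} (g0 : g 0 = 0) :
    ∃ ψ : E → E, IsBiholGerm ψ ∧ ∃ A : E → Matrix (Fin q) (Fin q) ℂ, MatAnalyticAt A 0 ∧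
      ∀ ν : E → Fin q → ℂ, ∀ hν : Hol ν 0, (∀ hμ : Hol (fun x => A x *ᵥ ν (ψ x)) 0,
          vecGerm (fun x => A x *ᵥ ν (ψ x)) hμ ∈ tangentVKe V g hg) →
        vecGerm ν hν ∈ tangentVKe V h hh := by
  obtain ⟨ψ, hψ, hV, A, hA, hA0, he⟩ := hs
  obtain ⟨φ, hφ, h1, h2, h4⟩ := hψ.exists_inverse
  have hB : MatAnalyticAt (fun x => (A (φ x))⁻¹) 0 := fun i j =>
    analyticAt_comp_zero (hA.inv hA0 i j) hφ.1 hφ.2.1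
  refine ⟨φ, hφ, _, hB, fun ν hν hm => ?_⟩
  have hμ := analyticAt_mulVec_comp hB hφ hν
  have := mulVec_comp_mem_tangent (hh := hh) g0 hψ hV hA hA0 he (hm hμ)
    (analyticAt_mulVec_comp hA hψ hμ)
  refine tangent_congr this hν ?_
  filter_upwards [h1, eventually_det_ne_zero hA hA0] with x a b
  rw [a, mulVec_mulVec, mul_nonsing_inv _ (isUnit_iff_ne_zero.2 b), one_mulVec]

open Matrix in
theorem MaxTangent.of_strongEquiv {h g : E → Fin q → ℂ} (hm : MaxTangent V g) (g0 : g 0 = 0)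
    (hs : StrongEquiv V h g) : MaxTangent V h := by
  obtain ⟨hg, hm⟩ := hm
  obtain ⟨ψ, hψ, A, hA, key⟩ := hs.mem_tangent (hh := hs.analyticAt hg) (hg := hg) g0
  refine ⟨hs.analyticAt hg, fun ν hν ν0 => key ν hν fun hμ => hm _ hμ ?_⟩
  simp [hψ.2.1, ν0]

open Matrix in
theorem SqTangent.of_strongEquiv {h g : E → Fin 1 → ℂ} (hm : SqTangent V g) (g0 : g 0 = 0)
    (hs : StrongEquiv V h g) : SqTangent V h := by
  obtain ⟨hg, hm⟩ := hm
  obtain ⟨ψ, hψ, A, hA, key⟩ := hs.mem_tangent (hh := hs.analyticAt hg) (hg := hg) g0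
  refine ⟨hs.analyticAt hg, fun f f' hf hf' f0 f0' hν => key _ hν fun hμ => ?_⟩
  have b1 := analyticAt_comp_zero hf hψ.1 hψ.2.1
  have b2 := analyticAt_comp_zero hf' hψ.1 hψ.2.1
  have b3 := (hA 0 0).mul b1
  refine tangent_congr (hm _ _ b3 b2 (by simp [hψ.2.1, f0]) (by simp [hψ.2.1, f0'])
    (analyticAt_pi_iff.2 fun _ => b3.mul b2)) hμ (.of_forall fun x => ?_)
  funext j
  obtain rfl := Subsingleton.elim j 0
  simp [mulVec, dotProduct, mul_assoc]

/-- For a function of codimension two the tangent space is not the whole maximal ideal, and this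
is visible on linear parts. -/
theorem exists_linear_obstruction {ι : Type*} [Fintype ι] [DecidableEq ι] {V : Set (ι → ℂ)}
    {h : (ι → ℂ) → Fin 1 → ℂ} {hh : Hol h 0} (h0 : h 0 = 0)
    (hc : codimVKe V h hh = 2) : ∃ e : ι → ℂ, e ≠ 0 ∧ ∀ ν, ∀ hν : Hol ν 0,
      vecGerm ν hν ∈ tangentVKe V h hh → 𝒟 ν 0 e 0 = 0 := by
  obtain ⟨hh', hsq⟩ := sqTangent_of_codim h0 hc
  let L : Submodule ℂ (Module.Dual ℂ (ι → ℂ)) :=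
    { carrier := {l | ∃ ν, ∃ hν : Hol ν 0, vecGerm ν hν ∈ tangentVKe V h hh ∧ ∀ e, l e = 𝒟 ν 0 e 0}
      zero_mem' := ⟨fun _ => 0, analyticAt_const, by
        rw [← vecGerm_zero]; exact Submodule.zero_mem _, by simp⟩
      add_mem' := by
        rintro a b ⟨ν, hν, hT, ha⟩ ⟨ν', hν', hT', hb⟩
        refine ⟨fun x => ν x + ν' x, hν.add hν', Submodule.add_mem _ hT hT', fun e => ?_⟩
        rw [fderiv_fun_add hν.differentiableAt hν'.differentiableAt]
        simp [ha, hb]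
      smul_mem' := by
        rintro c a ⟨ν, hν, hT, ha⟩
        refine ⟨_, _, smul_mem_tangent (analyticAt_const (v := c)) hT, fun e => ?_⟩
        rw [fderiv_fun_const_smul hν.differentiableAt]
        simp [ha] }
  by_cases hL : L = ⊤
  · exfalso
    have hall : ∀ ν : (ι → ℂ) → Fin 1 → ℂ, ∀ hν : Hol ν 0, ν 0 = 0 →
        vecGerm ν hν ∈ tangentVKe V h hh := by
      intro ν hν ν0
      let l : Module.Dual ℂ (ι → ℂ) :=
        ((prj (0 : Fin 1)).comp (𝒟 ν 0)).toLinearMap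
      have hl : l ∈ L := hL ▸ Submodule.mem_top
      obtain ⟨μ, hμ, hT, he⟩ := hl
      have hμ0 := tangent_zero h0 hT
      let F : (ι → ℂ) → ℂ := fun x => ν x 0 - μ x 0
      have hF : Hol F 0 := (analyticAt_pi_iff.1 hν 0).sub (analyticAt_pi_iff.1 hμ 0)
      have hFd : 𝒟 F 0 = 0 := by
        ext e
        have h1 : HasFDerivAt F _ 0 :=
          ((hasFDerivAt_pi'.1 hν.differentiableAt.hasFDerivAt) 0).sub
            ((hasFDerivAt_pi'.1 hμ.differentiableAt.hasFDerivAt) 0)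
        have := he e
        simp only [l] at this
        simp [h1.fderiv] at this ⊢
        rw [this, sub_self]
      obtain ⟨G, hG, hGe⟩ := exists_coordinate_coeff (S := ℂ) (s₀ := 0)
        (F := fun z : (ι → ℂ) × ℂ => F z.1) (analyticAt_comp_zero hF analyticAt_fst rfl)
        (by simp [F, ν0, hμ0])
      let G' : ι → (ι → ℂ) → ℂ := fun l x => G (x, 0) l
      have hG' : ∀ l, Hol (G' l) 0 := fun l =>
        analyticAt_comp_zero (analyticAt_pi_iff.1 hG l) (analyticAt_id.prod analyticAt_const) rfl
      have hGx : ∀ᶠ x in 𝓝 0, F x = ∑ l, x l * G' l x := by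
        have ht : Tendsto (fun x : ι → ℂ => (x, (0 : ℂ))) (𝓝 0) (𝓝 (0, 0)) :=
          (continuous_id.prodMk continuous_const).tendsto' _ _ rfl
        exact ht.eventually hGe
      have hcoord : ∀ l, Hol (fun x : ι → ℂ => x l) 0 := 
        analyticAt_pi_iff.1 analyticAt_id
      have hG0 : ∀ l, G' l 0 = 0 := by
        intro l
        have h1 : HasFDerivAt F (∑ j, ((0 : ι → ℂ) j • 𝒟 (G' j) 0 +
            G' j 0 • prj j)) 0 := by
          refine HasFDerivAt.congr_of_eventuallyEq ?_ hGx
          exact HasFDerivAt.fun_sum fun j _ =>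
            (prj j).hasFDerivAt.mul
              (hG' j).differentiableAt.hasFDerivAt
        have h2 := congrArg (fun K : (ι → ℂ) →L[ℂ] ℂ => K (Pi.single l 1)) (h1.fderiv.symm.trans hFd)
        simpa [_root_.sum_apply, Pi.single_apply] using h2
      have hs : ∀ s : Finset ι, vecGerm (fun x => (fun _ => ∑ l ∈ s, x l * G' l x : Fin 1 → ℂ))
          (analyticAt_fun_const (analyticAt_finset_sum s fun l _ => (hcoord l).mul (hG' l))) ∈ tangentVKe V h hh := by
        intro s
        induction s using Finset.induction_on with
        | empty =>
          simp only [sum_empty]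
          exact Submodule.zero_mem _
        | insert a s ha ih =>
          have := Submodule.add_mem _ (hsq _ _ (hcoord a) (hG' a) rfl (hG0 a)
            (analyticAt_fun_const ((hcoord a).mul (hG' a)))) ih
          rw [vecGerm_add] at this
          refine tangent_congr this _ (.of_forall fun x => ?_)
          funext j
          rw [sum_insert ha]
          rfl
      have := Submodule.add_mem _ hT (hs univ)
      rw [vecGerm_add] at this
      refine tangent_congr this hν ?_
      filter_upwards [hGx] with x hx
      funext j
      obtain rfl := Subsingleton.elim j 0
      simp only [Pi.add_apply]
      rw [← hx]
      simp [F]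
    have hr : codimVKe V h hh ≤ 1 := by
      unfold codimVKe
      refine rank_le_one (Submodule.Quotient.mk (vecGerm (fun _ => fun _ => 1) analyticAt_const))
        fun x => ?_
      obtain ⟨x, rfl⟩ := Submodule.Quotient.mk_surjective _ x
      obtain ⟨f, hf, rfl⟩ := exists_vecGerm x
      refine ⟨f 0 0, ?_⟩
      change Submodule.Quotient.mk (f 0 0 • vecGerm (fun _ => fun _ => 1) analyticAt_const) = _
      rw [smul_vecGerm, Submodule.Quotient.eq]
      refine hall (fun x => f 0 0 • (fun _ => 1) - f x)
        (((analyticAt_const (v := f 0 0)).smul analyticAt_const).sub hf) ?_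
      funext j
      obtain rfl := Subsingleton.elim j 0
      simp
    rw [hc] at hr
    exact absurd hr (by norm_num)
  · obtain ⟨f, hf0, hf⟩ := Submodule.exists_le_ker_of_lt_top L (lt_top_iff_ne_top.2 hL)
    obtain ⟨e, rfl⟩ := (Module.evalEquiv ℂ (ι → ℂ)).surjective f
    refine ⟨e, fun h1 => hf0 (by simp [h1]), fun ν hν hT => ?_⟩
    exact hf (show ((prj (0 : Fin 1)).comp (𝒟 ν 0)).toLinearMap ∈ L from ⟨ν, hν, hT, fun e => rfl⟩)

/-- For a function of codimension two there is at most one linear obstruction. -/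
theorem not_two_linear_obstructions {h : E → Fin 1 → ℂ} {hh : Hol h 0} (h0 : h 0 = 0)
    (hc : codimVKe V h hh = 2) {e e' : E} (f f' : E →L[ℂ] ℂ) (h1 : f e = 1) (h2 : f e' = 0)
    (h3 : f' e = 0) (h4 : f' e' = 1)
    (he : ∀ ν, ∀ hν : Hol ν 0, vecGerm ν hν ∈ tangentVKe V h hh → 𝒟 ν 0 e 0 = 0)
    (he' : ∀ ν, ∀ hν : Hol ν 0, vecGerm ν hν ∈ tangentVKe V h hh → 𝒟 ν 0 e' 0 = 0) : False := by
  let P : (E →L[ℂ] ℂ) → E →L[ℂ] (Fin 1 → ℂ) := fun f => ContinuousLinearMap.pi fun _ => f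
  obtain ⟨c, hc0, hcT⟩ := exists_relation_of_codim_lt (V := V) (hh := hh) (n := 3)
    (by rw [hc]; exact_mod_cast Nat.lt_succ_self 2)
    ![vecGerm (fun _ => (fun _ => 1)) analyticAt_const, vecGerm _ ((P f).analyticAt 0),
      vecGerm _ ((P f').analyticAt 0)]
  rw [Fin.sum_univ_three] at hcT
  simp only [Matrix.cons_val] at hcT
  rw [smul_vecGerm, smul_vecGerm, smul_vecGerm, vecGerm_add, vecGerm_add] at hcT
  have hz := congrFun (tangent_zero h0 hcT) 0
  simp at hz
  have hd : HasFDerivAt (fun x => ((c 0 • fun _ => 1 : Fin 1 → ℂ) + c 1 • P f x) + c 2 • P f' x)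
      (0 + c 1 • P f + c 2 • P f') 0 := by
    exact ((hasFDerivAt_const (c 0 • fun _ => 1 : Fin 1 → ℂ) 0).add
      ((P f).hasFDerivAt.const_smul (c 1))).add ((P f').hasFDerivAt.const_smul (c 2))
  have k1 := he _ _ hcT
  have k2 := he' _ _ hcT
  rw [hd.fderiv] at k1 k2
  simp [P, h1, h2, h3, h4] at k1 k2
  apply hc0
  funext i
  fin_cases i <;> simp [hz, k1, k2]

theorem MaxTangent.eq_zero {h : E → Fin q → ℂ} (hm : MaxTangent V h) (h0 : h 0 = 0) (e : Fin q → E)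
    (hpull : ∀ i m, 𝒟 h 0 (e m) i = 0) (hfield : ∀ ξ, IsThetaV V ξ → ∑ m, 𝒟 h 0 (𝒟 ξ 0 (e m)) m = 0)
    (m : Fin q) (f : E →L[ℂ] ℂ) : f (e m) = 0 := by
  obtain ⟨hh, hm⟩ := hm
  let P : E →L[ℂ] (Fin q → ℂ) := ContinuousLinearMap.pi fun j => if j = m then f else 0
  have := tangent_linear h0 e hpull hfield (hm _ (P.analyticAt 0) (map_zero P))
  rw [P.fderiv, Fintype.sum_eq_single m fun j hj => by simp [P, hj]] at this
  simpa [P] using this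

end Consequences

/-- The coefficient of `y ^ i` in the monic polynomial `P` attached to a point of the target. -/
def pc (X : Target k) (i : ℕ) : ℂ := if i = 0 then -W₁ X else U i X

/-- The coefficient of `y ^ i` in the polynomial `Q` attached to a point of the target. -/
def qc (X : Target k) (i : ℕ) : ℂ := if i = 0 then -X (Sum.inr (Sum.inr 1)) else V i X

/-- The point of the target with prescribed coefficients. -/
def mk (k : ℕ) (p q : ℕ → ℂ) : Target k :=
  Sum.elim (fun i => p (i.val + 1)) (Sum.elim (fun i => q (i.val + 1)) ![-p 0, -q 0])

theorem pc_mk (p q : ℕ → ℂ) {i : ℕ} (hi : i ≤ k - 2) : pc (mk k p q) i = p i := by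
  rcases Nat.eq_zero_or_pos i with rfl | h
  · simp [pc, mk, W₁]
  · have h1 : 1 ≤ i ∧ i ≤ k - 2 := ⟨h, hi⟩
    simp only [pc, U, dif_pos h1, if_neg (by omega : ¬ i = 0), mk, Sum.elim_inl]
    congr 1
    omega

theorem qc_mk (p q : ℕ → ℂ) {i : ℕ} (hi : i ≤ k - 1) : qc (mk k p q) i = q i := by
  rcases Nat.eq_zero_or_pos i with rfl | h
  · simp [qc, mk]
  · have h1 : 1 ≤ i ∧ i ≤ k - 1 := ⟨h, hi⟩
    simp only [qc, V, dif_pos h1, if_neg (by omega : ¬ i = 0), mk, Sum.elim_inl, Sum.elim_inr]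
    congr 1
    omega

theorem pc_eq_zero (X : Target k) {i : ℕ} (h0 : i ≠ 0) (hi : k - 2 < i) : pc X i = 0 := by
  simp only [pc, if_neg h0, U]
  rw [dif_neg]
  omega

theorem qc_eq_zero (X : Target k) {i : ℕ} (h0 : i ≠ 0) (hi : k - 1 < i) : qc X i = 0 := by
  simp only [qc, if_neg h0, V]
  rw [dif_neg]
  omega

theorem mk_pc (X : Target k) : mk k (pc X) (qc X) = X := by
  funext l
  rcases l with i | i | i
  · simp [mk, pc, U]
  · simp [mk, qc, V]
  · fin_cases i <;> simp [mk, pc, qc, W₁]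

theorem mk_congr {p q p' q' : ℕ → ℂ} (h0 : p 0 = p' 0) (h1 : q 0 = q' 0)
    (hp : ∀ i, i ≤ k - 2 → p i = p' i) (hq : ∀ i, i ≤ k - 1 → q i = q' i) :
    mk k p q = mk k p' q' := by
  funext l
  rcases l with i | i | i
  · simpa [mk] using hp _ (by omega)
  · simpa [mk] using hq _ (by omega)
  · fin_cases i <;> simp [mk, h0, h1]

theorem target_ext {X Y : Target k} (hp : ∀ i, i ≤ k - 2 → pc X i = pc Y i)
    (hq : ∀ i, i ≤ k - 1 → qc X i = qc Y i) : X = Y := by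
  rw [← mk_pc X, ← mk_pc Y]
  exact mk_congr (hp 0 (Nat.zero_le _)) (hq 0 (Nat.zero_le _)) hp hq

/-- `pc` as a continuous linear form. -/
def pcL (k i : ℕ) : Target k →L[ℂ] ℂ :=
  LinearMap.toContinuousLinearMap
    { toFun := fun X => pc X i
      map_add' := fun X Y => by
        simp only [pc, W₁, U]
        split_ifs <;> simp [add_comm]
      map_smul' := fun c X => by
        simp only [pc, W₁, U]
        split_ifs <;> simp }

/-- `qc` as a continuous linear form. -/
def qcL (k i : ℕ) : Target k →L[ℂ] ℂ :=
  LinearMap.toContinuousLinearMap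
    { toFun := fun X => qc X i
      map_add' := fun X Y => by
        simp only [qc, V]
        split_ifs <;> simp [add_comm]
      map_smul' := fun c X => by
        simp only [qc, V]
        split_ifs <;> simp }

@[simp] theorem pcL_apply (i : ℕ) (X : Target k) : pcL k i X = pc X i := rfl

@[simp] theorem qcL_apply (i : ℕ) (X : Target k) : qcL k i X = qc X i := rfl

theorem pc_zero (i : ℕ) : pc (0 : Target k) i = 0 := map_zero (pcL k i)
theorem qc_zero (i : ℕ) : qc (0 : Target k) i = 0 := map_zero (qcL k i)
theorem pc_add (X Y : Target k) (i : ℕ) : pc (X + Y) i = pc X i + pc Y i := map_add (pcL k i) X Y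
theorem qc_add (X Y : Target k) (i : ℕ) : qc (X + Y) i = qc X i + qc Y i := map_add (qcL k i) X Y
theorem pc_smul (c : ℂ) (X : Target k) (i : ℕ) : pc (c • X) i = c * pc X i := map_smul (pcL k i) c X
theorem qc_smul (c : ℂ) (X : Target k) (i : ℕ) : qc (c • X) i = c * qc X i := map_smul (qcL k i) c X

theorem analyticAt_mk {p q : E → ℕ → ℂ} {a : E} (hp : ∀ i, i ≤ k - 2 → Hol (fun x => p x i) a)
    (hq : ∀ i, i ≤ k - 1 → Hol (fun x => q x i) a) : Hol (fun x => mk k (p x) (q x)) a := by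
  rw [analyticAt_pi_iff]
  rintro (i | i | i)
  · exact hp _ (by omega)
  · exact hq _ (by omega)
  · fin_cases i
    · exact (hp 0 (Nat.zero_le _)).neg
    · exact (hq 0 (Nat.zero_le _)).neg

theorem hasDerivAt_mk {p q : ℂ → ℕ → ℂ} {p' q' : ℕ → ℂ} {a : ℂ}
    (hp : ∀ i, i ≤ k - 2 → HasDerivAt (fun x => p x i) (p' i) a)
    (hq : ∀ i, i ≤ k - 1 → HasDerivAt (fun x => q x i) (q' i) a) :
    HasDerivAt (fun x => mk k (p x) (q x)) (mk k p' q') a := by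
  rw [hasDerivAt_pi]
  rintro (i | i | i)
  · exact hp _ (by omega)
  · exact hq _ (by omega)
  · fin_cases i
    · exact (hp 0 (Nat.zero_le _)).neg
    · exact (hq 0 (Nat.zero_le _)).neg

/-- The vector of coefficients of `P`. -/
def pv (X : Target k) : Fin k → ℂ := fun i => pc X i

/-- The vector of coefficients of `Q`. -/
def qv (X : Target k) : Fin k → ℂ := fun i => qc X i

/-- The value of the monic polynomial with lower coefficients `p`. -/
def evalP (p : Fin k → ℂ) (y : ℂ) : ℂ := y ^ k + ∑ i, p i * y ^ i.val

/-- The value of the polynomial with coefficients `q`. -/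
def evalQ (q : Fin k → ℂ) (y : ℂ) : ℂ := ∑ i, q i * y ^ i.val

/-- The monic polynomial `P` and the polynomial `Q` have a common root. -/
def CommonRoot (p q : Fin k → ℂ) : Prop := ∃ y, evalP p y = 0 ∧ evalQ q y = 0

theorem mem_image_iff (hk : 2 ≤ k) (X : Target k) : X ∈ image k ↔ CommonRoot (pv X) (qv X) := by
  obtain ⟨n, rfl⟩ : ∃ n, k = n + 2 := ⟨k - 2, by omega⟩
  have eP : ∀ y, evalP (pv X) y = y ^ (n + 2) - W₁ X +
      ∑ i : Fin (n + 2 - 2), X (Sum.inl i) * y ^ (i.val + 1) := by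
    intro y
    have e1 : ∑ i : Fin (n + 2), pv X i * y ^ i.val =
        ∑ i ∈ range (n + 2), pc X i * y ^ i := sum_range (fun i => pc X i * y ^ i) |>.symm
    have e2 : ∑ i : Fin (n + 2 - 2), X (Sum.inl i) * y ^ (i.val + 1) =
        ∑ i ∈ range n, pc X (i + 1) * y ^ (i + 1) := by
      rw [sum_range]
      refine sum_congr rfl fun i _ => ?_
      have : 1 ≤ i.val + 1 ∧ i.val + 1 ≤ n + 2 - 2 := ⟨by omega, by omega⟩
      simp [pc, U, this]
    rw [evalP, e1, e2, sum_range_succ, sum_range_succ',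
      pc_eq_zero X (i := n + 1) (by omega) (by omega)]
    simp [pc]
    ring
  have eQ : ∀ y, evalQ (qv X) y = - X (Sum.inr (Sum.inr 1)) +
      ∑ i : Fin (n + 2 - 1), X (Sum.inr (Sum.inl i)) * y ^ (i.val + 1) := by
    intro y
    have e1 : ∑ i : Fin (n + 2), qv X i * y ^ i.val =
        ∑ i ∈ range (n + 2), qc X i * y ^ i := sum_range (fun i => qc X i * y ^ i) |>.symm
    have e2 : ∑ i : Fin (n + 2 - 1), X (Sum.inr (Sum.inl i)) * y ^ (i.val + 1) =
        ∑ i ∈ range (n + 1), qc X (i + 1) * y ^ (i + 1) := by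
      rw [sum_range]
      refine sum_congr rfl fun i _ => ?_
      have : 1 ≤ i.val + 1 ∧ i.val + 1 ≤ n + 2 - 1 := ⟨by omega, by omega⟩
      simp only [qc, V, dif_pos this, if_neg (Nat.succ_ne_zero _)]
      rfl
    rw [evalQ, e1, e2, sum_range_succ']
    simp [qc]
    ring
  constructor
  · rintro ⟨x, rfl⟩
    refine ⟨x (Sum.inr (Sum.inr 0)), ?_, ?_⟩
    · rw [eP]
      simp [phi, W₁]
    · rw [eQ]
      simp [phi]
  · rintro ⟨y, h1, h2⟩
    rw [eP] at h1
    rw [eQ] at h2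
    refine ⟨Sum.elim (fun i => X (Sum.inl i)) (Sum.elim (fun i => X (Sum.inr (Sum.inl i)))
      fun _ => y), ?_⟩
    funext l
    rcases l with i | i | i
    · simp [phi]
    · simp [phi]
    · fin_cases i
      · simp only [phi, Sum.elim_inl, Sum.elim_inr]
        change y ^ (n + 2) + _ = W₁ X
        linear_combination h1
      · simp only [phi, Sum.elim_inl, Sum.elim_inr]
        change _ = X (Sum.inr (Sum.inr 1))
        exact (neg_add_eq_zero.1 h2).symm

section Companion

open Matrix

/-- The companion matrix of `y ^ k + ∑ p i * y ^ i`: multiplication by `y` modulo this polynomial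
in the basis `1, y, …`. -/
def compan (p : Fin k → ℂ) : Matrix (Fin k) (Fin k) ℂ :=
  Matrix.of fun i j => if j.val + 1 = k then -p i else if i.val = j.val + 1 then 1 else 0

/-- The first basis vector. -/
def e0 : Fin k → ℂ := fun i => if i.val = 0 then 1 else 0

/-- The row vector `(1, y, …, y ^ (k - 1))`. -/
def ev (y : ℂ) : Fin k → ℂ := fun i => y ^ i.val

theorem ev_dotProduct (y : ℂ) (q : Fin k → ℂ) : ev y ⬝ᵥ q = evalQ q y := by
  simp [dotProduct, ev, evalQ, mul_comm]

theorem vecMul_compan_of_lt (v p : Fin k → ℂ) (j : Fin k) (hj : j.val + 1 < k) :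
    (v ᵥ* compan p) j = v ⟨j.val + 1, hj⟩ := by
  simp only [vecMul, dotProduct, compan, of_apply]
  rw [sum_eq_single ⟨j.val + 1, hj⟩]
  · simp [hj.ne]
  · intro i _ hi
    have : i.val ≠ j.val + 1 := fun h => hi (Fin.ext h)
    simp [hj.ne, this]
  · simp

theorem vecMul_compan_last (v p : Fin k → ℂ) (j : Fin k) (hj : j.val + 1 = k) :
    (v ᵥ* compan p) j = -(v ⬝ᵥ p) := by
  simp [vecMul, dotProduct, compan, hj]

theorem ev_vecMul_compan (p : Fin k → ℂ) (y : ℂ) :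
    ev y ᵥ* compan p = fun j => y * ev y j - if j.val + 1 = k then evalP p y else 0 := by
  funext j
  by_cases hj : j.val + 1 = k
  · rw [vecMul_compan_last _ _ _ hj, ev_dotProduct, if_pos hj]
    simp only [ev, evalQ, evalP]
    have : y ^ k = y * y ^ j.val := by rw [← pow_succ', hj]
    rw [this]
    ring
  · rw [vecMul_compan_of_lt _ _ _ (by omega), if_neg hj]
    simp only [ev]
    ring

theorem ev_vecMul_compan_of_root {p : Fin k → ℂ} {y : ℂ} (hy : evalP p y = 0) :
    ev y ᵥ* compan p = y • ev y := by
  rw [ev_vecMul_compan]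
  funext j
  simp [hy]

theorem evalP_eq_zero_of_mem_spectrum (hk : 0 < k) {p : Fin k → ℂ} {y : ℂ}
    (hy : y ∈ spectrum ℂ (compan p)) : evalP p y = 0 := by
  rw [spectrum.mem_iff, Matrix.isUnit_iff_isUnit_det, isUnit_iff_ne_zero, not_not,
    ← exists_vecMul_eq_zero_iff] at hy
  obtain ⟨v, hv, h⟩ := hy
  have h1 : v ᵥ* compan p = y • v := by
    rw [vecMul_sub] at h
    rw [← sub_eq_zero.1 h, Algebra.algebraMap_eq_smul_one, vecMul_smul, vecMul_one]
  have h2 : ∀ i (hi : i < k), v ⟨i, hi⟩ = v ⟨0, hk⟩ * y ^ i := by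
    intro i
    induction i with
    | zero => simp
    | succ i ih =>
      intro hi
      have := congrFun h1 ⟨i, by omega⟩
      rw [vecMul_compan_of_lt _ _ _ hi, Pi.smul_apply, ih (by omega)] at this
      rw [this, smul_eq_mul]
      ring
  have h3 : v = v ⟨0, hk⟩ • ev y := by
    funext i
    exact h2 i.val i.isLt
  have h0 : v ⟨0, hk⟩ ≠ 0 := by
    intro h0
    apply hv
    rw [h3, h0, zero_smul]
  have h4 : ev y ᵥ* compan p = y • ev y := by
    rw [h3, smul_vecMul, smul_comm] at h1
    exact smul_right_injective _ h0 h1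
  rw [ev_vecMul_compan] at h4
  have := congrFun h4 ⟨k - 1, by omega⟩
  rw [if_pos (by simp; omega)] at this
  simpa using this

/-- The powers of the companion matrix applied to the first basis vector give the basis. -/
theorem compan_pow_mulVec_e0 (p : Fin k → ℂ) (j : ℕ) (hj : j < k) :
    compan p ^ j *ᵥ e0 = Pi.single ⟨j, hj⟩ 1 := by
  induction j with
  | zero =>
    funext i
    simp [e0, Pi.single_apply, Fin.ext_iff]
  | succ j ih =>
    rw [pow_succ', ← mulVec_mulVec, ih (by omega)]
    funext i
    simp [compan, Pi.single_apply, Fin.ext_iff, hj.ne]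

theorem compan_pow_self_mulVec_e0 (hk : 0 < k) (p : Fin k → ℂ) : compan p ^ k *ᵥ e0 = -p := by
  obtain ⟨n, rfl⟩ : ∃ n, k = n + 1 := ⟨k - 1, by omega⟩
  rw [pow_succ', ← mulVec_mulVec, compan_pow_mulVec_e0 p n (by omega)]
  funext i
  simp [compan]

/-- `∑ B m • A ^ m`, summed over `m < k`. -/
def matEval (B : ℕ → ℂ) (A : Matrix (Fin k) (Fin k) ℂ) : Matrix (Fin k) (Fin k) ℂ :=
  ∑ m ∈ range k, B m • A ^ m

/-- The polynomial `∑ B m * X ^ m`, summed over `m < k`. -/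
def polyOf (k : ℕ) (B : ℕ → ℂ) : Polynomial ℂ :=
  ∑ m ∈ range k, Polynomial.C (B m) * Polynomial.X ^ m

theorem aeval_polyOf (B : ℕ → ℂ) (A : Matrix (Fin k) (Fin k) ℂ) :
    Polynomial.aeval A (polyOf k B) = matEval B A := by
  simp [polyOf, matEval, Algebra.smul_def]

theorem mulVec_eq_matEval (p v : Fin k → ℂ) : v = ∑ i : Fin k, v i • (compan p ^ i.val *ᵥ e0) := by
  have : ∀ i : Fin k, compan p ^ i.val *ᵥ e0 = Pi.single i 1 := fun i =>
    compan_pow_mulVec_e0 p i.val i.isLt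
  simp only [this]
  funext j
  simp [Pi.single_apply]

theorem vecMul_aeval_of_vecMul {A : Matrix (Fin k) (Fin k) ℂ} {v : Fin k → ℂ} {y : ℂ}
    (h : v ᵥ* A = y • v) (f : Polynomial ℂ) : v ᵥ* Polynomial.aeval A f = f.eval y • v := by
  induction f using Polynomial.induction_on' with
  | add f g hf hg => rw [map_add, vecMul_add, hf, hg, Polynomial.eval_add, add_smul]
  | monomial n a =>
    have : ∀ n, v ᵥ* A ^ n = y ^ n • v := by
      intro n
      induction n with
      | zero => simp
      | succ n ih => rw [pow_succ, ← vecMul_vecMul, ih, smul_vecMul, h, smul_smul, pow_succ]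
    rw [Polynomial.aeval_monomial, Polynomial.eval_monomial, ← Algebra.smul_def, vecMul_smul, this,
      smul_smul]

/-- Evaluation of `B(C) q` where `C` is the companion matrix of `P`, at a point that need not be a
root of `P`. -/
theorem ev_dotProduct_pow_mulVec (p q : Fin k → ℂ) (y : ℂ) (hk : 0 < k) (m : ℕ) :
    ev y ⬝ᵥ (compan p ^ m *ᵥ q) = y ^ m * evalQ q y - evalP p y *
      ∑ i ∈ range m, y ^ (m - 1 - i) * (compan p ^ i *ᵥ q) ⟨k - 1, by omega⟩ := by
  induction m with
  | zero => simp [ev_dotProduct]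
  | succ m ih =>
    have h1 : ∀ v : Fin k → ℂ, ev y ⬝ᵥ (compan p *ᵥ v) =
        y * (ev y ⬝ᵥ v) - evalP p y * v ⟨k - 1, by omega⟩ := by
      intro v
      rw [dotProduct_mulVec, ev_vecMul_compan]
      simp only [dotProduct, sub_mul, sum_sub_distrib, mul_assoc, mul_sum]
      congr 1
      rw [sum_eq_single ⟨k - 1, by omega⟩]
      · rw [if_pos (by simp; omega)]
      · intro i _ hi
        rw [if_neg, zero_mul]
        intro h
        exact hi (Fin.ext (by simp; omega))
      · simp
    rw [pow_succ', ← mulVec_mulVec, h1, ih, sum_range_succ]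
    have : ∀ i ∈ range m, y ^ (m + 1 - 1 - i) * (compan p ^ i *ᵥ q) ⟨k - 1, by omega⟩ =
        y * (y ^ (m - 1 - i) * (compan p ^ i *ᵥ q) ⟨k - 1, by omega⟩) := by
      intro i hi
      have hi : i < m := mem_range.1 hi
      rw [← mul_assoc, ← pow_succ']
      congr 2
      omega
    rw [sum_congr rfl this, ← mul_sum]
    simp
    ring

/-- Roots of a monic polynomial with small coefficients are small. -/
theorem norm_lt_one_of_evalP {p : Fin k → ℂ} {y : ℂ} (hp : ∑ i, ‖p i‖ < 1) (hy : evalP p y = 0) :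
    ‖y‖ < 1 := by
  by_contra hcon
  push Not at hcon
  rcases Nat.eq_zero_or_pos k with rfl | hk
  · simp [evalP] at hy
  have h1 : ‖y‖ ^ k ≤ (∑ i, ‖p i‖) * ‖y‖ ^ (k - 1) := by
    have : y ^ k = -∑ i, p i * y ^ i.val := eq_neg_of_add_eq_zero_left hy
    rw [← norm_pow, this, norm_neg, sum_mul]
    refine (norm_sum_le _ _).trans (sum_le_sum fun i _ => ?_)
    rw [norm_mul, norm_pow]
    exact mul_le_mul_of_nonneg_left (pow_le_pow_right₀ hcon (by omega)) (norm_nonneg _)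
  have h2 : 0 < ‖y‖ ^ (k - 1) := by positivity
  have h3 : ‖y‖ ^ k = ‖y‖ * ‖y‖ ^ (k - 1) := by
    rw [← pow_succ']
    congr 1
    omega
  rw [h3] at h1
  have := le_of_mul_le_mul_right h1 h2
  linarith

end Companion

section Family

open Matrix

/-- `θ(C)`, where `θ = y * ∑ τ m * y ^ m`. -/
def thetaMat (τ : ℕ → ℂ) (p : Fin k → ℂ) : Matrix (Fin k) (Fin k) ℂ :=
  compan p * matEval τ (compan p)

/-- The mean of the eigenvalues of `θ(C)`. -/
def thetaMean (τ : ℕ → ℂ) (p : Fin k → ℂ) : ℂ := (thetaMat τ p).trace / k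

/-- `θ(C)` normalized to have trace zero. -/
def Dmat (τ : ℕ → ℂ) (p : Fin k → ℂ) : Matrix (Fin k) (Fin k) ℂ := thetaMat τ p - thetaMean τ p • 1

/-- The matrix with columns `D ^ j e₀`. -/
def Mmat (τ : ℕ → ℂ) (p : Fin k → ℂ) : Matrix (Fin k) (Fin k) ℂ :=
  Matrix.of fun i j => (Dmat τ p ^ j.val *ᵥ e0) i

/-- The coefficients of `P + B Q` modulo `P`. -/
def addP (B : ℕ → ℂ) (p q : Fin k → ℂ) : Fin k → ℂ := p + matEval B (compan p) *ᵥ q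

/-- The polynomial whose roots are the images of the roots of `P + B Q` by `θ`, translated to have
sum zero. -/
def newP (B τ : ℕ → ℂ) (p q : Fin k → ℂ) (i : ℕ) : ℂ := (Dmat τ (addP B p q)).charpoly.coeff i

/-- The polynomial `Q` in the new variable. -/
def newQ (B τ : ℕ → ℂ) (p q : Fin k → ℂ) : Fin k → ℂ := adjugate (Mmat τ (addP B p q)) *ᵥ q

/-- Extension of a vector by zero. -/
def extV (v : Fin k → ℂ) (i : ℕ) : ℂ := if h : i < k then v ⟨i, h⟩ else 0

/-- The transformations of the target preserving the image of the cross cap. -/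
def move (B τ : ℕ → ℂ) (X : Target k) : Target k :=
  mk k (newP B τ (pv X) (qv X)) (extV (newQ B τ (pv X) (qv X)))

theorem e0_eq (hk : 0 < k) : (e0 : Fin k → ℂ) = Pi.single ⟨0, hk⟩ 1 := by
  funext i
  simp [e0, Pi.single_apply, Fin.ext_iff]

theorem mulVec_e0 (hk : 0 < k) (A : Matrix (Fin k) (Fin k) ℂ) (i : Fin k) :
    (A *ᵥ e0) i = A i ⟨0, hk⟩ := by
  simp [e0_eq hk]

theorem trace_Dmat (hk : 0 < k) (τ : ℕ → ℂ) (p : Fin k → ℂ) : (Dmat τ p).trace = 0 := by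
  have : (k : ℂ) ≠ 0 := by exact_mod_cast hk.ne'
  rw [Dmat, trace_sub, trace_smul, trace_one, thetaMean]
  simp
  field_simp
  ring

theorem newP_last (hk : 0 < k) (B τ : ℕ → ℂ) (p q : Fin k → ℂ) : newP B τ p q (k - 1) = 0 := by
  have : Nonempty (Fin k) := ⟨⟨0, hk⟩⟩
  have := Matrix.trace_eq_neg_charpoly_coeff (Dmat τ (addP B p q))
  rw [trace_Dmat hk, Fintype.card_fin] at this
  rw [newP]
  simpa using this

theorem pv_move (hk : 2 ≤ k) (B τ : ℕ → ℂ) (X : Target k) :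
    pv (move B τ X) = fun i : Fin k => newP B τ (pv X) (qv X) i := by
  funext i
  by_cases hi : i.val ≤ k - 2
  · exact pc_mk _ _ hi
  · have : i.val = k - 1 := by omega
    rw [this, newP_last (by omega)]
    exact pc_eq_zero _ (by omega) (by omega)

theorem qv_move (B τ : ℕ → ℂ) (X : Target k) : qv (move B τ X) = newQ B τ (pv X) (qv X) := by
  funext i
  refine (qc_mk _ _ (by omega)).trans ?_
  simp [extV]

theorem charpoly_coeff_self (D : Matrix (Fin k) (Fin k) ℂ) : D.charpoly.coeff k = 1 := by
  simpa using D.charpoly_monic.coeff_natDegree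

theorem evalP_charpoly (D : Matrix (Fin k) (Fin k) ℂ) (z : ℂ) :
    evalP (fun i : Fin k => D.charpoly.coeff i) z = D.charpoly.eval z := by
  rw [Polynomial.eval_eq_sum_range, show D.charpoly.natDegree = k by simp, sum_range_succ,
    charpoly_coeff_self, sum_range, evalP]
  ring

/-- The polynomial that `Dmat` is the value of. -/
def DPoly (k : ℕ) (τ : ℕ → ℂ) (a : ℂ) : Polynomial ℂ := Polynomial.X * polyOf k τ - Polynomial.C a

theorem aeval_DPoly (τ : ℕ → ℂ) (p : Fin k → ℂ) :
    Polynomial.aeval (compan p) (DPoly k τ (thetaMean τ p)) = Dmat τ p := by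
  simp [DPoly, aeval_polyOf, Dmat, thetaMat, Algebra.algebraMap_eq_smul_one]

theorem ev_vecMul_Mmat {τ : ℕ → ℂ} {p : Fin k → ℂ} {y : ℂ} (hk : 0 < k) (hy : evalP p y = 0) :
    ev y ᵥ* Mmat τ p = ev ((DPoly k τ (thetaMean τ p)).eval y) := by
  have h1 := vecMul_aeval_of_vecMul (ev_vecMul_compan_of_root hy) (DPoly k τ (thetaMean τ p))
  rw [aeval_DPoly] at h1
  have h2 : ∀ n, ev y ᵥ* Dmat τ p ^ n = (DPoly k τ (thetaMean τ p)).eval y ^ n • ev y := by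
    intro n
    induction n with
    | zero => simp
    | succ n ih => rw [pow_succ, ← vecMul_vecMul, ih, smul_vecMul, h1, smul_smul, pow_succ]
  funext j
  have h3 : (ev y ᵥ* Mmat τ p) j = ev y ⬝ᵥ (Dmat τ p ^ j.val *ᵥ e0) := rfl
  rw [h3, dotProduct_mulVec, h2, smul_dotProduct, ev_dotProduct]
  simp [ev, evalQ, e0_eq hk, Pi.single_apply]

theorem evalQ_newQ {B τ : ℕ → ℂ} {p q : Fin k → ℂ} {y : ℂ} (hk : 0 < k)
    (hy : evalP (addP B p q) y = 0) :
    evalQ (newQ B τ p q) ((DPoly k τ (thetaMean τ (addP B p q))).eval y) =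
      (Mmat τ (addP B p q)).det * evalQ q y := by
  rw [← ev_dotProduct, ← ev_vecMul_Mmat hk hy, newQ, ← dotProduct_mulVec, mulVec_mulVec,
    mul_adjugate, smul_mulVec, one_mulVec, dotProduct_smul, ev_dotProduct, smul_eq_mul]

theorem evalP_addP (B : ℕ → ℂ) (p q : Fin k → ℂ) (y : ℂ) (hk : 0 < k) :
    evalP (addP B p q) y = evalP p y * (1 - ∑ m ∈ range k, B m * ∑ i ∈ range m,
      y ^ (m - 1 - i) * (compan p ^ i *ᵥ q) ⟨k - 1, by omega⟩) +
      (∑ m ∈ range k, B m * y ^ m) * evalQ q y := by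
  have h1 : evalP (addP B p q) y = evalP p y + ev y ⬝ᵥ (matEval B (compan p) *ᵥ q) := by
    rw [ev_dotProduct]
    simp only [evalP, evalQ, addP, Pi.add_apply, add_mul, sum_add_distrib]
    ring
  rw [h1, matEval, sum_mulVec, dotProduct_sum]
  simp only [smul_mulVec, dotProduct_smul, ev_dotProduct_pow_mulVec p q y hk, smul_eq_mul, mul_sub,
    sum_sub_distrib, sum_mul, mul_one, mul_sum]
  have h2 : ∀ m, B m * (y ^ m * evalQ q y) = B m * y ^ m * evalQ q y := fun m => by ring
  have h3 : ∀ m i, B m * (evalP p y * (y ^ (m - 1 - i) * (compan p ^ i *ᵥ q) ⟨k - 1, by omega⟩)) =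
      evalP p y * (B m * (y ^ (m - 1 - i) * (compan p ^ i *ᵥ q) ⟨k - 1, by omega⟩)) :=
    fun m i => by ring
  simp only [h2, h3]
  ring

theorem isRoot_charpoly_Dmat_iff (hk : 0 < k) (τ : ℕ → ℂ) (p : Fin k → ℂ) (z : ℂ) :
    evalP (fun i : Fin k => (Dmat τ p).charpoly.coeff i) z = 0 ↔
      ∃ y, evalP p y = 0 ∧ (DPoly k τ (thetaMean τ p)).eval y = z := by
  have : Nonempty (Fin k) := ⟨⟨0, hk⟩⟩
  rw [evalP_charpoly]
  constructor
  · intro h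
    have h1 : z ∈ spectrum ℂ (Dmat τ p) := Matrix.mem_spectrum_iff_isRoot_charpoly.2 h
    rw [← aeval_DPoly, spectrum.map_polynomial_aeval_of_nonempty _ _
      (spectrum.nonempty_of_isAlgClosed_of_finiteDimensional ℂ (compan p))] at h1
    obtain ⟨y, hy, rfl⟩ := h1
    exact ⟨y, evalP_eq_zero_of_mem_spectrum hk hy, rfl⟩
  · rintro ⟨y, hy, rfl⟩
    refine Matrix.mem_spectrum_iff_isRoot_charpoly.1 ?_
    rw [spectrum.mem_iff, Matrix.isUnit_iff_isUnit_det, isUnit_iff_ne_zero, not_not,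
      ← exists_vecMul_eq_zero_iff]
    refine ⟨ev y, fun h => ?_, ?_⟩
    · have := congrFun h ⟨0, hk⟩
      simp [ev] at this
    · have h1 := vecMul_aeval_of_vecMul (ev_vecMul_compan_of_root hy) (DPoly k τ (thetaMean τ p))
      rw [aeval_DPoly] at h1
      rw [vecMul_sub, h1, Algebra.algebraMap_eq_smul_one, vecMul_smul, vecMul_one, sub_self]

theorem commonRoot_new (hk : 0 < k) {B τ : ℕ → ℂ} {p q : Fin k → ℂ} (h : CommonRoot p q) :
    CommonRoot (fun i : Fin k => newP B τ p q i) (newQ B τ p q) := by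
  obtain ⟨y, h1, h2⟩ := h
  have h3 : evalP (addP B p q) y = 0 := by
    rw [evalP_addP B p q y hk, h1, h2]
    ring
  refine ⟨(DPoly k τ (thetaMean τ (addP B p q))).eval y,
    (isRoot_charpoly_Dmat_iff hk _ _ _).2 ⟨y, h3, rfl⟩, ?_⟩
  rw [evalQ_newQ hk h3, h2, mul_zero]

theorem commonRoot_of_new (hk : 0 < k) {B τ : ℕ → ℂ} {p q : Fin k → ℂ}
    (hp : ∑ i, ‖addP B p q i‖ < 1) (hM : (Mmat τ (addP B p q)).det ≠ 0)
    (hR : ∑ m ∈ range k, ‖B m‖ * ∑ i ∈ range m, ‖(compan p ^ i *ᵥ q) ⟨k - 1, by omega⟩‖ < 1)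
    (h : CommonRoot (fun i : Fin k => newP B τ p q i) (newQ B τ p q)) : CommonRoot p q := by
  obtain ⟨z, h1, h2⟩ := h
  obtain ⟨y, h3, rfl⟩ := (isRoot_charpoly_Dmat_iff hk _ _ _).1 h1
  rw [evalQ_newQ hk h3] at h2
  have h4 : evalQ q y = 0 := (mul_eq_zero.1 h2).resolve_left hM
  refine ⟨y, ?_, h4⟩
  rw [evalP_addP B p q y hk, h4, mul_zero, add_zero] at h3
  refine (mul_eq_zero.1 h3).resolve_right ?_
  have hy := norm_lt_one_of_evalP hp (by rw [evalP_addP B p q y hk, h4, mul_zero, add_zero, h3])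
  intro h5
  have h6 : ‖∑ m ∈ range k, B m * ∑ i ∈ range m,
      y ^ (m - 1 - i) * (compan p ^ i *ᵥ q) ⟨k - 1, by omega⟩‖ < 1 := by
    refine lt_of_le_of_lt ((norm_sum_le _ _).trans (sum_le_sum fun m _ => ?_)) hR
    rw [norm_mul]
    refine mul_le_mul_of_nonneg_left ((norm_sum_le _ _).trans (sum_le_sum fun i _ => ?_))
      (norm_nonneg _)
    rw [norm_mul, norm_pow]
    exact mul_le_of_le_one_left (norm_nonneg _) (pow_le_one₀ (norm_nonneg _) hy.le)
  rw [← sub_eq_zero.1 h5] at h6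
  simp at h6

end Family

section FamilyAnalytic

open Matrix

variable {a : E}
  {B τ : E → ℕ → ℂ} {p q : E → Fin k → ℂ}

theorem MatAnalyticAt.compan (hp : PiAnalyticAt p a) : MatAnalyticAt (fun x => compan (p x)) a := by
  intro i j
  simp only [CrossCap.compan, of_apply]
  split_ifs
  exacts [(hp i).neg, analyticAt_const, analyticAt_const]

theorem MatAnalyticAt.matEval {A : E → Matrix (Fin k) (Fin k) ℂ}
    (hB : PiAnalyticAt B a) (hA : MatAnalyticAt A a) :
    MatAnalyticAt (fun x => matEval (B x) (A x)) a :=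
  MatAnalyticAt.sum _ fun m _ => MatAnalyticAt.smul (hB m) (hA.pow m)

theorem MatAnalyticAt.thetaMat (hτ : PiAnalyticAt τ a) (hp : PiAnalyticAt p a) :
    MatAnalyticAt (fun x => thetaMat (τ x) (p x)) a :=
  (MatAnalyticAt.compan hp).mul (MatAnalyticAt.matEval hτ (MatAnalyticAt.compan hp))

theorem analyticAt_thetaMean (hτ : PiAnalyticAt τ a) (hp : PiAnalyticAt p a) :
    Hol (fun x => thetaMean (τ x) (p x)) a := by
  simp only [thetaMean, div_eq_mul_inv]
  exact (MatAnalyticAt.thetaMat hτ hp).trace.mul analyticAt_const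

theorem MatAnalyticAt.Dmat (hτ : PiAnalyticAt τ a)
    (hp : PiAnalyticAt p a) : MatAnalyticAt (fun x => Dmat (τ x) (p x)) a :=
  (MatAnalyticAt.thetaMat hτ hp).sub
    (MatAnalyticAt.smul (analyticAt_thetaMean hτ hp) (MatAnalyticAt.const 1))

theorem MatAnalyticAt.Mmat (hτ : PiAnalyticAt τ a)
    (hp : PiAnalyticAt p a) : MatAnalyticAt (fun x => Mmat (τ x) (p x)) a :=
  fun i j => MatAnalyticAt.mulVec (v := fun _ => e0) ((MatAnalyticAt.Dmat hτ hp).pow j.val)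
    (fun _ => analyticAt_const) i

theorem analyticAt_addP (hB : PiAnalyticAt B a) (hp : PiAnalyticAt p a) (hq : PiAnalyticAt q a)
    (i : Fin k) : Hol (fun x => addP (B x) (p x) (q x) i) a :=
  (hp i).add ((MatAnalyticAt.matEval hB (MatAnalyticAt.compan hp)).mulVec hq i)

theorem analyticAt_newP (hB : PiAnalyticAt B a) (hτ : PiAnalyticAt τ a) (hp : PiAnalyticAt p a)
    (hq : PiAnalyticAt q a) (i : ℕ) : Hol (fun x => newP (B x) (τ x) (p x) (q x) i) a :=
  (MatAnalyticAt.Dmat hτ (analyticAt_addP hB hp hq)).charpoly_coeff i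

theorem analyticAt_newQ (hB : PiAnalyticAt B a) (hτ : PiAnalyticAt τ a) (hp : PiAnalyticAt p a)
    (hq : PiAnalyticAt q a) (i : Fin k) : Hol (fun x => newQ (B x) (τ x) (p x) (q x) i) a :=
  (MatAnalyticAt.Mmat hτ (analyticAt_addP hB hp hq)).adjugate.mulVec hq i

end FamilyAnalytic

section LinearPart

open Matrix

theorem compan_zero_pow_apply (m : ℕ) (i j : Fin k) :
    ((compan (0 : Fin k → ℂ)) ^ m) i j = if i.val = j.val + m then 1 else 0 := by
  induction m generalizing i j with
  | zero => simp [Matrix.one_apply, Fin.ext_iff]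
  | succ m ih =>
    rw [pow_succ, Matrix.mul_apply]
    have hc : ∀ l j : Fin k, compan (0 : Fin k → ℂ) l j =
        if j.val + 1 = k then 0 else if l.val = j.val + 1 then 1 else 0 := fun l j => by
      simp [compan]
    simp only [ih, hc]
    by_cases hj : j.val + 1 = k
    · simp only [hj, if_true, mul_zero, sum_const_zero]
      rw [if_neg (by omega)]
    · rw [Fintype.sum_eq_single ⟨j.val + 1, by omega⟩]
      · simp only [if_neg hj, if_true, mul_one]
        exact if_congr (by omega) rfl rfl
      · grind

theorem matEval_compan_zero_apply (B : ℕ → ℂ) (i j : Fin k) :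
    matEval B (compan (0 : Fin k → ℂ)) i j = if j.val ≤ i.val then B (i.val - j.val) else 0 := by
  simp only [matEval, Matrix.sum_apply, Matrix.smul_apply, compan_zero_pow_apply, smul_eq_mul,
    mul_ite, mul_one, mul_zero]
  by_cases h : j.val ≤ i.val
  · rw [if_pos h, sum_eq_single (i.val - j.val)]
    · rw [if_pos (by omega)]
    · exact fun m _ hm => if_neg (by omega)
    · grind
  · rw [if_neg h]
    exact sum_eq_zero fun m _ => if_neg (by omega)

/-- A lower triangular Toeplitz matrix. -/
def Lower (A : Matrix (Fin k) (Fin k) ℂ) : Prop := ∀ i j : Fin k, i < j → A i j = 0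

theorem lower_matEval (B : ℕ → ℂ) : Lower (matEval B (compan (0 : Fin k → ℂ))) := by
  intro i j h
  rw [matEval_compan_zero_apply, if_neg]
  have : i.val < j.val := h
  omega

theorem Lower.mul {A A' : Matrix (Fin k) (Fin k) ℂ} (h : Lower A) (h' : Lower A') :
    Lower (A * A') := by
  intro i j hij
  rw [Matrix.mul_apply]
  refine sum_eq_zero fun l _ => ?_
  rcases lt_or_ge i l with h1 | h1
  · rw [h i l h1, zero_mul]
  · rw [h' l j (lt_of_le_of_lt h1 hij), mul_zero]

theorem Lower.one : Lower (1 : Matrix (Fin k) (Fin k) ℂ) := fun _ _ h => Matrix.one_apply_ne h.ne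

theorem Lower.pow {A : Matrix (Fin k) (Fin k) ℂ} (h : Lower A) (n : ℕ) : Lower (A ^ n) := by
  induction n with
  | zero => rw [pow_zero]; exact Lower.one
  | succ n ih => rw [pow_succ]; exact ih.mul h

theorem Lower.mul_diag {A A' : Matrix (Fin k) (Fin k) ℂ} (h : Lower A) (h' : Lower A') (i : Fin k) :
    (A * A') i i = A i i * A' i i := by
  rw [Matrix.mul_apply, sum_eq_single i]
  · intro l _ hl
    rcases lt_or_gt_of_ne hl with h1 | h1
    · rw [h' l i h1, mul_zero]
    · rw [h i l h1, zero_mul]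
  · simp

theorem Lower.pow_diag {A : Matrix (Fin k) (Fin k) ℂ} (h : Lower A) (i : Fin k) (n : ℕ) :
    (A ^ n) i i = A i i ^ n := by
  induction n with
  | zero => simp
  | succ n ih => rw [pow_succ, (h.pow n).mul_diag h, ih, pow_succ]

theorem Lower.det {A : Matrix (Fin k) (Fin k) ℂ} (h : Lower A) : A.det = ∏ i, A i i :=
  Matrix.det_of_isLowerTriangular A fun i j hij => h i j hij

theorem thetaMat_zero (τ : ℕ → ℂ) (i j : Fin k) :
    thetaMat τ (0 : Fin k → ℂ) i j = if j.val < i.val then τ (i.val - j.val - 1) else 0 := by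
  rw [thetaMat, Matrix.mul_apply]
  simp only [matEval_compan_zero_apply]
  have h1 : ∀ l : Fin k, compan (0 : Fin k → ℂ) i l = if i.val = l.val + 1 then 1 else 0 := by
    intro l
    simpa using compan_zero_pow_apply 1 i l
  simp only [h1]
  rcases Nat.eq_zero_or_pos i.val with hi | hi
  · rw [if_neg (by omega)]
    exact sum_eq_zero fun l _ => by rw [if_neg (by omega), zero_mul]
  · rw [Fintype.sum_eq_single ⟨i.val - 1, by omega⟩]
    · rw [if_pos (by simp; omega), one_mul]
      grind
    · grind

theorem thetaMean_zero (τ : ℕ → ℂ) : thetaMean τ (0 : Fin k → ℂ) = 0 := by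
  simp [thetaMean, Matrix.trace, thetaMat_zero]

theorem Dmat_zero (τ : ℕ → ℂ) : Dmat τ (0 : Fin k → ℂ) = thetaMat τ 0 := by
  rw [Dmat, thetaMean_zero, zero_smul, sub_zero]

theorem commute_matEval (τ : ℕ → ℂ) (A : Matrix (Fin k) (Fin k) ℂ) : Commute A (matEval τ A) := by
  exact Commute.sum_right _ _ _ fun m _ => ((Commute.refl A).pow_right m).smul_right _

/-- The linear system satisfied by the new coefficients. -/
theorem Mmat_mulVec_charpoly (hk : 0 < k) (τ : ℕ → ℂ) (p : Fin k → ℂ) :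
    Mmat τ p *ᵥ (fun i : Fin k => (Dmat τ p).charpoly.coeff i) =
      matEval τ (compan p) ^ k *ᵥ p + thetaMean τ p •
        ((∑ i ∈ range k, thetaMat τ p ^ i * Dmat τ p ^ (k - 1 - i)) *ᵥ e0) := by
  have hd : (Dmat τ p).charpoly.natDegree = k := by simp
  have h1 : ∑ i ∈ range k, (Dmat τ p).charpoly.coeff i • Dmat τ p ^ i + Dmat τ p ^ k = 0 := by
    have := Matrix.aeval_self_charpoly (Dmat τ p)
    rwa [Polynomial.aeval_eq_sum_range, hd, sum_range_succ, charpoly_coeff_self, one_smul] at this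
  have h2 : Mmat τ p *ᵥ (fun i : Fin k => (Dmat τ p).charpoly.coeff i) =
      (∑ i ∈ range k, (Dmat τ p).charpoly.coeff i • Dmat τ p ^ i) *ᵥ e0 := by
    rw [sum_mulVec, sum_range]
    funext l
    simp only [mulVec, dotProduct, Mmat, of_apply, Finset.sum_apply, Matrix.smul_apply,
      smul_eq_mul, sum_mul]
    refine sum_congr rfl fun i _ => sum_congr rfl fun j _ => ?_
    ring
  have hcomm : Commute (thetaMat τ p) (Dmat τ p) :=
    (Commute.refl _).sub_right ((Commute.one_right _).smul_right _)
  have h3 := hcomm.mul_geom_sum₂ k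
  have h4 : thetaMat τ p - Dmat τ p = thetaMean τ p • 1 := by simp [Dmat]
  rw [h4, smul_mul_assoc, one_mul] at h3
  have h5 : thetaMat τ p ^ k *ᵥ e0 = -(matEval τ (compan p) ^ k *ᵥ p) := by
    rw [thetaMat, (commute_matEval τ (compan p)).mul_pow,
      ((commute_matEval τ (compan p)).pow_pow k k).eq, ← mulVec_mulVec,
      compan_pow_self_mulVec_e0 hk, mulVec_neg]
  have h6 : Dmat τ p ^ k = thetaMat τ p ^ k -
      thetaMean τ p • ∑ i ∈ range k, thetaMat τ p ^ i * Dmat τ p ^ (k - 1 - i) := by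
    rw [h3]; abel
  rw [h2, eq_neg_of_add_eq_zero_left h1, h6, neg_mulVec, sub_mulVec, h5, smul_mulVec]
  abel

theorem matEval_zero_diag (τ : ℕ → ℂ) (i : Fin k) :
    matEval τ (compan (0 : Fin k → ℂ)) i i = τ 0 := by
  simp [matEval_compan_zero_apply]

theorem Mmat_zero_apply (τ : ℕ → ℂ) (i j : Fin k) : Mmat τ (0 : Fin k → ℂ) i j =
      if j.val ≤ i.val then ((matEval τ (compan (0 : Fin k → ℂ))) ^ j.val *ᵥ e0)
        ⟨i.val - j.val, by omega⟩ else 0 := by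
  have h1 : Mmat τ (0 : Fin k → ℂ) i j = ((compan (0 : Fin k → ℂ)) ^ j.val *ᵥ
      ((matEval τ (compan (0 : Fin k → ℂ))) ^ j.val *ᵥ e0)) i := by
    rw [Mmat, of_apply, Dmat_zero, thetaMat, (commute_matEval τ _).mul_pow, mulVec_mulVec]
  rw [h1]
  generalize matEval τ (compan (0 : Fin k → ℂ)) ^ j.val *ᵥ e0 = v
  simp only [mulVec, dotProduct, compan_zero_pow_apply]
  by_cases h : j.val ≤ i.val
  · rw [if_pos h, Fintype.sum_eq_single ⟨i.val - j.val, by omega⟩]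
    · rw [if_pos (by simp; omega), one_mul]
    · grind
  · rw [if_neg h]
    exact sum_eq_zero fun l _ => by rw [if_neg (by omega), zero_mul]

theorem lower_Mmat_zero (τ : ℕ → ℂ) : Lower (Mmat τ (0 : Fin k → ℂ)) := by
  intro i j h
  have : i.val < j.val := h
  rw [Mmat_zero_apply, if_neg (by omega)]

theorem Mmat_zero_diag (τ : ℕ → ℂ) (i : Fin k) : Mmat τ (0 : Fin k → ℂ) i i = τ 0 ^ i.val := by
  have hk : 0 < k := by have := i.isLt; omega
  rw [Mmat_zero_apply, if_pos le_rfl, mulVec_e0 hk]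
  have : (⟨i.val - i.val, by omega⟩ : Fin k) = ⟨0, hk⟩ := by simp
  rw [this, (lower_matEval τ).pow_diag, matEval_zero_diag]

theorem det_Mmat_zero {τ : ℕ → ℂ} (h : τ 0 ≠ 0) : (Mmat τ (0 : Fin k → ℂ)).det ≠ 0 := by
  rw [(lower_Mmat_zero τ).det]
  simp only [Mmat_zero_diag]
  exact prod_ne_zero_iff.2 fun i _ => pow_ne_zero _ h

theorem geom_zero_mulVec (hk : 0 < k) {τ : ℕ → ℂ} :
    (∑ i ∈ range k, thetaMat τ (0 : Fin k → ℂ) ^ i * Dmat τ (0 : Fin k → ℂ) ^ (k - 1 - i)) *ᵥ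
      e0 = Mmat τ (0 : Fin k → ℂ) *ᵥ Pi.single ⟨k - 1, by omega⟩ (k : ℂ) := by
  have h1 : ∀ i ∈ range k, thetaMat τ (0 : Fin k → ℂ) ^ i *
      Dmat τ (0 : Fin k → ℂ) ^ (k - 1 - i) = Dmat τ (0 : Fin k → ℂ) ^ (k - 1) := by
    intro i hi
    have := mem_range.1 hi
    rw [Dmat_zero, ← pow_add, show i + (k - 1 - i) = k - 1 by omega]
  rw [sum_congr rfl h1, sum_const, card_range, smul_mulVec]
  funext i
  simp [Mmat, mul_comm]

theorem hasDerivAt_mulVec_of_zero {A : ℂ → Matrix (Fin k) (Fin k) ℂ} {v : ℂ → Fin k → ℂ}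
    {v' : Fin k → ℂ} (hA : ∀ i j, ContinuousAt (fun t => A t i j) 0) (hv0 : v 0 = 0)
    (hv : ∀ j, HasDerivAt (fun t => v t j) (v' j) 0) (i : Fin k) :
    HasDerivAt (fun t => (A t *ᵥ v t) i) ((A 0 *ᵥ v') i) 0 := by
  simp only [mulVec, dotProduct]
  refine HasDerivAt.fun_sum fun j _ => ?_
  have h1 := hv j
  rw [hasDerivAt_iff_tendsto_slope_zero] at h1 ⊢
  have h2 := ((hA i j).tendsto.mono_left nhdsWithin_le_nhds).mul h1
  refine h2.congr' (.of_forall fun t => ?_)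
  simp [hv0]
  ring

variable {B τ : ℂ → ℕ → ℂ} {p q : ℂ → Fin k → ℂ} {p' q' : Fin k → ℂ}

theorem hasDerivAt_addP (hB : PiAnalyticAt B 0) (hpa : PiAnalyticAt p 0)
    (p0 : p 0 = 0) (q0 : q 0 = 0) (hp : ∀ i, HasDerivAt (fun t => p t i) (p' i) 0)
    (hq : ∀ i, HasDerivAt (fun t => q t i) (q' i) 0) (i : Fin k) :
    HasDerivAt (fun t => addP (B t) (p t) (q t) i) ((p' + matEval (B 0) (compan 0) *ᵥ q') i) 0 := by
  have h1 := hasDerivAt_mulVec_of_zero (A := fun t => matEval (B t) (compan (p t)))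
    (fun i j => (MatAnalyticAt.matEval hB (MatAnalyticAt.compan hpa) i j).continuousAt) q0 hq i
  rw [p0] at h1
  exact (hp i).add h1

theorem addP_zero (B : ℕ → ℂ) : addP B (0 : Fin k → ℂ) 0 = 0 := by simp [addP]

/-- The linear part of the new coefficients of `P`. -/
theorem hasDerivAt_newP (hk : 0 < k) (hB : PiAnalyticAt B 0)
    (hτ : PiAnalyticAt τ 0) (hτ0 : τ 0 0 ≠ 0) (hpa : PiAnalyticAt p 0) (hqa : PiAnalyticAt q 0)
    (p0 : p 0 = 0) (q0 : q 0 = 0) (hp : ∀ i, HasDerivAt (fun t => p t i) (p' i) 0)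
    (hq : ∀ i, HasDerivAt (fun t => q t i) (q' i) 0) (i : Fin k) (hi : i.val ≠ k - 1) :
    HasDerivAt (fun t => newP (B t) (τ t) (p t) (q t) i)
      (((Mmat (τ 0) 0)⁻¹ *ᵥ (matEval (τ 0) (compan 0) ^ k *ᵥ
        (p' + matEval (B 0) (compan 0) *ᵥ q'))) i) 0 := by
  let r : ℂ → Fin k → ℂ := fun t => addP (B t) (p t) (q t)
  have r0 : r 0 = 0 := by simp only [r, p0, q0, addP_zero]
  have hra : PiAnalyticAt r 0 := analyticAt_addP hB hpa hqa
  have hM := MatAnalyticAt.Mmat hτ hra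
  have hdet : (Mmat (τ 0) (r 0)).det ≠ 0 := by rw [r0]; exact det_Mmat_zero hτ0
  have hMi := hM.inv hdet
  let A : ℂ → Matrix (Fin k) (Fin k) ℂ := fun t =>
    (Mmat (τ t) (r t))⁻¹ * matEval (τ t) (compan (r t)) ^ k
  have hA : MatAnalyticAt A 0 := hMi.mul ((MatAnalyticAt.matEval hτ (MatAnalyticAt.compan hra)).pow k)
  let S : ℂ → Matrix (Fin k) (Fin k) ℂ := fun t => (Mmat (τ t) (r t))⁻¹ *
    ∑ i ∈ range k, thetaMat (τ t) (r t) ^ i * Dmat (τ t) (r t) ^ (k - 1 - i)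
  have hS : MatAnalyticAt S 0 := hMi.mul (MatAnalyticAt.sum _ fun i _ =>
    ((MatAnalyticAt.thetaMat hτ hra).pow i).mul ((MatAnalyticAt.Dmat hτ hra).pow _))
  have ha := analyticAt_thetaMean hτ hra
  have ha0 : thetaMean (τ 0) (r 0) = 0 := by rw [r0, thetaMean_zero]
  have h1 := hasDerivAt_mulVec_of_zero (A := A) (fun i j => (hA i j).continuousAt) r0
    (hasDerivAt_addP hB hpa p0 q0 hp hq) i
  have h2 := hasDerivAt_mulVec_of_zero (A := S) (v := fun t => thetaMean (τ t) (r t) • e0)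
    (v' := deriv (fun t => thetaMean (τ t) (r t)) 0 • e0)
    (fun i j => (hS i j).continuousAt) (by rw [ha0, zero_smul])
    (fun j => ha.differentiableAt.hasDerivAt.mul_const _) i
  have h3 := h1.add h2
  have e1 : A 0 = (Mmat (τ 0) 0)⁻¹ * matEval (τ 0) (compan 0) ^ k := by simp only [A, r0]
  have e2 : (S 0 *ᵥ (deriv (fun t => thetaMean (τ t) (r t)) 0 • e0)) i = 0 := by
    rw [mulVec_smul]
    simp only [S, r0]
    rw [← mulVec_mulVec, geom_zero_mulVec hk, mulVec_mulVec,
      nonsing_inv_mul _ (isUnit_iff_ne_zero.2 (det_Mmat_zero hτ0)), one_mulVec, Pi.smul_apply,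
      Pi.single_eq_of_ne, smul_zero]
    intro h
    exact hi (by rw [h])
  rw [e1, e2, add_zero, ← mulVec_mulVec] at h3
  refine h3.congr_of_eventuallyEq ?_
  filter_upwards [hM.det.continuousAt.eventually_ne hdet] with t ht
  have h4 := Mmat_mulVec_charpoly hk (τ t) (r t)
  have h5 := congrArg (fun v => ((Mmat (τ t) (r t))⁻¹ *ᵥ v) i) h4
  simp only [mulVec_mulVec, nonsing_inv_mul _ (isUnit_iff_ne_zero.2 ht), one_mulVec,
    mulVec_add] at h5
  refine h5.trans ?_
  simp only [A, S, Pi.add_apply, mulVec_smul, mulVec_mulVec]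

/-- The linear part of the new coefficients of `Q`. -/
theorem hasDerivAt_newQ (hB : PiAnalyticAt B 0) (hτ : PiAnalyticAt τ 0)
    (hpa : PiAnalyticAt p 0) (hqa : PiAnalyticAt q 0)
    (p0 : p 0 = 0) (q0 : q 0 = 0) (hq : ∀ i, HasDerivAt (fun t => q t i) (q' i) 0) (i : Fin k) :
    HasDerivAt (fun t => newQ (B t) (τ t) (p t) (q t) i) ((adjugate (Mmat (τ 0) 0) *ᵥ q') i) 0 := by
  have hM := (MatAnalyticAt.Mmat hτ (analyticAt_addP hB hpa hqa)).adjugate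
  have := hasDerivAt_mulVec_of_zero (fun i j => (hM i j).continuousAt) q0 hq i
  rw [p0, q0, addP_zero] at this
  exact this

end LinearPart

section Moves

open Matrix

theorem analyticAt_pc {f : E → Target k} {a : E}
    (hf : Hol f a) (i : ℕ) : Hol (fun x => pc (f x) i) a :=
  ((pcL k i).analyticAt _).comp hf

theorem hol_pc {a : Target k} (i : ℕ) : Hol (fun X => pc X i) a := (pcL k i).analyticAt a

theorem hol_qc {a : Target k} (i : ℕ) : Hol (fun X => qc X i) a := (qcL k i).analyticAt a

theorem analyticAt_qc {f : E → Target k} {a : E}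
    (hf : Hol f a) (i : ℕ) : Hol (fun x => qc (f x) i) a :=
  ((qcL k i).analyticAt _).comp hf

theorem hasDerivAt_comp_smul {h : E → F}
    (hh : Hol h 0) (v : E) : HasDerivAt (fun t : ℂ => h (t • v)) (𝒟 h 0 v) 0 := by
  have h2 : HasFDerivAt h (𝒟 h 0) ((0 : ℂ) • v) := by
    rw [zero_smul]; exact hh.differentiableAt.hasFDerivAt
  have h3 : HasDerivAt (fun t : ℂ => t • v) ((1 : ℂ) • v) 0 := (hasDerivAt_id 0).smul_const _
  rw [one_smul] at h3
  exact h2.comp_hasDerivAt 0 h3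

theorem hasDerivAt_affine (a b : ℂ) : HasDerivAt (fun ε : ℂ => a + ε * b) b 0 := by
  simpa using ((hasDerivAt_id (0 : ℂ)).mul_const b).const_add a

theorem fderiv_apply_eq_of_hasDerivAt {f : E → F} (hf : DifferentiableAt ℂ f 0) {v : E} {L : F}
    (hL : HasDerivAt (fun t : ℂ => f (t • v)) L 0) : 𝒟 f 0 v = L := by
  have h2 : HasFDerivAt f (𝒟 f 0) ((0 : ℂ) • v) := by rw [zero_smul]; exact hf.hasFDerivAt
  have h3 : HasDerivAt (fun t : ℂ => t • v) ((1 : ℂ) • v) 0 := (hasDerivAt_id 0).smul_const v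
  rw [one_smul] at h3
  exact (h2.comp_hasDerivAt 0 h3).unique hL

/-- Biholomorphic germs are recognized by the derivatives along lines. -/
theorem isBiholGerm_of_hasDerivAt {f : Target k → Target k} (hf : Hol f 0) (h0 : f 0 = 0)
    (L : Target k → Target k) (hL : ∀ v, HasDerivAt (fun t : ℂ => f (t • v)) (L v) 0)
    (hinj : ∀ v, L v = 0 → v = 0) : IsBiholGerm f := by
  refine isBiholGerm_of_injective hf h0 fun v hv => hinj v ?_
  rw [← fderiv_apply_eq_of_hasDerivAt hf.differentiableAt (hL v), hv]

/-- The linear part of `newP` at the origin. -/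
def linP (B τ : ℕ → ℂ) (p q : Fin k → ℂ) : Fin k → ℂ :=
  (Mmat τ 0)⁻¹ *ᵥ (matEval τ (compan 0) ^ k *ᵥ (p + matEval B (compan 0) *ᵥ q))

/-- The linear part of `move` at the origin. -/
def moveLin (B τ : ℕ → ℂ) (v : Target k) : Target k :=
  mk k (extV (linP B τ (pv v) (qv v))) (extV (adjugate (Mmat τ 0) *ᵥ qv v))

theorem extV_of_lt (v : Fin k → ℂ) {i : ℕ} (hi : i < k) : extV v i = v ⟨i, hi⟩ := dif_pos hi

theorem pv_zero : pv (0 : Target k) = 0 := by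
  funext i
  exact pc_zero _

theorem qv_zero : qv (0 : Target k) = 0 := by
  funext i
  exact qc_zero _

theorem newP_zero (hk : 0 < k) (B : ℕ → ℂ) {τ : ℕ → ℂ} (hτ : τ 0 ≠ 0) (i : ℕ) (hi : i < k) :
    newP B τ (0 : Fin k → ℂ) 0 i = 0 := by
  have h := Mmat_mulVec_charpoly hk τ (0 : Fin k → ℂ)
  rw [thetaMean_zero, mulVec_zero, zero_smul, add_zero] at h
  have h1 := congrArg (fun v => (Mmat τ (0 : Fin k → ℂ))⁻¹ *ᵥ v) h
  simp only [mulVec_mulVec, nonsing_inv_mul _ (isUnit_iff_ne_zero.2 (det_Mmat_zero hτ)),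
    one_mulVec, mulVec_zero] at h1
  rw [newP, addP_zero]
  exact congrFun h1 ⟨i, hi⟩

theorem move_zero (hk : 2 ≤ k) (B : ℕ → ℂ) {τ : ℕ → ℂ} (hτ : τ 0 ≠ 0) :
    move B τ (0 : Target k) = 0 := by
  refine target_ext (fun i hi => ?_) fun i hi => ?_
  · rw [move, pc_mk _ _ hi, pv_zero, qv_zero, newP_zero (by omega) B hτ i (by omega), pc_zero]
  · rw [move, qc_mk _ _ hi, pv_zero, qv_zero, extV_of_lt _ (by omega), newQ, mulVec_zero, qc_zero]
    rfl

theorem Lower.mulVec_eq_zero {A : Matrix (Fin k) (Fin k) ℂ} (h : Lower A) {v : Fin k → ℂ} (n : ℕ)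
    (hv : ∀ i : Fin k, i.val < n → v i = 0) (i : Fin k) (hi : i.val < n) : (A *ᵥ v) i = 0 := by
  rw [mulVec, dotProduct]
  refine sum_eq_zero fun j _ => ?_
  rcases lt_or_ge i j with h1 | h1
  · rw [h i j h1, zero_mul]
  · have : j.val ≤ i.val := h1
    rw [hv j (by omega), mul_zero]

theorem Lower.eq_zero_of_mulVec {A : Matrix (Fin k) (Fin k) ℂ} (h : Lower A)
    (hd : ∀ i, A i i ≠ 0) {v : Fin k → ℂ} (n : ℕ)
    (hv : ∀ i : Fin k, i.val < n → (A *ᵥ v) i = 0) (i : Fin k) (hi : i.val < n) : v i = 0 := by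
  obtain ⟨m, hm⟩ := i
  induction m using Nat.strong_induction_on with
  | _ m ih =>
    have h1 := hv ⟨m, hm⟩ hi
    rw [mulVec, dotProduct, sum_eq_single ⟨m, hm⟩] at h1
    · exact (mul_eq_zero.1 h1).resolve_left (hd _)
    · intro j _ hj
      rcases lt_or_ge (⟨m, hm⟩ : Fin k) j with h2 | h2
      · rw [h _ _ h2, zero_mul]
      · have h3 : j.val ≤ m := h2
        have h4 : j.val ≠ m := fun h => hj (Fin.ext h)
        rw [ih j.val (by omega) j.isLt (by simp at hi ⊢; omega), mul_zero]
    · simp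

theorem moveLin_injective (hk : 2 ≤ k) (B : ℕ → ℂ) {τ : ℕ → ℂ} (hτ : τ 0 ≠ 0) {v : Target k}
    (hv : moveLin B τ v = 0) : v = 0 := by
  have hdet := det_Mmat_zero (k := k) hτ
  have hq : adjugate (Mmat τ 0) *ᵥ qv v = 0 := by
    funext i
    have := congrArg (fun X => qc X i.val) hv
    simp only [moveLin, qc_zero] at this
    rw [qc_mk _ _ (by omega), extV_of_lt _ i.isLt] at this
    exact this
  have hq' : qv v = 0 := by
    have := congrArg (fun w => Mmat τ 0 *ᵥ w) hq
    simp only [mulVec_mulVec, mul_adjugate, smul_mulVec, one_mulVec, mulVec_zero] at this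
    exact (smul_eq_zero.1 this).resolve_left hdet
  have hp : ∀ i : Fin k, i.val < k - 1 → linP B τ (pv v) (qv v) i = 0 := by
    intro i hi
    have := congrArg (fun X => pc X i.val) hv
    simp only [moveLin, pc_zero] at this
    rw [pc_mk _ _ (by omega), extV_of_lt _ i.isLt] at this
    exact this
  have h1 : matEval τ (compan 0) ^ k *ᵥ pv v = Mmat τ 0 *ᵥ linP B τ (pv v) (qv v) := by
    rw [linP, mulVec_mulVec, mul_nonsing_inv _ (isUnit_iff_ne_zero.2 hdet), one_mulVec, hq',
      mulVec_zero, add_zero]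
  have h2 := fun i hi => (lower_Mmat_zero τ).mulVec_eq_zero (k - 1) hp i hi
  rw [← h1] at h2
  have h3 := ((lower_matEval (k := k) τ).pow k).eq_zero_of_mulVec (fun i => by
    rw [(lower_matEval τ).pow_diag, matEval_zero_diag]; exact pow_ne_zero _ hτ) (k - 1) h2
  refine target_ext (fun i hi => ?_) fun i hi => ?_
  · rw [pc_zero]
    exact h3 ⟨i, by omega⟩ (by simp; omega)
  · rw [qc_zero]
    exact congrFun hq' ⟨i, by omega⟩

theorem analyticAt_pv : PiAnalyticAt (pv (k := k)) 0 := fun i => hol_pc i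

theorem analyticAt_qv : PiAnalyticAt (qv (k := k)) 0 := fun i => hol_qc i

theorem hasDerivAt_pc_smul (v : Target k) (i : ℕ) :
    HasDerivAt (fun t : ℂ => pc (t • v) i) (pc v i) 0 := by
  simp only [pc_smul]
  simpa using (hasDerivAt_id (0 : ℂ)).mul_const (pc v i)

theorem hasDerivAt_qc_smul (v : Target k) (i : ℕ) :
    HasDerivAt (fun t : ℂ => qc (t • v) i) (qc v i) 0 := by
  simp only [qc_smul]
  simpa using (hasDerivAt_id (0 : ℂ)).mul_const (qc v i)

theorem analyticAt_move {B τ : E → ℕ → ℂ} {f : E → Target k} {a : E} (hB : PiAnalyticAt B a)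
    (hτ : PiAnalyticAt τ a) (hf : Hol f a) (hk : 2 ≤ k) :
    Hol (fun x => move (B x) (τ x) (f x)) a := by
  have hp : ∀ i : Fin k, Hol (fun x => pv (f x) i) a := fun i => analyticAt_pc hf i
  have hq : ∀ i : Fin k, Hol (fun x => qv (f x) i) a := fun i => analyticAt_qc hf i
  refine analyticAt_mk (fun i _ => analyticAt_newP hB hτ hp hq i) fun i hi => ?_
  simp only [extV_of_lt _ (by omega : i < k)]
  exact analyticAt_newQ hB hτ hp hq _

variable {B τ : Target k → ℕ → ℂ}

theorem hasDerivAt_move (hk : 2 ≤ k) (hB : PiAnalyticAt B 0)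
    (hτ : PiAnalyticAt τ 0) (hτ0 : τ 0 0 ≠ 0) (v : Target k) :
    HasDerivAt (fun t : ℂ => move (B (t • v)) (τ (t • v)) (t • v)) (moveLin (B 0) (τ 0) v) 0 := by
  have hl : Hol (fun t : ℂ => t • v) 0 := analyticAt_id.smul analyticAt_const
  have hz : (0 : ℂ) • v = 0 := zero_smul _ _
  have hB' : ∀ m, Hol (fun t : ℂ => B (t • v) m) 0 := fun m =>
    analyticAt_comp_zero (hB m) hl hz
  have hτ' : ∀ m, Hol (fun t : ℂ => τ (t • v) m) 0 := fun m =>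
    analyticAt_comp_zero (hτ m) hl hz
  have hp : ∀ i : Fin k, Hol (fun t : ℂ => pv (t • v) i) 0 := fun i => analyticAt_pc hl i
  have hq : ∀ i : Fin k, Hol (fun t : ℂ => qv (t • v) i) 0 := fun i => analyticAt_qc hl i
  have hp1 : ∀ i : Fin k, HasDerivAt (fun t : ℂ => pv (t • v) i) (pv v i) 0 := fun i =>
    hasDerivAt_pc_smul v i
  have hq1 : ∀ i : Fin k, HasDerivAt (fun t : ℂ => qv (t • v) i) (qv v i) 0 := fun i =>
    hasDerivAt_qc_smul v i
  have hp0 : pv ((0 : ℂ) • v) = 0 := by rw [hz, pv_zero]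
  have hq0 : qv ((0 : ℂ) • v) = 0 := by rw [hz, qv_zero]
  refine hasDerivAt_mk (fun i hi => ?_) fun i hi => ?_
  · have := hasDerivAt_newP (by omega) hB' hτ' (by rw [hz]; exact hτ0) hp hq hp0 hq0 hp1 hq1
      ⟨i, by omega⟩ (by simp; omega)
    rw [hz] at this
    rw [extV_of_lt _ (by omega)]
    exact this
  · have := hasDerivAt_newQ hB' hτ' hp hq hp0 hq0 hq1 ⟨i, by omega⟩
    rw [hz] at this
    rw [extV_of_lt _ (by omega)]
    simp only [extV_of_lt _ (by omega : i < k)]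
    exact this

theorem isBiholGerm_move (hk : 2 ≤ k) (hB : PiAnalyticAt B 0)
    (hτ : PiAnalyticAt τ 0) (hτ0 : τ 0 0 ≠ 0) : IsBiholGerm (fun X => move (B X) (τ X) X) :=
  isBiholGerm_of_hasDerivAt (analyticAt_move hB hτ analyticAt_id hk) (move_zero hk _ hτ0) _
    (hasDerivAt_move hk hB hτ hτ0) fun _ hv => moveLin_injective hk _ hτ0 hv

theorem mapsSetGerm_move (hk : 2 ≤ k) (hB : PiAnalyticAt B 0)
    (hτ : PiAnalyticAt τ 0) (hτ0 : τ 0 0 ≠ 0) :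
    MapsSetGerm (fun X => move (B X) (τ X) X) (image k) (image k) := by
  have hp := analyticAt_pv (k := k)
  have hq := analyticAt_qv (k := k)
  have hr := analyticAt_addP hB hp hq
  have c1 : ContinuousAt (fun X => ∑ i, ‖addP (B X) (pv X) (qv X) i‖) 0 :=
    tendsto_finsetSum _ fun i _ => (hr i).continuousAt.norm
  have c2 := (MatAnalyticAt.Mmat hτ hr).det.continuousAt
  have c3 : ContinuousAt (fun X => ∑ m ∈ range k, ‖B X m‖ * ∑ i ∈ range m,
      ‖(compan (pv X) ^ i *ᵥ qv X) ⟨k - 1, by omega⟩‖) 0 :=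
    tendsto_finsetSum _ fun m _ => (hB m).continuousAt.norm.mul
      (tendsto_finsetSum _ fun i _ =>
        (((MatAnalyticAt.compan hp).pow i).mulVec hq _).continuousAt.norm)
  have e1 : ∀ᶠ X in 𝓝 (0 : Target k), ∑ i, ‖addP (B X) (pv X) (qv X) i‖ < 1 :=
    c1.eventually_lt_const (by simp [pv_zero, qv_zero, addP_zero])
  have e2 : ∀ᶠ X in 𝓝 (0 : Target k), (Mmat (τ X) (addP (B X) (pv X) (qv X))).det ≠ 0 := by
    refine c2.eventually_ne ?_
    simp only [pv_zero, qv_zero, addP_zero]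
    exact det_Mmat_zero hτ0
  have e3 : ∀ᶠ X in 𝓝 (0 : Target k), ∑ m ∈ range k, ‖B X m‖ * ∑ i ∈ range m,
      ‖(compan (pv X) ^ i *ᵥ qv X) ⟨k - 1, by omega⟩‖ < 1 :=
    c3.eventually_lt_const (by simp [qv_zero])
  filter_upwards [e1, e2, e3] with X h1 h2 h3
  rw [mem_image_iff hk, mem_image_iff hk, pv_move hk, qv_move]
  exact ⟨commonRoot_new (by omega), commonRoot_of_new (by omega) h1 h2 h3⟩

theorem matEval_single (A : Matrix (Fin k) (Fin k) ℂ) (hk : 0 < k) (τ : ℕ → ℂ)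
    (h : ∀ m, m < k → τ m = if m = 0 then 1 else 0) : matEval τ A = 1 := by
  rw [matEval, sum_eq_single 0]
  · rw [h 0 hk]; simp
  · intro m hm hm0
    rw [h m (mem_range.1 hm), if_neg hm0, zero_smul]
  · intro h'
    exact absurd (mem_range.2 hk) h'

theorem trace_compan (hk : 2 ≤ k) (p : Fin k → ℂ) : (compan p).trace = -p ⟨k - 1, by omega⟩ := by
  rw [trace, sum_eq_single ⟨k - 1, by omega⟩]
  · simp [compan, Nat.sub_add_cancel (by omega : 1 ≤ k)]
  · intro i _ hi
    have : i.val + 1 ≠ k := fun h => hi (Fin.ext (by simp; omega))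
    simp [compan, this]
  · simp

theorem thetaMat_of_one (hk : 0 < k) {τ : ℕ → ℂ} (h : ∀ m, m < k → τ m = if m = 0 then 1 else 0)
    (p : Fin k → ℂ) : thetaMat τ p = compan p := by
  rw [thetaMat, matEval_single _ hk τ h, mul_one]

theorem Mmat_of_one (hk : 2 ≤ k) {τ : ℕ → ℂ} (h : ∀ m, m < k → τ m = if m = 0 then 1 else 0)
    {p : Fin k → ℂ} (hp : p ⟨k - 1, by omega⟩ = 0) : Mmat τ p = 1 ∧ Dmat τ p = compan p := by
  have h1 : thetaMean τ p = 0 := by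
    rw [thetaMean, thetaMat_of_one (by omega) h, trace_compan hk, hp]
    simp
  have h2 : Dmat τ p = compan p := by
    rw [Dmat, h1, thetaMat_of_one (by omega) h, zero_smul, sub_zero]
  refine ⟨?_, h2⟩
  ext i j
  rw [Mmat, of_apply, h2, compan_pow_mulVec_e0 p j.val j.isLt]
  simp [Matrix.one_apply, Pi.single_apply]

theorem matEval_eq_zero (A : Matrix (Fin k) (Fin k) ℂ) {B : ℕ → ℂ} (h : ∀ m, m < k → B m = 0) :
    matEval B A = 0 :=
  sum_eq_zero fun m hm => by rw [h m (mem_range.1 hm), zero_smul]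

/-- The trivial transformation. -/
theorem move_eq_self (hk : 2 ≤ k) {B τ : ℕ → ℂ} (hB : ∀ m, m < k → B m = 0)
    (h : ∀ m, m < k → τ m = if m = 0 then 1 else 0) (X : Target k) : move B τ X = X := by
  have h0 : addP B (pv X) (qv X) = pv X := by rw [addP, matEval_eq_zero _ hB, zero_mulVec, add_zero]
  have hp : pv X ⟨k - 1, by omega⟩ = 0 := pc_eq_zero X (by simp; omega) (by simp; omega)
  obtain ⟨h1, h2⟩ := Mmat_of_one hk h hp
  have h3 := Mmat_mulVec_charpoly (by omega) τ (pv X)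
  have h4 : thetaMean τ (pv X) = 0 := by
    rw [thetaMean, thetaMat_of_one (by omega) h, trace_compan hk, hp]
    simp
  rw [h1, one_mulVec, h4, zero_smul, add_zero, matEval_single _ (by omega) τ h, one_pow,
    one_mulVec] at h3
  refine target_ext (fun i hi => ?_) fun i hi => ?_
  · rw [move, pc_mk _ _ hi, newP, h0]
    exact congrFun h3 ⟨i, by omega⟩
  · rw [move, qc_mk _ _ hi, extV_of_lt _ (by omega), newQ, h0, h1, adjugate_one, one_mulVec]
    rfl

end Moves

/-- The weighted scalings. -/
def scale (l m : ℂ) (X : Target k) : Target k :=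
  mk k (fun i => l ^ (k - i) * pc X i) (fun i => m * l ^ (k - 1 - i) * qc X i)

theorem pc_scale (l m : ℂ) (X : Target k) {i : ℕ} (hi : i ≤ k - 2) :
    pc (scale l m X) i = l ^ (k - i) * pc X i := pc_mk _ _ hi

theorem qc_scale (l m : ℂ) (X : Target k) {i : ℕ} (hi : i ≤ k - 1) :
    qc (scale l m X) i = m * l ^ (k - 1 - i) * qc X i := qc_mk _ _ hi

theorem scale_mem_image (hk : 2 ≤ k) {l m : ℂ} (hl : l ≠ 0) (hm : m ≠ 0) (X : Target k) :
    X ∈ image k ↔ scale l m X ∈ image k := by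
  have hP : ∀ y, evalP (pv (scale l m X)) (l * y) = l ^ k * evalP (pv X) y := by
    intro y
    rw [evalP, evalP, mul_add, mul_pow, mul_sum]
    refine congrArg _ (sum_congr rfl fun i _ => ?_)
    have h1 : pv (scale l m X) i = l ^ (k - i.val) * pv X i := by
      by_cases hi : i.val ≤ k - 2
      · exact pc_scale l m X hi
      · rw [pv, pv, pc_eq_zero _ (by omega) (by omega), pc_eq_zero _ (by omega) (by omega), mul_zero]
    have h2 : l ^ k = l ^ (k - i.val) * l ^ i.val := by rw [pow_sub_mul_pow _ i.isLt.le]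
    rw [h1, h2, mul_pow]
    ring
  have hQ : ∀ y, evalQ (qv (scale l m X)) (l * y) = m * l ^ (k - 1) * evalQ (qv X) y := by
    intro y
    rw [evalQ, evalQ, mul_sum]
    refine sum_congr rfl fun i _ => ?_
    have h1 : qv (scale l m X) i = m * l ^ (k - 1 - i.val) * qv X i := qc_scale l m X (by omega)
    have h2 : l ^ (k - 1) = l ^ (k - 1 - i.val) * l ^ i.val := by rw [pow_sub_mul_pow _ (by omega)]
    rw [h1, h2, mul_pow]
    ring
  rw [mem_image_iff hk, mem_image_iff hk]
  constructor
  · rintro ⟨y, h1, h2⟩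
    exact ⟨l * y, by rw [hP, h1, mul_zero], by rw [hQ, h2, mul_zero]⟩
  · rintro ⟨z, h1, h2⟩
    have hP' := hP (l⁻¹ * z)
    have hQ' := hQ (l⁻¹ * z)
    rw [mul_inv_cancel_left₀ hl, eq_comm] at hP' hQ'
    exact ⟨l⁻¹ * z, by simpa [h1, hl] using hP', by simpa [h2, hl, hm] using hQ'⟩

theorem hasDerivAt_mul_of_zero {f g : ℂ → ℂ} {g' : ℂ} (hf : ContinuousAt f 0) (g0 : g 0 = 0)
    (hg : HasDerivAt g g' 0) : HasDerivAt (fun t => f t * g t) (f 0 * g') 0 := by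
  rw [hasDerivAt_iff_tendsto_slope_zero] at hg ⊢
  refine ((hf.tendsto.mono_left nhdsWithin_le_nhds).mul hg).congr' (.of_forall fun t => ?_)
  simp [g0]
  ring

/-- Scalings by nonvanishing functions. -/
theorem isBiholGerm_scale {l m : Target k → ℂ} (hl : Hol l 0) (hm : Hol m 0)
    (l0 : l 0 ≠ 0) (m0 : m 0 ≠ 0) : IsBiholGerm (fun X => scale (l X) (m X) X) := by
  refine isBiholGerm_of_hasDerivAt ?_ ?_ (scale (l 0) (m 0)) (fun v => ?_) fun v hv => ?_
  · exact analyticAt_mk (fun i _ => (hl.pow _).mul (hol_pc i))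
      fun i _ => (hm.mul (hl.pow _)).mul (hol_qc i)
  · refine target_ext (fun i hi => ?_) fun i hi => ?_
    · rw [pc_scale _ _ _ hi, pc_zero, mul_zero]
    · rw [qc_scale _ _ _ hi, qc_zero, mul_zero]
  · have hc : Hol (fun t : ℂ => t • v) 0 := analyticAt_id.smul analyticAt_const
    have hz : (0 : ℂ) • v = 0 := zero_smul _ _
    have hl' := analyticAt_comp_zero hl hc hz
    have hm' := analyticAt_comp_zero hm hc hz
    refine hasDerivAt_mk (fun i hi => ?_) fun i hi => ?_
    · have := hasDerivAt_mul_of_zero (hl'.pow (k - i)).continuousAt (by rw [hz, pc_zero])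
        (hasDerivAt_pc_smul v i)
      simpa [hz] using this
    · have := hasDerivAt_mul_of_zero (hm'.mul (hl'.pow (k - 1 - i))).continuousAt
        (by rw [hz, qc_zero]) (hasDerivAt_qc_smul v i)
      simpa [hz] using this
  · refine target_ext (fun i hi => ?_) fun i hi => ?_
    · have := congrArg (fun X => pc X i) hv
      simpa [pc_scale _ _ _ hi, pc_zero, l0] using this
    · have := congrArg (fun X => qc X i) hv
      simpa [qc_scale _ _ _ hi, qc_zero, l0, m0] using this

theorem mapsSetGerm_scale (hk : 2 ≤ k) {l m : Target k → ℂ} (hl : Hol l 0)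
    (hm : Hol m 0) (l0 : l 0 ≠ 0) (m0 : m 0 ≠ 0) :
    MapsSetGerm (fun X => scale (l X) (m X) X) (image k) (image k) := by
  filter_upwards [hl.continuousAt.eventually_ne l0, hm.continuousAt.eventually_ne m0] with X h1 h2
  exact scale_mem_image hk h1 h2 X

section Multiply

open Matrix

/-- Multiplication of `Q` by a polynomial, modulo `P`. -/
def mulQ (A : ℕ → ℂ) (X : Target k) : Target k :=
  mk k (pc X) (extV (matEval A (compan (pv X)) *ᵥ qv X))

theorem pc_mulQ (A : ℕ → ℂ) (X : Target k) (i : ℕ) : pc (mulQ A X) i = pc X i := by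
  by_cases hi : i ≤ k - 2
  · exact pc_mk _ _ hi
  · rw [pc_eq_zero _ (by omega) (by omega), pc_eq_zero _ (by omega) (by omega)]

theorem qv_mulQ (A : ℕ → ℂ) (X : Target k) : qv (mulQ A X) = matEval A (compan (pv X)) *ᵥ qv X := by
  funext i
  refine (qc_mk _ _ (by omega)).trans ?_
  simp [extV]

theorem mulQ_mem_image (hk : 2 ≤ k) {A : ℕ → ℂ} {X : Target k}
    (hA : (matEval A (compan (pv X))).det ≠ 0) : X ∈ image k ↔ mulQ A X ∈ image k := by
  have hP : pv (mulQ A X) = pv X := by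
    funext i
    exact pc_mulQ A X i
  have hQ : ∀ y, evalP (pv X) y = 0 →
      evalQ (qv (mulQ A X)) y = (polyOf k A).eval y * evalQ (qv X) y := by
    intro y hy
    rw [qv_mulQ, ← ev_dotProduct, dotProduct_mulVec, ← aeval_polyOf,
      vecMul_aeval_of_vecMul (ev_vecMul_compan_of_root hy), smul_dotProduct, ev_dotProduct,
      smul_eq_mul]
  rw [mem_image_iff hk, mem_image_iff hk, hP]
  constructor
  · rintro ⟨y, h1, h2⟩
    exact ⟨y, h1, by rw [hQ y h1, h2, mul_zero]⟩
  · rintro ⟨y, h1, h2⟩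
    rw [hQ y h1] at h2
    refine ⟨y, h1, (mul_eq_zero.1 h2).resolve_left fun h3 => hA ?_⟩
    rw [← exists_vecMul_eq_zero_iff]
    refine ⟨ev y, fun h => ?_, ?_⟩
    · have := congrFun h ⟨0, by omega⟩
      simp [ev] at this
    · rw [← aeval_polyOf, vecMul_aeval_of_vecMul (ev_vecMul_compan_of_root h1), h3, zero_smul]

/-- A linear combination of the coefficients of `Q` that involves the leading one with a
nonvanishing coefficient becomes the leading coefficient of `Q` in suitable coordinates. -/
theorem exists_mulQ (hk : 2 ≤ k) {m : Target k → Fin k → ℂ} (hm : PiAnalyticAt m 0)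
    (m0 : m 0 ⟨k - 1, by omega⟩ ≠ 0) :
    ∃ ψ : Target k → Target k, IsBiholGerm ψ ∧ MapsSetGerm ψ (image k) (image k) ∧
      (∀ X i, pc (ψ X) i = pc X i) ∧ ∀ᶠ X in 𝓝 0, qc (ψ X) (k - 1) = ∑ i, m X i * qv X i := by
  let last : Fin k := ⟨k - 1, by omega⟩
  have hp := analyticAt_pv (k := k)
  have hq := analyticAt_qv (k := k)
  let H : Target k → Matrix (Fin k) (Fin k) ℂ := fun X =>
    Matrix.of fun i j => (compan (pv X) ^ j.val) last i
  have hH : MatAnalyticAt H 0 := fun i j => (MatAnalyticAt.compan hp).pow j.val last i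
  have hH0 : H 0 = Matrix.of fun i j => if k - 1 = i.val + j.val then 1 else 0 := by
    ext i j
    simp only [H, of_apply, pv_zero, compan_zero_pow_apply]
    rfl
  have hHH : H 0 * H 0 = 1 := by
    ext i j
    rw [hH0, mul_apply, Fintype.sum_eq_single ⟨k - 1 - i.val, by omega⟩]
    · simp only [of_apply, one_apply, Fin.ext_iff]
      rw [if_pos (by omega), one_mul]
      exact if_congr (by omega) rfl rfl
    · intro l hl
      rw [of_apply, if_neg, zero_mul]
      exact fun h => hl (Fin.ext (by simp; omega))
  have hdet : (H 0).det ≠ 0 := by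
    intro h
    have := congrArg Matrix.det hHH
    simp [h] at this
  let A : Target k → ℕ → ℂ := fun X => extV ((H X)⁻¹ *ᵥ m X)
  have hA : PiAnalyticAt A 0 := by
    intro j
    by_cases hj : j < k
    · simp only [A, extV_of_lt _ hj]
      exact (hH.inv hdet).mulVec hm _
    · simp only [A, extV, dif_neg hj]
      exact analyticAt_const
  have hA0 : A 0 0 ≠ 0 := by
    simp only [A, extV_of_lt _ (by omega : 0 < k), Matrix.inv_eq_left_inv hHH]
    rw [hH0, mulVec, dotProduct, Fintype.sum_eq_single last]
    · simpa [last] using m0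
    · intro l hl
      rw [of_apply, if_neg, zero_mul]
      exact fun h => hl (Fin.ext (by simp [last] at h ⊢; omega))
  have hmat := MatAnalyticAt.matEval hA (MatAnalyticAt.compan hp)
  have hd0 : ∀ i : Fin k, matEval (A 0) (compan 0) i i ≠ 0 := fun i => by
    rw [matEval_zero_diag]; exact hA0
  refine ⟨fun X => mulQ (A X) X, ?_, ?_, fun X i => pc_mulQ _ _ _, ?_⟩
  · refine isBiholGerm_of_hasDerivAt ?_ ?_ (fun v => mk k (pc v)
      (extV (matEval (A 0) (compan 0) *ᵥ qv v))) (fun v => ?_) fun v hv => ?_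
    · refine analyticAt_mk (fun i _ => hol_pc i) fun i hi => ?_
      simp only [extV_of_lt _ (by omega : i < k)]
      exact hmat.mulVec hq _
    · refine target_ext (fun i hi => pc_mulQ _ _ _) fun i hi => ?_
      rw [mulQ, qc_mk _ _ hi, extV_of_lt _ (by omega), qv_zero, mulVec_zero, qc_zero]
      rfl
    · have hc : Hol (fun t : ℂ => t • v) 0 := analyticAt_id.smul analyticAt_const
      have hz : (0 : ℂ) • v = 0 := zero_smul _ _
      refine hasDerivAt_mk (fun i hi => hasDerivAt_pc_smul v i) fun i hi => ?_
      simp only [extV_of_lt _ (by omega : i < k)]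
      have := hasDerivAt_mulVec_of_zero
        (A := fun t : ℂ => matEval (A (t • v)) (compan (pv (t • v))))
        (fun i j => (analyticAt_comp_zero (hmat i j) hc hz).continuousAt)
        (v := fun t => qv (t • v)) (by rw [hz, qv_zero])
        (fun j => hasDerivAt_qc_smul v j) ⟨i, by omega⟩
      rw [hz, pv_zero] at this
      exact this
    · have hq' : ∀ i : Fin k, (matEval (A 0) (compan 0) *ᵥ qv v) i = 0 := by
        intro i
        have := congrArg (fun X => qc X i.val) hv
        simp only [qc_zero] at this
        rwa [qc_mk _ _ (by omega), extV_of_lt _ i.isLt] at this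
      have := (lower_matEval (k := k) (A 0)).eq_zero_of_mulVec hd0 k fun i _ => hq' i
      refine target_ext (fun i hi => ?_) fun i hi => ?_
      · have := congrArg (fun X => pc X i) hv
        simp only [pc_zero] at this
        rwa [pc_mk _ _ hi, ← pc_zero (k := k) i] at this
      · rw [qc_zero]
        exact this ⟨i, by omega⟩ (by simp; omega)
  · have h1 : (matEval (A 0) (compan (pv (0 : Target k)))).det ≠ 0 := by
      rw [pv_zero, (lower_matEval _).det]
      exact prod_ne_zero_iff.2 fun i _ => hd0 i
    filter_upwards [hmat.det.continuousAt.eventually_ne h1] with X hX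
    exact mulQ_mem_image hk hX
  · filter_upwards [hH.det.continuousAt.eventually_ne hdet] with X hX
    have h1 : qc (mulQ (A X) X) (k - 1) = (matEval (A X) (compan (pv X)) *ᵥ qv X) last :=
      congrFun (qv_mulQ (A X) X) last
    have h2 : H X *ᵥ (fun j : Fin k => A X j) = m X := by
      have : (fun j : Fin k => A X j) = (H X)⁻¹ *ᵥ m X := by
        funext j
        simp only [A, extV_of_lt _ j.isLt]
      rw [this, mulVec_mulVec, mul_nonsing_inv _ (isUnit_iff_ne_zero.2 hX), one_mulVec]
    rw [h1, ← h2]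
    simp only [mulVec, dotProduct, H, of_apply, matEval, Matrix.sum_apply, Matrix.smul_apply,
      smul_eq_mul]
    refine sum_congr rfl fun i _ => ?_
    rw [sum_range]
    congr 1
    exact sum_congr rfl fun j _ => mul_comm _ _

end Multiply

section Solve

variable {ι : Type*} [Fintype ι] [DecidableEq ι]

/-- The second order coefficient of a function of one variable vanishing to second order. -/
theorem exists_tendsto_div_sq {f : ℂ → ℂ} (hf : Hol f 0) (h0 : f 0 = 0)
    (h1 : HasDerivAt f 0 0) : ∃ c, Tendsto (fun t => f t / t ^ 2) (𝓝[≠] 0) (𝓝 c) := by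
  obtain ⟨G, hG, hGe⟩ := exists_sq_coeff (S := ℂ) (s₀ := 0) (0 : Fin 1)
    (F := fun z : (Fin 1 → ℂ) × ℂ => f (z.1 0))
    (analyticAt_comp_zero hf (analyticAt_pi_iff.1 analyticAt_fst 0) rfl)
    (.of_forall fun s => h0) (.of_forall fun s => by simpa using h1)
  have := tendsto_single_of_sq_coeff hG.continuousAt hGe
  simp only [Pi.single_eq_same] at this
  exact ⟨_, this⟩

/-- Implicit function theorem for the coefficients of the monomials `X_l` for `l ≠ w` and
`X_w ^ 2`. The parameter `d` is the direction in which only the last coefficient varies. -/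
theorem exists_solve_sq (w : ι) {F : (ι → ℂ) × (ι → ℂ) → ℂ} {s₀ : ι → ℂ}
    (hF : Hol F (0, s₀)) (h0 : ∀ᶠ s in 𝓝 s₀, F (0, s) = 0)
    (hw : ∀ᶠ s in 𝓝 s₀, HasDerivAt (fun t => F (Pi.single w t, s)) 0 0) {J : (ι → ℂ) → ι → ℂ}
    (hJ : ∀ᶠ s in 𝓝 s₀, ∀ l ≠ w, HasDerivAt (fun t => F (Pi.single l t, s)) (J s l) 0)
    (d : ι → ℂ) (hd : ∀ δ : ι → ℂ,
      (∀ l ≠ w, HasDerivAt (fun ε : ℂ => J (s₀ + ε • δ) l) 0 0) → ∃ c : ℂ, δ = c • d)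
    {j₀ c₁ : ℂ} (hc₁ : c₁ ≠ 0)
    (hc : ∀ᶠ ε : ℂ in 𝓝 0, Tendsto (fun t => F (Pi.single w t, s₀ + ε • d) / t ^ 2) (𝓝[≠] 0)
      (𝓝 (j₀ + ε * c₁))) {O : Set (ι → ℂ)} (hO : O ∈ 𝓝 s₀) :
    ∃ N ∈ 𝓝 (Function.update (J s₀) w j₀), ∀ H : (ι → ℂ) → ℂ, Hol H 0 → H 0 = 0 →
      HasDerivAt (fun t => H (Pi.single w t)) 0 0 → ∀ j : ι → ℂ,
      (∀ l ≠ w, HasDerivAt (fun t => H (Pi.single l t)) (j l) 0) →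
      Tendsto (fun t => H (Pi.single w t) / t ^ 2) (𝓝[≠] 0) (𝓝 (j w)) → j ∈ N →
      ∃ s : (ι → ℂ) → ι → ℂ, Hol s 0 ∧ s 0 ∈ O ∧
        (j = Function.update (J s₀) w j₀ → s 0 = s₀) ∧ ∀ᶠ x in 𝓝 0, F (x, s x) = H x := by
  obtain ⟨G, hG, hGe⟩ := exists_sq_coeff w hF h0 hw
  have t1 : Tendsto (fun s : ι → ℂ => ((0 : ι → ℂ), s)) (𝓝 s₀) (𝓝 (0, s₀)) :=
    (Continuous.prodMk_right _).tendsto _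
  have hGJ : ∀ᶠ s in 𝓝 s₀, ∀ l ≠ w, G (0, s) l = J s l := by
    filter_upwards [hJ, t1.eventually hGe.eventually_nhds,
      t1.eventually hG.eventually_analyticAt] with s h1 h2 h3 l hl
    exact (hasDerivAt_single_of_sq_coeff h3.continuousAt h2 hl).unique (h1 l hl)
  have tl : ∀ δ : ι → ℂ, Tendsto (fun ε : ℂ => s₀ + ε • δ) (𝓝 0) (𝓝 s₀) := fun δ => by
    have : Continuous (fun ε : ℂ => s₀ + ε • δ) := by fun_prop
    exact this.tendsto' _ _ (by simp)
  have hGw : ∀ᶠ ε : ℂ in 𝓝 0, G (0, s₀ + ε • d) w = j₀ + ε * c₁ := by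
    filter_upwards [hc, (t1.comp (tl d)).eventually hGe.eventually_nhds,
      (t1.comp (tl d)).eventually hG.eventually_analyticAt] with ε h1 h2 h3
    exact tendsto_nhds_unique (tendsto_single_of_sq_coeff h3.continuousAt h2) h1
  have hbase : G (0, s₀) = Function.update (J s₀) w j₀ := by
    funext l
    rcases eq_or_ne l w with rfl | hl
    · simpa using hGw.self_of_nhds
    · rw [Function.update_of_ne hl]
      exact hGJ.self_of_nhds l hl
  have hline : ∀ δ : ι → ℂ, ∀ l, HasDerivAt (fun ε : ℂ => G (0, s₀ + ε • δ) l)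
      (𝒟 G (0, s₀) (0, δ) l) 0 := by
    intro δ l
    have h1 : HasDerivAt (fun ε : ℂ => ((0 : ι → ℂ), s₀ + ε • δ)) ((0 : ι → ℂ), δ) 0 := by
      refine (hasDerivAt_const _ _).prodMk ?_
      simpa using ((hasDerivAt_id (0 : ℂ)).smul_const δ).const_add s₀
    have h2 : HasFDerivAt G (𝒟 G (0, s₀)) ((0 : ι → ℂ), s₀ + (0 : ℂ) • δ) := by
      rw [zero_smul, add_zero]; exact hG.differentiableAt.hasFDerivAt
    exact hasDerivAt_pi.1 (h2.comp_hasDerivAt 0 h1) l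
  have hinj : ∀ δ, 𝒟 G (0, s₀) (0, δ) = 0 → δ = 0 := by
    intro δ hδ
    have h1 : ∀ l ≠ w, HasDerivAt (fun ε : ℂ => J (s₀ + ε • δ) l) 0 0 := by
      intro l hl
      have h2 := hline δ l
      rw [hδ] at h2
      refine h2.congr_of_eventuallyEq ?_
      filter_upwards [(tl δ).eventually hGJ] with ε hε
      exact (hε l hl).symm
    obtain ⟨c, rfl⟩ := hd δ h1
    have h2 := hline d w
    have h3 : HasDerivAt (fun ε : ℂ => G (0, s₀ + ε • d) w) c₁ 0 := by
      have h4 : HasDerivAt (fun ε : ℂ => j₀ + ε * c₁) c₁ 0 := by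
        simpa using ((hasDerivAt_id (0 : ℂ)).mul_const c₁).const_add j₀
      exact h4.congr_of_eventuallyEq hGw
    have h5 := h2.unique h3
    have h6 : ((0 : ι → ℂ), c • d) = c • ((0 : ι → ℂ), d) := by simp
    rw [h6, map_smul] at hδ
    have h7 := congrFun hδ w
    simp only [Pi.smul_apply, h5, smul_eq_mul, Pi.zero_apply, mul_eq_zero, hc₁, or_false] at h7
    rw [h7, zero_smul]
  obtain ⟨N, hN, key⟩ := exists_implicit hG hinj
    (Filter.inter_mem hO (t1.eventually hGe.eventually_nhds))
  rw [hbase] at hN key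
  refine ⟨N, hN, fun H hH H0 Hw j hj hjw hjN => ?_⟩
  obtain ⟨K, hK, hKe⟩ := exists_sq_coeff (S := ℂ) (s₀ := 0) w (F := fun z => H z.1)
    (analyticAt_comp_zero hH analyticAt_fst rfl) (.of_forall fun _ => H0)
    (.of_forall fun _ => Hw)
  have hK0 : K (0, 0) = j := by
    funext l
    rcases eq_or_ne l w with rfl | hl
    · exact tendsto_nhds_unique (tendsto_single_of_sq_coeff hK.continuousAt hKe) hjw
    · exact (hasDerivAt_single_of_sq_coeff hK.continuousAt hKe hl).unique (hj l hl)
  have t2 : Tendsto (fun x : ι → ℂ => (x, (0 : ℂ))) (𝓝 0) (𝓝 (0, 0)) :=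
    (continuous_id.prodMk continuous_const).tendsto' _ _ rfl
  obtain ⟨s, hs, hsO, hs0, hse⟩ := key (fun x => K (x, 0))
    (analyticAt_comp_zero hK (analyticAt_id.prod analyticAt_const) rfl) (by rw [hK0]; exact hjN)
  rw [hK0] at hs0
  refine ⟨s, hs, hsO.1, hs0, ?_⟩
  have t3 : Tendsto (fun x => (x, s x)) (𝓝 0) (𝓝 (0, s 0)) :=
    (continuousAt_id.prodMk hs.continuousAt).tendsto
  filter_upwards [t3.eventually hsO.2, hse, t2.eventually hKe] with x h1 h2 h3
  rw [h1, h2]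
  exact h3.symm

end Solve

section LinearVariation

open Matrix

theorem hasDerivAt_pow_of_one {A : ℂ → Matrix (Fin k) (Fin k) ℂ} {A' : Matrix (Fin k) (Fin k) ℂ}
    (hA : ∀ i j, HasDerivAt (fun t => A t i j) (A' i j) 0) (h1 : A 0 = 1) (n : ℕ) (i j : Fin k) :
    HasDerivAt (fun t => (A t ^ n) i j) (n * A' i j) 0 := by
  induction n generalizing i j with
  | zero => simpa using hasDerivAt_const (0 : ℂ) _
  | succ n ih =>
    simp only [pow_succ, mul_apply]
    have := HasDerivAt.fun_sum fun l (_ : l ∈ univ) => (ih i l).mul (hA l j)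
    refine this.congr_deriv ?_
    simp only [h1, one_pow, sum_add_distrib, one_apply, mul_ite, mul_one, mul_zero,
      ite_mul, one_mul, zero_mul]
    simp
    ring

theorem hasDerivAt_matEval {B : ℂ → ℕ → ℂ} {B' : ℕ → ℂ}
    (hB : ∀ m, m < k → HasDerivAt (fun t => B t m) (B' m) 0) (C : Matrix (Fin k) (Fin k) ℂ)
    (i j : Fin k) : HasDerivAt (fun t => matEval (B t) C i j) (matEval B' C i j) 0 := by
  simp only [matEval, Matrix.sum_apply, Matrix.smul_apply, smul_eq_mul]
  exact HasDerivAt.fun_sum fun m hm => (hB m (mem_range.1 hm)).mul_const _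

theorem hasDerivAt_Mmat_zero {τ : ℂ → ℕ → ℂ} {τ' : ℕ → ℂ}
    (hτ : ∀ m, m < k → HasDerivAt (fun t => τ t m) (τ' m) 0)
    (h1 : ∀ m, m < k → τ 0 m = if m = 0 then 1 else 0) (i j : Fin k) :
    HasDerivAt (fun t => Mmat (τ t) (0 : Fin k → ℂ) i j)
      (if j.val ≤ i.val then j.val * τ' (i.val - j.val) else 0) 0 := by
  have hk : 0 < k := by have := i.isLt; omega
  simp only [Mmat_zero_apply]
  by_cases h : j.val ≤ i.val
  · simp only [if_pos h, mulVec_e0 hk]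
    have := hasDerivAt_pow_of_one (hasDerivAt_matEval hτ (compan (0 : Fin k → ℂ)))
      (matEval_single _ hk _ h1) j.val ⟨i.val - j.val, by omega⟩ ⟨0, hk⟩
    refine this.congr_deriv ?_
    rw [matEval_compan_zero_apply]
    simp
  · simp only [if_neg h]
    exact hasDerivAt_const _ _

theorem hasDerivAt_linP (hk : 2 ≤ k) {B τ : ℂ → ℕ → ℂ} {B' τ' : ℕ → ℂ}
    (hBa : PiAnalyticAt B 0) (hτa : PiAnalyticAt τ 0)
    (hB : ∀ m, m < k → HasDerivAt (fun t => B t m) (B' m) 0)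
    (hτ : ∀ m, m < k → HasDerivAt (fun t => τ t m) (τ' m) 0)
    (hB0 : ∀ m, m < k → B 0 m = 0) (h1 : ∀ m, m < k → τ 0 m = if m = 0 then 1 else 0)
    (p q : Fin k → ℂ) (i : Fin k) : HasDerivAt (fun t => linP (B t) (τ t) p q i)
      (∑ j : Fin k, if j.val ≤ i.val then
        ((k : ℂ) - j.val) * τ' (i.val - j.val) * p j + B' (i.val - j.val) * q j else 0) 0 := by
  have hτ0 : τ 0 0 ≠ 0 := by rw [h1 0 (by omega)]; simp
  have hMa : MatAnalyticAt (fun t => Mmat (τ t) (0 : Fin k → ℂ)) 0 :=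
    MatAnalyticAt.Mmat hτa fun _ => analyticAt_const
  have hdet := det_Mmat_zero (k := k) hτ0
  have hM1 : Mmat (τ 0) (0 : Fin k → ℂ) = 1 := (Mmat_of_one hk h1 rfl).1
  have hTa : MatAnalyticAt (fun t => matEval (τ t) (compan (0 : Fin k → ℂ)) ^ k) 0 :=
    (MatAnalyticAt.matEval hτa (MatAnalyticAt.const _)).pow k
  have hBm : MatAnalyticAt (fun t => matEval (B t) (compan (0 : Fin k → ℂ))) 0 :=
    MatAnalyticAt.matEval hBa (MatAnalyticAt.const _)
  have hra : ∀ i, Hol (fun t => (p + matEval (B t) (compan 0) *ᵥ q) i) 0 := fun i =>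
    analyticAt_const.add (MatAnalyticAt.mulVec (v := fun _ => q) hBm (fun _ => analyticAt_const) i)
  have hua : ∀ i, Hol (fun t => linP (B t) (τ t) p q i) 0 := (hMa.inv hdet).mulVec (hTa.mulVec hra)
  have hBq : ∀ i, HasDerivAt (fun t => (p + matEval (B t) (compan 0) *ᵥ q) i)
      ((matEval B' (compan 0) *ᵥ q) i) 0 := by
    intro i
    simp only [Pi.add_apply, mulVec, dotProduct]
    exact (HasDerivAt.fun_sum fun j _ => (hasDerivAt_matEval hB (compan 0) i j).mul_const _).const_add _
  have hB00 : matEval (B 0) (compan (0 : Fin k → ℂ)) = 0 := matEval_eq_zero _ hB0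
  have hT1 : matEval (τ 0) (compan (0 : Fin k → ℂ)) = 1 := matEval_single _ (by omega) _ h1
  have hu0 : linP (B 0) (τ 0) p q = p := by
    rw [linP, hM1, inv_one, one_mulVec, hT1, one_pow, one_mulVec, hB00, zero_mulVec, add_zero]
  have hT : ∀ i j : Fin k, HasDerivAt (fun t => (matEval (τ t) (compan (0 : Fin k → ℂ)) ^ k) i j)
      (k * matEval τ' (compan (0 : Fin k → ℂ)) i j) 0 := fun i j =>
    hasDerivAt_pow_of_one (hasDerivAt_matEval hτ _) hT1 k i j
  have hv : HasDerivAt (fun t => (matEval (τ t) (compan 0) ^ k *ᵥ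
      (p + matEval (B t) (compan 0) *ᵥ q)) i)
      (∑ j, (k * matEval τ' (compan (0 : Fin k → ℂ)) i j * p j) + (matEval B' (compan 0) *ᵥ q) i) 0 := by
    change HasDerivAt (fun t => ∑ j, (matEval (τ t) (compan 0) ^ k) i j *
      (p + matEval (B t) (compan 0) *ᵥ q) j) _ 0
    have := HasDerivAt.fun_sum fun j (_ : j ∈ univ) => (hT i j).mul (hBq j)
    refine this.congr_deriv ?_
    rw [hB00, hT1]
    simp [sum_add_distrib, one_apply]
  have hMu : HasDerivAt (fun t => (Mmat (τ t) (0 : Fin k → ℂ) *ᵥ linP (B t) (τ t) p q) i)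
      (∑ j, (if j.val ≤ i.val then j.val * τ' (i.val - j.val) else 0) * p j +
        deriv (fun t => linP (B t) (τ t) p q i) 0) 0 := by
    change HasDerivAt (fun t => ∑ j, Mmat (τ t) (0 : Fin k → ℂ) i j * linP (B t) (τ t) p q j) _ 0
    have := HasDerivAt.fun_sum fun j (_ : j ∈ univ) =>
      (hasDerivAt_Mmat_zero hτ h1 i j).mul (hua j).differentiableAt.hasDerivAt
    refine this.congr_deriv ?_
    rw [hu0, hM1]
    simp [sum_add_distrib, one_apply]
  have he : (fun t => (Mmat (τ t) (0 : Fin k → ℂ) *ᵥ linP (B t) (τ t) p q) i) =ᶠ[𝓝 0]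
      fun t => (matEval (τ t) (compan 0) ^ k *ᵥ (p + matEval (B t) (compan 0) *ᵥ q)) i := by
    filter_upwards [hMa.det.continuousAt.eventually_ne hdet] with t ht
    rw [linP, mulVec_mulVec, mul_nonsing_inv _ (isUnit_iff_ne_zero.2 ht), one_mulVec]
  have h2 := (hMu.congr_of_eventuallyEq he.symm).unique hv
  have h3 := (hua i).differentiableAt.hasDerivAt
  refine h3.congr_deriv ?_
  rw [← sub_eq_iff_eq_add'.2 h2.symm]
  simp only [mulVec, dotProduct]
  rw [← sum_add_distrib, ← sum_sub_distrib]
  refine sum_congr rfl fun j _ => ?_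
  simp only [matEval_compan_zero_apply]
  split_ifs <;> ring

theorem linP_of_one (hk : 2 ≤ k) {B τ : ℕ → ℂ} (hB : ∀ m, m < k → B m = 0)
    (h1 : ∀ m, m < k → τ m = if m = 0 then 1 else 0) (p q : Fin k → ℂ) : linP B τ p q = p := by
  rw [linP, (Mmat_of_one hk h1 rfl).1, inv_one, one_mulVec, matEval_single _ (by omega) _ h1,
    one_pow, one_mulVec, matEval_eq_zero _ hB, zero_mulVec, add_zero]

/-- `linP` respects the filtration by order. -/
theorem linP_eq_zero {B τ : ℕ → ℂ} (hτ : τ 0 ≠ 0) {p q : Fin k → ℂ} (n : ℕ)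
    (h : ∀ i : Fin k, i.val < n → (p + matEval B (compan 0) *ᵥ q) i = 0) (i : Fin k)
    (hi : i.val < n) : linP B τ p q i = 0 := by
  have hdet := det_Mmat_zero (k := k) hτ
  refine (lower_Mmat_zero (k := k) τ).eq_zero_of_mulVec (fun i => ?_) n (fun i hi => ?_) i hi
  · rw [Mmat_zero_diag]; exact pow_ne_zero _ hτ
  · rw [linP, mulVec_mulVec, mul_nonsing_inv _ (isUnit_iff_ne_zero.2 hdet), one_mulVec]
    exact ((lower_matEval (k := k) τ).pow k).mulVec_eq_zero n h i hi

end LinearVariation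

/-- The space of pairs of coefficient vectors. -/
abbrev PQ (k : ℕ) : Type := Fin (k - 1) ⊕ Fin k → ℂ

/-- The first block, extended by zero. -/
def sP (s : PQ k) (i : ℕ) : ℂ := if h : i < k - 1 then s (Sum.inl ⟨i, h⟩) else 0

/-- The second block, extended by zero. -/
def sQ (s : PQ k) (i : ℕ) : ℂ := if h : i < k then s (Sum.inr ⟨i, h⟩) else 0

theorem sP_add (s t : PQ k) (i : ℕ) : sP (s + t) i = sP s i + sP t i := by
  simp only [sP]; split_ifs <;> simp

theorem sQ_add (s t : PQ k) (i : ℕ) : sQ (s + t) i = sQ s i + sQ t i := by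
  simp only [sQ]; split_ifs <;> simp

theorem sP_smul (c : ℂ) (s : PQ k) (i : ℕ) : sP (c • s) i = c * sP s i := by
  simp only [sP]; split_ifs <;> simp

theorem sQ_smul (c : ℂ) (s : PQ k) (i : ℕ) : sQ (c • s) i = c * sQ s i := by
  simp only [sQ]; split_ifs <;> simp

theorem sP_inl (s : PQ k) (j : Fin (k - 1)) : sP s j.val = s (Sum.inl j) := dif_pos j.isLt

theorem sQ_inr (s : PQ k) (j : Fin k) : sQ s j.val = s (Sum.inr j) := dif_pos j.isLt

theorem mk_add (p q p' q' : ℕ → ℂ) :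
    mk k (fun i => p i + p' i) (fun i => q i + q' i) = mk k p q + mk k p' q' := by
  funext l
  rcases l with i | i | i
  on_goal 3 => fin_cases i
  all_goals simp [mk, add_comm]

theorem mk_smul (c : ℂ) (p q : ℕ → ℂ) :
    mk k (fun i => c * p i) (fun i => c * q i) = c • mk k p q := by
  funext l
  rcases l with i | i | i
  on_goal 3 => fin_cases i
  all_goals simp [mk]

/-- The point of the target attached to a pair of coefficient vectors. -/
def ofPQ (k : ℕ) : PQ k →L[ℂ] Target k :=
  LinearMap.toContinuousLinearMap
    { toFun := fun s => mk k (sP s) (sQ s)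
      map_add' := fun s t => by
        rw [← mk_add]
        congr 1 <;> funext i
        exacts [sP_add s t i, sQ_add s t i]
      map_smul' := fun c s => by
        rw [RingHom.id_apply, ← mk_smul]
        congr 1 <;> funext i
        exacts [sP_smul c s i, sQ_smul c s i] }

/-- The pair of coefficient vectors of a point of the target. -/
def toPQ (k : ℕ) : Target k →L[ℂ] PQ k :=
  ContinuousLinearMap.pi (Sum.rec (fun i => pcL k i.val) fun i => qcL k i.val)

theorem toPQ_inr (X : Target k) (i : Fin k) : toPQ k X (Sum.inr i) = qc X i := rfl

theorem pc_ofPQ (hk : 2 ≤ k) (s : PQ k) (i : ℕ) : pc (ofPQ k s) i = sP s i := by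
  by_cases hi : i ≤ k - 2
  · exact pc_mk _ _ hi
  · rw [pc_eq_zero _ (by omega) (by omega), sP, dif_neg (by omega)]

theorem qc_ofPQ (hk : 2 ≤ k) (s : PQ k) (i : ℕ) : qc (ofPQ k s) i = sQ s i := by
  by_cases hi : i ≤ k - 1
  · exact qc_mk _ _ hi
  · rw [qc_eq_zero _ (by omega) (by omega), sQ, dif_neg (by omega)]

theorem ofPQ_toPQ (hk : 2 ≤ k) (X : Target k) : ofPQ k (toPQ k X) = X := by
  refine target_ext (fun i hi => ?_) fun i hi => ?_
  · rw [pc_ofPQ hk, sP, dif_pos (by omega)]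
    rfl
  · rw [qc_ofPQ hk, sQ, dif_pos (by omega)]
    rfl

/-- The basis vectors of the target. -/
def bas (k : ℕ) (l : Fin (k - 1) ⊕ Fin k) : Target k := ofPQ k (Pi.single l 1)

local notation "eP[" k "]" => bas k (Sum.inl ⟨k - 2, by omega⟩)
local notation "eQ[" k "]" => bas k (Sum.inr ⟨k - 1, by omega⟩)

theorem ofPQ_single (l : Fin (k - 1) ⊕ Fin k) (t : ℂ) : ofPQ k (Pi.single l t) = t • bas k l := by
  rw [bas, ← map_smul, ← Pi.single_smul, smul_eq_mul, mul_one]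

theorem pc_bas_inl (hk : 2 ≤ k) (j : Fin (k - 1)) (i : ℕ) :
    pc (bas k (.inl j)) i = if i = j.val then 1 else 0 := by
  rw [bas, pc_ofPQ hk, sP]
  by_cases h : i < k - 1
  · rw [dif_pos h]
    simp [Pi.single_apply, Fin.ext_iff]
  · rw [dif_neg h, if_neg (by omega)]

theorem qc_bas_inl (hk : 2 ≤ k) (j : Fin (k - 1)) (i : ℕ) : qc (bas k (.inl j)) i = 0 := by
  rw [bas, qc_ofPQ hk, sQ]
  split_ifs <;> simp

theorem pc_bas_inr (hk : 2 ≤ k) (j : Fin k) (i : ℕ) : pc (bas k (.inr j)) i = 0 := by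
  rw [bas, pc_ofPQ hk, sP]
  split_ifs <;> simp

theorem qc_bas_inr (hk : 2 ≤ k) (j : Fin k) (i : ℕ) :
    qc (bas k (.inr j)) i = if i = j.val then 1 else 0 := by
  rw [bas, qc_ofPQ hk, sQ]
  by_cases h : i < k
  · rw [dif_pos h]
    simp [Pi.single_apply, Fin.ext_iff]
  · rw [dif_neg h, if_neg (by omega)]

theorem analyticAt_sP {f : E → PQ k} {a : E}
    (hf : Hol f a) (i : ℕ) : Hol (fun x => sP (f x) i) a := by
  simp only [sP]
  split_ifs
  exacts [analyticAt_pi_iff.1 hf _, analyticAt_const]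

theorem analyticAt_sQ {f : E → PQ k} {a : E}
    (hf : Hol f a) (i : ℕ) : Hol (fun x => sQ (f x) i) a := by
  simp only [sQ]
  split_ifs
  exacts [analyticAt_pi_iff.1 hf _, analyticAt_const]

/-- The multiplier of `Q` encoded by a parameter. -/
def parB (s : PQ k) (m : ℕ) : ℂ := if m ≤ k - 2 then sQ s (k - 2 - m) else 0

/-- The change of variable encoded by a parameter. -/
def parT (s : PQ k) (m : ℕ) : ℂ := if m = 0 then 1 else if m ≤ k - 2 then sP s (k - 2 - m) else 0

theorem analyticAt_parB {f : E → PQ k} {a : E}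
    (hf : Hol f a) (m : ℕ) : Hol (fun x => parB (f x) m) a := by
  simp only [parB]
  split_ifs
  exacts [analyticAt_sQ hf _, analyticAt_const]

theorem analyticAt_parT {f : E → PQ k} {a : E}
    (hf : Hol f a) (m : ℕ) : Hol (fun x => parT (f x) m) a := by
  simp only [parT]
  split_ifs
  exacts [analyticAt_const, analyticAt_sP hf _, analyticAt_const]

theorem parT_zero (s : PQ k) : parT s 0 = 1 := if_pos rfl

/-- The base parameter. -/
def baseS (k : ℕ) (c : ℂ) : PQ k :=
  Sum.elim (fun i => if i.val = k - 2 then 1 else 0) (fun i => if i.val = k - 1 then c else 0)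

theorem parB_baseS (hk : 2 ≤ k) (c : ℂ) (m : ℕ) : parB (baseS k c) m = 0 := by
  simp only [parB, sQ, baseS]
  split_ifs <;> simp
  omega

theorem parT_baseS (c : ℂ) (m : ℕ) : parT (baseS k c) m = if m = 0 then 1 else 0 := by
  simp only [parT, sP, baseS]
  split_ifs <;> simp
  omega

/-- The first order coefficients of `U_{k-2}` after a transformation. -/
def topLin (hk : 2 ≤ k) (s : PQ k) (l : Fin (k - 1) ⊕ Fin k) : ℂ :=
  linP (parB s) (parT s) (pv (bas k l)) (qv (bas k l)) ⟨k - 2, by omega⟩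

theorem hasDerivAt_move_smul (hk : 2 ≤ k) {B τ : ℕ → ℂ} (hτ : τ 0 ≠ 0) (v : Target k) :
    HasDerivAt (fun t : ℂ => move B τ (t • v)) (moveLin B τ v) 0 :=
  hasDerivAt_move (B := fun _ => B) (τ := fun _ => τ) hk (fun _ => analyticAt_const)
    (fun _ => analyticAt_const) hτ v

theorem hasDerivAt_pc_move (hk : 2 ≤ k) (s : PQ k) (l : Fin (k - 1) ⊕ Fin k) :
    HasDerivAt (fun t => pc (move (parB s) (parT s) (ofPQ k (Pi.single l t))) (k - 2))
      (topLin hk s l) 0 := by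
  simp only [ofPQ_single]
  have h := (pcL k (k - 2)).hasFDerivAt.comp_hasDerivAt 0
    (hasDerivAt_move_smul hk (B := parB s) (τ := parT s) (by rw [parT_zero]; simp) (bas k l))
  refine h.congr_deriv ?_
  rw [pcL_apply, moveLin, pc_mk _ _ le_rfl, extV_of_lt _ (by omega)]
  rfl

theorem topLin_last (hk : 2 ≤ k) (s : PQ k) : topLin hk s (Sum.inr ⟨k - 1, by omega⟩) = 0 := by
  refine linP_eq_zero (by rw [parT_zero]; simp) (k - 1) (fun i hi => ?_) _ (by simp; omega)
  have h1 : pv eQ[k] = 0 := by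
    funext j
    exact pc_bas_inr hk _ _
  rw [h1, zero_add]
  refine (lower_matEval (k := k) _).mulVec_eq_zero (k - 1) (fun j hj => ?_) i hi
  have : qv eQ[k] j = _ := qc_bas_inr hk _ _
  rw [this, if_neg (by simp; omega)]

theorem topLin_baseS (hk : 2 ≤ k) (c : ℂ) (l : Fin (k - 1) ⊕ Fin k) :
    topLin hk (baseS k c) l = if l = Sum.inl ⟨k - 2, by omega⟩ then 1 else 0 := by
  rw [topLin, linP_of_one hk (fun m _ => parB_baseS hk c m) (fun m _ => parT_baseS c m)]
  rcases l with j | j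
  · rw [pv, pc_bas_inl hk]
    congr 1
    simp [Fin.ext_iff, eq_comm]
  · rw [pv, pc_bas_inr hk]
    simp

/-- The variation of the first order coefficients at the base parameter. -/
theorem hasDerivAt_topLin (hk : 2 ≤ k) (c : ℂ) (δ : PQ k) (l : Fin (k - 1) ⊕ Fin k) :
    HasDerivAt (fun ε : ℂ => topLin hk (baseS k c + ε • δ) l)
      (Sum.elim (fun j : Fin (k - 1) => if j.val = k - 2 then 0 else ((k : ℂ) - j.val) * δ (Sum.inl j))
        (fun j : Fin k => if j.val = k - 1 then 0 else δ (Sum.inr j)) l) 0 := by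
  have hl : Hol (fun ε : ℂ => baseS k c + ε • δ) 0 :=
    analyticAt_const.add (analyticAt_id.smul analyticAt_const)
  have hB : ∀ m, m < k → HasDerivAt (fun ε : ℂ => parB (baseS k c + ε • δ) m) (parB δ m) 0 := by
    intro m _
    simp only [parB]
    split_ifs
    · simp only [sQ_add, sQ_smul]
      exact hasDerivAt_affine _ _
    · exact hasDerivAt_const _ _
  have hT : ∀ m, m < k → HasDerivAt (fun ε : ℂ => parT (baseS k c + ε • δ) m)
      (if m = 0 then 0 else parT δ m) 0 := by
    intro m _
    simp only [parT]
    split_ifs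
    · exact hasDerivAt_const _ _
    · simp only [sP_add, sP_smul]
      exact hasDerivAt_affine _ _
    · exact hasDerivAt_const _ _
  have h := hasDerivAt_linP hk (fun m => analyticAt_parB hl m) (fun m => analyticAt_parT hl m) hB hT
    (fun m _ => by simpa using parB_baseS hk c m) (fun m _ => by simpa using parT_baseS c m)
    (pv (bas k l)) (qv (bas k l)) ⟨k - 2, by omega⟩
  refine h.congr_deriv ?_
  rcases l with j | j
  · rw [sum_eq_single ⟨j.val, by omega⟩]
    · simp only [Sum.elim_inl, pv, qv, pc_bas_inl hk, qc_bas_inl hk]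
      rw [if_pos (by omega)]
      by_cases hj : j.val = k - 2
      · simp [hj]
      · have hj' : k - 2 - j.val ≠ 0 := by omega
        rw [if_neg hj', if_neg hj, parT, if_neg hj', if_pos (Nat.sub_le _ _)]
        have : k - 2 - (k - 2 - j.val) = j.val := by omega
        rw [this, sP_inl]
        simp
    · intro i _ hi
      have : i.val ≠ j.val := fun h => hi (Fin.ext h)
      simp [pv, qv, pc_bas_inl hk, qc_bas_inl hk, this]
    · simp
  · rw [sum_eq_single j]
    · simp only [Sum.elim_inr, pv, qv, pc_bas_inr hk, qc_bas_inr hk]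
      by_cases hj : j.val = k - 1
      · rw [if_neg (by omega), if_pos hj]
      · have h2 : parB δ (k - 2 - j.val) = δ (Sum.inr j) := by
          rw [parB, if_pos (Nat.sub_le _ _), show k - 2 - (k - 2 - j.val) = j.val by omega, sQ_inr]
        rw [if_pos (by omega), if_neg hj, h2]
        simp
    · intro i _ hi
      have : i.val ≠ j.val := fun h => hi (Fin.ext h)
      simp [pv, qv, pc_bas_inr hk, qc_bas_inr hk, this]
    · simp

theorem analyticAt_move_par (hk : 2 ≤ k) (z : PQ k × PQ k) :
    Hol (fun z : PQ k × PQ k => move (parB z.2) (parT z.2) (ofPQ k z.1)) z :=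
  analyticAt_move (analyticAt_parB analyticAt_snd) (analyticAt_parT analyticAt_snd)
    (((ofPQ k).analyticAt _).comp analyticAt_fst) hk

theorem move_par_zero (hk : 2 ≤ k) (s : PQ k) : move (parB s) (parT s) (ofPQ k 0) = 0 := by
  rw [map_zero, move_zero hk _ (by rw [parT_zero]; simp)]

theorem strongEquiv_one {V : Set E}
    {f g lam : E → ℂ} {ψ : E → E} (hψ : IsBiholGerm ψ) (hV : MapsSetGerm ψ V V)
    (hl : Hol lam 0) (l0 : lam 0 ≠ 0) (he : ∀ᶠ x in 𝓝 0, f x = lam x * g (ψ x)) :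
    StrongEquiv V (fun x => ![f x]) (fun x => ![g x]) := by
  refine ⟨ψ, hψ, hV, fun x => Matrix.of fun _ _ => lam x, fun _ _ => hl, by simpa using l0, ?_⟩
  filter_upwards [he] with x hx
  funext i
  obtain rfl := Subsingleton.elim i 0
  simp [Matrix.mulVec, dotProduct, hx]

/-- Solving for the parameters of a transformation, with a second order correction. -/
theorem exists_solve_top (hk : 2 ≤ k) (c : ℂ) {e : PQ k × PQ k → ℂ}
    (he : Hol e (0, baseS k c)) (he0 : ∀ s, e (0, s) = 0)
    (hed : ∀ s l, HasDerivAt (fun t => e (Pi.single l t, s)) 0 0)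
    (hew : ∀ c', Tendsto (fun t => e (Pi.single (Sum.inr ⟨k - 1, by omega⟩) t, baseS k c') / t ^ 2)
      (𝓝[≠] 0) (𝓝 1)) : ∃ N ∈ 𝓝 (baseS k c), ∀ h : Target k → ℂ,
    Hol h 0 → h 0 = 0 → 𝒟 h 0 eQ[k] = 0 →
    ∀ j : PQ k, (∀ l, l ≠ Sum.inr ⟨k - 1, by omega⟩ → 𝒟 h 0 (bas k l) = j l) →
    Tendsto (fun t : ℂ => h (t • eQ[k]) / t ^ 2) (𝓝[≠] 0)
      (𝓝 (j (Sum.inr ⟨k - 1, by omega⟩))) → j ∈ N →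
    ∃ σ : Target k → PQ k, Hol σ 0 ∧ σ 0 (Sum.inl ⟨k - 2, by omega⟩) ≠ 0 ∧
      (j = baseS k c → σ 0 = baseS k c) ∧ ∀ᶠ X in 𝓝 0,
      h X = σ X (Sum.inl ⟨k - 2, by omega⟩) * (pc (move (parB (σ X)) (parT (σ X)) X) (k - 2) +
        σ X (Sum.inr ⟨k - 1, by omega⟩) * e (toPQ k X, σ X)) := by
  let w : Fin (k - 1) ⊕ Fin k := Sum.inr ⟨k - 1, by omega⟩
  let a : Fin (k - 1) ⊕ Fin k := Sum.inl ⟨k - 2, by omega⟩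
  let mv : PQ k × PQ k → Target k := fun z => move (parB z.2) (parT z.2) (ofPQ k z.1)
  let F : PQ k × PQ k → ℂ := fun z => z.2 a * (pc (mv z) (k - 2) + z.2 w * e z)
  have hs : ∀ (l : Fin (k - 1) ⊕ Fin k) z, Hol (fun z : PQ k × PQ k => z.2 l) z :=
    fun l _ => analyticAt_pi_iff.1 analyticAt_snd l
  have hmv := analyticAt_move_par hk
  have hF : Hol F (0, baseS k c) := (hs a _).mul ((analyticAt_pc (hmv _) _).add ((hs w _).mul he))
  have hF0 : ∀ s, F (0, s) = 0 := by
    intro s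
    simp only [F, mv, move_par_zero hk, pc_zero, he0]
    ring
  have hderiv : ∀ s l, HasDerivAt (fun t => F (Pi.single l t, s)) (s a * topLin hk s l) 0 := by
    intro s l
    have h3 := (((hasDerivAt_pc_move hk s l).add ((hed s l).const_mul (s w))).const_mul (s a))
    refine h3.congr_deriv ?_
    ring
  have hbw : ∀ ε : ℂ, baseS k c + ε • Pi.single w 1 = baseS k (c + ε) := by
    intro ε
    funext l
    rcases l with i | i
    · simp [baseS, w]
    · by_cases hi : i.val = k - 1
      · have : i = ⟨k - 1, by omega⟩ := Fin.ext hi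
        simp [baseS, w, this]
      · have : i ≠ ⟨k - 1, by omega⟩ := fun h => hi (by rw [h])
        simp [baseS, w, this, hi]
  have hba : ∀ c, baseS k c a = 1 := fun c => by simp [baseS, a]
  have hbw' : ∀ c, baseS k c w = c := fun c => by simp [baseS, w]
  obtain ⟨N, hN, key⟩ := exists_solve_sq w (F := F) (s₀ := baseS k c) hF
    (.of_forall hF0) (.of_forall fun s => by
      have := hderiv s w
      rwa [topLin_last hk, mul_zero] at this)
    (J := fun s l => s a * topLin hk s l) (.of_forall fun s l _ => hderiv s l)
    (Pi.single w 1) (fun δ hδ => by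
      have hvar : ∀ l, HasDerivAt (fun ε : ℂ => (baseS k c + ε • δ) a *
          topLin hk (baseS k c + ε • δ) l) _ 0 := fun l => by
        exact (hasDerivAt_affine _ _).mul (hasDerivAt_topLin hk c δ l)
      refine ⟨δ w, ?_⟩
      funext l
      rcases eq_or_ne l w with rfl | hl
      · simp
      · have h1 := (hvar l).unique (hδ l hl)
        simp only [zero_smul, add_zero, topLin_baseS, hba] at h1
        rcases l with i | i
        · by_cases hi : i.val = k - 2
          · have : i = ⟨k - 2, by omega⟩ := Fin.ext hi
            simp [this] at h1
            simp [w, this, a] at h1 ⊢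
            exact h1
          · have h2 : (Sum.inl i : Fin (k - 1) ⊕ Fin k) ≠ Sum.inl ⟨k - 2, by omega⟩ := fun h =>
              hi (by rw [Sum.inl.inj h])
            have h3 : (k : ℂ) - i.val ≠ 0 := by
              rw [sub_ne_zero]
              exact_mod_cast (by omega : k ≠ i.val)
            simp [hi, h2, h3] at h1
            simp [w, h1]
        · have hi : i.val ≠ k - 1 := fun h => hl (by simp [w, Fin.ext_iff, h])
          simp [hi] at h1
          simp [h1, hl])
    (j₀ := c) (c₁ := 1) one_ne_zero
    (.of_forall fun ε => by
      rw [hbw]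
      have h1 := (hew (c + ε)).const_mul (c + ε)
      refine (h1.congr' (.of_forall fun t => ?_)).trans (by simp)
      simp only [F, mv, hba, hbw']
      rw [move_eq_self hk (fun m _ => parB_baseS hk _ m) (fun m _ => parT_baseS _ m), pc_ofPQ hk]
      simp [sP, w, mul_div_assoc])
    (O := {s | s a ≠ 0}) ((continuous_apply a).continuousAt.eventually_ne (by rw [hba]; simp))
  have hbase : Function.update (fun l => baseS k c a * topLin hk (baseS k c) l) w c = baseS k c := by
    funext l
    rcases eq_or_ne l w with rfl | hl
    · simp [hbw']
    · rw [Function.update_of_ne hl, hba, one_mul, topLin_baseS]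
      rcases l with i | i
      · simp [baseS, Fin.ext_iff]
      · have hi : i.val ≠ k - 1 := fun h => hl (by simp [w, Fin.ext_iff, h])
        simp [baseS, hi]
  rw [hbase] at hN key
  refine ⟨N, hN, fun h hh h0 hw j hj hjw hjN => ?_⟩
  have hd : ∀ l, HasDerivAt (fun t => h (ofPQ k (Pi.single l t))) (𝒟 h 0 (bas k l)) 0 := by
    intro l
    simp only [ofPQ_single]
    exact hasDerivAt_comp_smul hh _
  obtain ⟨s, hsa, hsO, hs0, hse⟩ := key (fun Y => h (ofPQ k Y))
    (analyticAt_comp_zero hh ((ofPQ k).analyticAt _) (map_zero _)) (by rw [map_zero, h0])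
    (by have := hd w; rwa [show 𝒟 h 0 (bas k w) = 0 from hw] at this) j (fun l hl => by rw [← hj l hl]; exact hd l)
    (by simp only [ofPQ_single]; exact hjw) hjN
  have ht : Tendsto (toPQ k) (𝓝 0) (𝓝 0) := (toPQ k).continuous.tendsto' _ _ (map_zero _)
  refine ⟨fun X => s (toPQ k X), analyticAt_comp_zero hsa ((toPQ k).analyticAt _) (map_zero _),
    ?_, fun hjb => ?_, ?_⟩
  · simp only [map_zero]; exact hsO
  · simp only [map_zero]; exact hs0 hjb
  · filter_upwards [ht.eventually hse] with X h1
    simp only [F, mv, ofPQ_toPQ hk] at h1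
    exact h1.symm

theorem exists_nf_one_near (hk : 2 ≤ k) (c : ℂ) : ∃ N ∈ 𝓝 (baseS k c), ∀ h : Target k → ℂ,
    Hol h 0 → h 0 = 0 → 𝒟 h 0 eQ[k] = 0 →
    ∀ j : PQ k, (∀ l, l ≠ Sum.inr ⟨k - 1, by omega⟩ → 𝒟 h 0 (bas k l) = j l) →
    Tendsto (fun t : ℂ => h (t • eQ[k]) / t ^ 2) (𝓝[≠] 0)
      (𝓝 (j (Sum.inr ⟨k - 1, by omega⟩))) → j ∈ N →
    ∃ κ : Target k → ℂ, Hol κ 0 ∧ (j = baseS k c → κ 0 = c) ∧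
      StrongEquiv (image k) (fun X => ![h X])
        (fun X => ![pc X (k - 2) + κ X * qc X (k - 1) ^ 2]) := by
  let w : Fin (k - 1) ⊕ Fin k := Sum.inr ⟨k - 1, by omega⟩
  let a : Fin (k - 1) ⊕ Fin k := Sum.inl ⟨k - 2, by omega⟩
  let mv : PQ k × PQ k → Target k := fun z => move (parB z.2) (parT z.2) (ofPQ k z.1)
  have hmv := analyticAt_move_par hk
  obtain ⟨N, hN, key⟩ := exists_solve_top hk c (e := fun z => qc (mv z) (k - 1) ^ 2)
    ((analyticAt_qc (hmv _) _).pow 2)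
    (fun s => by simp only [mv, move_par_zero hk, qc_zero]; ring)
    (fun s l => by
      have h2 : HasDerivAt (fun t => qc (mv (Pi.single l t, s)) (k - 1))
          (deriv (fun t => qc (mv (Pi.single l t, s)) (k - 1)) 0) 0 := by
        refine DifferentiableAt.hasDerivAt ?_
        have e1 : Hol (fun t : ℂ => ((Pi.single l t : PQ k), s)) 0 :=
          (((ContinuousLinearMap.single ℂ (fun _ => ℂ) l).analyticAt _)).prod analyticAt_const
        exact (AnalyticAt.comp (f := fun t : ℂ => ((Pi.single l t : PQ k), s))
          (analyticAt_qc (hmv _) (k - 1)) e1).differentiableAt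
      have h3 := h2.pow 2
      refine h3.congr_deriv ?_
      have : qc (mv (Pi.single l 0, s)) (k - 1) = 0 := by
        simp only [Pi.single_zero, mv, move_par_zero hk, qc_zero]
      rw [this]
      ring)
    (fun c' => by
      refine (tendsto_const_nhds (x := (1 : ℂ))).congr' ?_
      filter_upwards [self_mem_nhdsWithin] with t ht
      have ht : t ≠ 0 := ht
      simp only [mv]
      rw [move_eq_self hk (fun m _ => parB_baseS hk _ m) (fun m _ => parT_baseS _ m), qc_ofPQ hk]
      simp [sQ, (by omega : k - 1 < k)]
      field_simp)
  refine ⟨N, hN, fun h hh h0 hw j hj hjw hjN => ?_⟩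
  obtain ⟨σ, hσ, σa, σ0, hσe⟩ := key h hh h0 hw j hj hjw hjN
  have hσl : PiAnalyticAt σ 0 := analyticAt_pi_iff.1 hσ
  let ψ : Target k → Target k := fun X => move (parB (σ X)) (parT (σ X)) X
  have hψ : IsBiholGerm ψ := isBiholGerm_move (B := fun X => parB (σ X)) (τ := fun X => parT (σ X)) hk
    (analyticAt_parB hσ) (analyticAt_parT hσ) (by rw [parT_zero]; simp)
  have hψV : MapsSetGerm ψ (image k) (image k) :=
    mapsSetGerm_move (B := fun X => parB (σ X)) (τ := fun X => parT (σ X)) hk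
    (analyticAt_parB hσ) (analyticAt_parT hσ) (by rw [parT_zero]; simp)
  obtain ⟨φ, hφ, hφ1, hφ2, -⟩ := hψ.exists_inverse
  refine ⟨fun X => σ (φ X) w, analyticAt_comp_zero (hσl w) hφ.1 hφ.2.1, fun hjb => ?_,
    strongEquiv_one hψ hψV (hσl a) σa ?_⟩
  · change σ (φ 0) w = c
    rw [hφ.2.1, σ0 hjb]
    simp [baseS, w]
  · filter_upwards [hσe, hφ1] with X h1 h2
    simp only [mv, ofPQ_toPQ hk] at h1
    rw [h1, h2]

/-- The factor by which scaling acts on a coordinate. -/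
def wt (l m : ℂ) : Fin (k - 1) ⊕ Fin k → ℂ :=
  Sum.elim (fun i => l ^ (k - i.val)) fun i => m * l ^ (k - 1 - i.val)

theorem scale_smul_bas (hk : 2 ≤ k) (l m t : ℂ) (i : Fin (k - 1) ⊕ Fin k) :
    scale l m (t • bas k i) = (wt l m i * t) • bas k i := by
  refine target_ext (fun n hn => ?_) fun n hn => ?_
  · rw [pc_scale _ _ _ hn, pc_smul, pc_smul]
    rcases i with i | i
    · rw [pc_bas_inl hk]
      split_ifs with h
      · simp [wt, h]
      · simp
    · rw [pc_bas_inr hk]; simp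
  · rw [qc_scale _ _ _ hn, qc_smul, qc_smul]
    rcases i with i | i
    · rw [qc_bas_inl hk]; simp
    · rw [qc_bas_inr hk]
      split_ifs with h
      · simp [wt, h]
      · simp

theorem fderiv_comp_scale (hk : 2 ≤ k) (hh : Hol h 0) {l m : ℂ}
    (hl : l ≠ 0) (hm : m ≠ 0) (c : ℂ) (i : Fin (k - 1) ⊕ Fin k) :
    𝒟 (fun X => c * h (scale l m X)) 0 (bas k i) = c * (wt l m i * 𝒟 h 0 (bas k i)) := by
  have hs : IsBiholGerm (fun X : Target k => scale l m X) :=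
    isBiholGerm_scale analyticAt_const analyticAt_const hl hm
  have ha : Hol (fun X => c * h (scale l m X)) 0 :=
    analyticAt_const.mul (analyticAt_comp_zero hh hs.1 hs.2.1)
  refine (hasDerivAt_comp_smul ha (bas k i)).unique ?_
  simp only [scale_smul_bas hk]
  refine HasDerivAt.const_mul c ?_
  have h1 : HasDerivAt (fun t : ℂ => h (t • bas k i)) (𝒟 h 0 (bas k i)) (wt l m i * 0) := by
    rw [mul_zero]; exact hasDerivAt_comp_smul hh _
  have h2 : HasDerivAt (fun t : ℂ => wt l m i * t) (wt l m i) 0 := by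
    simpa using (hasDerivAt_id (0 : ℂ)).const_mul (wt (k := k) l m i)
  have h3 := h1.comp 0 h2
  rw [mul_comm]
  exact h3

theorem tendsto_comp_mul_div_sq {f : ℂ → ℂ} {a b : ℂ} (hb : b ≠ 0)
    (hf : Tendsto (fun t => f t / t ^ 2) (𝓝[≠] 0) (𝓝 a)) :
    Tendsto (fun t => f (b * t) / t ^ 2) (𝓝[≠] 0) (𝓝 (b ^ 2 * a)) := by
  have h1 : Tendsto (fun t : ℂ => b * t) (𝓝[≠] 0) (𝓝[≠] 0) := by
    refine tendsto_nhdsWithin_iff.2 ⟨?_, ?_⟩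
    · have : Continuous (fun t : ℂ => b * t) := by fun_prop
      exact (this.tendsto' 0 0 (by simp)).mono_left nhdsWithin_le_nhds
    · filter_upwards [self_mem_nhdsWithin] with t ht
      exact mul_ne_zero hb ht
  refine ((hf.comp h1).const_mul (b ^ 2)).congr' ?_
  filter_upwards [self_mem_nhdsWithin] with t ht
  have ht : t ≠ 0 := ht
  simp only [Function.comp]
  field_simp

/-- A function with vanishing `V_{k-1}`-derivative and nonvanishing `U_{k-2}`-derivative is
equivalent to `U_{k-2} + κ V_{k-1}²`. -/
theorem exists_nf_one (hk : 2 ≤ k) (hh : Hol h 0) (h0 : h 0 = 0)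
    (hw : 𝒟 h 0 eQ[k] = 0) (ha : 𝒟 h 0 eP[k] ≠ 0) : ∃ κ : Target k → ℂ, Hol κ 0 ∧
      StrongEquiv (image k) (fun X => ![h X])
        (fun X => ![pc X (k - 2) + κ X * qc X (k - 1) ^ 2]) := by
  obtain ⟨N, hN, key⟩ := exists_nf_one_near hk 0
  set w : Fin (k - 1) ⊕ Fin k := Sum.inr ⟨k - 1, by omega⟩ with hwdef
  set a : Fin (k - 1) ⊕ Fin k := Sum.inl ⟨k - 2, by omega⟩ with hadef
  set al := 𝒟 h 0 (bas k a) with hal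
  have hdw := hasDerivAt_comp_smul hh (bas k w)
  rw [hw] at hdw
  obtain ⟨c2, hc2⟩ := exists_tendsto_div_sq
    (f := fun t : ℂ => h (t • bas k w))
    (analyticAt_comp_zero hh (analyticAt_id.smul analyticAt_const) (by simp)) (by simp [h0]) hdw
  let j : ℂ → PQ k := fun ε => Sum.elim
    (fun i => (ε ^ 2) ^ (k - 2 - i.val) * 𝒟 h 0 (bas k (.inl i)) / al)
    (fun i => if i.val = k - 1 then ε ^ 2 * c2 / al else
      ε * (ε ^ 2) ^ (k - 2 - i.val) * 𝒟 h 0 (bas k (.inr i)) / al)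
  have hj : Tendsto j (𝓝[≠] 0) (𝓝 (baseS k 0)) := by
    have hcont : Continuous j := by
      refine continuous_pi fun l => ?_
      rcases l with i | i
      · simp only [j, Sum.elim_inl]; fun_prop
      · simp only [j, Sum.elim_inr]
        split_ifs <;> fun_prop
    refine (hcont.tendsto' 0 _ ?_).mono_left nhdsWithin_le_nhds
    funext l
    rcases l with i | i
    · by_cases hi : i.val = k - 2
      · have : i = ⟨k - 2, by omega⟩ := Fin.ext hi
        simp only [j, baseS, Sum.elim_inl, hi, if_true]
        rw [this, ← hadef, ← hal]
        simp [ha]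
      · have : k - 2 - i.val ≠ 0 := by omega
        simp [j, baseS, hi, this]
    · simp [j, baseS]
  obtain ⟨ε, hεN, hε⟩ := ((hj.eventually hN).and self_mem_nhdsWithin).exists
  have hε : ε ≠ 0 := hε
  have hs : IsBiholGerm (fun X : Target k => scale (ε ^ 2) (ε ^ 3) X) :=
    isBiholGerm_scale analyticAt_const analyticAt_const (by positivity) (by positivity)
  have hsV : MapsSetGerm (fun X : Target k => scale (ε ^ 2) (ε ^ 3) X) (image k) (image k) :=
    mapsSetGerm_scale hk analyticAt_const analyticAt_const (by positivity) (by positivity)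
  let c : ℂ := 1 / (ε ^ 4 * al)
  have hc : c ≠ 0 := one_div_ne_zero (mul_ne_zero (pow_ne_zero 4 hε) ha)
  obtain ⟨κ, hκ, -, hE⟩ := key (fun X => c * h (scale (ε ^ 2) (ε ^ 3) X))
    (analyticAt_const.mul (analyticAt_comp_zero hh hs.1 hs.2.1))
    (by have := hs.2.1; simp only at this; rw [this, h0, mul_zero])
    (by rw [fderiv_comp_scale hk hh (by positivity) (by positivity), hw]; ring) (j ε)
    (fun l hl => by
      rw [fderiv_comp_scale hk hh (by positivity) (by positivity)]
      rcases l with i | i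
      · simp only [wt, j, Sum.elim_inl, c]
        have : k - i.val = (k - 2 - i.val) + 2 := by omega
        rw [this, pow_add]
        field_simp
      · have hi : i.val ≠ k - 1 := fun h => hl (by simp [w, Fin.ext_iff, h])
        simp only [wt, j, Sum.elim_inr, c, if_neg hi]
        have : k - 1 - i.val = (k - 2 - i.val) + 1 := by omega
        rw [this, pow_add]
        field_simp)
    (by
      simp only [scale_smul_bas hk]
      have h1 := (tendsto_comp_mul_div_sq (b := wt (ε ^ 2) (ε ^ 3) w) (by
        simp [wt, w, hε]) hc2).const_mul c
      have e1 : j ε w = c * (wt (ε ^ 2) (ε ^ 3) w ^ 2 * c2) := by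
        simp only [j, w, wt, c, Sum.elim_inr, if_true]
        rw [Nat.sub_self]
        field_simp
      rw [e1]
      refine h1.congr fun t => ?_
      ring) hεN
  exact ⟨κ, hκ, (strongEquiv_one hs hsV analyticAt_const hc
    (.of_forall fun X => rfl)).symm.trans hE⟩

theorem exists_sqrt_unit {κ : E → ℂ} (hκ : Hol κ 0) (h0 : κ 0 ≠ 0) :
    ∃ ρ : E → ℂ, Hol ρ 0 ∧ ρ 0 ≠ 0 ∧ ∀ᶠ x in 𝓝 0, ρ x ^ 2 = κ x := by
  obtain ⟨c, hc⟩ := IsAlgClosed.exists_pow_nat_eq (κ 0) (n := 2) (by norm_num)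
  have hc0 : c ≠ 0 := by
    rintro rfl
    exact h0 (by simpa using hc.symm)
  refine ⟨fun x => Complex.exp (Complex.log (κ x / κ 0) / 2) * c, ?_, ?_, ?_⟩
  · refine AnalyticAt.mul (AnalyticAt.cexp ?_) analyticAt_const
    refine AnalyticAt.div_const (AnalyticAt.clog (hκ.div_const) ?_)
    rw [div_self h0]
    exact Complex.one_mem_slitPlane
  · exact mul_ne_zero (Complex.exp_ne_zero _) hc0
  · filter_upwards [hκ.continuousAt.eventually_ne h0] with x hx
    rw [mul_pow, ← Complex.exp_nat_mul, ← hc]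
    have : ((2 : ℕ) : ℂ) * (Complex.log (κ x / c ^ 2) / 2) = Complex.log (κ x / c ^ 2) := by
      push_cast; ring
    rw [this, Complex.exp_log (div_ne_zero hx (by positivity))]
    field_simp

theorem nf_one_normalize (hk : 2 ≤ k) (hκ : Hol κ 0) (h0 : κ 0 ≠ 0)
    {c : ℂ} (hc : c ≠ 0) : StrongEquiv (image k) (fun X => ![pc X (k - 2) + κ X * qc X (k - 1) ^ 2])
      (fun X => ![pc X (k - 2) + c * qc X (k - 1) ^ 2]) := by
  obtain ⟨ρ, hρ, ρ0, hρe⟩ := exists_sqrt_unit (κ := fun X => κ X / c) hκ.div_const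
    (div_ne_zero h0 hc)
  refine strongEquiv_one (lam := fun _ => 1)
    (isBiholGerm_scale (l := fun _ => 1) analyticAt_const hρ one_ne_zero ρ0)
    (mapsSetGerm_scale hk (l := fun _ => 1) analyticAt_const hρ one_ne_zero ρ0)
    analyticAt_const one_ne_zero ?_
  filter_upwards [hρe] with X hX
  rw [pc_scale _ _ _ le_rfl, qc_scale _ _ _ le_rfl]
  simp only [one_pow, one_mul, mul_one, mul_pow, hX]
  field_simp

section Reduction

open Matrix

/-- The functions of the coefficients of `P` alone. -/
def POnly (g : Target k → ℂ) : Prop := ∀ X Y, (∀ i, pc X i = pc Y i) → g X = g Y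

/-- The projection to the points with `Q = 0`. -/
def projP (X : Target k) : Target k := mk k (pc X) 0

theorem pc_projP (X : Target k) (i : ℕ) : pc (projP X) i = pc X i := by
  by_cases hi : i ≤ k - 2
  · exact pc_mk _ _ hi
  · rw [pc_eq_zero _ (by omega) (by omega), pc_eq_zero _ (by omega) (by omega)]

theorem qc_projP (X : Target k) (i : ℕ) : qc (projP X) i = 0 := by
  by_cases hi : i ≤ k - 1
  exacts [qc_mk _ _ hi, qc_eq_zero _ (by omega) (by omega)]

theorem analyticAt_projP {f : E → Target k} {a : E} (hf : Hol f a) : Hol (fun x => projP (f x)) a :=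
  analyticAt_mk (fun i _ => analyticAt_pc hf i) fun _ _ => analyticAt_const

theorem projP_zero : projP (0 : Target k) = 0 := by
  refine target_ext (fun i _ => ?_) fun i _ => ?_
  · rw [pc_projP]
  · rw [qc_projP, qc_zero]

theorem projP_eq_self (hk : 2 ≤ k) {X : Target k} (hX : qv X = 0) : projP X = X := by
  refine target_ext (fun i _ => pc_projP X i) fun i hi => ?_
  rw [qc_projP]
  exact (congrFun hX ⟨i, by omega⟩).symm

/-- A function with nonvanishing `V_{k-1}`-derivative is equivalent to the sum of `V_{k-1}` and its
restriction to `Q = 0`. -/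
theorem exists_mulQ_restrict (hk : 2 ≤ k) (hh : Hol h 0)
    (hg : Hol g 0) (hgp : POnly g) (hw : 𝒟 h 0 eQ[k] ≠ 0) (he : ∀ᶠ X in 𝓝 0, qv X = 0 → h X = g X) :
    ∃ ψ : Target k → Target k, IsBiholGerm ψ ∧ MapsSetGerm ψ (image k) (image k) ∧
      (∀ X i, pc (ψ X) i = pc X i) ∧ ∀ᶠ X in 𝓝 0, h X = qc (ψ X) (k - 1) + g (ψ X) := by
  let c : (Fin k → ℂ) × Target k → Target k := fun z => mk k (pc z.2) (extV z.1)
  have hc : Hol c (0, 0) := by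
    refine analyticAt_mk (fun i _ => analyticAt_pc analyticAt_snd i) fun i hi => ?_
    simp only [extV, dif_pos (by omega : i < k)]
    exact analyticAt_pi_iff.1 analyticAt_fst _
  have c0 : c (0, 0) = 0 := by
    refine target_ext (fun i hi => pc_mk _ _ hi) fun i hi => ?_
    simp only [c]
    rw [qc_mk _ _ hi, qc_zero, extV_of_lt _ (by omega)]
    rfl
  have hcq : ∀ X, c (qv X, X) = X := by
    intro X
    refine target_ext (fun i hi => pc_mk _ _ hi) fun i hi => ?_
    simp only [c]
    rw [qc_mk _ _ hi, extV_of_lt _ (by omega)]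
    rfl
  have hF : Hol (fun z => h (c z) - g (c z)) (0, 0) := by
    have h1 : Hol h (c (0, 0)) := by rw [c0]; exact hh
    have h2 : Hol g (c (0, 0)) := by rw [c0]; exact hg
    exact (h1.comp hc).sub (h2.comp hc)
  have t1 : Tendsto (fun X : Target k => c (0, X)) (𝓝 0) (𝓝 0) := by
    have h1 : ContinuousAt (fun X : Target k => c (0, X)) 0 :=
      ContinuousAt.comp (g := c) (f := fun X : Target k => ((0 : Fin k → ℂ), X)) hc.continuousAt
        (Continuous.prodMk_right _).continuousAt
    have h2 := h1.tendsto
    rwa [c0] at h2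
  obtain ⟨G, hG, hGe⟩ := exists_coordinate_coeff hF (by
    filter_upwards [t1.eventually he] with X hX
    refine sub_eq_zero.2 (hX ?_)
    funext i
    exact (qc_mk _ _ (by omega)).trans (extV_of_lt _ i.isLt))
  have hz : Hol (fun X : Target k => (qv X, X)) 0 := (analyticAt_pi_iff.2 analyticAt_qv).prod analyticAt_id
  have hz0 : (qv (0 : Target k), (0 : Target k)) = (0, 0) := by rw [qv_zero]
  have tz : Tendsto (fun X : Target k => (qv X, X)) (𝓝 0) (𝓝 (0, 0)) := by
    have := hz.continuousAt.tendsto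
    rwa [hz0] at this
  have hGz : Hol (fun X : Target k => G (qv X, X)) 0 := by
    refine AnalyticAt.comp (g := G) ?_ hz
    rw [hz0]; exact hG
  have hG' := analyticAt_pi_iff.1 hGz
  have hexp : ∀ᶠ X in 𝓝 (0 : Target k), h X - g X = ∑ l, qv X l * G (qv X, X) l := by
    filter_upwards [tz.eventually hGe] with X hX
    simpa only [hcq] using hX
  have hg0 : 𝒟 g 0 eQ[k] = 0 := by
    refine fderiv_apply_eq_of_hasDerivAt hg.differentiableAt ?_
    have : (fun t : ℂ => g (t • eQ[k])) = fun _ => g 0 := by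
      funext t
      refine hgp _ _ fun i => ?_
      rw [pc_smul, pc_bas_inr hk, mul_zero, pc_zero]
    rw [this]
    exact hasDerivAt_const _ _
  have hm0 : G (qv 0, 0) ⟨k - 1, by omega⟩ ≠ 0 := by
    have h1 := (hasDerivAt_comp_smul hh eQ[k]).sub
      (hasDerivAt_comp_smul hg eQ[k])
    rw [hg0, sub_zero] at h1
    have hcv : Hol (fun t : ℂ => t • eQ[k]) 0 := analyticAt_id.smul analyticAt_const
    have h2 := hasDerivAt_zero_of_eq_mul (f := fun t : ℂ =>
        h (t • eQ[k]) - g (t • eQ[k]))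
      (g := fun t : ℂ => G (qv (t • eQ[k]),
        t • eQ[k]) ⟨k - 1, by omega⟩)
      (analyticAt_comp_zero (hG' ⟨k - 1, by omega⟩) hcv (zero_smul _ _)).continuousAt (by
        filter_upwards [(tendsto_zero_of_analyticAt hcv (zero_smul _ _)).eventually hexp] with t ht
        rw [ht, sum_eq_single ⟨k - 1, by omega⟩]
        · simp [qv, qc_smul, qc_bas_inr hk]
        · intro i _ hi
          have : i.val ≠ k - 1 := fun h => hi (Fin.ext h)
          simp [qv, qc_smul, qc_bas_inr hk, this]
        · simp)
    have h3 := h1.unique h2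
    simp only [zero_smul] at h3
    rwa [← h3]
  obtain ⟨ψ, hψ, hψV, hψp, hψq⟩ := exists_mulQ hk hG' hm0
  refine ⟨ψ, hψ, hψV, hψp, ?_⟩
  filter_upwards [hexp, hψq] with X h1 h2
  rw [h2, hgp (ψ X) X (hψp X), ← sub_eq_iff_eq_add, h1]
  exact sum_congr rfl fun i _ => mul_comm _ _

theorem strongEquiv_add_restrict (hk : 2 ≤ k) (hh : Hol h 0)
    (hg : Hol g 0) (hgp : POnly g) (hw : 𝒟 h 0 eQ[k] ≠ 0) (he : ∀ᶠ X in 𝓝 0, qv X = 0 → h X = g X) :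
    StrongEquiv (image k) (fun X => ![h X]) (fun X => ![qc X (k - 1) + g X]) := by
  obtain ⟨ψ, hψ, hψV, -, hψe⟩ := exists_mulQ_restrict hk hh hg hgp hw he
  refine strongEquiv_one (lam := fun _ => 1) hψ hψV analyticAt_const one_ne_zero ?_
  filter_upwards [hψe] with X h1
  rw [h1, one_mul]

theorem fderiv_comp_inverse {ψ φ : E → E}
    (hψ : IsBiholGerm ψ) (hφ : IsBiholGerm φ) (hφ1 : ∀ᶠ x in 𝓝 0, φ (ψ x) = x) (w : E) :
    𝒟 φ 0 (𝒟 ψ 0 w) = w := by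
  have h1 : HasFDerivAt φ (𝒟 φ 0) (ψ 0) := by rw [hψ.2.1]; exact hφ.1.differentiableAt.hasFDerivAt
  have h2 := h1.comp 0 hψ.1.differentiableAt.hasFDerivAt
  have h3 : HasFDerivAt (φ ∘ ψ) (ContinuousLinearMap.id ℂ E) 0 :=
    (hasFDerivAt_id (0 : E)).congr_of_eventuallyEq hφ1
  have h4 := congrArg (fun L => L w) (h2.unique h3)
  simpa only [ContinuousLinearMap.comp_apply, id_apply] using h4

theorem fderiv_inv_mul_comp_ne_zero
    {h lam : E → ℂ} {ψ φ : E → E} (hh : Hol h 0) (h0 : h 0 = 0) {w : E}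
    (hw : 𝒟 h 0 w ≠ 0) (hψ : IsBiholGerm ψ) (hφ : IsBiholGerm φ)
    (hφ1 : ∀ᶠ x in 𝓝 0, φ (ψ x) = x) (hl : Hol lam 0) (l0 : lam 0 ≠ 0) {c : ℂ}
    (hψw : 𝒟 ψ 0 w = c • w) : 𝒟 (fun X => (lam (φ X))⁻¹ * h (φ X)) 0 w ≠ 0 := by
  have hlφ : Hol (fun X => (lam (φ X))⁻¹) 0 :=
    (analyticAt_comp_zero hl hφ.1 hφ.2.1).inv (by simpa only [hφ.2.1] using l0)
  have hhφ : Hol (fun X => h (φ X)) 0 := analyticAt_comp_zero hh hφ.1 hφ.2.1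
  have hcomp : 𝒟 φ 0 (c • w) = w := by
    rw [← hψw]
    exact fderiv_comp_inverse hψ hφ hφ1 w
  have hd : HasDerivAt (fun t : ℂ => (lam (φ (t • (c • w))))⁻¹ * h (φ (t • (c • w))))
      ((lam 0)⁻¹ * 𝒟 h 0 w) 0 := by
    have h1 : HasFDerivAt h (𝒟 h 0) (φ 0) := by rw [hφ.2.1]; exact hh.differentiableAt.hasFDerivAt
    have h2 : HasFDerivAt (fun X => h (φ X)) ((𝒟 h 0).comp (𝒟 φ 0)) 0 :=
      h1.comp 0 hφ.1.differentiableAt.hasFDerivAt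
    have h3 := hasDerivAt_comp_smul hhφ (c • w)
    rw [h2.fderiv, ContinuousLinearMap.comp_apply, hcomp] at h3
    have hcv : Hol (fun t : ℂ => t • (c • w)) 0 := analyticAt_id.smul analyticAt_const
    have h4 := hasDerivAt_mul_of_zero
      (analyticAt_comp_zero hlφ hcv (zero_smul _ _)).continuousAt
      (by simp only [zero_smul, hφ.2.1, h0]) h3
    simp only [zero_smul, hφ.2.1] at h4
    exact h4
  have h5 := fderiv_apply_eq_of_hasDerivAt (hlφ.mul hhφ).differentiableAt hd
  intro h6
  rw [map_smul] at h5
  have h7 : (lam 0)⁻¹ * 𝒟 h 0 w = 0 := by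
    rw [← h5]
    exact (congrArg (c • ·) h6).trans (smul_zero c)
  exact mul_ne_zero (inv_ne_zero l0) hw h7

/-- Reduction of the restriction to `Q = 0` by a transformation of the target. -/
theorem strongEquiv_add_of_restrict (hk : 2 ≤ k) {lam : Target k → ℂ} {ψ : Target k → Target k}
    (hh : Hol h 0) (h0 : h 0 = 0) (hg : Hol g 0) (hgp : POnly g) (hw : 𝒟 h 0 eQ[k] ≠ 0)
    (hψ : IsBiholGerm ψ) (hψV : MapsSetGerm ψ (image k) (image k))
    (hl : Hol lam 0) (l0 : lam 0 ≠ 0) {c : ℂ} (hψw : 𝒟 ψ 0 eQ[k] = c • eQ[k])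
    (hψq : ∀ᶠ X in 𝓝 0, qv (ψ X) = 0 → qv X = 0)
    (he : ∀ᶠ X in 𝓝 0, qv X = 0 → h X = lam X * g (ψ X)) :
    StrongEquiv (image k) (fun X => ![h X]) (fun X => ![qc X (k - 1) + g X]) := by
  obtain ⟨φ, hφ, hφ1, hφ2, -⟩ := hψ.exists_inverse
  have hlφ : Hol (fun X => (lam (φ X))⁻¹) 0 :=
    (analyticAt_comp_zero hl hφ.1 hφ.2.1).inv (by simpa only [hφ.2.1] using l0)
  have hhφ : Hol (fun X => h (φ X)) 0 := analyticAt_comp_zero hh hφ.1 hφ.2.1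
  let h₁ : Target k → ℂ := fun X => (lam (φ X))⁻¹ * h (φ X)
  have e1 : StrongEquiv (image k) (fun X => ![h X]) (fun X => ![h₁ X]) := by
    refine strongEquiv_one hψ hψV hl l0 ?_
    filter_upwards [hφ1, hl.continuousAt.eventually_ne l0] with X h1 h2
    simp only [h₁]
    rw [h1, mul_inv_cancel_left₀ h2]
  refine e1.trans (strongEquiv_add_restrict hk (hlφ.mul hhφ) hg hgp ?_ ?_)
  · exact fderiv_inv_mul_comp_ne_zero hh h0 hw hψ hφ hφ1 hl l0 hψw
  · filter_upwards [hφ2, hφ.tendsto.eventually hψq, hφ.tendsto.eventually he,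
      hφ.tendsto.eventually (hl.continuousAt.eventually_ne l0)] with X h1 h2 h3 h4 h5
    simp only [h1] at h2 h3
    simp only [h₁, h3 (h2 h5), inv_mul_cancel_left₀ h4]

theorem fderiv_move_last (hk : 2 ≤ k) {B τ : Target k → ℕ → ℂ}
    (hB : PiAnalyticAt B 0) (hτ : PiAnalyticAt τ 0)
    (hτ0 : τ 0 0 ≠ 0) : ∃ c : ℂ, 𝒟 (fun X => move (B X) (τ X) X) 0 eQ[k] = c • eQ[k] := by
  have h1 := fderiv_apply_eq_of_hasDerivAt
    (analyticAt_move hB hτ analyticAt_id hk).differentiableAt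
    (hasDerivAt_move hk hB hτ hτ0 eQ[k])
  have hp : pv eQ[k] = 0 := by
    funext j
    exact pc_bas_inr hk _ _
  have hq : ∀ j : Fin k, j.val < k - 1 → qv eQ[k] j = 0 := by
    intro j hj
    refine (qc_bas_inr hk _ _).trans (if_neg ?_)
    simp only
    omega
  have hadj : ∀ j : Fin k, j.val < k - 1 →
      (adjugate (Mmat (τ 0) (0 : Fin k → ℂ)) *ᵥ qv eQ[k]) j = 0 := by
    refine (lower_Mmat_zero (k := k) (τ 0)).eq_zero_of_mulVec (fun i => ?_) (k - 1) fun i hi => ?_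
    · rw [Mmat_zero_diag]; exact pow_ne_zero _ hτ0
    · rw [mulVec_mulVec, mul_adjugate, smul_mulVec, one_mulVec, Pi.smul_apply, hq i hi, smul_zero]
  refine ⟨_, h1.trans (target_ext (Y := (adjugate (Mmat (τ 0) (0 : Fin k → ℂ)) *ᵥ qv eQ[k])
      ⟨k - 1, by omega⟩ • eQ[k])
    (fun i hi => ?_) fun i hi => ?_)⟩
  · rw [moveLin, pc_mk _ _ hi, pc_smul, pc_bas_inr hk, mul_zero, extV_of_lt _ (by omega), hp]
    refine linP_eq_zero hτ0 (k - 1) (fun j hj => ?_) _ (by simp only; omega)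
    rw [zero_add]
    exact (lower_matEval (k := k) _).mulVec_eq_zero (k - 1) hq j hj
  · rw [moveLin, qc_mk _ _ hi, qc_smul, qc_bas_inr hk, extV_of_lt _ (by omega)]
    by_cases h : i = k - 1
    · subst h
      simp
    · simp only [if_neg h, mul_zero]
      exact hadj _ (by simp only; omega)

theorem qv_move_eq_zero {B τ : Target k → ℕ → ℂ} (hB : PiAnalyticAt B 0) (hτ : PiAnalyticAt τ 0)
    (hτ0 : τ 0 0 ≠ 0) : ∀ᶠ X in 𝓝 0, qv (move (B X) (τ X) X) = 0 → qv X = 0 := by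
  have hM : MatAnalyticAt (fun X : Target k => Mmat (τ X) (addP (B X) (pv X) (qv X))) 0 :=
    MatAnalyticAt.Mmat hτ (analyticAt_addP hB analyticAt_pv analyticAt_qv)
  have h0 : (Mmat (τ 0) (addP (B 0) (pv (0 : Target k)) (qv 0))).det ≠ 0 := by
    rw [pv_zero, qv_zero, addP_zero]
    exact det_Mmat_zero hτ0
  filter_upwards [hM.det.continuousAt.eventually_ne h0] with X hX h1
  rw [qv_move, newQ] at h1
  have h2 := congrArg (fun v => Mmat (τ X) (addP (B X) (pv X) (qv X)) *ᵥ v) h1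
  simp only [mulVec_mulVec, mul_adjugate, smul_mulVec, one_mulVec, mulVec_zero] at h2
  exact (smul_eq_zero.1 h2).resolve_left hX

theorem qv_move_of_eq_zero (B τ : ℕ → ℂ) {X : Target k} (hX : qv X = 0) : qv (move B τ X) = 0 := by
  rw [qv_move, newQ, hX, mulVec_zero]

end Reduction

/-- The points of the target with `Q = 0`. -/
def ofP (k : ℕ) : (Fin (k - 1) → ℂ) →L[ℂ] Target k :=
  (ofPQ k).comp (ContinuousLinearMap.pi (Sum.rec (fun i => prj i) fun _ => 0))

/-- The coefficients of `P`. -/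
def toP (k : ℕ) : Target k →L[ℂ] (Fin (k - 1) → ℂ) := ContinuousLinearMap.pi fun i => pcL k i.val

theorem pc_ofP (hk : 2 ≤ k) (x : Fin (k - 1) → ℂ) (i : Fin (k - 1)) : pc (ofP k x) i.val = x i := by
  rw [ofP, ContinuousLinearMap.comp_apply, pc_ofPQ hk, sP_inl]
  rfl

theorem qc_ofP (hk : 2 ≤ k) (x : Fin (k - 1) → ℂ) (i : ℕ) : qc (ofP k x) i = 0 := by
  rw [ofP, ContinuousLinearMap.comp_apply, qc_ofPQ hk, sQ]
  split_ifs <;> rfl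

theorem ofP_single (l : Fin (k - 1)) (t : ℂ) : ofP k (Pi.single l t) = t • bas k (.inl l) := by
  rw [← ofPQ_single, ofP, ContinuousLinearMap.comp_apply]
  congr 1
  funext i
  rcases i with i | i
  · simp [Pi.single_apply]
  · simp

theorem ofP_toP (hk : 2 ≤ k) {X : Target k} (hX : qv X = 0) : ofP k (toP k X) = X := by
  refine target_ext (fun i hi => ?_) fun i hi => ?_
  · exact pc_ofP hk (toP k X) ⟨i, by omega⟩
  · rw [qc_ofP hk]
    exact (congrFun hX ⟨i, by omega⟩).symm

theorem strongEquiv_of_solve (hk : 2 ≤ k) (hh : Hol h 0) (h0 : h 0 = 0)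
    (hw : 𝒟 h 0 eQ[k] ≠ 0) {T : (Fin (k - 1) → ℂ) → ℕ → ℂ} {lam κ : (Fin (k - 1) → ℂ) → ℂ}
    (hT : PiAnalyticAt T 0) (hT0 : T 0 0 ≠ 0) (hl : Hol lam 0)
    (l0 : lam 0 ≠ 0) (hκ : Hol κ 0) (a b : ℕ)
    (he : ∀ᶠ x in 𝓝 0, h (ofP k x) = lam x * (pc (move 0 (T x) (ofP k x)) a +
      κ x * pc (move 0 (T x) (ofP k x)) b ^ 2)) :
    ∃ κ' : Target k → ℂ, Hol κ' 0 ∧ POnly κ' ∧ κ' 0 = κ 0 ∧ (κ = 0 → κ' = 0) ∧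
      StrongEquiv (image k) (fun X => ![h X])
        (fun X => ![qc X (k - 1) + (pc X a + κ' X * pc X b ^ 2)]) := by
  have tP : Tendsto (toP k) (𝓝 0) (𝓝 0) := (toP k).continuous.tendsto' _ _ (map_zero _)
  have aP : ∀ {f : (Fin (k - 1) → ℂ) → ℂ}, Hol f 0 → Hol (fun X => f (toP k X)) 0 :=
    fun hf => analyticAt_comp_zero hf ((toP k).analyticAt _) (map_zero _)
  have hT' : ∀ m, Hol (fun X => T (toP k X) m) 0 := fun m => aP (hT m)
  have hT0' : T (toP k 0) 0 ≠ 0 := by rwa [map_zero]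
  have hB' : ∀ m, Hol (fun _ : Target k => (0 : ℕ → ℂ) m) 0 := fun m => analyticAt_const
  have hψ := isBiholGerm_move (B := fun _ => 0) (τ := fun X => T (toP k X)) hk hB' hT' hT0'
  have hψV := mapsSetGerm_move (B := fun _ => 0) (τ := fun X => T (toP k X)) hk hB' hT' hT0'
  obtain ⟨c, hc⟩ := fderiv_move_last (B := fun _ => 0) (τ := fun X => T (toP k X)) hk hB' hT' hT0'
  obtain ⟨φ, hφ, hφ1, hφ2, -⟩ := hψ.exists_inverse
  have hφP : Hol (fun X => φ (projP X)) 0 :=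
    analyticAt_comp_zero hφ.1 (analyticAt_projP analyticAt_id) projP_zero
  have hφP0 : φ (projP 0) = 0 := by rw [projP_zero, hφ.2.1]
  have hκ' : Hol (fun X => κ (toP k (φ (projP X)))) 0 :=
    analyticAt_comp_zero (g := fun X => κ (toP k X)) (aP hκ) hφP hφP0
  have hκp : POnly (fun X => κ (toP k (φ (projP X)))) := by
    intro X Y hXY
    have : projP X = projP Y := by
      refine target_ext (fun i _ => ?_) fun i _ => ?_
      · rw [pc_projP, pc_projP, hXY]
      · rw [qc_projP, qc_projP]
    simp only [this]
  refine ⟨fun X => κ (toP k (φ (projP X))), hκ', hκp, ?_, ?_, ?_⟩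
  · simp only [hφP0, map_zero]
  · rintro rfl
    rfl
  · refine strongEquiv_add_of_restrict (c := c) hk hh h0
      ((hol_pc a).add (hκ'.mul ((hol_pc b).pow 2)))
      (fun X Y hXY => ?_) hw hψ hψV (aP hl) (by rwa [map_zero]) hc
      (qv_move_eq_zero (B := fun _ => 0) (τ := fun X => T (toP k X)) hB' hT' hT0') ?_
    · simp only [hXY, hκp X Y hXY]
    · filter_upwards [tP.eventually he, hφ1] with X h1 h2 h3
      have h4 := projP_eq_self hk (qv_move_of_eq_zero 0 (T (toP k X)) h3)
      rw [ofP_toP hk h3] at h1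
      simp only [h4, h2, h1]

/-- The change of variable encoded by a parameter. -/
def parR (s : Fin (k - 1) → ℂ) (m : ℕ) : ℂ :=
  if m = 0 then 1 else if h : m ≤ k - 3 ∧ k - 3 - m < k - 1 then s ⟨k - 3 - m, h.2⟩ else 0

theorem analyticAt_parR {f : E → Fin (k - 1) → ℂ} {a : E}
    (hf : Hol f a) (m : ℕ) : Hol (fun x => parR (f x) m) a := by
  simp only [parR]
  split_ifs
  exacts [analyticAt_const, analyticAt_pi_iff.1 hf _, analyticAt_const]

theorem parR_zero (s : Fin (k - 1) → ℂ) : parR s 0 = 1 := if_pos rfl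

/-- The base parameter. -/
def baseR (k : ℕ) (c : ℂ) : Fin (k - 1) → ℂ := fun i =>
  if i.val = k - 3 then 1 else if i.val = k - 2 then c else 0

theorem parR_baseR (hk : 4 ≤ k) (c : ℂ) (m : ℕ) : parR (baseR k c) m = if m = 0 then 1 else 0 := by
  simp only [parR, baseR]
  by_cases h0 : m = 0
  · simp [h0]
  · rw [if_neg h0, if_neg h0]
    split_ifs <;> first | rfl | omega

/-- The first order coefficients of `U_{k-3}` after a transformation. -/
def botLin (hk : 4 ≤ k) (s : Fin (k - 1) → ℂ) (l : Fin (k - 1)) : ℂ :=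
  linP 0 (parR s) (pv (bas k (.inl l))) 0 ⟨k - 3, by omega⟩

theorem qv_bas_inl (hk : 2 ≤ k) (l : Fin (k - 1)) : qv (bas k (.inl l)) = 0 := by
  funext j
  exact qc_bas_inl hk _ _

theorem hasDerivAt_pc_move_inl (hk : 2 ≤ k) {τ : ℕ → ℂ} (hτ : τ 0 ≠ 0) (l : Fin (k - 1)) {i : ℕ}
    (hi : i ≤ k - 2) : HasDerivAt (fun t => pc (move 0 τ (ofP k (Pi.single l t))) i)
      (linP 0 τ (pv (bas k (.inl l))) 0 ⟨i, by omega⟩) 0 := by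
  simp only [ofP_single]
  have h := (pcL k i).hasFDerivAt.comp_hasDerivAt 0
    (hasDerivAt_move_smul hk (B := 0) (τ := τ) hτ (bas k (.inl l)))
  refine h.congr_deriv ?_
  rw [pcL_apply, moveLin, pc_mk _ _ hi, extV_of_lt _ (by omega), qv_bas_inl hk]

theorem linP_inl_of_lt (hk : 2 ≤ k) {τ : ℕ → ℂ} (hτ : τ 0 ≠ 0) (l : Fin (k - 1)) (i : Fin k)
    (hi : i.val < l.val) : linP 0 τ (pv (bas k (.inl l))) 0 i = 0 := by
  refine linP_eq_zero hτ l.val (fun j hj => ?_) i hi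
  rw [Matrix.mulVec_zero, add_zero]
  refine (pc_bas_inl hk _ _).trans (if_neg (by omega))

theorem botLin_baseR (hk : 4 ≤ k) (c : ℂ) (l : Fin (k - 1)) :
    botLin hk (baseR k c) l = if l.val = k - 3 then 1 else 0 := by
  rw [botLin, linP_of_one (B := 0) (by omega) (fun m _ => rfl) (fun m _ => parR_baseR hk c m), pv,
    pc_bas_inl (by omega)]
  simp [eq_comm]

theorem hasDerivAt_botLin (hk : 4 ≤ k) (c : ℂ) (δ : Fin (k - 1) → ℂ) (l : Fin (k - 1)) :
    HasDerivAt (fun ε : ℂ => botLin hk (baseR k c + ε • δ) l)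
      (if l.val < k - 3 then ((k : ℂ) - l.val) * δ l else 0) 0 := by
  have hl : Hol (fun ε : ℂ => baseR k c + ε • δ) 0 :=
    analyticAt_const.add (analyticAt_id.smul analyticAt_const)
  have hT : ∀ m, m < k → HasDerivAt (fun ε : ℂ => parR (baseR k c + ε • δ) m)
      (if m = 0 then 0 else parR δ m) 0 := by
    intro m _
    simp only [parR]
    split_ifs
    · exact hasDerivAt_const _ _
    · exact hasDerivAt_affine _ _
    · exact hasDerivAt_const _ _
  have h := hasDerivAt_linP (B := fun _ => 0) (B' := 0) (by omega) (fun m => analyticAt_const)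
    (fun m => analyticAt_parR hl m) (fun m _ => hasDerivAt_const _ _) hT
    (fun m _ => rfl) (fun m _ => by simpa using parR_baseR hk c m)
    (pv (bas k (.inl l))) 0 ⟨k - 3, by omega⟩
  refine h.congr_deriv ?_
  rw [sum_eq_single ⟨l.val, by omega⟩]
  · simp only [pv, pc_bas_inl (by omega : 2 ≤ k), if_true, mul_one, Pi.zero_apply, mul_zero, add_zero]
    by_cases hl3 : l.val < k - 3
    · rw [if_pos (by omega), if_neg (by omega), if_pos hl3, parR, if_neg (by omega),
        dif_pos ⟨by omega, by omega⟩]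
      congr 2
      exact Fin.ext (by simp only; omega)
    · rw [if_neg hl3]
      by_cases h2 : l.val = k - 3
      · simp [h2]
      · rw [if_neg (by omega)]
  · intro i _ hi
    have : i.val ≠ l.val := fun h => hi (Fin.ext h)
    simp [pv, pc_bas_inl (by omega : 2 ≤ k), this]
  · simp

theorem exists_nf_two_near (hk : 4 ≤ k) (c : ℂ) : ∃ N ∈ 𝓝 (baseR k c), ∀ h : Target k → ℂ,
    Hol h 0 → h 0 = 0 → 𝒟 h 0 eQ[k] ≠ 0 → 𝒟 h 0 eP[k] = 0 →
    ∀ j : Fin (k - 1) → ℂ, (∀ l, l ≠ ⟨k - 2, by omega⟩ → 𝒟 h 0 (bas k (.inl l)) = j l) →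
    Tendsto (fun t : ℂ => h (t • eP[k]) / t ^ 2) (𝓝[≠] 0) (𝓝 (j ⟨k - 2, by omega⟩)) → j ∈ N →
    ∃ κ : Target k → ℂ, Hol κ 0 ∧ POnly κ ∧ (j = baseR k c → κ 0 = c) ∧
      StrongEquiv (image k) (fun X => ![h X])
        (fun X => ![qc X (k - 1) + (pc X (k - 3) + κ X * pc X (k - 2) ^ 2)]) := by
  have hk2 : 2 ≤ k := by omega
  let w : Fin (k - 1) := ⟨k - 2, by omega⟩
  let b : Fin (k - 1) := ⟨k - 3, by omega⟩
  let mv : (Fin (k - 1) → ℂ) × (Fin (k - 1) → ℂ) → Target k := fun z =>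
    move 0 (parR z.2) (ofP k z.1)
  let F : (Fin (k - 1) → ℂ) × (Fin (k - 1) → ℂ) → ℂ := fun z =>
    z.2 b * (pc (mv z) (k - 3) + z.2 w * pc (mv z) (k - 2) ^ 2)
  have hs : ∀ l z, Hol (fun z : (Fin (k - 1) → ℂ) × (Fin (k - 1) → ℂ) => z.2 l) z :=
    fun l _ => analyticAt_pi_iff.1 analyticAt_snd l
  have hmv : ∀ z, Hol mv z := fun z =>
    analyticAt_move (B := fun _ => 0) (fun _ => analyticAt_const) (analyticAt_parR analyticAt_snd)
      (((ofP k).analyticAt _).comp analyticAt_fst) hk2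
  have hmv0 : ∀ s, mv (0, s) = 0 := fun s => by
    simp only [mv, map_zero]
    exact move_zero hk2 _ (by rw [parR_zero]; simp)
  have hF : Hol F (0, baseR k c) :=
    (hs b _).mul ((analyticAt_pc (hmv _) _).add ((hs w _).mul ((analyticAt_pc (hmv _) _).pow 2)))
  have hF0 : ∀ s, F (0, s) = 0 := by
    intro s
    simp only [F, hmv0, pc_zero]
    ring
  have hderiv : ∀ s l, HasDerivAt (fun t => F (Pi.single l t, s)) (s b * botLin hk s l) 0 := by
    intro s l
    have hτ : parR s 0 ≠ 0 := by rw [parR_zero]; simp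
    have h1 := hasDerivAt_pc_move_inl hk2 hτ l (i := k - 3) (by omega)
    have h2 := hasDerivAt_pc_move_inl hk2 hτ l (i := k - 2) le_rfl
    have h3 := ((h1.add ((h2.pow 2).const_mul (s w))).const_mul (s b))
    refine h3.congr_deriv ?_
    have : pc (move 0 (parR s) (ofP k (Pi.single l 0))) (k - 2) = 0 := by
      have := hmv0 s
      simp only [mv] at this
      rw [Pi.single_zero, this, pc_zero]
    rw [this, botLin]
    ring
  have hlast : ∀ s, botLin hk s w = 0 := fun s =>
    linP_inl_of_lt hk2 (by rw [parR_zero]; simp) _ _ (by simp only [w]; omega)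
  have hbw : ∀ ε : ℂ, baseR k c + ε • Pi.single w 1 = baseR k (c + ε) := by
    intro ε
    funext i
    by_cases hi : i = w
    · subst hi
      have : k - 2 ≠ k - 3 := by omega
      simp [baseR, w, this]
    · have : i.val ≠ k - 2 := fun h => hi (Fin.ext h)
      simp [baseR, hi, this]
  have hba : ∀ c, baseR k c b = 1 := fun c => by simp [baseR, b]
  have hbv : ∀ c, baseR k c w = c := fun c => by
    have : k - 2 ≠ k - 3 := by omega
    simp [baseR, w, this]
  obtain ⟨N, hN, key⟩ := exists_solve_sq w (F := F) (s₀ := baseR k c) hF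
    (.of_forall hF0) (.of_forall fun s => by
      have := hderiv s w
      rwa [hlast, mul_zero] at this)
    (J := fun s l => s b * botLin hk s l) (.of_forall fun s l _ => hderiv s l)
    (Pi.single w 1) (fun δ hδ => by
      have hvar : ∀ l, HasDerivAt (fun ε : ℂ => (baseR k c + ε • δ) b *
          botLin hk (baseR k c + ε • δ) l) _ 0 := fun l => by
        exact (hasDerivAt_affine _ _).mul (hasDerivAt_botLin hk c δ l)
      refine ⟨δ w, ?_⟩
      funext l
      rcases eq_or_ne l w with rfl | hl
      · simp
      · have h1 := (hvar l).unique (hδ l hl)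
        simp only [zero_smul, add_zero, botLin_baseR, hba] at h1
        by_cases hi : l.val = k - 3
        · have : l = b := Fin.ext hi
          simp [hi] at h1
          rw [this] at hl ⊢
          simp [hl, h1]
        · have h2 : l.val < k - 3 := by
            have : l.val ≠ k - 2 := fun h => hl (Fin.ext h)
            omega
          have h3 : (k : ℂ) - l.val ≠ 0 := by
            rw [sub_ne_zero]
            exact_mod_cast (by omega : k ≠ l.val)
          simp [hi, h2, h3] at h1
          simp [hl, h1])
    (j₀ := c) (c₁ := 1) one_ne_zero
    (.of_forall fun ε => by
      refine (tendsto_const_nhds (x := c + ε * 1)).congr' ?_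
      filter_upwards [self_mem_nhdsWithin] with t ht
      have ht : t ≠ 0 := ht
      rw [hbw]
      simp only [F, mv, hba, hbv]
      have h1 : k - 3 ≠ k - 2 := by omega
      rw [move_eq_self (B := 0) hk2 (fun m _ => rfl) (fun m _ => parR_baseR hk (c + ε) m), ofP_single, pc_smul,
        pc_smul, pc_bas_inl hk2, pc_bas_inl hk2]
      simp [w, h1]
      field_simp)
    (O := {s | s b ≠ 0}) ((continuous_apply b).continuousAt.eventually_ne (by rw [hba]; simp))
  have hbase : Function.update (fun l => baseR k c b * botLin hk (baseR k c) l) w c = baseR k c := by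
    funext l
    rcases eq_or_ne l w with rfl | hl
    · simp [hbv]
    · rw [Function.update_of_ne hl, hba, one_mul, botLin_baseR]
      have : l.val ≠ k - 2 := fun h => hl (Fin.ext h)
      simp [baseR, this]
  rw [hbase] at hN key
  refine ⟨N, hN, fun h hh h0 hw hb j hj hjw hjN => ?_⟩
  have hd : ∀ l, HasDerivAt (fun t => h (ofP k (Pi.single l t)))
      (𝒟 h 0 (bas k (.inl l))) 0 := by
    intro l
    simp only [ofP_single]
    exact hasDerivAt_comp_smul hh _
  obtain ⟨s, hsa, hsO, hs0, hse⟩ := key (fun Y => h (ofP k Y))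
    (analyticAt_comp_zero hh ((ofP k).analyticAt _) (map_zero _)) (by rw [map_zero, h0])
    (by have := hd w; rwa [show 𝒟 h 0 (bas k (.inl w)) = 0 from hb] at this)
    j (fun l hl => by rw [← hj l hl]; exact hd l)
    (by simp only [ofP_single]; exact hjw) hjN
  obtain ⟨κ, h1, h2, h3, -, h4⟩ := strongEquiv_of_solve hk2 hh h0 hw
    (T := fun x => parR (s x)) (lam := fun x => s x b) (κ := fun x => s x w)
    (analyticAt_parR hsa) (by rw [parR_zero]; simp) (analyticAt_pi_iff.1 hsa b) hsO
    (analyticAt_pi_iff.1 hsa w) (k - 3) (k - 2) (by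
      filter_upwards [hse] with x hx
      exact hx.symm)
  refine ⟨κ, h1, h2, fun hjb => ?_, h4⟩
  rw [h3, hs0 hjb, hbv]

/-- Scaling brings a function close to the base. -/
theorem exists_scaled_near (hk : 3 ≤ k) {N : Set (Fin (k - 1) → ℂ)} (hN : N ∈ 𝓝 (baseR k 0))
    (hh : Hol h 0) (h0 : h 0 = 0) (hw : 𝒟 h 0 eQ[k] ≠ 0) (ha : 𝒟 h 0 eP[k] = 0)
    (hb : 𝒟 h 0 (bas k (.inl ⟨k - 3, by omega⟩)) ≠ 0) : ∃ h' : Target k → ℂ, Hol h' 0 ∧ h' 0 = 0 ∧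
      𝒟 h' 0 eQ[k] ≠ 0 ∧ 𝒟 h' 0 eP[k] = 0 ∧
      StrongEquiv (image k) (fun X => ![h X]) (fun X => ![h' X]) ∧ ∃ j ∈ N,
      (∀ l, l ≠ ⟨k - 2, by omega⟩ → 𝒟 h' 0 (bas k (.inl l)) = j l) ∧
      Tendsto (fun t : ℂ => h' (t • eP[k]) / t ^ 2) (𝓝[≠] 0) (𝓝 (j ⟨k - 2, by omega⟩)) := by
  have hk2 : 2 ≤ k := by omega
  set al := 𝒟 h 0 (bas k (.inl ⟨k - 3, by omega⟩)) with hal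
  have hdw := hasDerivAt_comp_smul hh eP[k]
  rw [ha] at hdw
  obtain ⟨c2, hc2⟩ := exists_tendsto_div_sq
    (f := fun t : ℂ => h (t • eP[k]))
    (analyticAt_comp_zero hh (analyticAt_id.smul analyticAt_const) (by simp)) (by simp [h0]) hdw
  let j : ℂ → Fin (k - 1) → ℂ := fun ε i => if i.val = k - 2 then ε * c2 / al else
    ε ^ (k - 3 - i.val) * 𝒟 h 0 (bas k (.inl i)) / al
  have hj : Tendsto j (𝓝[≠] 0) (𝓝 (baseR k 0)) := by
    have hcont : Continuous j := by
      refine continuous_pi fun l => ?_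
      simp only [j]
      split_ifs <;> fun_prop
    refine (hcont.tendsto' 0 _ ?_).mono_left nhdsWithin_le_nhds
    funext i
    by_cases hi : i.val = k - 2
    · have : k - 2 ≠ k - 3 := by omega
      simp [j, baseR, hi, this]
    · by_cases h3 : i.val = k - 3
      · have : i = ⟨k - 3, by omega⟩ := Fin.ext h3
        simp only [j, baseR, if_neg hi, h3, if_true]
        rw [this, ← hal]
        simp [hb]
      · have : k - 3 - i.val ≠ 0 := by omega
        simp [j, baseR, hi, h3, this]
  obtain ⟨ε, hεN, hε⟩ := ((hj.eventually hN).and self_mem_nhdsWithin).exists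
  have hε : ε ≠ 0 := hε
  have hs : IsBiholGerm (fun X : Target k => scale ε 1 X) :=
    isBiholGerm_scale analyticAt_const analyticAt_const hε one_ne_zero
  have hsV : MapsSetGerm (fun X : Target k => scale ε 1 X) (image k) (image k) :=
    mapsSetGerm_scale hk2 analyticAt_const analyticAt_const hε one_ne_zero
  let c : ℂ := 1 / (ε ^ 3 * al)
  have hc : c ≠ 0 := one_div_ne_zero (mul_ne_zero (pow_ne_zero 3 hε) hb)
  refine ⟨fun X => c * h (scale ε 1 X), analyticAt_const.mul (analyticAt_comp_zero hh hs.1 hs.2.1),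
    by have := hs.2.1; simp only at this ⊢; rw [this, h0, mul_zero], ?_, ?_,
    (strongEquiv_one hs hsV analyticAt_const hc (.of_forall fun X => rfl)).symm,
    j ε, hεN, fun l hl => ?_, ?_⟩
  · rw [fderiv_comp_scale hk2 hh hε one_ne_zero]
    refine mul_ne_zero hc (mul_ne_zero ?_ hw)
    simp [wt]
  · rw [fderiv_comp_scale hk2 hh hε one_ne_zero, ha]
    ring
  · rw [fderiv_comp_scale hk2 hh hε one_ne_zero]
    have hl : l.val ≠ k - 2 := fun h => hl (Fin.ext h)
    simp only [wt, j, Sum.elim_inl, c, if_neg hl]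
    have : k - l.val = (k - 3 - l.val) + 3 := by omega
    rw [this, pow_add]
    field_simp
  · simp only [scale_smul_bas hk2]
    have h1 := (tendsto_comp_mul_div_sq (b := wt ε 1 (Sum.inl (⟨k - 2, by omega⟩ : Fin (k - 1)))) (by
      simp [wt, hε]) hc2).const_mul c
    have e1 : j ε ⟨k - 2, by omega⟩ = c * (wt ε 1 (Sum.inl (⟨k - 2, by omega⟩ : Fin (k - 1))) ^ 2 * c2) := by
      simp only [j, wt, c, Sum.elim_inl, if_true]
      rw [show k - (k - 2) = 2 by omega]
      field_simp
    rw [e1]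
    refine h1.congr fun t => ?_
    ring

theorem exists_nf_two (hk : 4 ≤ k) (hh : Hol h 0) (h0 : h 0 = 0)
    (hw : 𝒟 h 0 eQ[k] ≠ 0) (ha : 𝒟 h 0 eP[k] = 0)
    (hb : 𝒟 h 0 (bas k (.inl ⟨k - 3, by omega⟩)) ≠ 0) : ∃ κ : Target k → ℂ, Hol κ 0 ∧ POnly κ ∧
      StrongEquiv (image k) (fun X => ![h X])
        (fun X => ![qc X (k - 1) + (pc X (k - 3) + κ X * pc X (k - 2) ^ 2)]) := by
  obtain ⟨N, hN, key⟩ := exists_nf_two_near hk 0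
  obtain ⟨h', h1, h2, h3, h4, h5, j, hj, h6, h7⟩ := exists_scaled_near (by omega) hN hh h0 hw ha hb
  obtain ⟨κ, h8, h9, -, h10⟩ := key h' h1 h2 h3 h4 j h6 h7 hj
  exact ⟨κ, h8, h9, h5.trans h10⟩

theorem fderiv_qc_add (hk : 2 ≤ k) (hg : Hol g 0) (hgp : POnly g) :
    𝒟 (fun X => qc X (k - 1) + g X) 0 eQ[k] = 1 := by
  refine fderiv_apply_eq_of_hasDerivAt
    ((hol_qc _).add hg).differentiableAt ?_
  have : (fun t : ℂ => qc (t • eQ[k]) (k - 1) +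
      g (t • eQ[k])) = fun t => t + g 0 := by
    funext t
    rw [qc_smul, qc_bas_inr hk, hgp _ 0 fun i => ?_]
    · simp
    · rw [pc_smul, pc_bas_inr hk, mul_zero, pc_zero]
  change HasDerivAt (fun t : ℂ => qc (t • eQ[k]) (k - 1) + g (t • eQ[k])) 1 0
  rw [this]
  exact (hasDerivAt_id 0).add_const _

theorem nf_two_normalize (hk : 4 ≤ k) (hκ : Hol κ 0) (κ0 : κ 0 ≠ 0) (hκp : POnly κ) :
    StrongEquiv (image k) (fun X => ![qc X (k - 1) + (pc X (k - 3) + κ X * pc X (k - 2) ^ 2)])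
      (fun X => ![qc X (k - 1) + (pc X (k - 3) + pc X (k - 2) ^ 2)]) := by
  have hk2 : 2 ≤ k := by omega
  have hgp : POnly (fun X : Target k => pc X (k - 3) + κ X * pc X (k - 2) ^ 2) := fun X Y hXY => by
    simp only [hXY, hκp X Y hXY]
  have hga : Hol (fun X : Target k => pc X (k - 3) + κ X * pc X (k - 2) ^ 2) 0 :=
    (hol_pc (k - 3)).add (hκ.mul ((hol_pc (k - 2)).pow 2))
  refine strongEquiv_add_of_restrict (c := 1) hk2 (ψ := fun X => scale (κ X) 1 X)
    (lam := fun X => (κ X ^ 3)⁻¹)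
    ((hol_qc _).add hga)
    (by simp [pc_zero, qc_zero]) ((hol_pc (k - 3)).add ((hol_pc (k - 2)).pow 2))
    (fun X Y hXY => by simp only [hXY]) ?_
    (isBiholGerm_scale hκ analyticAt_const κ0 one_ne_zero)
    (mapsSetGerm_scale hk2 hκ analyticAt_const κ0 one_ne_zero)
    ((hκ.pow 3).inv (pow_ne_zero 3 κ0)) (inv_ne_zero (pow_ne_zero 3 κ0)) ?_ ?_ ?_
  · have := fderiv_qc_add hk2 hga hgp
    rw [this]
    exact one_ne_zero
  · refine fderiv_apply_eq_of_hasDerivAt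
      (isBiholGerm_scale hκ analyticAt_const κ0 one_ne_zero).1.differentiableAt ?_
    simp only [scale_smul_bas hk2]
    simp only [wt, Sum.elim_inr, Nat.sub_self, pow_zero, one_mul]
    exact (hasDerivAt_id (0 : ℂ)).smul_const _
  · filter_upwards [hκ.continuousAt.eventually_ne κ0] with X hX h1
    funext i
    have h2 := congrFun h1 i
    simp only [qv] at h2 ⊢
    rw [qc_scale _ _ _ (by omega), one_mul] at h2
    exact (mul_eq_zero.1 h2).resolve_left (pow_ne_zero _ hX)
  · filter_upwards [hκ.continuousAt.eventually_ne κ0] with X hX h1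
    have h2 : qc X (k - 1) = 0 := congrFun h1 ⟨k - 1, by omega⟩
    rw [h2, pc_scale _ _ _ (by omega), pc_scale _ _ _ le_rfl, show k - (k - 3) = 3 by omega,
      show k - (k - 2) = 2 by omega]
    field_simp
    ring

/-- The case `k = 2`. -/
theorem exists_nf_two_of_eq_two {h : Target 2 → ℂ} (hh : Hol h 0) (h0 : h 0 = 0)
    (hw : 𝒟 h 0 (bas 2 (.inr 1)) ≠ 0) (ha : 𝒟 h 0 (bas 2 (.inl 0)) = 0) :
    ∃ κ : Target 2 → ℂ, Hol κ 0 ∧ POnly κ ∧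
      Tendsto (fun t : ℂ => h (t • bas 2 (.inl 0)) / t ^ 2) (𝓝[≠] 0) (𝓝 (κ 0)) ∧
      StrongEquiv (image 2) (fun X => ![h X]) (fun X => ![qc X 1 + κ X * pc X 0 ^ 2]) := by
  have hd : HasDerivAt (fun t : ℂ => h (ofP 2 (Pi.single 0 t))) 0 0 := by
    simp only [ofP_single]
    have := hasDerivAt_comp_smul hh (bas 2 (.inl 0))
    rwa [ha] at this
  obtain ⟨G, hG, hGe⟩ := exists_sq_coeff (S := ℂ) (s₀ := 0) (0 : Fin (2 - 1))
    (F := fun z : (Fin (2 - 1) → ℂ) × ℂ => h (ofP 2 z.1))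
    (AnalyticAt.comp (g := h) (f := fun z : (Fin (2 - 1) → ℂ) × ℂ => ofP 2 z.1)
      (by simpa using hh) (((ofP 2).analyticAt _).comp analyticAt_fst))
    (.of_forall fun s => by simpa using h0) (.of_forall fun s => hd)
  let κ : Target 2 → ℂ := fun X => G (toP 2 X, 0) 0
  have hz : Hol (fun X : Target 2 => (toP 2 X, (0 : ℂ))) 0 :=
    ((toP 2).analyticAt _).prod analyticAt_const
  have hz0 : (toP 2 (0 : Target 2), (0 : ℂ)) = (0, 0) := by rw [map_zero]
  have hκ : Hol κ 0 := by
    refine analyticAt_pi_iff.1 (AnalyticAt.comp (g := G) ?_ hz) 0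
    rw [hz0]; exact hG
  have hκp : POnly κ := by
    intro X Y hXY
    have : toP 2 X = toP 2 Y := funext fun i => hXY i.val
    simp only [κ, this]
  refine ⟨κ, hκ, hκp, ?_, ?_⟩
  · have := tendsto_single_of_sq_coeff hG.continuousAt hGe
    simp only [ofP_single] at this
    simpa only [κ, map_zero] using this
  · refine strongEquiv_add_restrict le_rfl hh
      (hκ.mul ((hol_pc 0).pow 2)) (fun X Y hXY => ?_) hw ?_
    · rw [hκp X Y hXY, hXY 0]
    · have tz : Tendsto (fun X : Target 2 => (toP 2 X, (0 : ℂ))) (𝓝 0) (𝓝 (0, 0)) := by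
        have := hz.continuousAt.tendsto
        rwa [hz0] at this
      filter_upwards [tz.eventually hGe] with X h1 h2
      simp only [ofP_toP le_rfl h2] at h1
      rw [h1, sum_eq_single 0 (fun i _ hi => absurd (Fin.ext (by have := i.isLt; simp only [Fin.val_zero]; omega)) hi) (by simp)]
      simp only [sqAt, Function.update_self, κ]
      rw [mul_comm]
      rfl

theorem nf_two_normalize_of_eq_two {κ : Target 2 → ℂ} (hκ : Hol κ 0) (κ0 : κ 0 ≠ 0)
    (hκp : POnly κ) : StrongEquiv (image 2) (fun X => ![qc X 1 + κ X * pc X 0 ^ 2])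
      (fun X => ![qc X 1 + pc X 0 ^ 2]) := by
  have hga : Hol (fun X : Target 2 => κ X * pc X 0 ^ 2) 0 := hκ.mul ((hol_pc 0).pow 2)
  have hgp : POnly (fun X : Target 2 => κ X * pc X 0 ^ 2) := fun X Y hXY => by
    simp only [hXY, hκp X Y hXY]
  refine strongEquiv_add_of_restrict (c := 1) le_rfl (lam := κ) (ψ := fun X => X)
    ((hol_qc 1).add hga) (by simp [pc_zero, qc_zero]) ((hol_pc 0).pow 2)
    (fun X Y hXY => by simp [hXY]) ?_ isBiholGerm_id
    (.of_forall fun _ => Iff.rfl) hκ κ0 ?_ (.of_forall fun X h => h) ?_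
  · have := fderiv_qc_add le_rfl hga hgp
    exact this.trans_ne one_ne_zero
  · rw [one_smul, fderiv_fun_id]
    rfl
  · refine .of_forall fun X h1 => ?_
    have h2 : qc X 1 = 0 := congrFun h1 ⟨1, by omega⟩
    simp [h2]

section NormalFormThree

open Matrix

/-- The change of variable `y + c y²`. -/
def parC (c : ℂ) (m : ℕ) : ℂ := if m = 0 then 1 else if m = 1 then c else 0

theorem compan_three (t : ℂ) : compan (![0, t, 0] : Fin 3 → ℂ) = !![0, 0, 0; 1, 0, -t; 0, 1, 0] := by
  ext i j
  fin_cases i <;> fin_cases j <;> simp [compan]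

theorem thetaMat_three (c t : ℂ) :
    thetaMat (parC c) (![0, t, 0] : Fin 3 → ℂ) = !![0, 0, 0; 1, -(c * t), -t; c, 1, -(c * t)] := by
  rw [thetaMat, matEval, compan_three]
  simp only [sum_range_succ, sum_range_zero, parC]
  ext i j
  fin_cases i <;> fin_cases j <;> simp [mul_apply, Fin.sum_univ_three]
  ring

theorem coeff_charpoly_Dmat_three (c t : ℂ) :
    (Dmat (parC c) (![0, t, 0] : Fin 3 → ℂ)).charpoly.coeff 0 =
      -(2 / 3 * c * t ^ 2) - 2 / 27 * c ^ 3 * t ^ 3 := by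
  have h := det_eq_sign_charpoly_coeff (Dmat (parC c) (![0, t, 0] : Fin 3 → ℂ))
  have hD : Dmat (parC c) (![0, t, 0] : Fin 3 → ℂ) =
      !![2 / 3 * (c * t), 0, 0; 1, -(c * t) + 2 / 3 * (c * t), -t;
        c, 1, -(c * t) + 2 / 3 * (c * t)] := by
    have hm : thetaMean (parC c) (![0, t, 0] : Fin 3 → ℂ) = -(2 / 3 * (c * t)) := by
      rw [thetaMean, thetaMat_three, trace_fin_three]
      simp
      ring
    rw [Dmat, hm, thetaMat_three]
    ext i j
    fin_cases i <;> fin_cases j <;> simp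
  rw [hD, det_fin_three] at h
  rw [hD]
  simp at h
  linear_combination h

/-- The case `k = 3`. -/
theorem exists_nf_two_of_eq_three {h : Target 3 → ℂ} (hh : Hol h 0) (h0 : h 0 = 0)
    (hw : 𝒟 h 0 (bas 3 (.inr ⟨3 - 1, by omega⟩)) ≠ 0)
    (ha : 𝒟 h 0 (bas 3 (.inl ⟨3 - 2, by omega⟩)) = 0)
    (hb : 𝒟 h 0 (bas 3 (.inl ⟨3 - 3, by omega⟩)) ≠ 0) :
    StrongEquiv (image 3) (fun X => ![h X]) (fun X => ![qc X 2 + pc X 0]) := by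
  have hk2 : 2 ≤ 3 := by omega
  let mv : (Fin (3 - 1) → ℂ) × (Fin (3 - 1) → ℂ) → Target 3 := fun z =>
    move 0 (parC (z.2 1)) (ofP 3 z.1)
  let F : (Fin (3 - 1) → ℂ) × (Fin (3 - 1) → ℂ) → ℂ := fun z => z.2 0 * pc (mv z) 0
  have hs : ∀ l z, Hol (fun z : (Fin (3 - 1) → ℂ) × (Fin (3 - 1) → ℂ) => z.2 l) z :=
    fun l _ => analyticAt_pi_iff.1 analyticAt_snd l
  have hpar : ∀ {E : Type} [NormedAddCommGroup E] [NormedSpace ℂ E] {f : E → ℂ} {a : E},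
      Hol f a → ∀ m, Hol (fun x => parC (f x) m) a := by
    intro E _ _ f a hf m
    simp only [parC]
    split_ifs
    exacts [analyticAt_const, hf, analyticAt_const]
  have hpar0 : ∀ c, parC c 0 = 1 := fun c => if_pos rfl
  have hpar0' : ∀ c, parC c 0 ≠ 0 := fun c => by rw [hpar0]; exact one_ne_zero
  have hpar1 : ∀ m, parC 0 m = if m = 0 then 1 else 0 := fun m => by simp [parC]
  have hmv : ∀ z, Hol mv z := fun z =>
    analyticAt_move (B := fun _ => 0) (fun _ => analyticAt_const) (hpar (hs 1 z))
      (((ofP 3).analyticAt _).comp analyticAt_fst) hk2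
  have hmv0 : ∀ s, mv (0, s) = 0 := fun s => by
    simp only [mv, map_zero]
    exact move_zero hk2 _ (hpar0' _)
  have b0 : baseR 3 0 0 = 1 := rfl
  have b1 : baseR 3 0 1 = 0 := by simp [baseR]
  let lin : (Fin (3 - 1) → ℂ) → Fin (3 - 1) → ℂ := fun s l =>
    linP 0 (parC (s 1)) (pv (bas 3 (.inl l))) 0 0
  have hF : Hol F (0, baseR 3 0) := (hs 0 _).mul (analyticAt_pc (hmv _) _)
  have hF0 : ∀ s, F (0, s) = 0 := by
    intro s
    simp only [F, hmv0, pc_zero, mul_zero]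
  have hderiv : ∀ s l, HasDerivAt (fun t => F (Pi.single l t, s)) (s 0 * lin s l) 0 := fun s l =>
    (hasDerivAt_pc_move_inl hk2 (hpar0' _) l (i := 0) (by omega)).const_mul (s 0)
  have hlast : ∀ s, lin s 1 = 0 := fun s => linP_inl_of_lt hk2 (hpar0' _) _ _ (by simp)
  have hlin0 : lin (baseR 3 0) 0 = 1 := by
    simp only [lin, b1]
    rw [linP_of_one (B := 0) hk2 (fun _ _ => rfl) (fun m _ => hpar1 m)]
    exact pc_bas_inl hk2 0 0
  obtain ⟨N, hN, key⟩ := exists_solve_sq (1 : Fin (3 - 1)) (F := F) (s₀ := baseR 3 0) hF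
    (.of_forall hF0) (.of_forall fun s => by
      have := hderiv s 1
      rwa [hlast, mul_zero] at this)
    (J := fun s l => s 0 * lin s l) (.of_forall fun s l _ => hderiv s l)
    (Pi.single 1 1) (fun δ hδ => by
      have hl : Hol (fun ε : ℂ => (baseR 3 0 + ε • δ) 1) 0 := by
        simp only [Pi.add_apply, Pi.smul_apply]
        exact analyticAt_const.add (analyticAt_id.smul analyticAt_const)
      have h1 : HasDerivAt (fun ε : ℂ => (baseR 3 0 + ε • δ) 0) (δ 0) 0 :=
        hasDerivAt_affine _ _
      have hd : ∀ m, HasDerivAt (fun ε : ℂ => parC ((baseR 3 0 + ε • δ) 1) m)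
          (if m = 1 then δ 1 else 0) 0 := by
        intro m
        simp only [parC]
        by_cases m0 : m = 0
        · simp only [m0, if_true]
          exact hasDerivAt_const _ _
        · by_cases m1 : m = 1
          · simp only [m1]
            simpa using hasDerivAt_affine (baseR 3 0 1) (δ 1)
          · simp only [m0, m1, if_false]
            exact hasDerivAt_const _ _
      have h2 := hasDerivAt_linP (B := fun _ => 0) (B' := 0) hk2 (fun m => analyticAt_const)
        (hpar hl) (fun m _ => hasDerivAt_const _ _) (fun m _ => hd m)
        (fun m _ => rfl) (fun m _ => by simpa [b1] using hpar1 m)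
        (pv (bas 3 (.inl 0))) 0 0
      have h3 := h1.mul h2
      have h4 := h3.unique (hδ 0 (by decide))
      have h5 : δ 0 = 0 := by
        simp at h4
        exact h4.resolve_right fun h => zero_ne_one (h.symm.trans hlin0)
      refine ⟨δ 1, ?_⟩
      funext l
      fin_cases l
      · simpa using h5
      · simp)
    (j₀ := 0) (c₁ := -(2 / 3)) (by norm_num)
    (.of_forall fun ε => by
      have hval : ∀ t, F (Pi.single 1 t, baseR 3 0 + ε • Pi.single 1 1) =
          -(2 / 3 * ε * t ^ 2) - 2 / 27 * ε ^ 3 * t ^ 3 := by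
        intro t
        have e0 : (baseR 3 0 + ε • (Pi.single 1 1 : Fin (3 - 1) → ℂ)) 0 = 1 := by simp [b0]
        have e1 : (baseR 3 0 + ε • (Pi.single 1 1 : Fin (3 - 1) → ℂ)) 1 = ε := by simp [b1]
        have hp : pv (t • bas 3 (.inl 1)) = ![0, t, 0] := by
          funext i
          simp only [pv, pc_smul, pc_bas_inl hk2]
          fin_cases i <;> simp
        simp only [F, mv, e0, e1, one_mul, ofP_single]
        rw [move, pc_mk _ _ (by omega), newP, addP, matEval_eq_zero (B := 0) _ fun _ _ => rfl, hp,
          Matrix.zero_mulVec, add_zero]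
        exact coeff_charpoly_Dmat_three ε t
      simp only [hval]
      have hc : Tendsto (fun t : ℂ => -(2 / 3 * ε) - 2 / 27 * ε ^ 3 * t) (𝓝[≠] 0)
          (𝓝 (0 + ε * -(2 / 3))) := by
        have : Continuous (fun t : ℂ => -(2 / 3 * ε) - 2 / 27 * ε ^ 3 * t) := by fun_prop
        exact (this.tendsto' 0 _ (by ring)).mono_left nhdsWithin_le_nhds
      refine hc.congr' ?_
      filter_upwards [self_mem_nhdsWithin] with t ht
      have ht : t ≠ 0 := ht
      field_simp)
    (O := {s | s 0 ≠ 0}) ((continuous_apply _).continuousAt.eventually_ne (by rw [b0]; simp))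
  have hbase : Function.update (fun l => baseR 3 0 0 * lin (baseR 3 0) l) 1 0 = baseR 3 0 := by
    funext l
    fin_cases l
    · simp [b0, hlin0]
    · simp [b1]
  rw [hbase] at hN key
  obtain ⟨h', h1, h2, h3, h4, h5, j, hj, h6, h7⟩ := exists_scaled_near (le_refl 3) hN hh h0 hw ha hb
  have hd : ∀ l, HasDerivAt (fun t => h' (ofP 3 (Pi.single l t)))
      (𝒟 h' 0 (bas 3 (.inl l))) 0 := by
    intro l
    simp only [ofP_single]
    exact hasDerivAt_comp_smul h1 _
  obtain ⟨s, hsa, hsO, hs0, hse⟩ := key (fun Y => h' (ofP 3 Y))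
    (analyticAt_comp_zero h1 ((ofP 3).analyticAt _) (map_zero _)) (by rw [map_zero, h2])
    (by have := hd 1; rwa [show 𝒟 h' 0 (bas 3 (.inl 1)) = 0 from h4] at this)
    j (fun l hl => by rw [← h6 l hl]; exact hd l)
    (by simp only [ofP_single]; exact h7) hj
  obtain ⟨κ, -, -, -, h8, h9⟩ := strongEquiv_of_solve hk2 h1 h2 h3
    (T := fun x => parC (s x 1)) (lam := fun x => s x 0) (κ := 0)
    (hpar (analyticAt_pi_iff.1 hsa 1)) (hpar0' _) (analyticAt_pi_iff.1 hsa 0) hsO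
    analyticAt_const 0 0 (by
      filter_upwards [hse] with x hx
      rw [← hx]
      simp [F, mv])
  rw [h8 rfl] at h9
  simp only [Pi.zero_apply, zero_mul, add_zero] at h9
  exact h5.trans h9

end NormalFormThree

theorem strongEquiv_two {V : Set E}
    {f₁ f₂ g₁ g₂ a b c d : E → ℂ} {ψ : E → E} (hψ : IsBiholGerm ψ) (hV : MapsSetGerm ψ V V)
    (ha : Hol a 0) (hb : Hol b 0) (hc : Hol c 0) (hd : Hol d 0) (h0 : a 0 * d 0 - b 0 * c 0 ≠ 0)
    (h1 : ∀ᶠ x in 𝓝 0, f₁ x = a x * g₁ (ψ x) + b x * g₂ (ψ x))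
    (h2 : ∀ᶠ x in 𝓝 0, f₂ x = c x * g₁ (ψ x) + d x * g₂ (ψ x)) :
    StrongEquiv V (fun x => ![f₁ x, f₂ x]) (fun x => ![g₁ x, g₂ x]) := by
  refine ⟨ψ, hψ, hV, fun x => !![a x, b x; c x, d x], fun i j => ?_, ?_, ?_⟩
  · fin_cases i <;> fin_cases j
    · exact ha
    · exact hb
    · exact hc
    · exact hd
  · rw [Matrix.det_fin_two_of]
    exact h0
  · filter_upwards [h1, h2] with x h1 h2
    funext i
    fin_cases i
    · simp [Matrix.mulVec, dotProduct, h1]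
    · simp [Matrix.mulVec, dotProduct, h2]

/-- Normalization of a pair whose first component has linear part `U_{k-2}`. -/
theorem exists_pair_top (hk : 2 ≤ k) {h₁ h₂ : Target k → ℂ} (hh₁ : Hol h₁ 0)
    (h₁0 : h₁ 0 = 0) (hh₂ : Hol h₂ 0) (h₂0 : h₂ 0 = 0)
    (hd : ∀ l, 𝒟 h₁ 0 (bas k l) = if l = Sum.inl ⟨k - 2, by omega⟩ then 1 else 0)
    (hw : 𝒟 h₂ 0 eQ[k] ≠ 0) : ∃ g : Target k → ℂ, Hol g 0 ∧ g 0 = 0 ∧ 𝒟 g 0 = 𝒟 h₂ 0 ∧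
      StrongEquiv (image k) (fun X => ![h₁ X, h₂ X]) (fun X => ![pc X (k - 2), g X]) := by
  set β := 𝒟 h₂ 0 eQ[k] with hβ
  have hdw := hasDerivAt_comp_smul hh₁ eQ[k]
  rw [hd, if_neg (by simp)] at hdw
  obtain ⟨c, hc⟩ := exists_tendsto_div_sq
    (f := fun t : ℂ => h₁ (t • eQ[k]))
    (analyticAt_comp_zero hh₁ (analyticAt_id.smul analyticAt_const) (by simp)) (by simp [h₁0]) hdw
  have hpr : ∀ z : PQ k × PQ k, Hol
      (fun z : PQ k × PQ k => z.1 (Sum.inr ⟨k - 1, by omega⟩)) z := fun z =>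
    analyticAt_pi_iff.1 analyticAt_fst _
  have hd₂ : ∀ l, HasDerivAt (fun t => h₂ (ofPQ k (Pi.single l t))) (𝒟 h₂ 0 (bas k l)) 0 := by
    intro l
    simp only [ofPQ_single]
    exact hasDerivAt_comp_smul hh₂ _
  obtain ⟨N, hN, key⟩ := exists_solve_top hk c
    (e := fun z => β⁻¹ * z.1 (Sum.inr ⟨k - 1, by omega⟩) * h₂ (ofPQ k z.1))
    ((analyticAt_const.mul (hpr _)).mul
      (AnalyticAt.comp (g := h₂) (f := fun z : PQ k × PQ k => ofPQ k z.1) (by simpa using hh₂)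
        (((ofPQ k).analyticAt _).comp analyticAt_fst)))
    (fun s => by simp)
    (fun s l => by
      have h1 : HasDerivAt (fun t : ℂ => β⁻¹ * (Pi.single l t : PQ k) (Sum.inr ⟨k - 1, by omega⟩))
          (β⁻¹ * (Pi.single l 1 : PQ k) (Sum.inr ⟨k - 1, by omega⟩)) 0 := by
        refine HasDerivAt.const_mul _ ?_
        by_cases hl : l = Sum.inr ⟨k - 1, by omega⟩
        · subst hl
          simp only [Pi.single_eq_same]
          exact hasDerivAt_id (0 : ℂ)
        · simp only [Pi.single_apply, if_neg (Ne.symm hl)]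
          exact hasDerivAt_const _ _
      refine (h1.mul (hd₂ l)).congr_deriv ?_
      simp [h₂0])
    (fun c' => by
      have h1 := (hasDerivAt_iff_tendsto_slope_zero.1 (hd₂ (Sum.inr ⟨k - 1, by omega⟩))).const_mul
        β⁻¹
      rw [← hβ, inv_mul_cancel₀ hw] at h1
      refine h1.congr' ?_
      filter_upwards [self_mem_nhdsWithin] with t ht
      have ht : t ≠ 0 := ht
      simp [h₂0]
      field_simp)
  have hbw : baseS k c (Sum.inr ⟨k - 1, by omega⟩) = c := by simp [baseS]
  obtain ⟨σ, hσ, σa, σ0, hσe⟩ := key h₁ hh₁ h₁0 (by rw [hd, if_neg (by simp)]) (baseS k c)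
    (fun l hl => by
      rw [hd]
      rcases l with i | i
      · simp [baseS, Fin.ext_iff]
      · have hi : i.val ≠ k - 1 := fun h => hl (by simp [Fin.ext_iff, h])
        simp [baseS, hi])
    (by rw [hbw]; exact hc) (mem_of_mem_nhds hN)
  have σ0 := σ0 rfl
  have hσl : PiAnalyticAt σ 0 := analyticAt_pi_iff.1 hσ
  let ψ : Target k → Target k := fun X => move (parB (σ X)) (parT (σ X)) X
  have hψ : IsBiholGerm ψ := isBiholGerm_move (B := fun X => parB (σ X)) (τ := fun X => parT (σ X)) hk
    (analyticAt_parB hσ) (analyticAt_parT hσ) (by rw [parT_zero]; simp)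
  have hψV : MapsSetGerm ψ (image k) (image k) :=
    mapsSetGerm_move (B := fun X => parB (σ X)) (τ := fun X => parT (σ X)) hk
    (analyticAt_parB hσ) (analyticAt_parT hσ) (by rw [parT_zero]; simp)
  have hψd : ∀ v, 𝒟 ψ 0 v = v := by
    intro v
    have h1 := hasDerivAt_move (B := fun X => parB (σ X)) (τ := fun X => parT (σ X)) hk
      (analyticAt_parB hσ) (analyticAt_parT hσ) (by rw [parT_zero]; simp) v
    refine (fderiv_apply_eq_of_hasDerivAt hψ.1.differentiableAt h1).trans ?_
    have hB : ∀ m, m < k → parB (σ 0) m = 0 := fun m _ => by rw [σ0]; exact parB_baseS hk c m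
    have hT : ∀ m, m < k → parT (σ 0) m = if m = 0 then 1 else 0 := fun m _ => by
      rw [σ0]; exact parT_baseS c m
    refine target_ext (fun i hi => ?_) fun i hi => ?_
    · rw [moveLin, pc_mk _ _ hi, extV_of_lt _ (by omega), linP_of_one hk hB hT]
      rfl
    · rw [moveLin, qc_mk _ _ hi, extV_of_lt _ (by omega), (Mmat_of_one hk hT rfl).1,
        Matrix.adjugate_one, Matrix.one_mulVec]
      rfl
  obtain ⟨φ, hφ, hφ1, hφ2, -⟩ := hψ.exists_inverse
  refine ⟨fun X => h₂ (φ X), analyticAt_comp_zero hh₂ hφ.1 hφ.2.1, by simp only [hφ.2.1, h₂0], ?_,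
    strongEquiv_two (ψ := ψ) (a := fun X => σ X (Sum.inl ⟨k - 2, by omega⟩))
      (b := fun X => σ X (Sum.inl ⟨k - 2, by omega⟩) * (σ X (Sum.inr ⟨k - 1, by omega⟩) *
        (β⁻¹ * qc X (k - 1)))) (c := fun _ => 0) (d := fun _ => 1) hψ hψV (hσl _)
      ((hσl _).mul ((hσl _).mul (analyticAt_const.mul (hol_qc _))))
      analyticAt_const analyticAt_const ?_ ?_ ?_⟩
  · ext v
    have h1 : HasFDerivAt h₂ (𝒟 h₂ 0) (φ 0) := by
      rw [hφ.2.1]; exact hh₂.differentiableAt.hasFDerivAt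
    have h2 : HasFDerivAt (fun X => h₂ (φ X)) ((𝒟 h₂ 0).comp (𝒟 φ 0)) 0 :=
      h1.comp 0 hφ.1.differentiableAt.hasFDerivAt
    have h3 := fderiv_comp_inverse hψ hφ hφ1 v
    rw [hψd] at h3
    rw [h2.fderiv, ContinuousLinearMap.comp_apply, h3]
  · simpa using σa
  · filter_upwards [hσe, hφ1] with X h1 h2
    rw [h1, h2, ofPQ_toPQ hk, toPQ_inr]
    simp only [ψ]
    ring
  · filter_upwards [hφ1] with X h1
    rw [h1]
    ring

/-- Reduction of the second component of a pair. -/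
theorem strongEquiv_pair_of_restrict (hk : 2 ≤ k) {h g lam μ l : Target k → ℂ}
    (hh : Hol h 0) (h0 : h 0 = 0) (hg : Hol g 0) (hgp : POnly g) (hw : 𝒟 h 0 eQ[k] ≠ 0)
    (hlam : Hol lam 0) (lam0 : lam 0 ≠ 0) (hl : Hol l 0) (l0 : l 0 ≠ 0) (hμ : Hol μ 0)
    (he : ∀ᶠ X in 𝓝 0, qv X = 0 → h X = lam X * g (scale (l X) 1 X) + μ X * pc X (k - 2)) :
    StrongEquiv (image k) (fun X => ![pc X (k - 2), h X])
      (fun X => ![pc X (k - 2), qc X (k - 1) + g X]) := by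
  let ψ : Target k → Target k := fun X => scale (l X) 1 X
  have hψ : IsBiholGerm ψ := isBiholGerm_scale hl analyticAt_const l0 one_ne_zero
  have hψV : MapsSetGerm ψ (image k) (image k) :=
    mapsSetGerm_scale hk hl analyticAt_const l0 one_ne_zero
  obtain ⟨φ, hφ, hφ1, hφ2, -⟩ := hψ.exists_inverse
  let h' : Target k → ℂ := fun X => h X - μ X * pc X (k - 2)
  have hh' : Hol h' 0 := hh.sub (hμ.mul (hol_pc (k - 2)))
  have h0' : h' 0 = 0 := by simp only [h', h0, pc_zero]; ring
  have hw' : 𝒟 h' 0 eQ[k] ≠ 0 := by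
    have : 𝒟 h' 0 eQ[k] =
        𝒟 h 0 eQ[k] := by
      refine fderiv_apply_eq_of_hasDerivAt hh'.differentiableAt ?_
      simp only [h', pc_smul, pc_bas_inr hk, mul_zero, sub_zero]
      exact hasDerivAt_comp_smul hh _
    rwa [this]
  have hψw : 𝒟 ψ 0 eQ[k] =
      (1 : ℂ) • eQ[k] := by
    refine fderiv_apply_eq_of_hasDerivAt hψ.1.differentiableAt ?_
    simp only [ψ, scale_smul_bas hk]
    simp only [wt, Sum.elim_inr, Nat.sub_self, pow_zero, one_mul]
    exact (hasDerivAt_id (0 : ℂ)).smul_const _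
  let h'' : Target k → ℂ := fun X => (lam (φ X))⁻¹ * h' (φ X)
  have hlφ : Hol (fun X => (lam (φ X))⁻¹) 0 :=
    (analyticAt_comp_zero hlam hφ.1 hφ.2.1).inv (by simpa only [hφ.2.1] using lam0)
  have hψq : ∀ᶠ X in 𝓝 0, qv (ψ X) = 0 → qv X = 0 := by
    filter_upwards [hl.continuousAt.eventually_ne l0] with X hX h1
    funext i
    have h2 := congrFun h1 i
    simp only [qv, ψ] at h2 ⊢
    rw [qc_scale _ _ _ (by omega), one_mul] at h2
    exact (mul_eq_zero.1 h2).resolve_left (pow_ne_zero _ hX)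
  obtain ⟨χ, hχ, hχV, hχp, hχe⟩ := exists_mulQ_restrict hk (h := h'')
    (hlφ.mul (analyticAt_comp_zero hh' hφ.1 hφ.2.1)) hg hgp
    (fderiv_inv_mul_comp_ne_zero hh' h0' hw' hψ hφ hφ1 hlam lam0 hψw) (by
      filter_upwards [hφ2, hφ.tendsto.eventually hψq, hφ.tendsto.eventually he,
        hφ.tendsto.eventually (hlam.continuousAt.eventually_ne lam0)] with X h1 h2 h3 h4 h5
      rw [h1] at h2
      have h6 := h3 (h2 h5)
      change h (φ X) = lam (φ X) * g (ψ (φ X)) + _ at h6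
      rw [h1] at h6
      simp only [h'', h']
      rw [h6, add_sub_cancel_right, inv_mul_cancel_left₀ h4])
  have h3 : ∀ X, pc (ψ X) (k - 2) = l X ^ 2 * pc X (k - 2) := fun X => by
    have := pc_scale (l X) 1 X (le_refl (k - 2))
    rwa [show k - (k - 2) = 2 by omega] at this
  have hl2 : Hol (fun X => (l X ^ 2)⁻¹) 0 :=
    AnalyticAt.fun_inv (hl.pow 2) (pow_ne_zero 2 l0 : l 0 ^ 2 ≠ 0)
  have hl2' : Hol (fun X => (l X ^ 2)⁻¹ * μ X) 0 := hl2.mul hμ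
  have e1 : StrongEquiv (image k) (fun X => ![pc X (k - 2), h X])
      (fun X => ![pc X (k - 2), h'' X]) := by
    refine strongEquiv_two (g₁ := fun X => pc X (k - 2)) (g₂ := h'') (ψ := ψ)
      (a := fun X => (l X ^ 2)⁻¹) (b := fun _ => 0) (c := fun X => (l X ^ 2)⁻¹ * μ X) (d := lam)
      hψ hψV hl2 analyticAt_const hl2' hlam ?_ ?_ ?_
    · simp [l0, lam0]
    · filter_upwards [hl.continuousAt.eventually_ne l0] with X hX
      rw [h3, inv_mul_cancel_left₀ (pow_ne_zero 2 hX)]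
      ring
    · filter_upwards [hl.continuousAt.eventually_ne l0, hφ1,
        hlam.continuousAt.eventually_ne lam0] with X hX h1 h2
      have h4 : h'' (ψ X) = (lam X)⁻¹ * (h X - μ X * pc X (k - 2)) := by simp only [h'', h', h1]
      rw [h3, h4, mul_inv_cancel_left₀ h2]
      field_simp
      ring
  refine e1.trans (strongEquiv_two (ψ := χ) (a := fun _ => 1) (b := fun _ => 0) (c := fun _ => 0)
      (d := fun _ => 1) hχ hχV analyticAt_const analyticAt_const analyticAt_const analyticAt_const
      (by simp) ?_ ?_)
  · exact .of_forall fun X => by rw [hχp]; ring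
  · filter_upwards [hχe] with X h1
    rw [h1]
    ring

theorem exists_restrict_coeff (hk : 2 ≤ k) (hh : Hol h 0)
    (h0 : h 0 = 0) : ∃ G : Target k → Fin (k - 1) → ℂ, (PiAnalyticAt G 0) ∧
      (∀ l, G 0 l = 𝒟 h 0 (bas k (.inl l))) ∧
      ∀ᶠ X in 𝓝 0, qv X = 0 → h X = ∑ l : Fin (k - 1), pc X l * G X l := by
  obtain ⟨G, hG, hGe⟩ := exists_coordinate_coeff (S := ℂ) (s₀ := 0)
    (F := fun z : (Fin (k - 1) → ℂ) × ℂ => h (ofP k z.1))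
    (AnalyticAt.comp (g := h) (f := fun z : (Fin (k - 1) → ℂ) × ℂ => ofP k z.1)
      (by simpa using hh) (((ofP k).analyticAt _).comp analyticAt_fst))
    (.of_forall fun s => by simpa using h0)
  have hz : Hol (fun X : Target k => (toP k X, (0 : ℂ))) 0 :=
    ((toP k).analyticAt _).prod analyticAt_const
  have hz0 : (toP k (0 : Target k), (0 : ℂ)) = (0, 0) := by rw [map_zero]
  refine ⟨fun X => G (toP k X, 0), analyticAt_pi_iff.1 (AnalyticAt.comp (g := G) ?_ hz),
    fun l => ?_, ?_⟩
  · rw [hz0]; exact hG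
  · have h1 := hasDerivAt_single_of_coeff hG.continuousAt hGe l
    simp only [ofP_single] at h1
    simp only [map_zero]
    exact h1.unique (hasDerivAt_comp_smul hh _)
  · have tz : Tendsto (fun X : Target k => (toP k X, (0 : ℂ))) (𝓝 0) (𝓝 (0, 0)) := by
      have := hz.continuousAt.tendsto
      rwa [hz0] at this
    filter_upwards [tz.eventually hGe] with X h1 h2
    simp only [ofP_toP hk h2] at h1
    rw [h1]
    rfl

theorem pair_form_two {h : Target 2 → ℂ} (hh : Hol h 0) (h0 : h 0 = 0)
    (hw : 𝒟 h 0 (bas 2 (.inr 1)) ≠ 0) :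
    StrongEquiv (image 2) (fun X => ![pc X 0, h X]) (fun X => ![V 1 X, W₁ X]) := by
  obtain ⟨G, hG, -, hGe⟩ := exists_restrict_coeff le_rfl hh h0
  have h1 := strongEquiv_pair_of_restrict le_rfl (g := fun _ => 0) (lam := fun _ => 1)
    (l := fun _ => 1) (μ := fun X => G X 0) hh h0 analyticAt_const (fun _ _ _ => rfl) hw
    analyticAt_const one_ne_zero analyticAt_const one_ne_zero (hG 0) (by
      filter_upwards [hGe] with X h1 h2
      rw [h1 h2]
      simp [mul_comm])
  refine h1.trans (strongEquiv_two (ψ := fun X => X) (a := fun _ => 0) (b := fun _ => -1)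
    (c := fun _ => 1) (d := fun _ => 0) isBiholGerm_id (.of_forall fun _ => Iff.rfl)
    analyticAt_const analyticAt_const analyticAt_const analyticAt_const (by simp) ?_ ?_)
  · exact .of_forall fun X => by simp [pc]
  · exact .of_forall fun X => by simp [qc]

theorem pair_form_three {h : Target 3 → ℂ} (hh : Hol h 0) (h0 : h 0 = 0)
    (hw : 𝒟 h 0 (bas 3 (.inr 2)) ≠ 0) (hb : 𝒟 h 0 (bas 3 (.inl 0)) ≠ 0) :
    StrongEquiv (image 3) (fun X => ![pc X 1, h X]) (fun X => ![U 1 X, V 2 X + W₁ X]) := by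
  obtain ⟨G, hG, hG0, hGe⟩ := exists_restrict_coeff (by omega) hh h0
  have h1 := strongEquiv_pair_of_restrict (by omega) (g := fun X => -pc X 0)
    (lam := fun X => -G X 0)
    (l := fun _ => 1) (μ := fun X => G X 1) hh h0 (hol_pc 0).neg
    (fun X Y h => by simp only [h]) hw
    (hG 0).neg (by rw [hG0]; simpa using hb) analyticAt_const one_ne_zero (hG 1) (by
      filter_upwards [hGe] with X h1 h2
      rw [h1 h2, pc_scale _ _ _ (by omega)]
      simp [mul_comm])
  refine h1.trans (strongEquiv_two (ψ := fun X => X) (a := fun _ => 1) (b := fun _ => 0)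
    (c := fun _ => 0) (d := fun _ => 1) isBiholGerm_id (.of_forall fun _ => Iff.rfl)
    analyticAt_const analyticAt_const analyticAt_const analyticAt_const (by simp) ?_ ?_)
  · exact .of_forall fun X => by simp [pc]
  · exact .of_forall fun X => by simp [qc, pc]

theorem pair_form_four {h : Target 4 → ℂ} (hh : Hol h 0) (h0 : h 0 = 0)
    (hw : 𝒟 h 0 (bas 4 (.inr 3)) ≠ 0) (hb : 𝒟 h 0 (bas 4 (.inl 0)) ≠ 0)
    (hc : 𝒟 h 0 (bas 4 (.inl 1)) ≠ 0) :
    StrongEquiv (image 4) (fun X => ![pc X 2, h X]) (fun X => ![U 2 X, U 1 X + V 3 X + W₁ X]) := by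
  obtain ⟨G, hG, hG0, hGe⟩ := exists_restrict_coeff (by omega) hh h0
  rw [← hG0] at hb hc
  have hl : Hol (fun X => -(G X 0 / G X 1)) 0 := ((hG 0).div (hG 1) hc).neg
  have l0 : -(G 0 0 / G 0 1) ≠ 0 := neg_ne_zero.2 (div_ne_zero hb hc)
  have hl3 : Hol (fun X => (-(G X 0 / G X 1)) ^ 3) 0 := hl.pow 3
  have hlam : Hol (fun X => G X 1 / (-(G X 0 / G X 1)) ^ 3) 0 := (hG 1).div hl3 (pow_ne_zero 3 l0)
  have hg : Hol (fun X : Target 4 => pc X 1 - pc X 0) 0 := (hol_pc 1).sub (hol_pc 0)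
  have h1 := strongEquiv_pair_of_restrict (by omega) (μ := fun X => G X 2) hh h0 hg
    (fun X Y h => by rw [h, h]) hw hlam (div_ne_zero hc (pow_ne_zero 3 l0)) hl l0 (hG 2) (by
      filter_upwards [hGe, (hG 0).continuousAt.eventually_ne hb,
        (hG 1).continuousAt.eventually_ne hc] with X h1 h2 h3 h4
      rw [h1 h4, pc_scale _ _ _ (by omega), pc_scale _ _ _ (by omega)]
      have hsum : ∑ l : Fin (4 - 1), pc X l * G X l = pc X 0 * G X 0 + pc X 1 * G X 1 +
          pc X 2 * G X 2 := Fin.sum_univ_three (fun l : Fin 3 => pc X l * G X l)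
      rw [hsum]
      simp only [Nat.add_one_sub_one, Nat.sub_zero, Nat.reduceSub]
      field_simp
      ring)
  refine h1.trans (strongEquiv_two (ψ := fun X => X) (a := fun _ => 1) (b := fun _ => 0)
    (c := fun _ => 0) (d := fun _ => 1) isBiholGerm_id (.of_forall fun _ => Iff.rfl)
    analyticAt_const analyticAt_const analyticAt_const analyticAt_const (by simp) ?_ ?_)
  · exact .of_forall fun X => by simp [pc]
  · refine .of_forall fun X => ?_
    simp [qc, pc]
    ring

section Jets

variable [CompleteSpace F]

theorem SameJet.isBigO {r : ℕ} {f g : E → F} (hf : Hol f 0) (hg : Hol g 0) (h : SameJet r f g) :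
    (fun x => f x - g x) =O[𝓝 0] fun x => ‖x‖ ^ (r + 1) := by
  obtain ⟨p, R, hp⟩ := hf
  obtain ⟨p', R', hp'⟩ := hg
  have h1 := hp.hasFPowerSeriesAt.isBigO_sub_partialSum_pow (r + 1)
  have h2 := hp'.hasFPowerSeriesAt.isBigO_sub_partialSum_pow (r + 1)
  have h3 : ∀ x, p.partialSum (r + 1) x = p'.partialSum (r + 1) x := by
    intro x
    refine sum_congr rfl fun i hi => ?_
    have e1 := hp.factorial_smul x i
    have e2 := hp'.factorial_smul x i
    rw [h i (by have := mem_range.1 hi; omega), ← e2] at e1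
    have : (Nat.factorial i : ℂ) ≠ 0 := by exact_mod_cast Nat.factorial_ne_zero i
    rw [← Nat.cast_smul_eq_nsmul ℂ, ← Nat.cast_smul_eq_nsmul ℂ] at e1
    exact smul_right_injective F this e1
  refine (h1.sub h2).congr_left fun x => ?_
  simp only [zero_add, h3]
  abel

theorem SameJet.apply_zero {r : ℕ} {f g : E → F} (h : SameJet r f g) : f 0 = g 0 := by
  have := congrArg (fun m => m 0) (h 0 (Nat.zero_le _))
  simpa only [iteratedFDeriv_zero_apply] using this

theorem SameJet.fderiv_eq {r : ℕ} (hr : 1 ≤ r) {f g : E → F} (h : SameJet r f g) :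
    𝒟 f 0 = 𝒟 g 0 := by
  ext v
  simpa using congrArg (fun m => m fun _ => v) (h 1 hr)

end Jets

theorem jet_line {q : ℕ} {f g : Target k → Fin q → ℂ} (hf : Hol f 0)
    (hg : Hol g 0) (h : SameJet 2 f g) (i : Fin q) (v : Target k) {a b : ℂ}
    (hl : ∀ t : ℂ, f (t • v) i = a * t + b * t ^ 2) : 𝒟 (fun X => g X i) 0 v = a ∧
      Tendsto (fun t : ℂ => (g (t • v) i - a * t) / t ^ 2) (𝓝[≠] 0) (𝓝 b) := by
  have h1 := h.isBigO hf hg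
  have hc : Tendsto (fun t : ℂ => t • v) (𝓝 0) (𝓝 0) := by
    have : Continuous fun t : ℂ => t • v := by fun_prop
    exact this.tendsto' _ _ (zero_smul _ _)
  have h2 : (fun t : ℂ => f (t • v) i - g (t • v) i) =O[𝓝 0] fun t : ℂ => t ^ 3 := by
    have e1 := h1.comp_tendsto hc
    have e2 : (fun t : ℂ => f (t • v) i - g (t • v) i) =O[𝓝 0]
        ((fun x => f x - g x) ∘ fun t : ℂ => t • v) :=
      isBigO_of_le _ fun t => norm_le_pi_norm (f (t • v) - g (t • v)) i
    refine (e2.trans e1).trans (IsBigO.of_bound (‖v‖ ^ 3) (.of_forall fun t => ?_))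
    simp only [Function.comp, norm_smul, norm_pow, norm_mul, norm_norm, mul_pow]
    rw [mul_comm]
  have h3 : Tendsto (fun t : ℂ => (f (t • v) i - g (t • v) i) / t ^ 2) (𝓝[≠] 0) (𝓝 0) := by
    have e1 := h2.mono (nhdsWithin_le_nhds (s := {0}ᶜ))
    have e2 : (fun t : ℂ => t ^ 3) =o[𝓝[≠] 0] fun t : ℂ => t ^ 2 :=
      (isLittleO_pow_pow (by norm_num)).mono nhdsWithin_le_nhds
    exact (e1.trans_isLittleO e2).tendsto_div_nhds_zero
  have h4 : Tendsto (fun t : ℂ => (g (t • v) i - a * t) / t ^ 2) (𝓝[≠] 0) (𝓝 b) := by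
    have := (tendsto_const_nhds (x := b)).sub h3
    rw [sub_zero] at this
    refine this.congr' ?_
    filter_upwards [self_mem_nhdsWithin] with t ht
    have ht : t ≠ 0 := ht
    rw [hl]
    field_simp
    ring
  refine ⟨fderiv_apply_eq_of_hasDerivAt (analyticAt_pi_iff.1 hg i).differentiableAt ?_, h4⟩
  have g0 : g ((0 : ℂ) • v) i = 0 := by
    have e1 := hl 0
    rw [zero_smul, h.apply_zero] at e1
    rw [zero_smul, e1]
    ring
  rw [hasDerivAt_iff_tendsto_slope_zero]
  have h5 : Tendsto (fun t : ℂ => a + t * ((g (t • v) i - a * t) / t ^ 2)) (𝓝[≠] 0)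
      (𝓝 (a + 0 * b)) :=
    tendsto_const_nhds.add ((tendsto_id.mono_left nhdsWithin_le_nhds).mul h4)
  rw [zero_mul, add_zero] at h5
  refine h5.congr' ?_
  filter_upwards [self_mem_nhdsWithin] with t ht
  have ht : t ≠ 0 := ht
  simp only [zero_add, g0, sub_zero, smul_eq_mul]
  field_simp
  ring

theorem hol_vec_one {f : E → ℂ} (hf : Hol f 0) : Hol (fun x => ![f x]) 0 :=
  analyticAt_pi_iff.2 fun i => by simpa using hf

theorem fderiv_component {q : ℕ} {h : Target k → Fin q → ℂ} (hh : Hol h 0) (i : Fin q)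
    (v : Target k) : 𝒟 (fun X => h X i) 0 v = 𝒟 h 0 v i := by
  rw [fderiv_apply hh.differentiableAt]
  rfl

theorem vec_one (g : Target k → Fin 1 → ℂ) : (fun X => ![g X 0]) = g := by
  funext X i
  obtain rfl := Subsingleton.elim i 0
  rfl

theorem vec_two (g : Target k → Fin 2 → ℂ) : (fun X => ![g X 0, g X 1]) = g := by
  funext X i
  fin_cases i <;> rfl

theorem determined_nf_one (hk : 2 ≤ k) {c : ℂ} (hc : c ≠ 0) {f g : Target k → Fin 1 → ℂ}
    (hf : f = fun X => ![pc X (k - 2) + c * qc X (k - 1) ^ 2]) (hg : Hol g 0)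
    (h : SameJet 2 f g) : StrongEquiv (image k) g f := by
  have hfa : Hol f 0 := hf ▸ hol_vec_one ((hol_pc _).add (analyticAt_const.mul ((hol_qc _).pow 2)))
  have g0 : g 0 0 = 0 := by simp [← h.apply_zero, hf, pc_zero, qc_zero]
  have hv := fun v a b => jet_line hfa hg h 0 v (a := a) (b := b)
  simp only [hf, Matrix.cons_val_zero, pc_smul, qc_smul] at hv
  obtain ⟨hw1, hw2⟩ := hv eQ[k] 0 c fun t => by rw [pc_bas_inr hk, qc_bas_inr hk]; simp
  obtain ⟨N, hN, key⟩ := exists_nf_one_near hk c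
  obtain ⟨κ, hκ, κ0, hE⟩ := key (fun X => g X 0) (analyticAt_pi_iff.1 hg 0) g0 hw1 (baseS k c)
    (fun l hl => by
      rcases l with i | i
      · rw [(hv (bas k (.inl i)) (if k - 2 = i.val then 1 else 0) 0 fun t => by
          rw [pc_bas_inl hk, qc_bas_inl hk]; ring).1]
        simp [baseS, eq_comm]
      · have hi : i.val ≠ k - 1 := fun h => hl (by simp [Fin.ext_iff, h])
        rw [(hv (bas k (.inr i)) 0 0 fun t => by
          rw [pc_bas_inr hk, qc_bas_inr hk, if_neg hi.symm]; ring).1]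
        simp [baseS, hi])
    (by
      have : baseS k c (Sum.inr ⟨k - 1, by omega⟩) = c := by simp [baseS]
      rw [this]
      simpa using hw2) (mem_of_mem_nhds hN)
  rw [vec_one] at hE
  rw [hf]
  exact hE.trans (nf_one_normalize hk hκ (by rw [κ0 rfl]; exact hc) hc)

theorem determined_nf_two (hk : 4 ≤ k) {f g : Target k → Fin 1 → ℂ}
    (hf : f = fun X => ![qc X (k - 1) + (pc X (k - 3) + pc X (k - 2) ^ 2)])
    (hg : Hol g 0) (h : SameJet 2 f g) : StrongEquiv (image k) g f := by
  have hk2 : 2 ≤ k := by omega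
  have hfa : Hol f 0 := hf ▸ hol_vec_one ((hol_qc _).add ((hol_pc _).add ((hol_pc _).pow 2)))
  have g0 : g 0 0 = 0 := by simp [← h.apply_zero, hf, pc_zero, qc_zero]
  have hv := fun v a b => jet_line hfa hg h 0 v (a := a) (b := b)
  simp only [hf, Matrix.cons_val_zero, pc_smul, qc_smul] at hv
  have h23 : k - 3 ≠ k - 2 := by omega
  obtain ⟨hw1, hw2⟩ := hv eP[k] 0 1 fun t => by
    rw [pc_bas_inl hk2, qc_bas_inl hk2, pc_bas_inl hk2]; simp [h23]
  obtain ⟨N, hN, key⟩ := exists_nf_two_near hk 1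
  obtain ⟨κ, hκ, hκp, κ0, hE⟩ := key (fun X => g X 0) (analyticAt_pi_iff.1 hg 0) g0
    (by
      rw [(hv eQ[k] 1 0 fun t => by rw [pc_bas_inr hk2, qc_bas_inr hk2, pc_bas_inr hk2]; simp).1]
      exact one_ne_zero) hw1 (baseR k 1)
    (fun l hl => by
      have hi : l.val ≠ k - 2 := fun h => hl (Fin.ext h)
      rw [(hv (bas k (.inl l)) (if k - 3 = l.val then 1 else 0) 0 fun t => by
        rw [pc_bas_inl hk2, qc_bas_inl hk2, pc_bas_inl hk2, if_neg hi.symm]; ring).1]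
      simp [baseR, hi, eq_comm])
    (by
      have : baseR k 1 ⟨k - 2, by omega⟩ = 1 := by simp [baseR, h23.symm]
      rw [this]
      simpa using hw2) (mem_of_mem_nhds hN)
  rw [vec_one] at hE
  rw [hf]
  exact hE.trans (nf_two_normalize hk hκ (by rw [κ0 rfl]; exact one_ne_zero) hκp)

theorem determined_nf_two_of_eq_three {f g : Target 3 → Fin 1 → ℂ}
    (hf : f = fun X => ![V 2 X + W₁ X]) (hg : Hol g 0) (h : SameJet 2 f g) :
    StrongEquiv (image 3) g (fun X => ![qc X 2 + pc X 0]) := by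
  have hk2 : 2 ≤ 3 := by omega
  have hf : f = fun X => ![qc X 2 - pc X 0] := by
    rw [hf]
    funext X
    simp [pc, qc]
  have hfa : Hol f 0 := hf ▸ hol_vec_one ((hol_qc _).sub (hol_pc _))
  have g0 : g 0 0 = 0 := by simp [← h.apply_zero, hf, pc_zero, qc_zero]
  have hv := fun v a b => jet_line hfa hg h 0 v (a := a) (b := b)
  simp only [hf, Matrix.cons_val_zero, pc_smul, qc_smul] at hv
  have hE := exists_nf_two_of_eq_three (h := fun X => g X 0) (analyticAt_pi_iff.1 hg 0) g0
    (by
      rw [(hv (bas 3 (.inr ⟨3 - 1, by omega⟩)) 1 0 fun t => by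
        rw [pc_bas_inr hk2, qc_bas_inr hk2]; simp).1]
      exact one_ne_zero)
    (by
      rw [(hv (bas 3 (.inl ⟨3 - 2, by omega⟩)) 0 0 fun t => by
        rw [pc_bas_inl hk2, qc_bas_inl hk2]; simp).1])
    (by
      rw [(hv (bas 3 (.inl ⟨3 - 3, by omega⟩)) (-1) 0 fun t => by
        rw [pc_bas_inl hk2, qc_bas_inl hk2]; simp).1]
      simp)
  rwa [vec_one] at hE

theorem determined_nf_two_of_eq_two {f g : Target 2 → Fin 1 → ℂ}
    (hf : f = fun X => ![qc X 1 + pc X 0 ^ 2]) (hg : Hol g 0) (h : SameJet 2 f g) :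
    StrongEquiv (image 2) g f := by
  have hfa : Hol f 0 := hf ▸ hol_vec_one ((hol_qc _).add ((hol_pc _).pow 2))
  have g0 : g 0 0 = 0 := by simp [← h.apply_zero, hf, pc_zero, qc_zero]
  have hv := fun v a b => jet_line hfa hg h 0 v (a := a) (b := b)
  simp only [hf, Matrix.cons_val_zero, pc_smul, qc_smul] at hv
  obtain ⟨hw1, hw2⟩ := hv (bas 2 (.inl 0)) 0 1 fun t => by
    rw [pc_bas_inl le_rfl, qc_bas_inl le_rfl]; simp
  obtain ⟨κ, hκ, hκp, hκ0, hE⟩ := exists_nf_two_of_eq_two (h := fun X => g X 0)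
    (analyticAt_pi_iff.1 hg 0) g0
    (by
      rw [(hv (bas 2 (.inr 1)) 1 0 fun t => by rw [pc_bas_inr le_rfl, qc_bas_inr le_rfl]; simp).1]
      exact one_ne_zero) hw1
  have κ1 : κ 0 = 1 := tendsto_nhds_unique hκ0 (by simpa using hw2)
  rw [vec_one] at hE
  rw [hf]
  exact hE.trans (nf_two_normalize_of_eq_two hκ (by rw [κ1]; exact one_ne_zero) hκp)

theorem strongEquiv_linear_two {V : Set E}
    {f₁ f₂ g₁ g₂ : E → ℂ} (a b c d : ℂ) (h0 : a * d - b * c ≠ 0)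
    (h1 : ∀ x, f₁ x = a * g₁ x + b * g₂ x) (h2 : ∀ x, f₂ x = c * g₁ x + d * g₂ x) :
    StrongEquiv V (fun x => ![f₁ x, f₂ x]) (fun x => ![g₁ x, g₂ x]) :=
  strongEquiv_two (ψ := fun X => X) (a := fun _ => a) (b := fun _ => b)
    (c := fun _ => c) (d := fun _ => d) isBiholGerm_id (.of_forall fun _ => Iff.rfl)
    analyticAt_const analyticAt_const analyticAt_const analyticAt_const h0
    (.of_forall h1) (.of_forall h2)

theorem exists_pair_of_fderiv (hk : 2 ≤ k) {g : Target k → Fin 2 → ℂ} (hg : Hol g 0) (g0 : g 0 = 0)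
    (hd : ∀ v, 𝒟 g 0 v 0 = pc v (k - 2)) (hw : 𝒟 g 0 eQ[k] 1 ≠ 0) :
    ∃ g' : Target k → ℂ, Hol g' 0 ∧ g' 0 = 0 ∧ (∀ v, 𝒟 g' 0 v = 𝒟 g 0 v 1) ∧
      StrongEquiv (image k) g (fun X => ![pc X (k - 2), g' X]) := by
  have hga := analyticAt_pi_iff.1 hg
  obtain ⟨g', h1, h2, h3, h4⟩ := exists_pair_top hk (hga 0) (congrFun g0 0) (hga 1) (congrFun g0 1)
    (fun l => by
      rw [fderiv_component hg, hd]
      rcases l with l | l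
      · simp [pc_bas_inl hk, Fin.ext_iff, eq_comm]
      · simp [pc_bas_inr hk]) (by rwa [fderiv_component hg])
  rw [vec_two] at h4
  exact ⟨g', h1, h2, fun v => by rw [h3, fderiv_component hg], h4⟩

theorem SameJet.exists_pair (hk : 2 ≤ k) {f g : Target k → Fin 2 → ℂ}
    (L : Target k →L[ℂ] Fin 2 → ℂ) (hL : ∀ v, L v = f v) (hg : Hol g 0) (h : SameJet 2 f g)
    (hd : ∀ v, L v 0 = pc v (k - 2)) (hw : L eQ[k] 1 ≠ 0) :
    ∃ g' : Target k → ℂ, Hol g' 0 ∧ g' 0 = 0 ∧ (∀ v, 𝒟 g' 0 v = L v 1) ∧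
      StrongEquiv (image k) g (fun X => ![pc X (k - 2), g' X]) := by
  obtain rfl : ⇑L = f := funext hL
  have e : 𝒟 g 0 = L := (h.fderiv_eq one_le_two).symm.trans L.fderiv
  simpa only [e] using exists_pair_of_fderiv hk hg (h.apply_zero.symm.trans (map_zero L))
    (by rwa [e]) (by rwa [e])

theorem determined_pair_two {f g : Target 2 → Fin 2 → ℂ}
    (hf : f = fun X => ![V 1 X, W₁ X]) (hg : Hol g 0) (h : SameJet 2 f g) :
    StrongEquiv (image 2) g f := by
  let S : (Fin 2 → ℂ) →L[ℂ] Fin 2 → ℂ := ContinuousLinearMap.pi ![-prj 1, prj 0]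
  let L : Target 2 →L[ℂ] Fin 2 → ℂ := ContinuousLinearMap.pi ![qcL 2 1, -pcL 2 0]
  obtain rfl : ⇑L = f := by
    rw [hf]
    funext X i
    fin_cases i <;> simp [L, pc, qc]
  have e : 𝒟 (fun X => S (g X)) 0 = S.comp L := by
    rw [← L.fderiv (x := 0), h.fderiv_eq one_le_two]
    exact (S.hasFDerivAt.comp 0 hg.differentiableAt.hasFDerivAt).fderiv
  obtain ⟨g', h1, h2, h3, h4⟩ := exists_pair_of_fderiv le_rfl (g := fun X => S (g X))
    ((S.analyticAt _).comp hg) (by simp [← h.apply_zero]) (fun v => by rw [e]; simp [S, L])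
    (by rw [e]; simp [S, L, qc_bas_inr le_rfl])
  have e2 : StrongEquiv (image 2) g (fun X => S (g X)) := by
    have := strongEquiv_linear_two (V := image 2) (f₁ := fun X => g X 0) (f₂ := fun X => g X 1)
      (g₁ := fun X => S (g X) 0) (g₂ := fun X => S (g X) 1) 0 1 (-1) 0 (by simp) (by simp [S])
      (by simp [S])
    rwa [vec_two, vec_two] at this
  rw [hf]
  refine (e2.trans h4).trans (pair_form_two h1 h2 ?_)
  rw [h3, e]
  simp [S, L, qc_bas_inr le_rfl]

theorem determined_pair_three {f g : Target 3 → Fin 2 → ℂ}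
    (hf : f = fun X => ![U 1 X, V 2 X + W₁ X]) (hg : Hol g 0) (h : SameJet 2 f g) :
    StrongEquiv (image 3) g f := by
  have hk : 2 ≤ 3 := by omega
  obtain ⟨g', h1, h2, h3, h4⟩ := h.exists_pair hk
    (ContinuousLinearMap.pi ![pcL 3 1, qcL 3 2 - pcL 3 0])
    (fun X => by rw [hf]; funext i; fin_cases i <;> simp [pc, qc]) hg (fun v => rfl)
    (by simp [qc_bas_inr hk, pc_bas_inr hk])
  rw [hf]
  refine h4.trans (pair_form_three h1 h2 ?_ ?_) <;> rw [h3] <;>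
    simp [qc_bas_inr hk, pc_bas_inr hk, qc_bas_inl hk, pc_bas_inl hk]

theorem determined_pair_four {f g : Target 4 → Fin 2 → ℂ}
    (hf : f = fun X => ![U 2 X, U 1 X + V 3 X + W₁ X]) (hg : Hol g 0)
    (h : SameJet 2 f g) : StrongEquiv (image 4) g f := by
  have hk : 2 ≤ 4 := by omega
  obtain ⟨g', h1, h2, h3, h4⟩ := h.exists_pair hk
    (ContinuousLinearMap.pi ![pcL 4 2, pcL 4 1 + qcL 4 3 - pcL 4 0])
    (fun X => by rw [hf]; funext i; fin_cases i <;> simp [pc, qc]) hg (fun v => rfl)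
    (by simp [qc_bas_inr hk, pc_bas_inr hk])
  rw [hf]
  refine h4.trans (pair_form_four h1 h2 ?_ ?_ ?_) <;> rw [h3] <;>
    simp [qc_bas_inr hk, pc_bas_inr hk, qc_bas_inl hk, pc_bas_inl hk]

theorem U_eq_pc {i : ℕ} (hi : i ≠ 0) (X : Target k) : U i X = pc X i := by rw [pc, if_neg hi]

theorem V_eq_qc {i : ℕ} (hi : i ≠ 0) (X : Target k) : V i X = qc X i := by rw [qc, if_neg hi]

theorem W₁_eq_pc (X : Target k) : W₁ X = -pc X 0 := by rw [pc, if_pos rfl, neg_neg]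

theorem strongEquiv_const_mul {V : Set E}
    {f g : E → ℂ} {c : ℂ} (hc : c ≠ 0) (h : ∀ x, f x = c * g x) :
    StrongEquiv V (fun x => ![f x]) (fun x => ![g x]) :=
  strongEquiv_one (lam := fun _ => c) isBiholGerm_id (.of_forall fun _ => Iff.rfl)
    analyticAt_const hc (.of_forall h)

theorem nf_one_of_eq_two : StrongEquiv (image 2) (fun X => ![pc X (2 - 2) + -1 * qc X (2 - 1) ^ 2])
      (fun X => ![W₁ X + V 1 X ^ 2]) := by
  refine strongEquiv_const_mul (c := -1) (by simp) fun X => ?_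
  rw [W₁_eq_pc, V_eq_qc one_ne_zero]
  ring_nf

theorem SameJet.neg {r : ℕ} {f g : E → F} (h : SameJet r f g) :
    SameJet r (fun x => -f x) (fun x => -g x) := by
  intro i hi
  have e : ∀ f : E → F, (fun x => -f x) = -f := fun f => rfl
  rw [e f, e g, iteratedFDeriv_neg_apply, iteratedFDeriv_neg_apply, h i hi]

theorem three_form : StrongEquiv (image 3) (fun X => ![qc X 2 + pc X 0])
    (fun X => ![V 2 X + W₁ X]) := by
  refine strongEquiv_one (lam := fun _ => -1) (ψ := fun X => scale 1 (-1) X)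
    (isBiholGerm_scale analyticAt_const analyticAt_const one_ne_zero (by simp))
    (mapsSetGerm_scale (by omega) analyticAt_const analyticAt_const one_ne_zero (by simp))
    analyticAt_const (by simp) (.of_forall fun X => ?_)
  rw [W₁_eq_pc, V_eq_qc (by norm_num), pc_scale _ _ _ (by omega), qc_scale _ _ _ (by omega)]
  ring

theorem determined_one (hk : 2 ≤ k) {f : Target k → Fin 1 → ℂ} (hf : IsNormalFormOne k f) :
    VKDetermined (image k) 2 f := by
  intro g hg h
  refine StrongEquiv.vkEquiv (StrongEquiv.symm ?_)
  rcases hf with ⟨h3, hf⟩ | ⟨h4, hf⟩ | ⟨rfl, hf⟩ | ⟨rfl, hf⟩ | ⟨rfl, hf⟩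
  · refine determined_nf_one hk one_ne_zero ?_ hg h
    rw [hf]
    funext X
    rw [U_eq_pc (by omega), V_eq_qc (by omega), one_mul]
  · refine determined_nf_two h4 ?_ hg h
    rw [hf]
    funext X
    rw [U_eq_pc (by omega), U_eq_pc (by omega), V_eq_qc (by omega), add_assoc]
  · rw [hf]
    exact (determined_nf_two_of_eq_three hf hg h).trans three_form
  · refine determined_nf_two_of_eq_two ?_ hg h
    rw [hf]
    funext X
    rw [W₁_eq_pc, V_eq_qc one_ne_zero, neg_sq]
  · have e1 := determined_nf_one le_rfl (c := -1) (by simp) rfl hg.neg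
      (f := fun X => ![pc X (2 - 2) + -1 * qc X (2 - 1) ^ 2]) (by
        have := h.neg
        convert this using 1
        · rw [hf]
          funext X i
          obtain rfl := Subsingleton.elim i 0
          simp [W₁_eq_pc, V_eq_qc]
          ring
        · rfl)
    have e2 : StrongEquiv (image 2) g (fun X => -g X) := by
      have := strongEquiv_const_mul (V := image 2) (f := fun X => g X 0) (g := fun X => -g X 0)
        (c := -1) (by simp) (by simp)
      rw [vec_one] at this
      have e3 : (fun X => ![-g X 0]) = fun X => -g X := vec_one fun X => -g X
      rwa [e3] at this
    rw [hf]
    exact (e2.trans e1).trans nf_one_of_eq_two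

theorem determined_two {f : Target k → Fin 2 → ℂ} (hf : IsNormalFormTwo k f) :
    VKDetermined (image k) 2 f := by
  intro g hg h
  refine StrongEquiv.vkEquiv (StrongEquiv.symm ?_)
  rcases hf with ⟨rfl, hf⟩ | ⟨rfl, hf⟩ | ⟨rfl, hf⟩
  · exact determined_pair_two hf hg h
  · exact determined_pair_three hf hg h
  · exact determined_pair_four hf hg h

theorem differentiable_evalP (p : Fin k → ℂ) : Differentiable ℂ (evalP p) := by
  unfold evalP; fun_prop

theorem differentiable_evalQ (q : Fin k → ℂ) : Differentiable ℂ (evalQ q) := by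
  unfold evalQ; fun_prop

theorem tendsto_evalQ_smul {l : Filter ℂ} {v : ℂ → Fin k → ℂ} {v₀ : Fin k → ℂ}
    {y : ℂ → ℂ} {y₀ : ℂ} (hv : ∀ i, Tendsto (fun t => v t i) l (𝓝 (v₀ i)))
    (hy : Tendsto y l (𝓝 y₀)) : Tendsto (fun t => evalQ (v t) (y t)) l (𝓝 (evalQ v₀ y₀)) :=
  tendsto_finsetSum _ fun i _ => (hv i).mul (hy.pow _)

theorem evalQ_sub (v v' : Fin k → ℂ) (y : ℂ) : evalQ (v - v') y = evalQ v y - evalQ v' y := by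
  simp [evalQ, sub_mul]

theorem evalQ_add (v v' : Fin k → ℂ) (y : ℂ) : evalQ (v + v') y = evalQ v y + evalQ v' y := by
  simp [evalQ, add_mul, sum_add_distrib]

theorem evalQ_smul (c : ℂ) (v : Fin k → ℂ) (y : ℂ) : evalQ (c • v) y = c * evalQ v y := by
  simp [evalQ, mul_sum, mul_assoc]

theorem evalQ_bound {v : Fin k → ℂ} {y : ℂ} (hy : ‖y‖ ≤ 1) : ‖evalQ v y‖ ≤ ∑ i, ‖v i‖ := by
  refine (norm_sum_le _ _).trans (sum_le_sum fun i _ => ?_)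
  rw [norm_mul, norm_pow]
  exact mul_le_of_le_one_right (norm_nonneg _) (pow_le_one₀ (norm_nonneg _) hy)

/-- Points on a curve of pairs with a common root, at a pair with a unique common root. -/
theorem unique_root_relation (hk : 2 ≤ k) {x : ℂ → Target k} {X' : Target k} {y₀ : ℂ}
    (hx : HasDerivAt x X' 0) (hV : ∀ᶠ t in 𝓝 0, x t ∈ image k)
    (hs : ∑ i, ‖pv (x 0) i‖ < 1) (hP : evalP (pv (x 0)) y₀ = 0) (hQ : evalQ (qv (x 0)) y₀ = 0)
    (hu : ∀ y, evalP (pv (x 0)) y = 0 → evalQ (qv (x 0)) y = 0 → y = y₀) :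
    evalQ (pv X') y₀ * deriv (evalQ (qv (x 0))) y₀ =
      evalQ (qv X') y₀ * deriv (evalP (pv (x 0))) y₀ := by
  have hp : ∀ i : Fin k, HasDerivAt (fun t => pv (x t) i) (pv X' i) 0 := fun i =>
    (pcL k i).hasFDerivAt.comp_hasDerivAt 0 hx
  have hq : ∀ i : Fin k, HasDerivAt (fun t => qv (x t) i) (qv X' i) 0 := fun i =>
    (qcL k i).hasFDerivAt.comp_hasDerivAt 0 hx
  have hex : ∀ᶠ t in 𝓝 (0 : ℂ), ∃ y, evalP (pv (x t)) y = 0 ∧ evalQ (qv (x t)) y = 0 ∧ ‖y‖ ≤ 1 := by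
    have h1 : ContinuousAt (fun t => ∑ i, ‖pv (x t) i‖) 0 :=
      tendsto_finsetSum _ fun i _ => (hp i).continuousAt.norm
    filter_upwards [hV, h1.eventually_lt continuousAt_const hs] with t h2 h3
    obtain ⟨y, e1, e2⟩ := (mem_image_iff hk _).1 h2
    exact ⟨y, e1, e2, (norm_lt_one_of_evalP h3 e1).le⟩
  obtain ⟨y, hy⟩ : ∃ y : ℂ → ℂ, ∀ᶠ t in 𝓝 (0 : ℂ), evalP (pv (x t)) (y t) = 0 ∧
      evalQ (qv (x t)) (y t) = 0 ∧ ‖y t‖ ≤ 1 := by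
    classical
    refine ⟨fun t => if h : ∃ y, evalP (pv (x t)) y = 0 ∧ evalQ (qv (x t)) y = 0 ∧ ‖y‖ ≤ 1 then
      h.choose else 0, ?_⟩
    filter_upwards [hex] with t ht
    rw [dif_pos ht]
    exact ht.choose_spec
  have small : ∀ {v : ℂ → Fin k → ℂ} {v₀ : Fin k → ℂ}, (∀ i, Tendsto (fun t => v t i) (𝓝[≠] 0)
      (𝓝 (v₀ i))) → Tendsto (fun t => evalQ (v t) (y t) - evalQ v₀ (y t)) (𝓝[≠] 0) (𝓝 0) := by
    intro v v₀ hv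
    have h1 : Tendsto (fun t => ∑ i, ‖v t i - v₀ i‖) (𝓝[≠] 0) (𝓝 0) := by
      have h2 : Tendsto (fun t => ∑ i, ‖v t i - v₀ i‖) (𝓝[≠] 0) (𝓝 (∑ i, ‖v₀ i - v₀ i‖)) :=
        tendsto_finsetSum _ fun i _ => ((hv i).sub_const _).norm
      simpa using h2
    refine squeeze_zero_norm' ?_ h1
    filter_upwards [hy.filter_mono nhdsWithin_le_nhds] with t ht
    rw [← evalQ_sub]
    exact evalQ_bound ht.2.2
  have cp : ∀ i : Fin k, Tendsto (fun t => pv (x t) i) (𝓝[≠] 0) (𝓝 (pv (x 0) i)) := fun i =>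
    (hp i).continuousAt.tendsto.mono_left nhdsWithin_le_nhds
  have cq : ∀ i : Fin k, Tendsto (fun t => qv (x t) i) (𝓝[≠] 0) (𝓝 (qv (x 0) i)) := fun i =>
    (hq i).continuousAt.tendsto.mono_left nhdsWithin_le_nhds
  have hdiff : ∀ t, evalP (pv (x t)) (y t) - evalP (pv (x 0)) (y t) =
      evalQ (pv (x t)) (y t) - evalQ (pv (x 0)) (y t) := fun t => by
    simp only [evalP, evalQ]; ring
  have hP0 : Tendsto (fun t => evalP (pv (x 0)) (y t)) (𝓝[≠] 0) (𝓝 0) := by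
    have := (small cp).neg
    rw [neg_zero] at this
    refine this.congr' ?_
    filter_upwards [hy.filter_mono nhdsWithin_le_nhds] with t ht
    rw [← hdiff, ht.1]
    ring
  have hQ0 : Tendsto (fun t => evalQ (qv (x 0)) (y t)) (𝓝[≠] 0) (𝓝 0) := by
    have := (small cq).neg
    rw [neg_zero] at this
    refine this.congr' ?_
    filter_upwards [hy.filter_mono nhdsWithin_le_nhds] with t ht
    rw [ht.2.1]
    ring
  have hyt : Tendsto y (𝓝[≠] 0) (𝓝 y₀) := by
    refine (isCompact_closedBall (0 : ℂ) 1).tendsto_nhds_of_unique_mapClusterPt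
      (by filter_upwards [hy.filter_mono nhdsWithin_le_nhds] with t ht using by simpa using ht.2.2)
      fun z _ hz => hu z ?_ ?_
    · have h1 := hz.continuousAt_comp (differentiable_evalP (pv (x 0))).continuous.continuousAt
      exact eq_of_nhds_neBot (h1.clusterPt.mono hP0)
    · have h1 := hz.continuousAt_comp (differentiable_evalQ (qv (x 0))).continuous.continuousAt
      exact eq_of_nhds_neBot (h1.clusterPt.mono hQ0)
  have quot : ∀ {v : ℂ → Fin k → ℂ} {v' : Fin k → ℂ}, (∀ i, HasDerivAt (fun t => v t i) (v' i) 0) →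
      Tendsto (fun t => t⁻¹ * (evalQ (v t) (y t) - evalQ (v 0) (y t))) (𝓝[≠] 0)
        (𝓝 (evalQ v' y₀)) := by
    intro v v' hv
    have h1 := tendsto_evalQ_smul (l := 𝓝[≠] 0) (v := fun t => t⁻¹ • (v t - v 0)) (v₀ := v') (y := y)
      (fun i => by simpa using (hasDerivAt_iff_tendsto_slope_zero.1 (hv i))) hyt
    refine h1.congr fun t => ?_
    rw [evalQ_smul, evalQ_sub]
  have sl : ∀ {f : ℂ → ℂ}, Differentiable ℂ f →
      Tendsto (fun t => dslope f y₀ (y t)) (𝓝[≠] 0) (𝓝 (deriv f y₀)) := by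
    intro f hf
    have h1 := (continuousAt_dslope_same.2 (hf y₀)).tendsto.comp hyt
    rwa [dslope_same] at h1
  have l1 := (quot hp).mul (sl (differentiable_evalQ (qv (x 0))))
  have l2 := (quot hq).mul (sl (differentiable_evalP (pv (x 0))))
  refine tendsto_nhds_unique l1 (l2.congr' ?_)
  filter_upwards [hy.filter_mono nhdsWithin_le_nhds] with t ht
  have e1 := sub_smul_dslope (evalP (pv (x 0))) y₀ (y t)
  have e2 := sub_smul_dslope (evalQ (qv (x 0))) y₀ (y t)
  rw [smul_eq_mul, hP, sub_zero] at e1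
  rw [smul_eq_mul, hQ, sub_zero] at e2
  have e3 := hdiff t
  rw [ht.1] at e3
  rw [← e3, ht.2.1, ← e1, ← e2]
  ring

/-- The relation satisfied by the fields in `Θ_V` at the pairs with a unique common root. -/
theorem IsThetaV.unique_root (hk : 2 ≤ k) (hξ : IsThetaV (image k) ξ) :
    ∀ᶠ X in 𝓝 (0 : Target k), ∀ y₀, evalP (pv X) y₀ = 0 → evalQ (qv X) y₀ = 0 →
      (∀ y, evalP (pv X) y = 0 → evalQ (qv X) y = 0 → y = y₀) →
      evalQ (pv (ξ X)) y₀ * deriv (evalQ (qv X)) y₀ =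
        evalQ (qv (ξ X)) y₀ * deriv (evalP (pv X)) y₀ := by
  obtain ⟨-, Φ, -, h0, hd, -, hV⟩ := hξ
  have t1 : Tendsto (fun X : Target k => ((0 : ℂ), X)) (𝓝 0) (𝓝 0) :=
    (Continuous.prodMk_right _).tendsto' _ _ rfl
  have hs : ∀ᶠ X in 𝓝 (0 : Target k), ∑ i, ‖pv X i‖ < 1 := by
    have h1 : ContinuousAt (fun X : Target k => ∑ i, ‖pv X i‖) 0 :=
      tendsto_finsetSum _ fun i _ => (pcL k i).continuous.continuousAt.norm
    refine h1.eventually_lt continuousAt_const ?_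
    simp [pv_zero]
  filter_upwards [h0, t1.eventually hd, t1.eventually hV.eventually_nhds, hs] with X e1 e2 e3 e4
    y₀ hP hQ hu
  have t2 : Tendsto (fun t : ℂ => (t, X)) (𝓝 0) (𝓝 (0, X)) := (Continuous.prodMk_left _).tendsto _
  have hX : X ∈ image k := (mem_image_iff hk X).2 ⟨y₀, hP, hQ⟩
  simp only [e1] at e2
  have := unique_root_relation hk (x := fun t => Φ (t, X)) (y₀ := y₀) e2
    ((t2.eventually e3).mono fun t ht => ht.1 hX)
  simp only [e1] at this
  exact this e4 hP hQ hu

theorem pv_add_smul (X L : Target k) (s : ℂ) : pv (X + s • L) = pv X + s • pv L := by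
  funext i; simp [pv, pc_add, pc_smul]

theorem qv_add_smul (X L : Target k) (s : ℂ) : qv (X + s • L) = qv X + s • qv L := by
  funext i; simp [qv, qc_add, qc_smul]

section Polynomials

open Polynomial

/-- The monic polynomial with lower coefficients `p`. -/
def polyP (p : Fin k → ℂ) : Polynomial ℂ := X ^ k + ∑ i, C (p i) * X ^ i.val

theorem eval_polyP (p : Fin k → ℂ) (y : ℂ) : (polyP p).eval y = evalP p y := by
  simp [polyP, evalP, eval_finsetSum]

theorem degree_sum_lt (p : Fin k → ℂ) : (∑ i, C (p i) * X ^ i.val).degree < (k : WithBot ℕ) := by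
  refine (degree_sum_le _ _).trans_lt ((Finset.sup_lt_iff (WithBot.bot_lt_coe k)).2 ?_)
  intro i _
  exact (degree_C_mul_X_pow_le _ _).trans_lt (WithBot.coe_lt_coe.2 i.isLt)

theorem monic_polyP (p : Fin k → ℂ) : (polyP p).Monic := monic_X_pow_add (degree_sum_lt p)

theorem natDegree_polyP (p : Fin k → ℂ) : (polyP p).natDegree = k := by
  refine natDegree_eq_of_degree_eq_some ?_
  rw [polyP, degree_add_eq_left_of_degree_lt, degree_X_pow]
  rw [degree_X_pow]
  exact degree_sum_lt p

theorem deriv_evalP_eq (p : Fin k → ℂ) (y : ℂ) :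
    deriv (evalP p) y = (polyP p).derivative.eval y := by
  rw [← Polynomial.deriv]
  congr 1
  funext z
  exact (eval_polyP p z).symm

/-- All roots of the monic polynomial with lower coefficients `p` are simple. -/
def SimpleRoots (p : Fin k → ℂ) : Prop := ∀ r, evalP p r = 0 → deriv (evalP p) r ≠ 0

theorem SimpleRoots.eq_zero {p : Fin k → ℂ} (hp : SimpleRoots p) {v : Fin k → ℂ}
    (hv : ∀ r, evalP p r = 0 → evalQ v r = 0) : v = 0 := by
  classical
  have hne := (monic_polyP p).ne_zero
  have h1 : (polyP p).roots.Nodup := by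
    rw [Multiset.nodup_iff_count_le_one]
    intro r
    rw [count_roots]
    by_contra! h
    rw [one_lt_rootMultiplicity_iff_isRoot hne] at h
    refine hp r ?_ ?_
    · rw [← eval_polyP]; exact h.1
    · rw [deriv_evalP_eq]; exact h.2
  have h2 : (polyP p).roots.toFinset.card = k := by
    rw [Multiset.toFinset_card_of_nodup h1]
    exact (splits_iff_card_roots.1 (IsAlgClosed.splits _)).trans (natDegree_polyP p)
  have h3 : (∑ i, C (v i) * X ^ i.val) = 0 := by
    refine eq_zero_of_degree_lt_of_eval_finset_eq_zero (s := (polyP p).roots.toFinset)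
      (by rw [h2]; exact degree_sum_lt v) fun r hr => ?_
    rw [Multiset.mem_toFinset, mem_roots hne] at hr
    have h4 := hv r (by rw [← eval_polyP]; exact hr)
    simpa [eval_finsetSum, evalQ] using h4
  funext i
  have h4 := congrArg (fun f => coeff f i.val) h3
  simpa [finsetSum_coeff, coeff_X_pow, ← Fin.ext_iff] using h4

theorem eventually_simpleRoots (hk : 0 < k) (p : Fin k → ℂ) :
    ∀ᶠ s in 𝓝[≠] (0 : ℂ), SimpleRoots (p + s • e0) := by
  have he : ∀ s y, evalP (p + s • e0) y = evalP p y + s := by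
    intro s y
    have : ∑ i : Fin k, (s • e0 : Fin k → ℂ) i * y ^ i.val = s := by
      rw [sum_eq_single ⟨0, hk⟩]
      · simp [e0]
      · intro i _ hi
        have : i.val ≠ 0 := fun h => hi (Fin.ext h)
        simp [e0, this]
      · simp
    simp only [evalP, Pi.add_apply, add_mul, sum_add_distrib, this]
    ring
  have hd : (polyP p).derivative ≠ 0 := by
    intro h
    have := derivative_eq_zero.1 h
    rw [natDegree_polyP] at this
    omega
  set S : Set ℂ := (fun y => -evalP p y) '' ((polyP p).derivative.rootSet ℂ) with hS
  have hfin : S.Finite := (rootSet_finite _ _).image _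
  have h1 : ∀ᶠ s in 𝓝 (0 : ℂ), s ∉ S \ {0} :=
    (hfin.subset Set.sdiff_subset).isClosed.isOpen_compl.mem_nhds (by simp)
  filter_upwards [h1.filter_mono nhdsWithin_le_nhds, self_mem_nhdsWithin] with s hs hs0 r hr hr'
  refine hs ⟨⟨r, ?_, ?_⟩, hs0⟩
  · rw [mem_rootSet_of_ne hd, coe_aeval_eq_eval, ← deriv_evalP_eq]
    have : evalP (p + s • e0) = fun y => evalP p y + s := funext (he s)
    rwa [this, deriv_add_const] at hr'
  · rw [he] at hr
    simp only
    linear_combination -hr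

end Polynomials

theorem eventually_eq_zero_of_simpleRoots (hk : 2 ≤ k) {F : Target k → Fin k → ℂ}
    (hF : ∀ᶠ X in 𝓝 (0 : Target k), ContinuousAt F X)
    (h : ∀ᶠ X in 𝓝 (0 : Target k), qv X = 0 → SimpleRoots (pv X) →
      ∀ r, evalP (pv X) r = 0 → evalQ (F X) r = 0) :
    ∀ᶠ X in 𝓝 (0 : Target k), qv X = 0 → F X = 0 := by
  filter_upwards [hF, h.eventually_nhds] with X h1 h2 h3
  set e : Target k := bas k (.inl ⟨0, by omega⟩)
  have hpe : pv e = e0 := by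
    funext i
    simp only [e, pv, e0, pc_bas_inl hk]
  have hqe : qv e = 0 := by
    funext i
    simp only [e, qv, qc_bas_inl hk, Pi.zero_apply]
  have t : Tendsto (fun s : ℂ => X + s • e) (𝓝 0) (𝓝 X) :=
    Continuous.tendsto' (by fun_prop) _ _ (by simp)
  have h4 : Tendsto (fun s : ℂ => F (X + s • e)) (𝓝[≠] 0) (𝓝 (F X)) :=
    (h1.tendsto.comp t).mono_left nhdsWithin_le_nhds
  refine tendsto_nhds_unique h4 (tendsto_const_nhds.congr' ?_)
  filter_upwards [(t.eventually h2).filter_mono nhdsWithin_le_nhds,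
    eventually_simpleRoots (by omega) (pv X)] with s h5 h6
  rw [pv_add_smul, qv_add_smul, hpe, hqe, h3, smul_zero, add_zero] at h5
  exact (h6.eq_zero (h5 rfl h6)).symm

/-- Along a direction `L` in the second block, at a point where the second block vanishes. -/
theorem IsThetaV.simple_root (hk : 2 ≤ k) (hξ : IsThetaV (image k) ξ) :
    ∀ᶠ X in 𝓝 (0 : Target k), qv X = 0 → ∀ (L : Target k) (r : ℂ), pv L = 0 →
      evalP (pv X) r = 0 → evalQ (qv L) r = 0 → deriv (evalP (pv X)) r ≠ 0 →
      (∀ y, evalP (pv X) y = 0 → evalQ (qv L) y = 0 → y = r) →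
      evalQ (qv (ξ X)) r = 0 ∧ evalQ (pv (ξ X)) r * deriv (evalQ (qv L)) r =
        evalQ (qv (𝒟 ξ X L)) r * deriv (evalP (pv X)) r := by
  filter_upwards [hξ.1.eventually_analyticAt, (hξ.unique_root hk).eventually_nhds] with
    X han hu hqX L r hpL hP hQ hd hun
  have t : Tendsto (fun s : ℂ => X + s • L) (𝓝 0) (𝓝 X) :=
    Continuous.tendsto' (by fun_prop) _ _ (by simp)
  have hder : HasDerivAt (fun s : ℂ => ξ (X + s • L)) (𝒟 ξ X L) 0 := by
    have h1 : HasDerivAt (fun s : ℂ => X + s • L) L 0 := by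
      simpa using ((hasDerivAt_id (0 : ℂ)).smul_const L).const_add X
    have h2 : HasFDerivAt ξ (𝒟 ξ X) (X + (0 : ℂ) • L) := by
      simpa using han.differentiableAt.hasFDerivAt
    exact h2.comp_hasDerivAt 0 h1
  set g : ℂ → ℂ := fun s => evalQ (qv (ξ (X + s • L))) r with hg
  have hgd : HasDerivAt g (evalQ (qv (𝒟 ξ X L)) r) 0 := by
    have h1 : ∀ i : Fin k, HasDerivAt (fun s : ℂ => qv (ξ (X + s • L)) i)
        (qv (𝒟 ξ X L) i) 0 := fun i => (qcL k i).hasFDerivAt.comp_hasDerivAt 0 hder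
    exact HasDerivAt.fun_sum fun i _ => (h1 i).mul_const _
  have hf : Tendsto (fun s : ℂ => evalQ (pv (ξ (X + s • L))) r) (𝓝[≠] 0)
      (𝓝 (evalQ (pv (ξ X)) r)) := by
    have h1 : ∀ i : Fin k, Tendsto (fun s : ℂ => pv (ξ (X + s • L)) i) (𝓝[≠] 0)
        (𝓝 (pv (ξ X) i)) := fun i =>
      (((pcL k i).continuous.continuousAt (x := ξ X)).tendsto.comp
        (han.continuousAt.tendsto.comp t)).mono_left nhdsWithin_le_nhds
    exact tendsto_finsetSum _ fun i _ => (h1 i).mul_const _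
  have hrel : ∀ᶠ s in 𝓝[≠] (0 : ℂ), evalQ (pv (ξ (X + s • L))) r * (s * deriv (evalQ (qv L)) r) =
      g s * deriv (evalP (pv X)) r := by
    filter_upwards [(t.eventually hu).filter_mono nhdsWithin_le_nhds, self_mem_nhdsWithin] with s h1 h2
    have h3 : evalQ (s • qv L) = fun y => s * evalQ (qv L) y := funext fun y => evalQ_smul _ _ _
    rw [pv_add_smul, qv_add_smul, hpL, hqX, smul_zero, add_zero, zero_add, h3] at h1
    simp only [deriv_const_mul_field] at h1
    exact h1 r hP (by rw [hQ, mul_zero])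
      fun y hy hy' => hun y hy ((mul_eq_zero.1 hy').resolve_left h2)
  have hg0 : g 0 = 0 := by
    have h1 : Tendsto (fun s => g s * deriv (evalP (pv X)) r) (𝓝[≠] 0)
        (𝓝 (g 0 * deriv (evalP (pv X)) r)) :=
      (hgd.continuousAt.tendsto.mul_const _).mono_left nhdsWithin_le_nhds
    have h2 : Tendsto (fun s : ℂ => s) (𝓝[≠] 0) (𝓝 0) := nhdsWithin_le_nhds
    have h3 := (hf.mul (h2.mul_const (deriv (evalQ (qv L)) r))).congr' hrel
    have h4 := tendsto_nhds_unique h1 h3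
    rw [zero_mul, mul_zero] at h4
    exact (mul_eq_zero.1 h4).resolve_right hd
  refine ⟨by simpa [hg] using hg0, ?_⟩
  have h1 := (hasDerivAt_iff_tendsto_slope_zero.1 hgd).mul_const (deriv (evalP (pv X)) r)
  refine tendsto_nhds_unique (hf.mul_const _) (h1.congr' ?_)
  filter_upwards [hrel, self_mem_nhdsWithin] with s h2 h3
  rw [hg0, zero_add, sub_zero, smul_eq_mul, mul_assoc, ← h2]
  have h3 : s ≠ 0 := h3
  field_simp

/-- The direction `y - r` in the second block. -/
def dirL (hk : 2 ≤ k) (r : ℂ) : Target k :=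
  bas k (.inr ⟨1, by omega⟩) - r • bas k (.inr ⟨0, by omega⟩)

theorem evalQ_dirL (hk : 2 ≤ k) (r y : ℂ) : evalQ (qv (dirL hk r)) y = y - r := by
  have h : ∀ j : Fin k, evalQ (qv (bas k (.inr j))) y = y ^ j.val := by
    intro j
    simp only [evalQ, qv, qc_bas_inr hk, ← Fin.ext_iff]
    simp
  have h1 : qv (dirL hk r) = qv (bas k (.inr ⟨1, by omega⟩)) -
      r • qv (bas k (.inr ⟨0, by omega⟩)) := by
    rw [dirL, sub_eq_add_neg, ← neg_smul, qv_add_smul, neg_smul, ← sub_eq_add_neg]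
  rw [h1, evalQ_sub, evalQ_smul, h, h]
  simp

theorem pv_dirL (hk : 2 ≤ k) (r : ℂ) : pv (dirL hk r) = 0 := by
  rw [dirL, sub_eq_add_neg, ← neg_smul, pv_add_smul]
  funext i
  simp [pv, pc_bas_inr hk]

theorem IsThetaV.simpleRoots (hk : 2 ≤ k) (hξ : IsThetaV (image k) ξ) :
    ∀ᶠ X in 𝓝 (0 : Target k), qv X = 0 → SimpleRoots (pv X) → ∀ r, evalP (pv X) r = 0 →
      evalQ (qv (ξ X)) r = 0 ∧ evalQ (pv (ξ X)) r =
        evalQ (qv (𝒟 ξ X (dirL hk r))) r * deriv (evalP (pv X)) r := by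
  filter_upwards [hξ.simple_root hk] with X hX hq hs r hr
  have h1 : deriv (evalQ (qv (dirL hk r))) r = 1 := by
    rw [show evalQ (qv (dirL hk r)) = fun y => y - r from funext (evalQ_dirL hk r)]
    simp
  have h2 := hX hq (dirL hk r) r (pv_dirL hk r) hr (by rw [evalQ_dirL, sub_self]) (hs r hr)
    fun y _ hy => by rwa [evalQ_dirL, sub_eq_zero] at hy
  rwa [h1, mul_one] at h2

/-- The fields in `Θ_V` are tangent to the locus where the second block vanishes. -/
theorem IsThetaV.qv_eq_zero (hk : 2 ≤ k) (hξ : IsThetaV (image k) ξ) :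
    ∀ᶠ X in 𝓝 (0 : Target k), qv X = 0 → qv (ξ X) = 0 := by
  refine eventually_eq_zero_of_simpleRoots hk ?_ ?_
  · filter_upwards [hξ.1.eventually_analyticAt] with X hX
    exact continuousAt_pi.2 fun i => (qcL k i).continuous.continuousAt.comp hX.continuousAt
  · filter_upwards [hξ.simpleRoots hk] with X hX hq hs r hr using (hX hq hs r hr).1

/-- The coefficients of the polynomial `d` with `ξ_P = d P'` modulo `P` where `Q = 0`. -/
def dcoef (hk : 2 ≤ k) (ξ : Target k → Target k) (X : Target k) (m : ℕ) : ℂ :=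
  qc (𝒟 ξ X (bas k (.inr ⟨1, by omega⟩))) m -
    if m = 0 then 0 else qc (𝒟 ξ X (bas k (.inr ⟨0, by omega⟩))) (m - 1)

theorem analyticAt_dcoef (hk : 2 ≤ k) {X : Target k}
    (hξ : Hol ξ X) (m : ℕ) : Hol (fun X => dcoef hk ξ X m) X := by
  have h1 : ∀ (e : Target k) (i : ℕ), Hol (fun X => qc (𝒟 ξ X e) i) X :=
    fun e i => ((qcL k i).comp (apply ℂ (Target k) e)).analyticAt _ |>.comp
      hξ.fderiv
  unfold dcoef
  split_ifs
  · exact (h1 _ _).sub analyticAt_const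
  · exact (h1 _ _).sub (h1 _ _)

theorem sum_dcoef (hk : 2 ≤ k) (ξ : Target k → Target k) (X : Target k) (r : ℂ) :
    evalQ (qv (𝒟 ξ X (dirL hk r))) r = ∑ m ∈ range (k + 1), dcoef hk ξ X m * r ^ m := by
  simp only [dcoef, sub_mul, sum_sub_distrib]
  rw [sum_range_succ, qc_eq_zero _ (by omega) (by omega), zero_mul, add_zero,
    sum_range_succ']
  simp only [if_true, zero_mul, add_zero, Nat.add_one_ne_zero, if_false, Nat.add_sub_cancel]
  rw [dirL, map_sub, map_smul, sub_eq_add_neg, ← neg_smul, qv_add_smul, evalQ_add, evalQ_smul,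
    evalQ, evalQ, sum_range, sum_range, mul_sum, sub_eq_add_neg,
    ← sum_neg_distrib]
  congr 1
  refine sum_congr rfl fun i _ => ?_
  simp only [qv]
  ring

/-- The coefficients of the derivative of `P`. -/
def dvec (X : Target k) : Fin k → ℂ := fun i =>
  if i.val + 1 = k then (k : ℂ) else (i.val + 1) * pc X (i.val + 1)

theorem evalQ_dvec (hk : 0 < k) (X : Target k) (y : ℂ) :
    evalQ (dvec X) y = deriv (evalP (pv X)) y := by
  have h1 : HasDerivAt (evalP (pv X)) (k * y ^ (k - 1) + ∑ i : Fin k, pv X i * (i.val * y ^ (i.val - 1)))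
      y := (hasDerivAt_pow k y).add (HasDerivAt.fun_sum fun i _ => (hasDerivAt_pow i.val y).const_mul _)
  rw [h1.deriv]
  obtain ⟨n, rfl⟩ : ∃ n, k = n + 1 := ⟨k - 1, by omega⟩
  rw [evalQ, Fin.sum_univ_castSucc, Fin.sum_univ_succ]
  have h2 : ∀ i : Fin n, i.val ≠ n := fun i => i.isLt.ne
  simp only [dvec, pv, Fin.val_castSucc, Fin.val_last, Fin.val_succ, Fin.val_zero, add_left_inj, h2,
    if_false, if_true, Nat.add_sub_cancel, Nat.cast_zero, zero_mul, mul_zero, zero_add]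
  rw [add_comm]
  congr 1
  refine sum_congr rfl fun i _ => ?_
  push_cast
  ring

theorem continuous_compan_pv : Continuous fun X : Target k => compan (pv X) := by
  refine continuous_matrix fun i j => ?_
  simp only [compan, Matrix.of_apply, pv]
  split_ifs
  exacts [(pcL k _).continuous.neg, continuous_const, continuous_const]

/-- The restriction of a field in `Θ_V` to the locus where the second block vanishes. -/
theorem IsThetaV.pv_eq (hk : 2 ≤ k) (hξ : IsThetaV (image k) ξ) :
    ∀ᶠ X in 𝓝 (0 : Target k), qv X = 0 → pv (ξ X) =
      ∑ m ∈ range (k + 1), dcoef hk ξ X m • (compan (pv X) ^ m).mulVec (dvec X) := by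
  have h := eventually_eq_zero_of_simpleRoots hk (F := fun X => pv (ξ X) -
      ∑ m ∈ range (k + 1), dcoef hk ξ X m • (compan (pv X) ^ m).mulVec (dvec X)) ?_ ?_
  · filter_upwards [h] with X hX hq using sub_eq_zero.1 (hX hq)
  · filter_upwards [hξ.1.eventually_analyticAt] with X hX
    have c1 : ∀ i, Continuous fun X : Target k => pc X i := fun i => (pcL k i).continuous
    have c3 : Continuous fun X : Target k => dvec X := by
      refine continuous_pi fun i => ?_
      simp only [dvec]
      split_ifs
      exacts [continuous_const, continuous_const.mul (c1 _)]
    have c4 : ContinuousAt (fun X => pv (ξ X)) X :=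
      continuousAt_pi.2 fun i => (c1 _).continuousAt.comp hX.continuousAt
    refine c4.sub (tendsto_finsetSum _ fun m _ => ?_)
    exact (analyticAt_dcoef hk hX m).continuousAt.smul
      ((continuous_compan_pv.pow m).matrix_mulVec c3).continuousAt
  · filter_upwards [hξ.simpleRoots hk] with X hX hq hs r hr
    rw [evalQ_sub, (hX hq hs r hr).2, sum_dcoef, ← evalQ_dvec (by omega), ← ev_dotProduct r (∑ _ ∈ _, _),
      dotProduct_sum, sum_mul, sub_eq_zero]
    refine sum_congr rfl fun m _ => ?_
    have h1 := vecMul_aeval_of_vecMul (ev_vecMul_compan_of_root hr) (Polynomial.X ^ m)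
    rw [map_pow, Polynomial.aeval_X, Polynomial.eval_pow, Polynomial.eval_X] at h1
    rw [dotProduct_smul, Matrix.dotProduct_mulVec, h1, smul_dotProduct, ev_dotProduct]
    simp only [smul_eq_mul]
    ring

theorem coeff_eq_zero_of_isBigO : ∀ (n : ℕ) {a : ℕ → ℂ},
    (fun c => ∑ i ∈ range n, a i * c ^ i) =O[𝓝[≠] 0] (fun c : ℂ => c ^ n) → ∀ i < n, a i = 0
  | 0, _, _ => by simp
  | n + 1, a, h => by
    have h0 : a 0 = 0 := by
      have h1 : Tendsto (fun c : ℂ => c ^ (n + 1)) (𝓝[≠] 0) (𝓝 0) :=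
        (Continuous.tendsto' (by fun_prop) _ _ (by simp)).mono_left nhdsWithin_le_nhds
      have h2 : Tendsto (fun c => ∑ i ∈ range (n + 1), a i * c ^ i) (𝓝[≠] 0) (𝓝 (a 0)) := by
        refine (Continuous.tendsto' (by fun_prop) _ _ ?_).mono_left nhdsWithin_le_nhds
        rw [sum_range_succ']
        simp
      exact tendsto_nhds_unique h2 (h.trans_tendsto h1)
    have h3 : (fun c => ∑ i ∈ range n, a (i + 1) * c ^ i) =O[𝓝[≠] 0] (fun c : ℂ => c ^ n) := by
      refine ((isBigO_refl (fun c : ℂ => c⁻¹) (𝓝[≠] 0)).mul h).congr' ?_ ?_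
      · filter_upwards [self_mem_nhdsWithin] with c hc
        have hc : c ≠ 0 := hc
        rw [sum_range_succ', h0, zero_mul, add_zero, mul_sum]
        refine sum_congr rfl fun i _ => ?_
        field_simp
        ring
      · filter_upwards [self_mem_nhdsWithin] with c hc
        have hc : c ≠ 0 := hc
        rw [pow_succ', inv_mul_cancel_left₀ hc]
    intro i hi
    rcases i with _ | i
    · exact h0
    · exact coeff_eq_zero_of_isBigO n (a := fun i => a (i + 1)) h3 i (by omega)

/-- Evaluation at `y` of the first block. -/
def evP (k : ℕ) (y : ℂ) : Target k →L[ℂ] ℂ := ∑ i : Fin k, y ^ i.val • pcL k i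

/-- Evaluation at `y` of the second block. -/
def evQ (k : ℕ) (y : ℂ) : Target k →L[ℂ] ℂ := ∑ i : Fin k, y ^ i.val • qcL k i

theorem evP_apply (y : ℂ) (X : Target k) : evP k y X = evalQ (pv X) y := by
  simp [evP, evalQ, pv, mul_comm]

theorem evQ_apply (y : ℂ) (X : Target k) : evQ k y X = evalQ (qv X) y := by
  simp [evQ, evalQ, qv, mul_comm]

theorem evalP_eq (X : Target k) (y : ℂ) : evalP (pv X) y = y ^ k + evP k y X := by
  rw [evP_apply, evalP, evalQ]

theorem evP_inl (hk : 2 ≤ k) (y : ℂ) (j : Fin (k - 1)) : evP k y (bas k (.inl j)) = y ^ j.val := by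
  rw [evP_apply, evalQ, sum_eq_single ⟨j.val, by omega⟩]
  · simp [pv, pc_bas_inl hk]
  · intro i _ hi
    have : i.val ≠ j.val := fun h => hi (Fin.ext h)
    simp [pv, pc_bas_inl hk, this]
  · simp

theorem evP_inr (hk : 2 ≤ k) (y : ℂ) (j : Fin k) : evP k y (bas k (.inr j)) = 0 := by
  simp [evP_apply, evalQ, pv, pc_bas_inr hk]

theorem evQ_inl (hk : 2 ≤ k) (y : ℂ) (j : Fin (k - 1)) : evQ k y (bas k (.inl j)) = 0 := by
  simp [evQ_apply, evalQ, qv, qc_bas_inl hk]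

theorem evQ_inr (hk : 2 ≤ k) (y : ℂ) (j : Fin k) : evQ k y (bas k (.inr j)) = y ^ j.val := by
  simp only [evQ_apply, evalQ, qv, qc_bas_inr hk, ← Fin.ext_iff]
  simp

theorem pv_last (hk : 2 ≤ k) (X : Target k) : pc X (k - 1) = 0 := pc_eq_zero X (by omega) (by omega)

theorem evP_eq_sum (hk : 2 ≤ k) (y : ℂ) (X : Target k) :
    evP k y X = ∑ i ∈ range (k - 1), pc X i * y ^ i := by
  have : evP k y X = ∑ i ∈ range k, pc X i * y ^ i := by rw [evP_apply, evalQ, sum_range]; rfl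
  rw [this]
  obtain ⟨n, rfl⟩ : ∃ n, k = n + 1 := ⟨k - 1, by omega⟩
  have h := pv_last hk X
  rw [Nat.add_sub_cancel] at h
  rw [sum_range_succ, h]
  simp

theorem evQ_eq_sum (y : ℂ) (X : Target k) : evQ k y X = ∑ i ∈ range k, qc X i * y ^ i := by
  rw [evQ_apply, evalQ, sum_range]; rfl

/-- The vector `V_(k-1)`. -/
def eW (hk : 2 ≤ k) : Target k := eQ[k]

/-- Fields in `Θ_V` have no first block along the axis of `V_(k-1)`. -/
theorem IsThetaV.pc_axis (hk : 2 ≤ k) (hξ : IsThetaV (image k) ξ) :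
    ∀ᶠ w in 𝓝[≠] (0 : ℂ), ∀ i, i ≤ k - 2 → pc (ξ (w • eW hk)) i = 0 := by
  have t : Tendsto (fun w : ℂ => w • eW hk) (𝓝[≠] 0) (𝓝 0) :=
    (Continuous.tendsto' (by fun_prop) _ _ (by simp)).mono_left nhdsWithin_le_nhds
  filter_upwards [t.eventually (hξ.unique_root hk).eventually_nhds, self_mem_nhdsWithin,
    t.eventually hξ.1.eventually_analyticAt] with w hu hw han i hi
  have hw : w ≠ 0 := hw
  rcases hk.eq_or_lt with rfl | hk3
  · have h := hu.self_of_nhds 0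
    have hP : ∀ y, evalP (pv (w • eW hk)) y = y ^ 2 := fun y => by
      rw [evalP_eq, map_smul, eW, evP_inr hk]; simp
    have hQ : ∀ y, evalQ (qv (w • eW hk)) y = w * y := fun y => by
      rw [← evQ_apply, map_smul, eW, evQ_inr hk]; simp
    rw [funext hP, funext hQ] at h
    simp only [← evP_apply, ← evQ_apply] at h
    have h1 := h (by simp) (by simp) (by simp)
    have hi : i = 0 := by omega
    subst hi
    rw [evP_eq_sum hk] at h1
    simpa [hw] using h1
  · have hk1 : ((k : ℂ) - 1) ≠ 0 := by
      have : (k : ℂ) ≠ 1 := by exact_mod_cast (by omega : k ≠ 1)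
      exact sub_ne_zero.2 this
    set Z : ℂ → Target k := fun c => (c * (k - 1)) • bas k (.inl ⟨0, by omega⟩) -
      (k : ℂ) • bas k (.inl ⟨1, by omega⟩) - w • bas k (.inr ⟨0, by omega⟩) with hZ
    set X : ℂ → Target k := fun c => w • eW hk + c ^ (k - 1) • Z c with hX
    have hZc : Continuous Z := by fun_prop
    have t2 : Tendsto X (𝓝[≠] 0) (𝓝 (w • eW hk)) := by
      refine (Continuous.tendsto' (by fun_prop) _ _ ?_).mono_left nhdsWithin_le_nhds
      simp [hX, zero_pow (by omega : k - 1 ≠ 0)]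
    have hP : ∀ c y, evalP (pv (X c)) y = y ^ k + c ^ (k - 1) * (c * (k - 1) - k * y) := by
      intro c y
      rw [evalP_eq]
      simp only [hX, hZ, eW, map_add, map_sub, map_smul, evP_inl hk, evP_inr hk]
      simp
    have hQ : ∀ c y, evalQ (qv (X c)) y = w * (y ^ (k - 1) - c ^ (k - 1)) := by
      intro c y
      rw [← evQ_apply]
      simp only [hX, hZ, eW, map_add, map_sub, map_smul, evQ_inl hk, evQ_inr hk]
      simp
      ring
    have hkk : ∀ y : ℂ, y ^ k = y * y ^ (k - 1) := fun y => by
      rw [← pow_succ', Nat.sub_add_cancel (by omega)]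
    have key : ∀ᶠ c in 𝓝[≠] (0 : ℂ), evP k c (ξ (X c)) = 0 := by
      filter_upwards [t2.eventually hu, self_mem_nhdsWithin] with c h hc
      have hc : c ≠ 0 := hc
      have h1 := h c
      have dP : deriv (evalP (pv (X c))) c = 0 := by
        rw [funext (hP c)]
        have : HasDerivAt (fun y : ℂ => y ^ k + c ^ (k - 1) * (c * (k - 1) - k * y))
            (k * c ^ (k - 1) + c ^ (k - 1) * (-(k * 1))) c :=
          (hasDerivAt_pow k c).add ((((hasDerivAt_id c).const_mul (k : ℂ)).const_sub _).const_mul _)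
        rw [this.deriv]
        ring
      have dQ : deriv (evalQ (qv (X c))) c = w * ((k - 1 : ℕ) * c ^ (k - 1 - 1)) := by
        rw [funext (hQ c)]
        exact (((hasDerivAt_pow (k - 1) c).sub_const _).const_mul w).deriv
      rw [dP, dQ, mul_zero, hP, hQ] at h1
      have h2 := h1 (by rw [hkk]; ring) (by ring) fun y hy hy' => by
        rw [hQ] at hy'
        rw [hP, hkk] at hy
        have h3 : y ^ (k - 1) = c ^ (k - 1) := by
          have := (mul_eq_zero.1 hy').resolve_left hw
          linear_combination this
        rw [h3] at hy
        have h4 : ((k - 1 : ℂ) * c ^ (k - 1)) * (y - c) = 0 := by linear_combination -hy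
        exact sub_eq_zero.1 ((mul_eq_zero.1 h4).resolve_left (mul_ne_zero hk1 (pow_ne_zero _ hc)))
      rw [evP_apply]
      refine (mul_eq_zero.1 h2).resolve_right (mul_ne_zero hw (mul_ne_zero ?_ (pow_ne_zero _ hc)))
      rw [Nat.cast_ne_zero]
      omega
    refine coeff_eq_zero_of_isBigO (k - 1) (a := pc (ξ (w • eW hk))) ?_ i (by omega)
    have b1 : (fun c => ξ (X c) - ξ (w • eW hk)) =O[𝓝[≠] 0] (fun c : ℂ => c ^ (k - 1)) := by
      refine (han.differentiableAt.isBigO_sub.comp_tendsto t2).trans ?_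
      have hb : Z =O[𝓝[≠] 0] (fun _ => (1 : ℂ)) :=
        (hZc.continuousAt.tendsto.mono_left nhdsWithin_le_nhds).isBigO_one ℂ
      refine ((isBigO_refl (fun c : ℂ => c ^ (k - 1)) (𝓝[≠] 0)).smul hb).congr ?_ ?_
      · intro c; simp [hX]
      · intro c; simp
    have b2 : ∀ j, (fun c => pc (ξ (X c)) j - pc (ξ (w • eW hk)) j) =O[𝓝[≠] 0]
        (fun c : ℂ => c ^ (k - 1)) := fun j =>
      ((pcL k j).isBigO_comp _ _).trans b1 |>.congr_left fun c => map_sub (pcL k j) _ _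
    have b3 : (fun c => ∑ j ∈ range (k - 1), (pc (ξ (X c)) j - pc (ξ (w • eW hk)) j) * c ^ j)
        =O[𝓝[≠] 0] (fun c : ℂ => c ^ (k - 1)) := by
      refine IsBigO.fun_sum fun j _ => ?_
      have hb : (fun c : ℂ => c ^ j) =O[𝓝[≠] 0] (fun _ => (1 : ℂ)) :=
        ((continuous_pow j).continuousAt.tendsto.mono_left nhdsWithin_le_nhds).isBigO_one ℂ
      simpa using (b2 j).mul hb
    refine b3.neg_left.congr' ?_ EventuallyEq.rfl
    filter_upwards [key] with c hc
    rw [evP_eq_sum hk] at hc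
    simp only [sub_mul, sum_sub_distrib, hc]
    ring

theorem compan_pow_add_mulVec_e0 (hk : 0 < k) (X : Target k) (m : ℕ) :
    (compan (pv X) ^ (m + k)).mulVec e0 =
      -∑ i ∈ range k, pc X i • (compan (pv X) ^ (m + i)).mulVec e0 := by
  rw [pow_add, ← Matrix.mulVec_mulVec, compan_pow_self_mulVec_e0 hk, Matrix.mulVec_neg,
    mulVec_eq_matEval (pv X) (pv X), Matrix.mulVec_sum, sum_range]
  congr 1
  refine sum_congr rfl fun i _ => ?_
  rw [← mulVec_eq_matEval (pv X) (pv X), Matrix.mulVec_smul, Matrix.mulVec_mulVec, ← pow_add]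
  rfl

theorem compan_pow_succ_mulVec_dvec (hk : 2 ≤ k) (X : Target k) (m : ℕ) :
    (compan (pv X) ^ (m + 1)).mulVec (dvec X) =
      -∑ i ∈ range k, ((k - i : ℂ) * pc X i) • (compan (pv X) ^ (m + i)).mulVec e0 := by
  obtain ⟨n, rfl⟩ : ∃ n, k = n + 1 := ⟨k - 1, by omega⟩
  set C := compan (pv X) with hC
  have h1 : dvec X = ∑ i ∈ range n, ((i + 1 : ℂ) * pc X (i + 1)) • (C ^ i).mulVec e0 +
      ((n + 1 : ℕ) : ℂ) • (C ^ n).mulVec e0 := by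
    conv_lhs => rw [mulVec_eq_matEval (pv X) (dvec X)]
    rw [Fin.sum_univ_castSucc, sum_range]
    have h2 : ∀ i : Fin n, i.val ≠ n := fun i => i.isLt.ne
    simp [dvec, h2, hC]
  have h3 : ∀ a b, (C ^ a).mulVec ((C ^ b).mulVec e0) = (C ^ (a + b)).mulVec e0 := fun a b => by
    rw [Matrix.mulVec_mulVec, pow_add]
  have h4 : (C ^ (m + (n + 1))).mulVec e0 =
      -∑ i ∈ range (n + 1), pc X i • (C ^ (m + i)).mulVec e0 :=
    compan_pow_add_mulVec_e0 (by omega) X m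
  rw [h1, Matrix.mulVec_add, Matrix.mulVec_sum]
  simp only [Matrix.mulVec_smul, h3]
  rw [show m + 1 + n = m + (n + 1) by ring, h4, smul_neg, smul_sum]
  have h5 : ∑ i ∈ range n, ((i + 1 : ℂ) * pc X (i + 1)) • (C ^ (m + 1 + i)).mulVec e0 =
      ∑ i ∈ range (n + 1), ((i : ℂ) * pc X i) • (C ^ (m + i)).mulVec e0 := by
    rw [sum_range_succ']
    simp only [Nat.cast_zero, zero_mul, zero_smul, add_zero]
    refine sum_congr rfl fun i _ => ?_
    rw [show m + 1 + i = m + (i + 1) by ring]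
    push_cast
    rfl
  rw [h5, ← sub_eq_add_neg, ← neg_sub, ← sum_sub_distrib]
  congr 1
  refine sum_congr rfl fun i _ => ?_
  rw [smul_smul, ← sub_smul]
  congr 1
  ring

theorem IsThetaV.dcoef_zero (hk : 2 ≤ k) (hξ : IsThetaV (image k) ξ) :
    dcoef hk ξ 0 0 = 0 := by
  have h := (hξ.pv_eq hk).self_of_nhds (by funext i; simp [qv, qc_zero])
  have h1 := congrFun h ⟨k - 1, by omega⟩
  rw [sum_range_succ'] at h1
  simp only [compan_pow_succ_mulVec_dvec hk, pc_zero, mul_zero, zero_smul, sum_const_zero,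
    neg_zero, smul_zero, zero_add, pow_zero, Matrix.one_mulVec, Pi.smul_apply, smul_eq_mul] at h1
  rw [hξ.zero, pv, pc_zero, dvec, if_pos (by simp; omega)] at h1
  have : (k : ℂ) ≠ 0 := by exact_mod_cast (by omega : k ≠ 0)
  exact (mul_eq_zero.1 h1.symm).resolve_right this

theorem isBigO_pow_pow {a b : ℕ} (hab : b ≤ a) :
    (fun t : ℂ => t ^ a) =O[𝓝 0] fun t : ℂ => t ^ b := by
  rcases hab.eq_or_lt with rfl | h
  · exact isBigO_refl _ _
  · exact (isLittleO_pow_pow h).isBigO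

theorem tendsto_smul_zero (e : Target k) : Tendsto (fun t : ℂ => t • e) (𝓝 0) (𝓝 0) :=
  Continuous.tendsto' (by fun_prop) _ _ (by simp)

theorem IsThetaV.qc_fderiv_inl (hk : 2 ≤ k) (hξ : IsThetaV (image k) ξ)
    (j : Fin (k - 1)) {i : ℕ} (hi : i ≤ k - 1) : qc (𝒟 ξ 0 (bas k (.inl j))) i = 0 := by
  have h1 : HasDerivAt (fun t : ℂ => qc (ξ (t • bas k (.inl j))) i)
      (qc (𝒟 ξ 0 (bas k (.inl j))) i) 0 :=
    (qcL k i).hasFDerivAt.comp_hasDerivAt 0 (hasDerivAt_comp_smul hξ.1 _)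
  refine h1.unique ((hasDerivAt_const (0 : ℂ) (0 : ℂ)).congr_of_eventuallyEq ?_)
  filter_upwards [(tendsto_smul_zero _).eventually (hξ.qv_eq_zero hk)] with t ht
  exact congrFun (ht (by funext l; simp [qv, qc_smul, qc_bas_inl hk])) ⟨i, by omega⟩

theorem IsThetaV.pc_fderiv_inl (hk : 2 ≤ k) (hξ : IsThetaV (image k) ξ)
    (j : Fin (k - 1)) {i : ℕ} (hi : i ≤ k - 2) : pc (𝒟 ξ 0 (bas k (.inl j))) i =
      if j.val ≤ i then -(k - j.val : ℂ) * dcoef hk ξ 0 (i - j.val + 1) else 0 := by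
  set e : Target k := bas k (.inl j) with he
  have h1 : HasDerivAt (fun t : ℂ => pc (ξ (t • e)) i) (pc (𝒟 ξ 0 e) i) 0 :=
    (pcL k i).hasFDerivAt.comp_hasDerivAt 0 (hasDerivAt_comp_smul hξ.1 _)
  have h2 := hasDerivAt_iff_tendsto_slope_zero.1 h1
  have t0 : Tendsto (fun t : ℂ => t • e) (𝓝[≠] 0) (𝓝 0) :=
    (tendsto_smul_zero e).mono_left nhdsWithin_le_nhds
  have td : ∀ m, Tendsto (fun t : ℂ => dcoef hk ξ (t • e) m) (𝓝[≠] 0) (𝓝 (dcoef hk ξ 0 m)) :=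
    fun m => (analyticAt_dcoef hk hξ.1 m).continuousAt.tendsto.comp t0
  have tc : ∀ m, Tendsto (fun t : ℂ => ((compan (pv (t • e)) ^ m).mulVec e0) ⟨i, by omega⟩) (𝓝[≠] 0)
      (𝓝 (if i = m then 1 else 0)) := by
    intro m
    have c1 : Continuous fun X : Target k => ((compan (pv X) ^ m).mulVec e0) (⟨i, by omega⟩ : Fin k) :=
      (continuous_apply (⟨i, by omega⟩ : Fin k)).comp (g := fun v : Fin k → ℂ => v ⟨i, by omega⟩)
        ((continuous_compan_pv.pow m).matrix_mulVec continuous_const)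
    have c2 := (c1.tendsto 0).comp t0
    rwa [pv_zero, mulVec_e0 (by omega), compan_zero_pow_apply, zero_add] at c2
  have h3 : Tendsto (fun t : ℂ => dcoef hk ξ (t • e) 0 * ((i + 1) * pc e (i + 1)) +
      ∑ m ∈ range k, dcoef hk ξ (t • e) (m + 1) * (-(k - j.val : ℂ) *
        ((compan (pv (t • e)) ^ (m + j.val)).mulVec e0) ⟨i, by omega⟩)) (𝓝[≠] 0)
      (𝓝 (dcoef hk ξ 0 0 * ((i + 1) * pc e (i + 1)) + ∑ m ∈ range k,
        dcoef hk ξ 0 (m + 1) * (-(k - j.val : ℂ) * if i = m + j.val then 1 else 0))) :=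
    ((td 0).mul_const _).add (tendsto_finsetSum _ fun m _ => (td _).mul ((tc _).const_mul _))
  have h4 : pc (𝒟 ξ 0 e) i = _ := tendsto_nhds_unique h2 (h3.congr' ?_)
  · rw [h4, hξ.dcoef_zero hk, zero_mul, zero_add]
    split_ifs with hj
    · rw [sum_eq_single (i - j.val)]
      · rw [if_pos (by omega)]
        ring
      · intro m _ hm
        rw [if_neg (by omega)]
        ring
      · intro hm
        simp at hm
        omega
    · refine sum_eq_zero fun m _ => ?_
      rw [if_neg (by omega)]
      ring
  · filter_upwards [t0.eventually (hξ.pv_eq hk), self_mem_nhdsWithin] with t ht hne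
    have hne : t ≠ 0 := hne
    have h5 := congrFun (ht (by funext l; simp [qv, qc_smul, he, qc_bas_inl hk])) ⟨i, by omega⟩
    have h6 : ∀ m, (compan (pv (t • e)) ^ (m + 1)).mulVec (dvec (t • e)) =
        -(((k - j.val : ℂ) * t) • (compan (pv (t • e)) ^ (m + j.val)).mulVec e0) := by
      intro m
      rw [compan_pow_succ_mulVec_dvec hk, sum_eq_single j.val]
      · simp [pc_smul, he, pc_bas_inl hk]
      · intro l _ hl
        simp [pc_smul, he, pc_bas_inl hk, hl]
      · intro hl
        simp at hl
        omega
    rw [sum_range_succ'] at h5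
    simp only [h6, pow_zero, Matrix.one_mulVec, Pi.add_apply, Finset.sum_apply, Pi.smul_apply,
      Pi.neg_apply, smul_eq_mul] at h5
    have h7 : dvec (t • e) (⟨i, by omega⟩ : Fin k) = t * ((i + 1) * pc e (i + 1)) := by
      rw [dvec, if_neg (by simp; omega), pc_smul]
      ring
    change pv (ξ (t • e)) ⟨i, by omega⟩ = _ at h5
    have h8 : pc (ξ (t • e)) i = _ := h5
    rw [zero_add, zero_smul, hξ.zero, pc_zero, sub_zero, h8, h7, smul_eq_mul, mul_add,
      mul_sum, add_comm]
    congr 1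
    · refine sum_congr rfl fun m _ => ?_
      field_simp
    · field_simp

theorem IsThetaV.pc_fderiv_eW (hk : 2 ≤ k) (hξ : IsThetaV (image k) ξ)
    {i : ℕ} (hi : i ≤ k - 2) : pc (𝒟 ξ 0 (eW hk)) i = 0 := by
  have h1 : HasDerivAt (fun t : ℂ => pc (ξ (t • eW hk)) i) (pc (𝒟 ξ 0 (eW hk)) i) 0 :=
    (pcL k i).hasFDerivAt.comp_hasDerivAt 0 (hasDerivAt_comp_smul hξ.1 _)
  have h2 := hasDerivAt_iff_tendsto_slope_zero.1 h1
  refine tendsto_nhds_unique h2 (tendsto_const_nhds.congr' ?_)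
  filter_upwards [hξ.pc_axis hk] with t ht
  simp [ht i hi, hξ.zero, pc_zero]

theorem simpleRoots_pow (hk : 2 ≤ k) {c : ℂ} (hc : c ≠ 0) :
    SimpleRoots (pv (-c ^ k • bas k (.inl ⟨0, by omega⟩) : Target k)) := by
  have hP : ∀ y, evalP (pv (-c ^ k • bas k (.inl ⟨0, by omega⟩) : Target k)) y = y ^ k - c ^ k := by
    intro y
    rw [evalP_eq, map_smul, evP_inl hk]
    simp
    ring
  intro r hr
  rw [hP] at hr
  rw [funext hP, ((hasDerivAt_pow k r).sub_const _).deriv]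
  refine mul_ne_zero (Nat.cast_ne_zero.2 (by omega)) (pow_ne_zero _ ?_)
  rintro rfl
  rw [zero_pow (by omega), zero_sub, neg_eq_zero] at hr
  exact hc (pow_eq_zero_iff (by omega) |>.1 hr)

theorem IsThetaV.qc_fderiv_eW (hk : 2 ≤ k) (hξ : IsThetaV (image k) ξ)
    {i : ℕ} (hi : i < k - 1) : qc (𝒟 ξ 0 (eW hk)) i = 0 := by
  set e : Target k := bas k (.inl ⟨0, by omega⟩) with he
  set X : ℂ → Target k := fun c => (-c ^ k) • e with hX
  set M : ℂ → Target k := fun c => eW hk - c ^ (k - 1) • bas k (.inr ⟨0, by omega⟩) with hM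
  have hXc : Continuous X := by fun_prop
  have t0 : Tendsto X (𝓝[≠] 0) (𝓝 0) :=
    (hXc.tendsto' _ _ (by simp [hX, zero_pow (by omega : k ≠ 0)])).mono_left nhdsWithin_le_nhds
  have hP : ∀ c y, evalP (pv (X c)) y = y ^ k - c ^ k := by
    intro c y
    rw [evalP_eq, map_smul, evP_inl hk]
    simp
    ring
  have hQ : ∀ c y, evalQ (qv (M c)) y = y ^ (k - 1) - c ^ (k - 1) := by
    intro c y
    rw [← evQ_apply]
    simp only [hM, eW, map_sub, map_smul, evQ_inr hk]
    simp
  have hkk : ∀ y : ℂ, y ^ k = y * y ^ (k - 1) := fun y => by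
    rw [← pow_succ', Nat.sub_add_cancel (by omega)]
  have key : ∀ᶠ c in 𝓝[≠] (0 : ℂ), evQ k c (𝒟 ξ (X c) (M c)) =
      ((k - 1 : ℕ) * c ^ (k - 1 - 1)) * ∑ m ∈ range (k + 1), dcoef hk ξ (X c) m * c ^ m := by
    filter_upwards [t0.eventually (hξ.simple_root hk), t0.eventually (hξ.simpleRoots hk),
      self_mem_nhdsWithin] with c h1 h2 hc
    have hc : c ≠ 0 := hc
    have hqX : qv (X c) = 0 := by
      funext l
      simp only [qv, hX, qc_smul, he, qc_bas_inl hk, mul_zero, Pi.zero_apply]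
    have hs : SimpleRoots (pv (X c)) := simpleRoots_pow hk hc
    have hr : evalP (pv (X c)) c = 0 := by rw [hP, sub_self]
    have h3 := (h2 hqX hs c hr).2
    have hpM : pv (M c) = 0 := by
      funext l
      have : pc (M c) l = _ := map_sub (pcL k l) _ _
      simp only [pv, this]
      simp [eW, pc_bas_inr hk]
    have h4 := (h1 hqX (M c) c hpM hr (by rw [hQ, sub_self]) (hs c hr) fun y hy hy' => by
      rw [hP, hkk, hkk] at hy
      rw [hQ] at hy'
      have h5 : c ^ (k - 1) * (y - c) = 0 := by linear_combination hy - y * hy'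
      exact sub_eq_zero.1 ((mul_eq_zero.1 h5).resolve_left (pow_ne_zero _ hc))).2
    rw [h3, sum_dcoef, funext (hQ c), ((hasDerivAt_pow (k - 1) c).sub_const _).deriv] at h4
    rw [evQ_apply]
    refine mul_right_cancel₀ (hs c hr) ?_
    rw [← h4]
    ring
  have bp : ∀ {a b : ℕ}, b ≤ a → (fun c : ℂ => c ^ a) =O[𝓝[≠] 0] (fun c : ℂ => c ^ b) :=
    fun h => (isBigO_pow_pow h).mono nhdsWithin_le_nhds
  have bX : X =O[𝓝[≠] 0] (fun c : ℂ => c ^ k) := by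
    have h1 := ((isBigO_refl (fun c : ℂ => c ^ k) (𝓝[≠] 0)).neg_left).smul
      (isBigO_refl (fun _ : ℂ => e) (𝓝[≠] 0))
    refine h1.trans ?_
    simpa using (isBigO_refl (fun c : ℂ => c ^ k) (𝓝[≠] 0)).smul
      (isBigO_const_const e (one_ne_zero : (1 : ℂ) ≠ 0) (𝓝[≠] 0))
  have bD : (fun c => 𝒟 ξ (X c) (M c) - 𝒟 ξ 0 (eW hk)) =O[𝓝[≠] 0]
      (fun c : ℂ => c ^ (k - 1)) := by
    have h1 : (fun c => 𝒟 ξ (X c) (eW hk) - 𝒟 ξ 0 (eW hk)) =O[𝓝[≠] 0]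
        (fun c : ℂ => c ^ (k - 1)) := by
      have h2 : DifferentiableAt ℂ (fun X => 𝒟 ξ X (eW hk)) 0 :=
        hξ.1.fderiv.differentiableAt.clm_apply (differentiableAt_const _)
      refine (h2.isBigO_sub.comp_tendsto t0).trans ?_
      simpa [Function.comp_def] using bX.trans (bp (by omega))
    have h3 : (fun c => c ^ (k - 1) • 𝒟 ξ (X c) (bas k (.inr ⟨0, by omega⟩))) =O[𝓝[≠] 0]
        (fun c : ℂ => c ^ (k - 1)) := by
      have h4 : ContinuousAt (fun X => 𝒟 ξ X (bas k (.inr ⟨0, by omega⟩))) 0 :=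
        hξ.1.fderiv.continuousAt.clm_apply continuousAt_const
      have h5 := (h4.tendsto.comp t0).isBigO_one ℂ
      simpa using (isBigO_refl (fun c : ℂ => c ^ (k - 1)) (𝓝[≠] 0)).smul h5
    refine (h1.sub h3).congr_left fun c => ?_
    simp only [hM, map_sub, map_smul]
    abel
  have bS : (fun c => ((k - 1 : ℕ) * c ^ (k - 1 - 1)) *
      ∑ m ∈ range (k + 1), dcoef hk ξ (X c) m * c ^ m) =O[𝓝[≠] 0]
      (fun c : ℂ => c ^ (k - 1)) := by
    have h1 : (fun c => ∑ m ∈ range (k + 1), dcoef hk ξ (X c) m * c ^ m) =O[𝓝[≠] 0]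
        (fun c : ℂ => c ^ 1) := by
      refine IsBigO.fun_sum fun m _ => ?_
      rcases m with _ | m
      · have h2 := ((analyticAt_dcoef hk hξ.1 0).differentiableAt.isBigO_sub.comp_tendsto t0)
        simp only [Function.comp_def, hξ.dcoef_zero hk, sub_zero] at h2
        simpa using (h2.trans bX).trans (bp (by omega : 1 ≤ k))
      · have h2 := ((analyticAt_dcoef hk hξ.1 (m + 1)).continuousAt.tendsto.comp t0).isBigO_one ℂ
        simpa using h2.mul (bp (by omega : 1 ≤ m + 1))
    have h2 := ((isBigO_refl (fun c : ℂ => c ^ (k - 1 - 1)) (𝓝[≠] 0)).const_mul_left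
      ((k - 1 : ℕ) : ℂ)).mul h1
    refine h2.congr_right fun c => ?_
    rw [← pow_add]
    congr 1
    omega
  have bq : ∀ j, (fun c => qc (𝒟 ξ (X c) (M c) - 𝒟 ξ 0 (eW hk)) j * c ^ j) =O[𝓝[≠] 0]
      (fun c : ℂ => c ^ (k - 1)) := fun j => by
    have h1 := ((qcL k j).isBigO_comp _ _).trans bD
    simpa using h1.mul (bp (Nat.zero_le j))
  have bl := (bp (le_refl (k - 1))).const_mul_left (qc (𝒟 ξ 0 (eW hk)) (k - 1))
  refine coeff_eq_zero_of_isBigO (k - 1) (a := qc (𝒟 ξ 0 (eW hk))) ?_ i hi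
  have bs := IsBigO.fun_sum (s := range k) fun j _ => bq j
  refine ((bS.sub bs).sub bl).congr' ?_ EventuallyEq.rfl
  filter_upwards [key] with c hc
  rw [← hc, ← evQ_eq_sum, map_sub (evQ k c), sub_sub_cancel, evQ_eq_sum, sub_eq_iff_eq_add,
    ← sum_range_succ, Nat.sub_add_cancel (by omega)]

section Necessary

theorem eq_sum_bas (hk : 2 ≤ k) (X : Target k) :
    X = ∑ i : Fin (k - 1), pc X i • bas k (.inl i) + ∑ i : Fin k, qc X i • bas k (.inr i) := by
  refine target_ext (fun i hi => ?_) fun i hi => ?_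
  · rw [← pcL_apply, ← pcL_apply, map_add, map_sum, map_sum]
    simp only [map_smul, pcL_apply, pc_bas_inl hk, pc_bas_inr hk, smul_eq_mul, mul_zero,
      sum_const_zero, add_zero]
    rw [sum_eq_single ⟨i, by omega⟩]
    · simp
    · intro j _ hj
      have : i ≠ j.val := fun h => hj (Fin.ext h.symm)
      simp [this]
    · simp
  · rw [← qcL_apply, ← qcL_apply, map_add, map_sum, map_sum]
    simp only [map_smul, qcL_apply, qc_bas_inl hk, qc_bas_inr hk, smul_eq_mul, mul_zero,
      sum_const_zero, zero_add]
    rw [sum_eq_single ⟨i, by omega⟩]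
    · simp
    · intro j _ hj
      have : i ≠ j.val := fun h => hj (Fin.ext h.symm)
      simp [this]
    · simp

theorem IsThetaV.fderiv_inl (hk : 2 ≤ k) (hξ : IsThetaV (image k) ξ)
    (j : Fin (k - 1)) : 𝒟 ξ 0 (bas k (.inl j)) = ∑ i : Fin (k - 1),
      (if j ≤ i then -(k - j.val : ℂ) * dcoef hk ξ 0 (i.val - j.val + 1) else 0) •
        bas k (.inl i) := by
  conv_lhs => rw [eq_sum_bas hk (𝒟 ξ 0 (bas k (.inl j)))]
  rw [sum_eq_zero (s := (univ : Finset (Fin k))), add_zero]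
  · refine sum_congr rfl fun i _ => ?_
    rw [hξ.pc_fderiv_inl hk j (by omega)]
    rfl
  · intro i _
    rw [hξ.qc_fderiv_inl hk j (by omega), zero_smul]

theorem IsThetaV.fderiv_eW (hk : 2 ≤ k) (hξ : IsThetaV (image k) ξ) :
    𝒟 ξ 0 (eW hk) = qc (𝒟 ξ 0 (eW hk)) (k - 1) • eW hk := by
  conv_lhs => rw [eq_sum_bas hk (𝒟 ξ 0 (eW hk))]
  rw [sum_eq_zero (s := (univ : Finset (Fin (k - 1)))), zero_add,
    sum_eq_single ⟨k - 1, by omega⟩]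
  · rfl
  · intro i _ hi
    have : i.val ≠ k - 1 := fun h => hi (Fin.ext h)
    rw [hξ.qc_fderiv_eW hk (by omega), zero_smul]
  · simp
  · intro i _
    rw [hξ.pc_fderiv_eW hk (by omega), zero_smul]

variable {h : Target k → Fin 1 → ℂ} {hh : Hol h 0}

theorem obstruction_eW (hk : 2 ≤ k) (h0 : h 0 = 0) (hw : 𝒟 h 0 (eW hk) 0 = 0)
    {ν : Target k → Fin 1 → ℂ} (hν : Hol ν 0)
    (hT : vecGerm ν hν ∈ tangentVKe (image k) h hh) : 𝒟 ν 0 (eW hk) 0 = 0 := by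
  have := tangent_linear h0 (fun _ => eW hk) (fun i _ => by rwa [Subsingleton.elim i 0])
    (fun ξ hξ => by
      rw [hξ.fderiv_eW hk, Fin.sum_univ_one, map_smul, Pi.smul_apply, hw, smul_zero]) hT
  simpa using this

theorem obstruction_inl (hk : 2 ≤ k) (h0 : h 0 = 0) (j : Fin (k - 1))
    (hj : ∀ i, j ≤ i → 𝒟 h 0 (bas k (.inl i)) 0 = 0) {ν : Target k → Fin 1 → ℂ} (hν : Hol ν 0)
    (hT : vecGerm ν hν ∈ tangentVKe (image k) h hh) : 𝒟 ν 0 (bas k (.inl j)) 0 = 0 := by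
  have := tangent_linear h0 (fun _ => bas k (.inl j))
    (fun i _ => by rw [Subsingleton.elim i 0]; exact hj j le_rfl)
    (fun ξ hξ => by
      rw [hξ.fderiv_inl hk, Fin.sum_univ_one, map_sum, Finset.sum_apply]
      refine sum_eq_zero fun i _ => ?_
      rw [map_smul, Pi.smul_apply]
      split_ifs with hi
      · rw [hj i hi, smul_zero]
      · rw [zero_smul]) hT
  simpa using this

/-- One of the two leading coefficients of a function of codimension two is nonzero. -/
theorem leading_ne_zero (hk : 2 ≤ k) (h0 : h 0 = 0) (hc : codimVKe (image k) h hh = 2)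
    (hw : 𝒟 h 0 (eW hk) 0 = 0) : 𝒟 h 0 eP[k] 0 ≠ 0 := by
  intro ha
  refine not_two_linear_obstructions h0 hc (e := eW hk) (e' := eP[k])
    (qcL k (k - 1)) (pcL k (k - 2)) ?_ ?_ ?_ ?_
    (fun ν hν hT => obstruction_eW hk h0 hw hν hT)
    (fun ν hν hT => obstruction_inl hk h0 _ (fun i hi => ?_) hν hT)
  · simp [eW, qc_bas_inr hk]
  · simp [qc_bas_inl hk]
  · simp [eW, pc_bas_inr hk]
  · simp [pc_bas_inl hk]
  · have : i = ⟨k - 2, by omega⟩ := Fin.ext (by have := i.isLt; have : k - 2 ≤ i.val := hi; simp; omega)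
    rwa [this]

theorem second_ne_zero (hk : 3 ≤ k) (h0 : h 0 = 0) (hc : codimVKe (image k) h hh = 2)
    (ha : 𝒟 h 0 eP[k] 0 = 0) : 𝒟 h 0 (bas k (.inl ⟨k - 3, by omega⟩)) 0 ≠ 0 := by
  intro hb
  have hk2 : 2 ≤ k := by omega
  have hlast : ∀ i : Fin (k - 1), k - 2 ≤ i.val → 𝒟 h 0 (bas k (.inl i)) 0 = 0 := by
    intro i hi
    have : i = ⟨k - 2, by omega⟩ := Fin.ext (by have := i.isLt; simp; omega)
    rwa [this]
  refine not_two_linear_obstructions h0 hc (e := bas k (.inl ⟨k - 3, by omega⟩))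
    (e' := eP[k])
    (pcL k (k - 3)) (pcL k (k - 2)) ?_ ?_ ?_ ?_
    (fun ν hν hT => obstruction_inl hk2 h0 _ (fun i hi => ?_) hν hT)
    (fun ν hν hT => obstruction_inl hk2 h0 _ (fun i hi => hlast i hi) hν hT)
  · simp [pc_bas_inl hk2]
  · have : k - 3 ≠ k - 2 := by omega
    simp [pc_bas_inl hk2, this]
  · have : k - 2 ≠ k - 3 := by omega
    simp [pc_bas_inl hk2, this]
  · simp [pc_bas_inl hk2]
  · by_cases h : i.val = k - 3
    · rwa [show i = ⟨k - 3, by omega⟩ from Fin.ext h]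
    · have : k - 3 ≤ i.val := hi
      exact hlast i (by omega)

end Necessary

theorem vec_fderiv {f : E → ℂ} {f' : E →L[ℂ] ℂ} {x : E} (hf : HasFDerivAt f f' x) (v : E) :
    𝒟 (fun x => (![f x] : Fin 1 → ℂ)) x v 0 = f' v := by
  have h : HasFDerivAt (fun x => (![f x] : Fin 1 → ℂ))
      (ContinuousLinearMap.pi fun _ => f' : E →L[ℂ] Fin 1 → ℂ) x := by
    rw [hasFDerivAt_pi']
    intro i
    rw [Subsingleton.elim i 0]
    exact hf
  rw [h.fderiv]
  rfl

/-- A curve along which the fields have high contact with `a` obstructs the square of `b`. -/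
theorem sq_obstruction [CompleteSpace E] {V : Set E} (a b : E →L[ℂ] ℂ) {κ : E → ℂ} (hκ : Hol κ 0)
    (hs : SqTangent V fun X => ![a X + κ X * b X ^ 2]) {γ : ℂ → E}
    (hγ : γ =O[𝓝 0] fun t => t) (hγc : ContinuousAt γ 0)
    (ha : ∀ t, a (γ t) = 0) (hb : ∀ t, b (γ t) = t)
    (hf : ∀ ξ, IsThetaV V ξ → (fun t => a (ξ (γ t))) =O[𝓝 0] fun t => t ^ 3) : κ 0 ≠ 0 := by
  intro hκ0
  obtain ⟨hh, hs⟩ := hs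
  have hγ0 : γ 0 = 0 := by
    have := hγ.eq_zero_imp.self_of_nhds
    exact this rfl
  have tγ : Tendsto γ (𝓝 0) (𝓝 0) := by
    have := hγc.tendsto
    rwa [hγ0] at this
  have lin : ∀ {f : E → ℂ}, Hol f 0 → f 0 = 0 →
      (fun t => f (γ t)) =O[𝓝 0] fun t => t := by
    intro f hf f0
    have h1 := hf.differentiableAt.isBigO_sub.comp_tendsto tγ
    simp only [Function.comp_def, f0, sub_zero] at h1
    exact h1.trans hγ
  have bt : (fun t : ℂ => b (γ t)) =O[𝓝 0] fun t => t := by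
    simp only [hb]
    exact isBigO_refl _ _
  have h0 : (fun X => (![a X + κ X * b X ^ 2] : Fin 1 → ℂ)) 0 = 0 := by funext i; fin_cases i; simp
  have key := tangent_isBigO h0 hγc hγ0 3 (hh := hh) (V := V) ?_ ?_ (hs b b (b.analyticAt 0)
    (b.analyticAt 0) (map_zero b) (map_zero b)
    (analyticAt_pi_iff.2 fun _ => (b.analyticAt 0).mul (b.analyticAt 0)))
  · simp only [hb] at key
    have h1 : (fun t : ℂ => t ^ 3) =o[𝓝 0] fun t : ℂ => t ^ 2 := by
      exact isLittleO_pow_pow (by norm_num)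
    have h2 : (fun t : ℂ => t ^ 2) =o[𝓝 0] fun t : ℂ => t ^ 2 :=
      (key.congr_left fun t => (sq t).symm).trans_isLittleO h1
    have h3 : ∀ᶠ t in 𝓝[≠] (0 : ℂ), t ^ 2 ≠ 0 := by
      filter_upwards [self_mem_nhdsWithin] with t ht using pow_ne_zero 2 ht
    exact isLittleO_irrefl (h3.frequently.filter_mono nhdsWithin_le_nhds) h2
  · have h1 := (lin hκ hκ0).mul (bt.pow 2)
    refine h1.congr (fun t => ?_) fun t => by ring
    simp [ha]
  · intro ξ hξ
    have e1 : ∀ᶠ t in 𝓝 (0 : ℂ), 𝒟 (fun X => (![a X + κ X * b X ^ 2] : Fin 1 → ℂ)) (γ t)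
        (ξ (γ t)) 0 = a (ξ (γ t)) + (κ (γ t) * (2 * b (γ t) * b (ξ (γ t))) +
          b (γ t) ^ 2 * 𝒟 κ (γ t) (ξ (γ t))) := by
      filter_upwards [tγ.eventually hκ.eventually_analyticAt] with t ht
      have hd := a.hasFDerivAt (x := γ t) |>.add
        (ht.differentiableAt.hasFDerivAt.mul ((b.hasFDerivAt (x := γ t)).pow 2))
      refine (vec_fderiv hd _).trans ?_
      simp
    refine IsBigO.congr' ?_ (EventuallyEq.symm e1) EventuallyEq.rfl
    have hbl : (fun t => b (ξ (γ t))) =O[𝓝 0] fun t => t :=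
      lin (f := fun X => b (ξ X)) ((b.analyticAt _).comp hξ.1) (by simp [hξ.zero])
    have h1 := ((lin hκ hκ0).mul ((bt.const_mul_left 2).mul hbl))
    have h2 : (fun t => 𝒟 κ (γ t) (ξ (γ t))) =O[𝓝 0] fun t => t :=
      lin (f := fun X => 𝒟 κ X (ξ X))
        (((ContinuousLinearMap.id ℂ (E →L[ℂ] ℂ)).analyticAt_bilinear (𝒟 κ 0, ξ 0)).comp₂
          hκ.fderiv hξ.1) (by simp [hξ.zero])
    exact (hf ξ hξ).add ((h1.congr_right fun t => by ring).add
      (((bt.pow 2).mul h2).congr_right fun t => by ring))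

theorem isBigO_smul_self (e : E) : (fun t : ℂ => t • e) =O[𝓝 0] fun t => t := by
  simpa using (isBigO_refl (fun t : ℂ => t) (𝓝 0)).smul
    (isBigO_const_const e (one_ne_zero : (1 : ℂ) ≠ 0) (𝓝 0))

theorem nf_one_coeff_ne_zero (hk : 2 ≤ k) (hκ : Hol κ 0)
    (hs : SqTangent (image k) fun X => ![pc X (k - 2) + κ X * qc X (k - 1) ^ 2]) : κ 0 ≠ 0 := by
  refine sq_obstruction (pcL k (k - 2)) (qcL k (k - 1)) hκ hs (γ := fun t => t • eW hk)
    (isBigO_smul_self _) (by fun_prop) (fun t => ?_) (fun t => ?_) fun ξ hξ => ?_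
  · simp [eW, pc_bas_inr hk]
  · simp [eW, qc_bas_inr hk]
  · have h1 : ∀ᶠ t in 𝓝 (0 : ℂ), pcL k (k - 2) (ξ (t • eW hk)) = 0 := by
      filter_upwards [eventually_nhdsWithin_iff.1 (hξ.pc_axis hk)] with t ht
      by_cases h : t = 0
      · rw [h, zero_smul, hξ.zero, map_zero]
      · exact ht h _ le_rfl
    exact (isBigO_zero _ _).congr' (h1.mono fun t ht => ht.symm) EventuallyEq.rfl

theorem nf_two_coeff_ne_zero_of_eq_two {κ : Target 2 → ℂ} (hκ : Hol κ 0)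
    (hs : SqTangent (image 2) fun X => ![qc X 1 + κ X * pc X 0 ^ 2]) : κ 0 ≠ 0 := by
  have hk : 2 ≤ 2 := le_rfl
  refine sq_obstruction (qcL 2 1) (pcL 2 0) hκ hs (γ := fun t => t • bas 2 (.inl 0))
    (isBigO_smul_self _) (by fun_prop) (fun t => ?_) (fun t => ?_) fun ξ hξ => ?_
  · simp [qc_bas_inl hk]
  · simp [pc_bas_inl hk]
  · have h1 : ∀ᶠ t in 𝓝 (0 : ℂ), qcL 2 1 (ξ (t • bas 2 (.inl 0))) = 0 := by
      filter_upwards [(tendsto_smul_zero _).eventually (hξ.qv_eq_zero hk)] with t ht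
      exact congrFun (ht (by funext l; simp [qv, qc_smul, qc_bas_inl hk])) 1
    exact (isBigO_zero _ _).congr' (h1.mono fun t ht => ht.symm) EventuallyEq.rfl

/-- The curve along which the second normal form is tested. -/
def testCurve (hk : 4 ≤ k) (t : ℂ) : Target k :=
  t • eP[k] +
    ((1 / 2 - 1 / k : ℂ) * t ^ 2) • bas k (.inl ⟨k - 4, by omega⟩)

theorem pc_testCurve (hk : 4 ≤ k) (t : ℂ) (i : ℕ) : pc (testCurve hk t) i =
    (if i = k - 2 then t else 0) + if i = k - 4 then (1 / 2 - 1 / k : ℂ) * t ^ 2 else 0 := by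
  simp [testCurve, pc_add, pc_smul, pc_bas_inl (by omega : 2 ≤ k)]

theorem sum_testCurve (hk : 4 ≤ k) (t : ℂ) (c : ℕ → ℂ) (w : ℕ → Fin k → ℂ) :
    ∑ i ∈ range k, (c i * pc (testCurve hk t) i) • w i =
      (c (k - 2) * t) • w (k - 2) + (c (k - 4) * ((1 / 2 - 1 / k : ℂ) * t ^ 2)) • w (k - 4) := by
  simp only [pc_testCurve hk, mul_add, mul_ite, mul_zero, add_smul, sum_add_distrib, ite_smul,
    zero_smul, sum_ite_eq', mem_range]
  rw [if_pos (by omega), if_pos (by omega)]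

/-- The powers of the companion matrix along the test curve, applied to the first vector. -/
def curvePow (hk : 4 ≤ k) (n : ℕ) (t : ℂ) : Fin k → ℂ :=
  (compan (pv (testCurve hk t)) ^ n).mulVec e0

theorem curvePow_of_lt (hk : 4 ≤ k) {n : ℕ} (hn : n < k) (t : ℂ) (i : Fin k) :
    curvePow hk n t i = if i.val = n then 1 else 0 := by
  rw [curvePow, compan_pow_mulVec_e0 _ _ hn, Pi.single_apply]
  simp [Fin.ext_iff]

theorem curvePow_add (hk : 4 ≤ k) (n : ℕ) (t : ℂ) (i : Fin k) : curvePow hk (n + k) t i =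
    -(t * curvePow hk (n + (k - 2)) t i +
      (1 / 2 - 1 / k : ℂ) * t ^ 2 * curvePow hk (n + (k - 4)) t i) := by
  have h1 := compan_pow_add_mulVec_e0 (by omega) (testCurve hk t) n
  have h2 := sum_testCurve hk t (fun _ => 1) fun i => curvePow hk (n + i) t
  simp only [one_mul] at h2
  rw [curvePow, h1]
  change (-∑ i ∈ range k, pc (testCurve hk t) i • curvePow hk (n + i) t) i = _
  rw [h2]
  simp

theorem curvePow_isBigO (hk : 4 ≤ k) (n : ℕ) (i : Fin k) :
    (curvePow hk n · i) =O[𝓝 0] (fun t : ℂ => t ^ 0) ∧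
    (k ≤ n → (curvePow hk n · i) =O[𝓝 0] (fun t : ℂ => t ^ 1)) ∧
    (k + 2 ≤ n → (curvePow hk n · i) =O[𝓝 0] (fun t : ℂ => t ^ 2)) := by
  induction n using Nat.strong_induction_on with
  | _ n ih =>
    by_cases hn : n < k
    · refine ⟨?_, by omega, by omega⟩
      simp only [curvePow_of_lt hk hn, pow_zero]
      exact isBigO_const_const _ one_ne_zero _
    · obtain ⟨m, rfl⟩ : ∃ m, n = m + k := ⟨n - k, by omega⟩
      have i1 := ih (m + (k - 2)) (by omega)
      have i2 := ih (m + (k - 4)) (by omega)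
      have r1 : (fun t : ℂ => t) =O[𝓝 0] fun t : ℂ => t ^ 1 := by simpa using isBigO_pow_pow (le_refl 1)
      have r2 : (fun t : ℂ => (1 / 2 - 1 / k : ℂ) * t ^ 2) =O[𝓝 0] fun t : ℂ => t ^ 2 :=
        (isBigO_pow_pow le_rfl).const_mul_left _
      have b2 := r2.mul i2.1
      simp only [← pow_add] at b2
      have b1 := r1.mul i1.1
      simp only [← pow_add] at b1
      have c1 : (curvePow hk (m + k) · i) =O[𝓝 0] (fun t : ℂ => t ^ 1) := by
        simp only [curvePow_add hk m]
        exact (b1.add (b2.trans (isBigO_pow_pow (by norm_num)))).neg_left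
      refine ⟨c1.trans (isBigO_pow_pow (by norm_num)), fun _ => c1, fun h => ?_⟩
      have b3 := r1.mul (i1.2.1 (by omega))
      simp only [← pow_add] at b3
      simp only [curvePow_add hk m]
      exact (b3.add b2).neg_left

theorem IsThetaV.pc_testCurve (hk : 4 ≤ k) (hξ : IsThetaV (image k) ξ) :
    (fun t => pc (ξ (testCurve hk t)) (k - 3)) =O[𝓝 0] fun t => t ^ 3 := by
  have hk2 : 2 ≤ k := by omega
  have hk0 : (k : ℂ) ≠ 0 := Nat.cast_ne_zero.2 (by omega)
  set ρ : ℂ := 1 / 2 - 1 / k with hρ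
  have tγ : Tendsto (testCurve hk) (𝓝 0) (𝓝 0) := by
    unfold testCurve
    exact Continuous.tendsto' (by fun_prop) _ _ (by simp)
  set d : ℕ → ℂ → ℂ := fun m t => dcoef hk2 ξ (testCurve hk t) m with hd
  have bd : ∀ m, d m =O[𝓝 0] (fun t : ℂ => t ^ 0) := fun m => by
    simpa using ((analyticAt_dcoef hk2 hξ.1 m).continuousAt.tendsto.comp tγ).isBigO_one ℂ
  set s : ℕ → Fin k → ℂ → ℂ := fun m i t =>
    2 * t * curvePow hk (m + (k - 2)) t i + 4 * (ρ * t ^ 2) * curvePow hk (m + (k - 4)) t i with hs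
  have r1 : (fun t : ℂ => 2 * t) =O[𝓝 0] fun t : ℂ => t ^ 1 := by
    simpa using (isBigO_pow_pow (le_refl 1)).const_mul_left (2 : ℂ)
  have r2 : (fun t : ℂ => 4 * (ρ * t ^ 2)) =O[𝓝 0] fun t : ℂ => t ^ 2 :=
    ((isBigO_pow_pow le_rfl).const_mul_left _).const_mul_left _
  have hrow : ∀ᶠ t in 𝓝 (0 : ℂ), ∀ i : Fin k, pc (ξ (testCurve hk t)) i =
      d 0 t * dvec (testCurve hk t) i - ∑ m ∈ range k, d (m + 1) t * s m i t := by
    filter_upwards [tγ.eventually (hξ.pv_eq hk2)] with t ht i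
    have h1 := congrFun (ht (by
      funext l
      simp [qv, testCurve, qc_add, qc_smul, qc_bas_inl hk2])) i
    rw [sum_range_succ'] at h1
    have h2 : ∀ m, (compan (pv (testCurve hk t)) ^ (m + 1)).mulVec (dvec (testCurve hk t)) i =
        -s m i t := by
      intro m
      rw [compan_pow_succ_mulVec_dvec hk2]
      have h3 := sum_testCurve hk t (fun i => (k - i : ℂ)) fun i => curvePow hk (m + i) t
      change (-∑ i ∈ range k, ((k - i : ℂ) * pc (testCurve hk t) i) • curvePow hk (m + i) t) i = _
      rw [h3, Nat.cast_sub (by omega), Nat.cast_sub (by omega)]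
      simp only [hs, hρ, Pi.neg_apply, Pi.add_apply, Pi.smul_apply, smul_eq_mul]
      push_cast
      ring
    simp only [pow_zero, Matrix.one_mulVec, Pi.add_apply, Finset.sum_apply, Pi.smul_apply,
      smul_eq_mul, h2, mul_neg, sum_neg_distrib] at h1
    exact h1.trans (by ring)
  have sumO : ∀ (i : Fin k) (n : ℕ) (c : ℂ → ℂ), (∀ m, m ≠ 1 → s m i =O[𝓝 0] fun t : ℂ => t ^ n) →
      (∀ t, s 1 i t = c t) → (fun t => ∑ m ∈ range k, d (m + 1) t * s m i t - d 2 t * c t)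
        =O[𝓝 0] fun t : ℂ => t ^ n := by
    intro i n c h1 h2
    have h3 : (fun t => ∑ m ∈ (range k).erase 1, d (m + 1) t * s m i t) =O[𝓝 0]
        fun t : ℂ => t ^ n := IsBigO.fun_sum fun m hm => by
      have := (bd (m + 1)).mul (h1 m (ne_of_mem_erase hm))
      simpa using this
    refine h3.congr_left fun t => ?_
    rw [← add_sum_erase _ _ (mem_range.2 (by omega : 1 < k)), h2]
    ring
  have e1 : (fun t => d 0 t * k - 2 * t * d 2 t) =O[𝓝 0] fun t : ℂ => t ^ 2 := by
    refine (sumO ⟨k - 1, by omega⟩ 2 (fun t => 2 * t) ?_ ?_).congr' ?_ EventuallyEq.rfl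
    · intro m hm
      have b2 := r2.mul (curvePow_isBigO hk (m + (k - 4)) ⟨k - 1, by omega⟩).1
      simp only [pow_zero, mul_one] at b2
      refine IsBigO.add ?_ b2
      by_cases h : m = 0
      · simp only [curvePow_of_lt hk (by omega : m + (k - 2) < k)]
        rw [if_neg (by omega)]
        simpa using isBigO_zero _ _
      · have := r1.mul ((curvePow_isBigO hk (m + (k - 2)) ⟨k - 1, by omega⟩).2.1 (by omega))
        simpa only [← pow_add] using this
    · intro t
      simp only [hs, curvePow_of_lt hk (by omega : 1 + (k - 2) < k),
        curvePow_of_lt hk (by omega : 1 + (k - 4) < k)]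
      rw [if_pos (by omega), if_neg (by omega)]
      ring
    · filter_upwards [hrow] with t ht
      have h1 := ht ⟨k - 1, by omega⟩
      rw [dvec, if_pos (by simp; omega)] at h1
      have h2 : pc (ξ (testCurve hk t)) (k - 1) = 0 := pv_last hk2 _
      rw [h2] at h1
      linear_combination h1
  have e2 : (fun t => ∑ m ∈ range k, d (m + 1) t * s m ⟨k - 3, by omega⟩ t -
      d 2 t * (4 * (ρ * t ^ 2))) =O[𝓝 0] fun t : ℂ => t ^ 3 := by
    refine sumO ⟨k - 3, by omega⟩ 3 _ ?_ ?_
    · intro m hm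
      refine IsBigO.add ?_ ?_
      · have key : (curvePow hk (m + (k - 2)) · ⟨k - 3, by omega⟩) =O[𝓝 0] fun t : ℂ => t ^ 2 := by
          by_cases h : k + 2 ≤ m + (k - 2)
          · exact (curvePow_isBigO hk _ _).2.2 h
          by_cases h0 : m + (k - 2) < k
          · simp only [curvePow_of_lt hk h0]
            rw [if_neg (by omega)]
            exact isBigO_zero _ _
          · obtain ⟨n, hn⟩ : ∃ n, m + (k - 2) = n + k := ⟨m + (k - 2) - k, by omega⟩
            simp only [hn, curvePow_add hk, curvePow_of_lt hk (by omega : n + (k - 2) < k),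
              curvePow_of_lt hk (by omega : n + (k - 4) < k)]
            rw [if_neg (by omega)]
            simp only [mul_zero, zero_add]
            exact (((isBigO_pow_pow le_rfl).const_mul_left _).mul
              (isBigO_const_const _ one_ne_zero _)).neg_left.congr_right fun t => by rw [mul_one]
        have := r1.mul key
        simpa only [← pow_add] using this
      · by_cases h : k ≤ m + (k - 4)
        · have := r2.mul ((curvePow_isBigO hk _ ⟨k - 3, by omega⟩).2.1 h)
          simpa only [← pow_add] using this
        · simp only [curvePow_of_lt hk (by omega : m + (k - 4) < k)]
          rw [if_neg (by omega)]
          simpa using isBigO_zero _ _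
    · intro t
      simp only [hs, curvePow_of_lt hk (by omega : 1 + (k - 2) < k),
        curvePow_of_lt hk (by omega : 1 + (k - 4) < k)]
      rw [if_neg (by omega), if_pos (by omega)]
      ring
  have e3 := (((isBigO_pow_pow (le_refl 1)).const_mul_left ((k - 2 : ℂ) / k)).mul e1).congr_right
    (g₂ := fun t : ℂ => t ^ 3) fun t => by ring
  refine (e3.sub e2).congr' ?_ EventuallyEq.rfl
  filter_upwards [hrow] with t ht
  have h1 := ht ⟨k - 3, by omega⟩
  have h2 : dvec (testCurve hk t) (⟨k - 3, by omega⟩ : Fin k) = (k - 2 : ℂ) * t := by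
    rw [dvec, if_neg (by simp; omega), CrossCap.pc_testCurve hk]
    simp only
    rw [if_pos (by omega), if_neg (by omega), Nat.cast_sub (by omega)]
    push_cast
    ring
  rw [h2] at h1
  have h3 : pc (ξ (testCurve hk t)) (k - 3) = _ := h1
  rw [h3, hρ]
  field_simp
  ring

theorem nf_two_coeff_ne_zero (hk : 4 ≤ k) (hκ : Hol κ 0)
    (hs : SqTangent (image k) fun X => ![qc X (k - 1) + (pc X (k - 3) + κ X * pc X (k - 2) ^ 2)]) :
    κ 0 ≠ 0 := by
  have hk2 : 2 ≤ k := by omega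
  simp only [← add_assoc] at hs
  have tc : Continuous (testCurve hk) := by unfold testCurve; fun_prop
  refine sq_obstruction (qcL k (k - 1) + pcL k (k - 3)) (pcL k (k - 2)) hκ hs (γ := testCurve hk)
    ?_ tc.continuousAt (fun t => ?_) (fun t => ?_) fun ξ hξ => ?_
  · refine (isBigO_smul_self _).add ?_
    have h1 := ((isBigO_pow_pow (by norm_num : 1 ≤ 2)).const_mul_left (1 / 2 - 1 / k : ℂ)).smul
      (isBigO_const_const (bas k (.inl ⟨k - 4, by omega⟩) : Target k)
        (one_ne_zero : (1 : ℂ) ≠ 0) (𝓝 0))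
    simpa using h1
  · have : k - 3 ≠ k - 2 := by omega
    have : k - 3 ≠ k - 4 := by omega
    simp [testCurve, qc_add, qc_smul, qc_bas_inl hk2, pc_add, pc_smul, pc_bas_inl hk2, *]
  · have : k - 2 ≠ k - 4 := by omega
    simp [pc_testCurve hk, this]
  · refine (hξ.pc_testCurve hk).congr' ?_ EventuallyEq.rfl
    filter_upwards [(tc.tendsto' 0 0 (by simp [testCurve])).eventually (hξ.qv_eq_zero hk2)] with t ht
    have := congrFun (ht (by funext l; simp [qv, testCurve, qc_add, qc_smul, qc_bas_inl hk2]))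
      ⟨k - 1, by omega⟩
    have h2 : qc (ξ (testCurve hk t)) (k - 1) = 0 := this
    simp [h2]

/-- The infinitesimal generators of the weighted scalings. -/
def euler (a b : ℂ) (X : Target k) : Target k :=
  mk k (fun i => a * (k - i) * pc X i) (fun i => (b + a * (k - 1 - i)) * qc X i)

theorem isThetaV_euler (hk : 2 ≤ k) (a b : ℂ) : IsThetaV (image k) (euler (k := k) a b) := by
  have ap : PiAnalyticAt (pc (k := k)) 0 := fun i => (pcL k i).analyticAt _
  have aq : PiAnalyticAt (qc (k := k)) 0 := fun i => (qcL k i).analyticAt _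
  have e1 : ∀ c : ℂ, Hol (fun z : ℂ × Target k => Complex.exp (c * z.1)) 0 := fun c =>
    (analyticAt_const.mul analyticAt_fst).cexp
  have ha : Hol (euler (k := k) a b) 0 :=
    analyticAt_mk (fun i _ => analyticAt_const.mul (ap i)) fun i _ => analyticAt_const.mul (aq i)
  refine ⟨ha, fun z => scale (Complex.exp (a * z.1)) (Complex.exp (b * z.1)) z.2, ?_, ?_, ?_, ?_, ?_⟩
  · have bp : ∀ i, Hol (fun z : ℂ × Target k => pc z.2 i) 0 := fun i =>
      ((pcL k i).comp (snd ℂ ℂ (Target k))).analyticAt _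
    have bq : ∀ i, Hol (fun z : ℂ × Target k => qc z.2 i) 0 := fun i =>
      ((qcL k i).comp (snd ℂ ℂ (Target k))).analyticAt _
    exact analyticAt_mk (fun i _ => ((e1 a).pow _).mul (bp i))
      fun i _ => ((e1 b).mul ((e1 a).pow _)).mul (bq i)
  · refine .of_forall fun X => target_ext (fun i hi => ?_) fun i hi => ?_
    · rw [pc_scale _ _ _ hi]; simp
    · rw [qc_scale _ _ _ hi]; simp
  · refine .of_forall fun z => ?_
    have d1 : ∀ c : ℂ, HasDerivAt (fun t : ℂ => Complex.exp (c * t)) (Complex.exp (c * z.1) * c) z.1 :=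
      fun c => by simpa using ((hasDerivAt_id z.1).const_mul c).cexp
    have d2 : ∀ n : ℕ, HasDerivAt (fun t : ℂ => Complex.exp (a * t) ^ n)
        (n * a * Complex.exp (a * z.1) ^ n) z.1 := fun n => by
      have h1 := d1 (n * a)
      have h2 : ∀ t, Complex.exp (a * t) ^ n = Complex.exp (n * a * t) := fun t => by
        rw [← Complex.exp_nat_mul]; ring_nf
      simp only [h2]
      convert h1 using 1
      ring
    have h := hasDerivAt_mk (k := k) (p := fun t i => Complex.exp (a * t) ^ (k - i) * pc z.2 i)
      (q := fun t i => Complex.exp (b * t) * Complex.exp (a * t) ^ (k - 1 - i) * qc z.2 i) (a := z.1)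
      (fun i _ => (d2 (k - i)).mul_const _) fun i _ => ((d1 b).mul (d2 (k - 1 - i))).mul_const _
    refine h.congr_deriv (target_ext (fun i hi => ?_) fun i hi => ?_)
    · rw [pc_mk _ _ hi, euler, pc_mk _ _ hi, pc_scale _ _ _ hi, Nat.cast_sub (by omega)]
      ring
    · rw [qc_mk _ _ hi, euler, qc_mk _ _ hi, qc_scale _ _ _ hi, Nat.cast_sub (by omega),
        Nat.cast_sub (by omega)]
      push_cast
      ring
  · refine .of_forall fun t => target_ext (fun i hi => ?_) fun i hi => ?_
    · rw [pc_scale _ _ _ hi]; simp [pc_zero]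
    · rw [qc_scale _ _ _ hi]; simp [qc_zero]
  · exact .of_forall fun z =>
      scale_mem_image hk (Complex.exp_ne_zero _) (Complex.exp_ne_zero _) z.2

theorem fderiv_euler (hk : 2 ≤ k) (a b : ℂ) (v : Target k) :
    𝒟 (euler (k := k) a b) 0 v = euler a b v := by
  refine (hasDerivAt_comp_smul (isThetaV_euler hk a b).1 v).unique ?_
  have h : ∀ t : ℂ, euler a b (t • v) = t • euler a b v := fun t => by
    refine target_ext (fun i hi => ?_) fun i hi => ?_
    · rw [pc_smul, euler, euler, pc_mk _ _ hi, pc_mk _ _ hi, pc_smul]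
      ring
    · rw [qc_smul, euler, euler, qc_mk _ _ hi, qc_mk _ _ hi, qc_smul]
      ring
  simp only [h]
  simpa using (hasDerivAt_id (0 : ℂ)).smul_const (euler a b v)

theorem IsThetaV.exists_push_move (hk : 2 ≤ k)
    (hξ : IsThetaV (image k) ξ) (B : ℕ → ℂ) {τ : ℕ → ℂ} (hτ : τ 0 ≠ 0) :
    ∃ ξ', IsThetaV (image k) ξ' ∧ ∀ v, 𝒟 ξ' 0 (moveLin B τ v) = moveLin B τ (𝒟 ξ 0 v) := by
  have hB : ∀ m, Hol (fun _ : Target k => B m) 0 := fun m => analyticAt_const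
  have hT : ∀ m, Hol (fun _ : Target k => τ m) 0 := fun m => analyticAt_const
  have hφ : IsBiholGerm (fun X : Target k => move B τ X) := isBiholGerm_move hk hB hT hτ
  have hφV : MapsSetGerm (fun X : Target k => move B τ X) (image k) (image k) :=
    mapsSetGerm_move hk hB hT hτ
  obtain ⟨ψ, hψ, h1, h2, h3⟩ := hφ.exists_inverse
  have hp := hξ.push hφ hψ h1 h2 hφV (h3 _ hφV)
  refine ⟨_, hp, fun v => ?_⟩
  have hd : ∀ v, 𝒟 (fun X : Target k => move B τ X) 0 v = moveLin B τ v := fun v =>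
    (hasDerivAt_comp_smul hφ.1 v).unique (hasDerivAt_move hk hB hT hτ v)
  have hψd := hψ.1.differentiableAt.hasFDerivAt
  have g1 : HasFDerivAt ξ (𝒟 ξ 0) (ψ 0) := by rw [hψ.2.1]; exact hξ.1.differentiableAt.hasFDerivAt
  have g2 : HasFDerivAt (fun x => 𝒟 (fun X : Target k => move B τ X) (ψ x))
      _ 0 := (DifferentiableAt.hasFDerivAt (𝕜 := ℂ) (by
        have := hφ.1.fderiv.differentiableAt
        rw [← hψ.2.1] at this
        exact this.comp 0 hψ.1.differentiableAt))
  have g3 := g2.clm_apply (g1.comp 0 hψd)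
  rw [← hd, show (fun x => 𝒟 (fun X : Target k => move B τ X) (ψ x) (ξ (ψ x))) =
    fun x => 𝒟 (fun X : Target k => move B τ X) (ψ x) ((ξ ∘ ψ) x) from rfl, g3.fderiv]
  simp only [Function.comp_apply, hψ.2.1, hξ.zero,
    ContinuousLinearMap.comp_apply, map_zero, add_zero,
    fderiv_comp_inverse hφ hψ h1]
  rw [hd]

theorem triangular_eq_zero {n m₀ : ℕ} {a x : ℕ → ℂ} (ha : a n ≠ 0) (h : ∀ m, m ≤ n → m₀ ≤ m →
      ∑ i ∈ range (n + 1), a i * (if m ≤ i then x (i - m) else 0) = 0) :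
    ∀ j, j + m₀ ≤ n → x j = 0 := by
  intro j
  induction j using Nat.strong_induction_on with
  | _ j ih =>
    intro hj
    have h1 := h (n - j) (by omega) (by omega)
    rw [sum_range_succ, sum_eq_zero, zero_add, if_pos (by omega),
      show n - (n - j) = j by omega] at h1
    · exact (mul_eq_zero.1 h1).resolve_left ha
    · intro i hi
      rw [mem_range] at hi
      split_ifs with hm
      · rw [ih (i - (n - j)) (by omega) (by omega), mul_zero]
      · rw [mul_zero]

/-- The coefficients of a linear form on the first block. -/
def alpha (ℓ : Target k →L[ℂ] ℂ) (i : ℕ) : ℂ :=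
  if hi : i < k - 1 then ℓ (bas k (.inl ⟨i, hi⟩)) else 0

theorem linear_eq_sum (hk : 2 ≤ k) (ℓ : Target k →L[ℂ] ℂ) (X : Target k) :
    ℓ X = ∑ i ∈ range (k - 1), alpha ℓ i * pc X i + ∑ i : Fin k, qc X i * ℓ (bas k (.inr i)) := by
  conv_lhs => rw [eq_sum_bas hk X]
  rw [map_add, map_sum, map_sum, sum_range]
  simp only [map_smul, smul_eq_mul, alpha, Fin.is_lt, dif_pos, Fin.eta, mul_comm]

theorem tau_one_ne_zero : (Pi.single 0 1 : ℕ → ℂ) 0 ≠ 0 := by simp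

theorem push_second_block (hk : 2 ≤ k) {ℓ : Target k →L[ℂ] ℂ} {e : Target k}
    (he : ∀ ξ, IsThetaV (image k) ξ → ℓ (𝒟 ξ 0 e) = 0) (B : ℕ → ℂ) :
    ℓ (mk k (extV ((matEval B (compan 0)).mulVec (qv e))) (qc e)) = 0 := by
  have h1 : ∀ m, m < k → (Pi.single 0 1 : ℕ → ℂ) m = if m = 0 then 1 else 0 := fun m _ => by
    rw [Pi.single_apply]
  have hlin : ∀ v : Target k, moveLin B (Pi.single 0 1) v =
      mk k (extV (pv v + (matEval B (compan 0)).mulVec (qv v))) (extV (qv v)) := by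
    intro v
    rw [moveLin, linP, (Mmat_of_one hk h1 rfl).1, inv_one, Matrix.one_mulVec,
      matEval_single _ (by omega) _ h1, one_pow, Matrix.one_mulVec, Matrix.adjugate_one,
      Matrix.one_mulVec]
  obtain ⟨ξ, hξ, hv⟩ := (isThetaV_euler hk 0 1).exists_push_move hk B tau_one_ne_zero
  set v : Target k := mk k (fun i => pc e i - extV ((matEval B (compan 0)).mulVec (qv e)) i) (qc e)
    with hvd
  have hqv : qv v = qv e := by
    funext i
    exact qc_mk _ _ (by omega)
  have hve : moveLin B (Pi.single 0 1) v = e := by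
    rw [hlin, hqv]
    refine target_ext (fun i hi => ?_) fun i hi => ?_
    · rw [pc_mk _ _ hi, extV_of_lt _ (by omega), Pi.add_apply, pv, hvd, pc_mk _ _ hi,
        extV_of_lt _ (by omega)]
      ring
    · rw [qc_mk _ _ hi, extV_of_lt _ (by omega), qv]
  have h2 := he ξ hξ
  have h3 := hv v
  rw [hve, fderiv_euler hk, hlin] at h3
  rw [h3] at h2
  rw [← h2]
  have hq2 : qv (euler 0 1 v) = qv e := by
    rw [← hqv]
    funext i
    have : qc (euler 0 1 v) i = _ := qc_mk _ _ (by omega)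
    simp only [qv, this]
    ring
  have hp2 : pv (euler 0 1 v) = 0 := by
    funext i
    by_cases hi : i.val ≤ k - 2
    · have : pc (euler 0 1 v) i = _ := pc_mk _ _ hi
      simp only [pv, this]
      simp
    · exact pc_eq_zero _ (by omega) (by omega)
  rw [hq2, hp2, zero_add]
  congr 1
  refine target_ext (fun i hi => ?_) fun i hi => ?_
  · rw [pc_mk _ _ hi, pc_mk _ _ hi]
  · rw [qc_mk _ _ hi, qc_mk _ _ hi, extV_of_lt _ (by omega), qv]

theorem qv_eq_zero_of_obstruction (hk : 2 ≤ k) {ℓ : Target k →L[ℂ] ℂ} {e : Target k}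
    (he : ∀ ξ, IsThetaV (image k) ξ → ℓ (𝒟 ξ 0 e) = 0)
    (ha : ℓ eP[k] ≠ 0) (hw : ℓ (eW hk) ≠ 0) : qv e = 0 := by
  have ha' : alpha ℓ (k - 2) ≠ 0 := by rwa [alpha, dif_pos (by omega)]
  have hB0 := push_second_block hk he 0
  have h1 := fun B => linear_eq_sum hk ℓ (mk k (extV ((matEval B (compan 0)).mulVec (qv e))) (qc e))
  have h0 := h1 0
  rw [hB0] at h0
  have hz : ∀ i, extV ((matEval 0 (compan 0)).mulVec (qv e)) i = 0 := fun i => by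
    rw [matEval_eq_zero (B := 0) _ fun _ _ => rfl, Matrix.zero_mulVec]
    simp [extV]
  have hsum0 : ∑ i ∈ range (k - 1), alpha ℓ i *
      pc (mk k (extV ((matEval 0 (compan 0)).mulVec (qv e))) (qc e)) i = 0 :=
    sum_eq_zero fun i hi => by
      rw [mem_range] at hi
      rw [pc_mk _ _ (by omega), hz, mul_zero]
  have hqs : ∀ B, ∑ i : Fin k, qc (mk k (extV ((matEval B (compan 0)).mulVec (qv e))) (qc e)) i *
      ℓ (bas k (.inr i)) = ∑ i : Fin k, qc e i * ℓ (bas k (.inr i)) := fun B =>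
    sum_congr rfl fun i _ => by rw [qc_mk _ _ (by omega)]
  rw [hsum0, zero_add, hqs] at h0
  have hq : ∀ j, j + 0 ≤ k - 2 → qc e j = 0 := by
    refine triangular_eq_zero ha' fun m hm _ => ?_
    have h2 := h1 (Pi.single m 1)
    rw [push_second_block hk he, hqs, ← h0, add_zero] at h2
    rw [show k - 2 + 1 = k - 1 by omega]
    refine (sum_congr rfl fun i hi => ?_).trans h2.symm
    rw [mem_range] at hi
    rw [pc_mk _ _ (by omega), extV_of_lt _ (by omega)]
    congr 1
    simp only [Matrix.mulVec, dotProduct, matEval_compan_zero_apply]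
    split_ifs with hmi
    · rw [sum_eq_single ⟨i - m, by omega⟩]
      · rw [if_pos (by simp), show i - (i - m) = m by omega]
        simp [qv]
      · intro j _ hj
        have : j.val ≠ i - m := fun h => hj (Fin.ext h)
        split_ifs
        · rw [Pi.single_eq_of_ne (by omega), zero_mul]
        · rw [zero_mul]
      · simp
    · symm
      refine sum_eq_zero fun j _ => ?_
      split_ifs with hji
      · rw [Pi.single_eq_of_ne (by omega), zero_mul]
      · rw [zero_mul]
  have hl : qc e (k - 1) = 0 := by
    rw [sum_eq_single ⟨k - 1, by omega⟩] at h0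
    · exact (mul_eq_zero.1 h0.symm).resolve_right hw
    · intro i _ hi
      have : i.val ≠ k - 1 := fun h => hi (Fin.ext h)
      rw [hq _ (by omega), zero_mul]
    · simp
  funext i
  by_cases hi : i.val = k - 1
  · simp only [qv, hi, hl, Pi.zero_apply]
  · exact hq _ (by omega)

theorem differentiableAt_clm {ι : Type*} [Fintype ι]
    {A : ℂ → (ι → ℂ) →L[ℂ] F} (h : ∀ v, DifferentiableAt ℂ (fun t => A t v) 0) :
    DifferentiableAt ℂ A 0 := by
  classical
  have h1 : A = fun t => ∑ l, (prj l).smulRight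
      (A t (Pi.single l 1)) := by
    funext t
    ext v
    conv_lhs => rw [pi_eq_sum_univ' v, map_sum]
    simp
  rw [h1]
  refine DifferentiableAt.fun_sum fun l _ => ?_
  exact ((smulRightL ℂ (ι → ℂ) F (prj l)).differentiableAt).comp 0 (h _)

theorem moveLin_ofP (hk : 2 ≤ k) {τ : ℕ → ℂ} (hτ : τ 0 ≠ 0) (u : Fin (k - 1) → ℂ) :
    moveLin 0 τ (ofP k u) = ofP k (toP k (𝒟 (fun X : Target k => move 0 τ X) 0 (ofP k u))) := by
  have hB : ∀ m, Hol (fun _ : Target k => (0 : ℕ → ℂ) m) 0 := fun m => analyticAt_const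
  have hT : ∀ m, Hol (fun _ : Target k => τ m) 0 := fun m => analyticAt_const
  have hφ : IsBiholGerm (fun X : Target k => move 0 τ X) := isBiholGerm_move hk hB hT hτ
  rw [(hasDerivAt_comp_smul hφ.1 _).unique (hasDerivAt_move hk hB hT hτ (ofP k u)), ofP_toP hk]
  have hq : qv (ofP k u) = 0 := funext fun i => qc_ofP hk u i
  funext i
  rw [qv, moveLin, qc_mk _ _ (by omega), hq, Matrix.mulVec_zero, extV_of_lt _ i.isLt]

/-- The linear part, on the first block, of the substitutions `y ↦ y + t y ^ (m + 1)`. -/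
def shearP (k m : ℕ) (t : ℂ) : (Fin (k - 1) → ℂ) →L[ℂ] (Fin (k - 1) → ℂ) :=
  (toP k).comp ((𝒟 (fun X : Target k => move 0 (Pi.single 0 1 + t • Pi.single m 1) X) 0).comp
    (ofP k))

theorem shear_ne_zero {m : ℕ} (hm : 1 ≤ m) (t : ℂ) :
    (Pi.single 0 1 + t • Pi.single m 1 : ℕ → ℂ) 0 ≠ 0 := by
  have : (0 : ℕ) ≠ m := by omega
  simp [this]

theorem moveLin_shear (hk : 2 ≤ k) {m : ℕ} (hm : 1 ≤ m) (t : ℂ) (u : Fin (k - 1) → ℂ) :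
    moveLin 0 (Pi.single 0 1 + t • Pi.single m 1) (ofP k u) = ofP k (shearP k m t u) :=
  moveLin_ofP hk (shear_ne_zero hm t) u

theorem shearP_apply (hk : 2 ≤ k) {m : ℕ} (hm : 1 ≤ m) (t : ℂ) (u : Fin (k - 1) → ℂ)
    (i : Fin (k - 1)) : shearP k m t u i = linP 0 (Pi.single 0 1 + t • Pi.single m 1)
      (pv (ofP k u)) 0 ⟨i.val, by omega⟩ := by
  have h1 := pc_ofP hk (shearP k m t u) i
  rw [← moveLin_shear hk hm, moveLin, pc_mk _ _ (by omega), extV_of_lt _ (by omega)] at h1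
  rw [← h1, show qv (ofP k u) = 0 from funext fun i => qc_ofP hk u i]

theorem shearP_zero (hk : 2 ≤ k) {m : ℕ} (hm : 1 ≤ m) : shearP k m 0 = 1 := by
  ext1 u
  funext i
  rw [shearP_apply hk hm, linP_of_one hk (B := 0) (fun _ _ => rfl)]
  · exact pc_ofP hk u i
  · intro n _
    simp [Pi.single_apply]

theorem hasDerivAt_shearP (hk : 2 ≤ k) {m : ℕ} (hm : 1 ≤ m) (u : Fin (k - 1) → ℂ)
    (i : Fin (k - 1)) : HasDerivAt (fun t => shearP k m t u i)
      (if m ≤ i.val then (k - (i.val - m : ℕ) : ℂ) * pc (ofP k u) (i.val - m) else 0) 0 := by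
  simp only [shearP_apply hk hm]
  have h1 := hasDerivAt_linP hk (B := fun _ => 0) (τ := fun t => Pi.single 0 1 + t • Pi.single m 1)
    (B' := 0) (τ' := Pi.single m 1) (fun _ => analyticAt_const)
    (fun n => by
      simp only [Pi.add_apply, Pi.smul_apply, smul_eq_mul]
      exact analyticAt_const.add (analyticAt_id.mul analyticAt_const))
    (fun _ _ => hasDerivAt_const _ _)
    (fun n _ => by
      simp only [Pi.add_apply, Pi.smul_apply, smul_eq_mul]
      exact hasDerivAt_affine _ _)
    (fun _ _ => rfl) (fun n _ => by simp [Pi.single_apply]) (pv (ofP k u)) 0 ⟨i.val, by omega⟩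
  refine h1.congr_deriv ?_
  simp only [Pi.zero_apply, mul_zero, add_zero]
  split_ifs with hmi
  · rw [sum_eq_single ⟨i.val - m, by omega⟩]
    · rw [if_pos (by simp), show i.val - (i.val - m) = m by omega]
      simp [pv]
    · intro j _ hj
      have : j.val ≠ i.val - m := fun h => hj (Fin.ext h)
      split_ifs with hji
      · rw [Pi.single_eq_of_ne (by omega)]; ring
      · rfl
    · simp
  · refine sum_eq_zero fun j _ => ?_
    split_ifs with hji
    · rw [Pi.single_eq_of_ne (by omega)]; ring
    · rfl

theorem commutator_obstruction (hk : 2 ≤ k) {ℓ : Target k →L[ℂ] ℂ} {p : Fin (k - 1) → ℂ}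
    (he : ∀ ξ, IsThetaV (image k) ξ → ℓ (𝒟 ξ 0 (ofP k p)) = 0) {m : ℕ} (hm : 1 ≤ m) :
    ∑ i ∈ range (k - 1), alpha ℓ i *
      (if m ≤ i then (k - (i - m : ℕ) : ℂ) * pc (ofP k p) (i - m) else 0) = 0 := by
  have hm0 : (m : ℂ) ≠ 0 := Nat.cast_ne_zero.2 (by omega)
  set E : (Fin (k - 1) → ℂ) →L[ℂ] (Fin (k - 1) → ℂ) := ContinuousLinearMap.pi fun i =>
    ((k : ℂ) - i.val) • prj i with hE
  have hEa : ∀ u i, E u i = ((k : ℂ) - i.val) * u i := fun u i => rfl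
  have hEu : ∀ u, euler 1 0 (ofP k u) = ofP k (E u) := by
    intro u
    refine target_ext (fun i hi => ?_) fun i hi => ?_
    · have h1 := pc_ofP hk u ⟨i, by omega⟩
      have h2 := pc_ofP hk (E u) ⟨i, by omega⟩
      simp only at h1 h2
      rw [euler, pc_mk _ _ hi, h1, h2, hEa]
      ring
    · rw [euler, qc_mk _ _ hi, qc_ofP hk, qc_ofP hk, mul_zero]
  have hAd : DifferentiableAt ℂ (shearP k m) 0 := differentiableAt_clm fun v =>
    differentiableAt_pi.2 fun i => (hasDerivAt_shearP hk hm v i).differentiableAt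
  set K := deriv (shearP k m) 0 with hK
  have hA : HasDerivAt (shearP k m) K 0 := hAd.hasDerivAt
  have hKa : ∀ u i, K u i =
      if m ≤ i.val then (k - (i.val - m : ℕ) : ℂ) * pc (ofP k u) (i.val - m) else 0 := by
    intro u i
    have h1 := hasDerivAt_pi.1 (hA.clm_apply (hasDerivAt_const 0 u)) i
    have h2 := h1.unique (hasDerivAt_shearP hk hm u i)
    simpa using h2
  have hone := shearP_zero hk hm
  have hR : HasDerivAt (fun t => Ring.inverse (shearP k m t)) (-K) 0 := by
    have h1 := hasFDerivAt_ringInverse (𝕜 := ℂ) (1 : ((Fin (k - 1) → ℂ) →L[ℂ] (Fin (k - 1) → ℂ))ˣ)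
    rw [Units.val_one, ← hone] at h1
    refine (h1.comp_hasDerivAt 0 hA).congr_deriv ?_
    simp
  have hg := hA.clm_apply (E.hasFDerivAt.comp_hasDerivAt 0 (hR.clm_apply (hasDerivAt_const 0 p)))
  have hL := (ℓ.comp (ofP k)).hasFDerivAt.comp_hasDerivAt 0 hg
  have hz : ∀ᶠ t in 𝓝 (0 : ℂ), ℓ (ofP k (shearP k m t (E (Ring.inverse (shearP k m t) p)))) = 0 := by
    have hu : ∀ᶠ t in 𝓝 (0 : ℂ), IsUnit (shearP k m t) :=
      hA.continuousAt.eventually (Units.isOpen.mem_nhds (by rw [hone]; exact isUnit_one))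
    filter_upwards [hu] with t ht
    obtain ⟨ξ, hξ, hv⟩ := (isThetaV_euler hk 1 0).exists_push_move hk 0 (shear_ne_zero hm t)
    have h1 := hv (ofP k (Ring.inverse (shearP k m t) p))
    have h2 : shearP k m t (Ring.inverse (shearP k m t) p) = p := by
      rw [← mul_apply_eq_comp, Ring.mul_inverse_cancel _ ht]
      rfl
    rw [moveLin_shear hk hm, h2, fderiv_euler hk, hEu, moveLin_shear hk hm] at h1
    rw [← h1]
    exact he ξ hξ
  have h3 := hL.unique ((hasDerivAt_const (0 : ℂ) (0 : ℂ)).congr_of_eventuallyEq hz)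
  have hinv : Ring.inverse (1 : (Fin (k - 1) → ℂ) →L[ℂ] (Fin (k - 1) → ℂ)) = 1 := Ring.inverse_one _
  simp only [Function.comp_apply, hone, hinv, one_apply_eq_self, map_zero, add_zero,
    ContinuousLinearMap.comp_apply, _root_.neg_apply, map_neg, map_add] at h3
  rw [linear_eq_sum hk, linear_eq_sum hk] at h3
  simp only [qc_ofP hk, zero_mul, sum_const_zero, add_zero] at h3
  rw [← sub_eq_add_neg, ← sum_sub_distrib] at h3
  refine (mul_eq_zero.1 (?_ : (m : ℂ) * _ = 0)).resolve_left hm0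
  rw [mul_sum]
  refine (sum_congr rfl fun i hi => ?_).trans h3
  rw [mem_range] at hi
  have g1 := pc_ofP hk (K (E p)) ⟨i, hi⟩
  have g2 := pc_ofP hk (E (K p)) ⟨i, hi⟩
  simp only at g1 g2
  rw [g1, g2, hEa, hKa, hKa]
  simp only
  split_ifs with hmi
  · have g3 := pc_ofP hk (E p) ⟨i - m, by omega⟩
    have g4 := pc_ofP hk p ⟨i - m, by omega⟩
    simp only at g3 g4
    rw [g3, g4, hEa]
    simp only
    rw [Nat.cast_sub hmi]
    ring
  · ring

/-- The two leading coefficients of a function of codimension two are not both nonzero. -/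
theorem leading_eq_zero (hk : 2 ≤ k) {h : Target k → Fin 1 → ℂ} {hh : Hol h 0}
    (h0 : h 0 = 0) (hc : codimVKe (image k) h hh = 2) (hw : 𝒟 h 0 (eW hk) 0 ≠ 0) :
    𝒟 h 0 eP[k] 0 = 0 := by
  by_contra ha
  obtain ⟨e, he0, he⟩ := exists_linear_obstruction h0 hc
  set ℓ : Target k →L[ℂ] ℂ := (prj (0 : Fin 1)).comp (𝒟 h 0) with hℓ
  have hℓa : ∀ v, ℓ v = 𝒟 h 0 v 0 := fun v => rfl
  have h1 : ∀ ξ, IsThetaV (image k) ξ → ℓ (𝒟 ξ 0 e) = 0 := by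
    intro ξ hξ
    have h2 := he _ _ (field_mem_tangent hh hξ)
    rw [fderiv_clm_apply hh.fderiv.differentiableAt hξ.1.differentiableAt] at h2
    rw [hℓa]
    simpa [hξ.zero] using h2
  have h2 : ℓ e = 0 := by
    have h3 := he _ _ (pull_mem_tangent (V := image k) hh 0 (ν := fun _ => fun _ => 1) analyticAt_const)
    rw [fderiv_fun_smul (analyticAt_pi_iff.1 hh 0).differentiableAt (differentiableAt_const _)] at h3
    rw [hℓa, ← h3, fderiv_apply hh.differentiableAt]
    simp
  have hq := qv_eq_zero_of_obstruction hk h1 ha hw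
  have hep : ofP k (toP k e) = e := ofP_toP hk hq
  have ha' : alpha ℓ (k - 2) ≠ 0 := by rwa [alpha, dif_pos (by omega)]
  have hp : ∀ j, j + 1 ≤ k - 2 → (k - j : ℂ) * pc e j = 0 := by
    refine triangular_eq_zero (x := fun j => (k - j : ℂ) * pc e j) ha' fun m _ hm => ?_
    have h3 := commutator_obstruction hk (ℓ := ℓ) (p := toP k e) (by rwa [hep]) hm
    rw [hep] at h3
    rwa [show k - 2 + 1 = k - 1 by omega]
  have hp' : ∀ j, j + 1 ≤ k - 2 → pc e j = 0 := fun j hj => by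
    refine (mul_eq_zero.1 (hp j hj)).resolve_left (sub_ne_zero.2 ?_)
    exact_mod_cast (by omega : k ≠ j)
  have hl : pc e (k - 2) = 0 := by
    have hq' : ∀ i : Fin k, qc e i = 0 := fun i => congrFun hq i
    rw [linear_eq_sum hk, show range (k - 1) = range (k - 2 + 1) by congr 1; omega,
      sum_range_succ,
      sum_eq_zero] at h2
    · simp only [hq', zero_mul, sum_const_zero, add_zero, zero_add] at h2
      exact (mul_eq_zero.1 h2).resolve_left ha'
    · intro i hi
      rw [mem_range] at hi
      rw [hp' i (by omega), mul_zero]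
  refine he0 (target_ext (fun i hi => ?_) fun i hi => ?_)
  · rw [pc_zero]
    rcases hi.eq_or_lt with rfl | hi
    · exact hl
    · exact hp' i (by omega)
  · rw [qc_zero]
    exact congrFun hq ⟨i, by omega⟩

/-- Functions of codimension two are equivalent to the functions in the list. -/
theorem classify_one (hk : 2 ≤ k) {h : Target k → Fin 1 → ℂ} {hh : Hol h 0} (h0 : h 0 = 0)
    (hc : codimVKe (image k) h hh = 2) : ∃ g, IsNormalFormOne k g ∧ VKEquiv (image k) h g := by
  suffices hs : ∃ g, IsNormalFormOne k g ∧ StrongEquiv (image k) (fun X => ![h X 0]) g by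
    obtain ⟨g, hg, hs⟩ := hs
    rw [vec_one] at hs
    exact ⟨g, hg, hs.vkEquiv⟩
  have ha := analyticAt_pi_iff.1 hh 0
  have h00 : h 0 0 = 0 := by rw [h0]; rfl
  have hd := fderiv_component hh 0
  have hsq : ∀ {g}, StrongEquiv (image k) (fun X => ![h X 0]) g → SqTangent (image k) g := by
    intro g hg
    rw [vec_one] at hg
    exact (sqTangent_of_codim h0 hc).of_strongEquiv h0 hg.symm
  by_cases hw : 𝒟 h 0 (eW hk) 0 = 0
  · obtain ⟨κ, hκ, hs⟩ := exists_nf_one hk ha h00 ((hd _).trans hw)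
      (by rw [hd]; exact leading_ne_zero hk h0 hc hw)
    have hκ0 := nf_one_coeff_ne_zero hk hκ (hsq hs)
    rcases hk.eq_or_lt with rfl | hk3
    · exact ⟨_, Or.inr (Or.inr (Or.inr (Or.inr ⟨rfl, rfl⟩))),
        (hs.trans (nf_one_normalize hk hκ hκ0 (c := -1) (by simp))).trans nf_one_of_eq_two⟩
    · refine ⟨_, Or.inl ⟨hk3, rfl⟩, ?_⟩
      have := hs.trans (nf_one_normalize hk hκ hκ0 one_ne_zero)
      simpa only [U_eq_pc (by omega : k - 2 ≠ 0), V_eq_qc (by omega : k - 1 ≠ 0), one_mul] using this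
  · have hl := leading_eq_zero hk h0 hc hw
    rcases hk.eq_or_lt with rfl | hk3
    · obtain ⟨κ, hκ, hκP, -, hs⟩ := exists_nf_two_of_eq_two ha h00 (by rw [hd]; exact hw)
        (by rw [hd]; exact hl)
      have hκ0 := nf_two_coeff_ne_zero_of_eq_two hκ (hsq hs)
      refine ⟨_, Or.inr (Or.inr (Or.inr (Or.inl ⟨rfl, rfl⟩))), ?_⟩
      have := hs.trans (nf_two_normalize_of_eq_two hκ hκ0 hκP)
      simpa only [V_eq_qc one_ne_zero, W₁_eq_pc, neg_sq] using this
    · have hb := second_ne_zero hk3 h0 hc hl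
      have hk3' : 3 ≤ k := hk3
      rcases hk3'.eq_or_lt with rfl | hk4
      · exact ⟨_, Or.inr (Or.inr (Or.inl ⟨rfl, rfl⟩)), (exists_nf_two_of_eq_three ha h00
          (by rw [hd]; exact hw) (by rw [hd]; exact hl) (by rw [hd]; exact hb)).trans three_form⟩
      · obtain ⟨κ, hκ, hκP, hs⟩ := exists_nf_two hk4 ha h00 (by rw [hd]; exact hw)
          (by rw [hd]; exact hl) (by rw [hd]; exact hb)
        have hκ0 := nf_two_coeff_ne_zero hk4 hκ (hsq hs)
        refine ⟨_, Or.inr (Or.inl ⟨hk4, rfl⟩), ?_⟩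
        have := hs.trans (nf_two_normalize hk4 hκ hκ0 hκP)
        simpa only [U_eq_pc (by omega : k - 2 ≠ 0), U_eq_pc (by omega : k - 3 ≠ 0),
          V_eq_qc (by omega : k - 1 ≠ 0), add_assoc] using this

theorem exists_kernel_two {a b c d : ℂ} (h : a * d - b * c = 0) :
    ∃ x y : ℂ, (x ≠ 0 ∨ y ≠ 0) ∧ a * x + b * y = 0 ∧ c * x + d * y = 0 := by
  obtain ⟨v, hv, h1⟩ := Matrix.exists_mulVec_eq_zero_iff.2
    (show (!![a, b; c, d] : Matrix (Fin 2) (Fin 2) ℂ).det = 0 by rw [Matrix.det_fin_two_of, h])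
  refine ⟨v 0, v 1, ?_, ?_, ?_⟩
  · by_contra! h2
    exact hv (by funext i; fin_cases i <;> simp [h2])
  · simpa [Matrix.mulVec, dotProduct] using congrFun h1 0
  · simpa [Matrix.mulVec, dotProduct] using congrFun h1 1

/-- The leading coefficients of a map with maximal tangent space are independent. -/
theorem MaxTangent.leading_det_ne_zero (hk : 2 ≤ k) {h : Target k → Fin 2 → ℂ}
    (hm : MaxTangent (image k) h) (h0 : h 0 = 0) : 𝒟 h 0 eP[k] 0 * 𝒟 h 0 (eW hk) 1 -
      𝒟 h 0 (eW hk) 0 * 𝒟 h 0 eP[k] 1 ≠ 0 := by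
  intro hdet
  set A := 𝒟 h 0 eP[k] with hA
  set B := 𝒟 h 0 (eW hk) with hB
  obtain ⟨x, y, hxy, h1, h2⟩ := exists_kernel_two hdet
  obtain ⟨l, l', hl, h3, -⟩ := exists_kernel_two (a := A 0) (b := A 1) (c := 0) (d := 0) (by ring)
  set v : Target k := x • eP[k] + y • eW hk with hv
  have hdv : 𝒟 h 0 v = x • A + y • B := by rw [hv, map_add, map_smul, map_smul]
  have hdv0 : ∀ i, 𝒟 h 0 v i = 0 := by
    intro i
    rw [hdv]
    fin_cases i
    · simpa [mul_comm] using h1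
    · simpa [mul_comm] using h2
  have key := hm.eq_zero h0 (fun m => ![l, l'] m • v)
    (fun i m => by rw [map_smul, Pi.smul_apply, hdv0, smul_zero]) fun ξ hξ => by
      have e1 : 𝒟 ξ 0 v = (x * (-(k - (k - 2 : ℕ) : ℂ) * dcoef hk ξ 0 1)) •
          eP[k] + (y * qc (𝒟 ξ 0 (eW hk)) (k - 1)) • eW hk := by
        rw [hv, map_add, map_smul, map_smul, hξ.fderiv_inl hk, sum_eq_single ⟨k - 2, by omega⟩,
          smul_smul, if_pos le_rfl, Nat.sub_self, zero_add]
        · rw [mul_smul y, ← hξ.fderiv_eW hk]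
        · intro i _ hi
          have : i.val ≠ k - 2 := fun h => hi (Fin.ext h)
          rw [if_neg, zero_smul]
          intro h
          have : k - 2 ≤ i.val := h
          omega
        · simp
      have h1' : x * A 0 + y * B 0 = 0 := by linear_combination h1
      have h2' : x * A 1 + y * B 1 = 0 := by linear_combination h2
      simp only [Fin.sum_univ_two, map_smul, e1, map_add, ← hA, ← hB, Pi.smul_apply, Pi.add_apply, smul_eq_mul, Matrix.cons_val_zero, Matrix.cons_val_one]
      generalize (-(k - (k - 2 : ℕ) : ℂ) * dcoef hk ξ 0 1) = c
      generalize qc (𝒟 ξ 0 (eW hk)) (k - 1) = c'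
      linear_combination (c - c') * x * h3 + l * c' * h1' + l' * c' * h2'
  have hpx : pcL k (k - 2) v = x := by simp [hv, eW, pc_add, pc_smul, pc_bas_inl hk, pc_bas_inr hk]
  have hqy : qcL k (k - 1) v = y := by simp [hv, eW, qc_add, qc_smul, qc_bas_inl hk, qc_bas_inr hk]
  have kk : ∀ m : Fin 2, ![l, l'] m * x = 0 ∧ ![l, l'] m * y = 0 := fun m => by
    have a1 := key m (pcL k (k - 2))
    have a2 := key m (qcL k (k - 1))
    rw [map_smul, hpx] at a1
    rw [map_smul, hqy] at a2
    exact ⟨a1, a2⟩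
  have k0 := kk 0
  have k1 := kk 1
  simp only [Matrix.cons_val_zero, Matrix.cons_val_one, mul_eq_zero] at k0 k1
  tauto

theorem sum_shift (N j : ℕ) (F : ℕ → ℕ → ℂ) (hF : ∀ n i, N ≤ i → F n i = 0) :
    ∑ i ∈ range N, (if j ≤ i then F (i - j) i else 0) = ∑ n ∈ range N, F n (j + n) := by
  have h1 : ∑ n ∈ range N, F n (j + n) =
      ∑ n ∈ range N, if j + n < N then F n (j + n) else 0 :=
    sum_congr rfl fun n _ => by
      split_ifs
      exacts [rfl, hF _ _ (by omega)]
  rw [h1, ← sum_filter, ← sum_filter]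
  refine sum_nbij' (fun i => i - j) (fun n => j + n) ?_ ?_ ?_ ?_ ?_
  · intro i hi; simp at hi ⊢; omega
  · intro i hi; simp at hi ⊢; omega
  · intro i hi; simp at hi ⊢; omega
  · intro i hi; simp
  · intro i hi
    simp at hi
    rw [show j + (i - j) = i by omega]

theorem MaxTangent.eq_zero_of_moments (hk : 2 ≤ k) (hg : Hol g 0)
    (g0 : g 0 = 0) (hm : MaxTangent (image k) fun X => ![pc X (k - 2), g X])
    (hw : 𝒟 g 0 (eW hk) ≠ 0) {z : ℕ → ℂ} (hz : z (k - 2) = 0)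
    (h1 : ∑ j ∈ range (k - 1), alpha (𝒟 g 0) j * z j = 0)
    (h2 : ∑ j ∈ range (k - 1), alpha (𝒟 g 0) j * ((k - j : ℂ) * z j) = 0)
    {j : ℕ} (hj : j ≤ k - 2) : z j = 0 := by
  set ℓ := 𝒟 g 0 with hℓ
  have hh : Hol (fun X : Target k => (![pc X (k - 2), g X] : Fin 2 → ℂ)) 0 := by
    refine analyticAt_pi_iff.2 fun i => ?_
    fin_cases i
    · exact (pcL k (k - 2)).analyticAt 0
    · exact hg
  have d0 : ∀ v, 𝒟 (fun X : Target k => (![pc X (k - 2), g X] : Fin 2 → ℂ)) 0 v 0 =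
      pc v (k - 2) := fun v => by
    rw [← fderiv_component hh 0]
    exact congrArg (fun L : Target k →L[ℂ] ℂ => L v) (pcL k (k - 2)).fderiv
  have d1 : ∀ v, 𝒟 (fun X : Target k => (![pc X (k - 2), g X] : Fin 2 → ℂ)) 0 v 1 = ℓ v :=
    fun v => by rw [← fderiv_component hh 1]; rfl
  have hkj : ∀ j, j ≤ k - 2 → (k - j : ℂ) ≠ 0 := fun j hj =>
    sub_ne_zero.2 (by exact_mod_cast (by omega : k ≠ j))
  set x : ℕ → ℂ := fun j => -(k - j : ℂ)⁻¹ *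
    ∑ i ∈ range (k - 1), alpha ℓ (i + (k - 2 - j)) * ((k - i : ℂ) * z i) with hx
  have hxl : x (k - 2) = 0 := by simp only [hx, Nat.sub_self, add_zero, h2, mul_zero]
  set e2 : Target k := mk k z 0 with he2
  set u : Target k := mk k x 0 with hu
  set e1 : Target k := u + (-(ℓ u) / ℓ (eW hk)) • eW hk with he1
  have hqu : ∀ y : ℕ → ℂ, ∀ i : Fin k, qc (mk k y 0) i = 0 := fun y i => qc_mk _ _ (by omega)
  have hlin : ∀ (L : Target k →L[ℂ] ℂ) (y : ℕ → ℂ), L (mk k y 0) =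
      ∑ i ∈ range (k - 1), alpha L i * y i := by
    intro L y
    rw [linear_eq_sum hk, sum_eq_zero (s := (univ : Finset (Fin k))), add_zero]
    · refine sum_congr rfl fun i hi => ?_
      rw [mem_range] at hi
      rw [pc_mk _ _ (by omega)]
    · intro i _
      rw [hqu, zero_mul]
  have he2l : ℓ e2 = 0 := by rw [he2, hlin, h1]
  have key := hm.eq_zero (by funext i; fin_cases i <;> simp [pc_zero, g0]) ![e1, e2] ?_ ?_ 1 (pcL k j)
  · simpa [he2, pc_mk z 0 hj] using key
  · intro i m
    fin_cases i <;> fin_cases m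
    · refine (d0 e1).trans ?_
      rw [he1, pc_add, pc_smul, hu, pc_mk _ _ le_rfl, hxl, eW, pc_bas_inr hk]
      ring
    · refine (d0 e2).trans ?_
      rw [he2, pc_mk _ _ le_rfl, hz]
    · refine (d1 e1).trans ?_
      rw [he1, map_add, map_smul, smul_eq_mul]
      field_simp
      ring
    · refine (d1 e2).trans ?_
      rw [he2l]
  · intro ξ hξ
    rw [Fin.sum_univ_two, d0, d1]
    change pc (𝒟 ξ 0 e1) (k - 2) + ℓ (𝒟 ξ 0 e2) = 0
    have s1 : pc (𝒟 ξ 0 e1) (k - 2) = ∑ i ∈ range (k - 1),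
        (-(k - i : ℂ) * dcoef hk ξ 0 (k - 2 - i + 1)) * x i := by
      rw [he1, map_add, map_smul, pc_add, pc_smul, hξ.pc_fderiv_eW hk le_rfl, mul_zero, add_zero]
      have := hlin ((pcL k (k - 2)).comp (𝒟 ξ 0)) x
      rw [ContinuousLinearMap.comp_apply, pcL_apply] at this
      rw [hu, this]
      refine sum_congr rfl fun i hi => ?_
      rw [mem_range] at hi
      rw [alpha, dif_pos hi, ContinuousLinearMap.comp_apply, pcL_apply,
        hξ.pc_fderiv_inl hk _ le_rfl, if_pos (by simp; omega)]
    have s2 : ℓ (𝒟 ξ 0 e2) = ∑ i ∈ range (k - 1), (-(k - i : ℂ) *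
        ∑ n ∈ range (k - 1), dcoef hk ξ 0 (n + 1) * alpha ℓ (i + n)) * z i := by
      have := hlin (ℓ.comp (𝒟 ξ 0)) z
      rw [ContinuousLinearMap.comp_apply] at this
      rw [he2, this]
      refine sum_congr rfl fun i hi => ?_
      rw [mem_range] at hi
      rw [alpha, dif_pos hi, ContinuousLinearMap.comp_apply, hξ.fderiv_inl hk, map_sum,
        ← sum_shift (k - 1) i (fun n m => dcoef hk ξ 0 (n + 1) * alpha ℓ m)
          (fun n m hm => by rw [alpha, dif_neg (by omega), mul_zero]), sum_range,
          mul_sum]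
      congr 1
      refine sum_congr rfl fun l _ => ?_
      rw [map_smul, smul_eq_mul, alpha, dif_pos l.isLt]
      simp only [Fin.le_def]
      split_ifs <;> ring
    have s3 : ∑ i ∈ range (k - 1), (-(k - i : ℂ) * dcoef hk ξ 0 (k - 2 - i + 1)) * x i =
        ∑ n ∈ range (k - 1), dcoef hk ξ 0 (n + 1) *
          ∑ i ∈ range (k - 1), alpha ℓ (i + n) * ((k - i : ℂ) * z i) := by
      rw [← sum_range_reflect]
      refine sum_congr rfl fun n hn => ?_
      rw [mem_range] at hn
      have e1 : k - 1 - 1 - n ≤ k - 2 := by omega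
      have e2 : k - 2 - (k - 1 - 1 - n) = n := by omega
      have e3 := hkj _ e1
      simp only [hx, e2]
      field_simp
    rw [s1, s2, s3]
    simp only [mul_sum, sum_mul]
    rw [sum_comm, ← sum_add_distrib]
    refine sum_eq_zero fun i _ => ?_
    rw [← sum_add_distrib]
    refine sum_eq_zero fun n _ => ?_
    ring

/-- A pair with maximal tangent space can be brought to the form `(pc (k - 2), g)`. -/
theorem MaxTangent.exists_pair (hk : 2 ≤ k) {h : Target k → Fin 2 → ℂ}
    (hm : MaxTangent (image k) h) (h0 : h 0 = 0) :
    ∃ g : Target k → ℂ, Hol g 0 ∧ g 0 = 0 ∧ 𝒟 g 0 (eW hk) ≠ 0 ∧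
      StrongEquiv (image k) h (fun X => ![pc X (k - 2), g X]) := by
  have hh := hm.1
  have hΔ := hm.leading_det_ne_zero hk h0
  have c0 := analyticAt_pi_iff.1 hh 0
  have c1 := analyticAt_pi_iff.1 hh 1
  have dc := fderiv_component hh
  set A := 𝒟 h 0 eP[k] with hA
  set B := 𝒟 h 0 (eW hk) with hB
  set Δ := A 0 * B 1 - B 0 * A 1 with hΔ'
  set g₁ : Target k → ℂ := fun X => B 1 * h X 0 - B 0 * h X 1 with hg₁
  set g₂ : Target k → ℂ := fun X => -A 1 * h X 0 + A 0 * h X 1 with hg₂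
  have a1 : Hol g₁ 0 := (analyticAt_const.mul c0).sub (analyticAt_const.mul c1)
  have a2 : Hol g₂ 0 := (analyticAt_const.mul c0).add (analyticAt_const.mul c1)
  have z1 : g₁ 0 = 0 := by simp [hg₁, h0]
  have z2 : g₂ 0 = 0 := by simp [hg₂, h0]
  have d1 : ∀ v, 𝒟 g₁ 0 v = B 1 * 𝒟 h 0 v 0 - B 0 * 𝒟 h 0 v 1 := fun v => by
    rw [← dc, ← dc]
    exact congrArg (fun L : Target k →L[ℂ] ℂ => L v)
      ((c0.differentiableAt.hasFDerivAt.const_mul (B 1)).sub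
        (c1.differentiableAt.hasFDerivAt.const_mul (B 0))).fderiv
  have s1 : StrongEquiv (image k) h (fun X => ![g₁ X, g₂ X]) := by
    have := strongEquiv_linear_two (V := image k) (f₁ := fun X => h X 0) (f₂ := fun X => h X 1)
      (g₁ := g₁) (g₂ := g₂) (A 0 / Δ) (B 0 / Δ) (A 1 / Δ) (B 1 / Δ)
      (by rw [show A 0 / Δ * (B 1 / Δ) - B 0 / Δ * (A 1 / Δ) = Δ / Δ / Δ by rw [hΔ']; ring]
          rw [div_self hΔ]
          exact one_div_ne_zero hΔ)
      (fun X => by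
        simp only [hg₁, hg₂]
        field_simp
        rw [hΔ']
        ring)
      (fun X => by
        simp only [hg₁, hg₂]
        field_simp
        rw [hΔ']
        ring)
    rwa [vec_two] at this
  obtain ⟨κ, hκ, ψ, hψ, hV, M, hM, hM0, he⟩ := exists_nf_one hk a1 z1
    ((d1 (eW hk)).trans (by rw [← hB]; ring))
    (by rw [d1, ← hA]; convert hΔ using 1; rw [hΔ']; ring)
  set n : Target k → ℂ := fun X => pc X (k - 2) + κ X * qc X (k - 1) ^ 2 with hn
  obtain ⟨φ, hφ, l1, l2, lV⟩ := hψ.exists_inverse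
  set f : Target k → ℂ := fun X => g₂ (φ X) with hf
  have af : Hol f 0 := analyticAt_comp_zero a2 hφ.1 hφ.2.1
  have zf : f 0 = 0 := by rw [hf]; simp only [hφ.2.1, z2]
  have s2 : StrongEquiv (image k) (fun X => ![g₁ X, g₂ X]) (fun X => ![n X, f X]) := by
    refine strongEquiv_two (a := fun X => M X 0 0) (b := fun _ => 0) (c := fun _ => 0)
      (d := fun _ => 1) hψ hV (hM 0 0) analyticAt_const analyticAt_const analyticAt_const ?_ ?_ ?_
    · simpa [Matrix.det_fin_one] using hM0
    · filter_upwards [he] with X hX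
      have := congrFun hX 0
      simpa [Matrix.mulVec, dotProduct] using this
    · filter_upwards [l1] with X hX
      simp [hf, hX]
  have an : Hol n 0 := ((pcL k (k - 2)).analyticAt 0).add
    (hκ.mul (((qcL k (k - 1)).analyticAt 0).pow 2))
  have zn : n 0 = 0 := by simp [hn, pc_zero, qc_zero]
  have dn : 𝒟 n 0 = pcL k (k - 2) := by
    have := ((pcL k (k - 2)).hasFDerivAt (x := 0)).add
      (hκ.differentiableAt.hasFDerivAt.mul ((qcL k (k - 1)).hasFDerivAt.pow 2))
    exact this.fderiv.trans (by rw [map_zero]; ext v; simp)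
  have hm2 := hm.of_strongEquiv h0 (s1.trans s2).symm
  have znf : (![n 0, f 0] : Fin 2 → ℂ) = 0 := by simp [zn, zf]
  have hΔ2 := hm2.leading_det_ne_zero hk znf
  have dnf : ∀ v, 𝒟 (fun X : Target k => (![n X, f X] : Fin 2 → ℂ)) 0 v 0 = pc v (k - 2) :=
    fun v => by
      rw [← fderiv_component hm2.1 0]
      exact congrArg (fun L : Target k →L[ℂ] ℂ => L v) dn
  rw [dnf, dnf, eW, pc_bas_inr hk, zero_mul, sub_zero] at hΔ2
  have hfw := right_ne_zero_of_mul hΔ2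
  obtain ⟨g, ag, zg, dg, s3⟩ := exists_pair_of_fderiv hk hm2.1 znf dnf hfw
  exact ⟨g, ag, zg, by rw [dg]; exact hfw, (s1.trans s2).trans s3⟩

theorem MaxTangent.alpha_ne_zero (hk : 2 ≤ k) (hg : Hol g 0)
    (g0 : g 0 = 0) (hm : MaxTangent (image k) fun X => ![pc X (k - 2), g X])
    (hw : 𝒟 g 0 (eW hk) ≠ 0) {i : ℕ} (hi : i < k - 2) : alpha (𝒟 g 0) i ≠ 0 := by
  intro h
  have h1 : ∀ c : ℕ → ℂ, ∑ j ∈ range (k - 1),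
      alpha (𝒟 g 0) j * (c j * (Pi.single i 1 : ℕ → ℂ) j) = 0 := fun c =>
    sum_eq_zero fun j _ => by
      rcases eq_or_ne j i with rfl | hj
      · rw [h, zero_mul]
      · rw [Pi.single_eq_of_ne hj, mul_zero, mul_zero]
  have := hm.eq_zero_of_moments hk hg g0 hw (z := Pi.single i 1)
    (Pi.single_eq_of_ne (by omega) _) (by simpa using h1 fun _ => 1) (h1 _) hi.le
  simp at this

theorem MaxTangent.le_four (hk : 2 ≤ k) (hg : Hol g 0)
    (g0 : g 0 = 0) (hm : MaxTangent (image k) fun X => ![pc X (k - 2), g X])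
    (hw : 𝒟 g 0 (eW hk) ≠ 0) : k ≤ 4 := by
  by_contra! h5
  have ha := fun i (hi : i < k - 2) => hm.alpha_ne_zero hk hg g0 hw hi
  obtain ⟨m, rfl⟩ : ∃ m, k = m + 5 := ⟨k - 5, by omega⟩
  set a := alpha (𝒟 g 0) with haa
  have b0 := ha 0 (by omega)
  have b1 := ha 1 (by omega)
  have b2 := ha 2 (by omega)
  set z : ℕ → ℂ := fun j => if j = 0 then (a 0)⁻¹ else if j = 1 then -2 * (a 1)⁻¹ else
    if j = 2 then (a 2)⁻¹ else 0 with hz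
  have hs : ∀ c : ℕ → ℂ, ∑ j ∈ range (m + 5 - 1), a j * (c j * z j) =
      c 0 - 2 * c 1 + c 2 := fun c => by
    rw [show m + 5 - 1 = m + 1 + 1 + 1 + 1 by omega, sum_range_succ', sum_range_succ',
      sum_range_succ', sum_eq_zero]
    · simp [hz]
      field_simp
      ring
    · intro j _
      simp [hz]
  have := hm.eq_zero_of_moments hk hg g0 hw (z := z) (j := 0) (by simp [hz])
    (by simpa using (hs fun _ => 1).trans (by norm_num)) ((hs _).trans (by push_cast; ring)) (by omega)
  exact b0 (by simpa [hz] using this)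

/-- Pairs of codimension two are equivalent to the pairs in the list. -/
theorem classify_two (hk : 2 ≤ k) {h : Target k → Fin 2 → ℂ} {hh : Hol h 0} (h0 : h 0 = 0)
    (hc : codimVKe (image k) h hh = 2) : ∃ g, IsNormalFormTwo k g ∧ VKEquiv (image k) h g := by
  have hm := maxTangent_of_codim h0 (hc.trans Nat.cast_ofNat.symm)
  obtain ⟨g, ag, zg, hw, hs⟩ := hm.exists_pair hk h0
  have hm' := hm.of_strongEquiv h0 hs.symm
  have hk4 := hm'.le_four hk ag zg hw
  have ha := fun i (hi : i < k - 2) => hm'.alpha_ne_zero hk ag zg hw hi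
  interval_cases k
  · exact ⟨_, Or.inl ⟨rfl, rfl⟩, (hs.trans (pair_form_two ag zg hw)).vkEquiv⟩
  · have b0 := ha 0 (by omega)
    rw [alpha, dif_pos (by omega)] at b0
    exact ⟨_, Or.inr (Or.inl ⟨rfl, rfl⟩), (hs.trans (pair_form_three ag zg hw b0)).vkEquiv⟩
  · have b0 := ha 0 (by omega)
    have b1 := ha 1 (by omega)
    rw [alpha, dif_pos (by omega)] at b0 b1
    exact ⟨_, Or.inr (Or.inr ⟨rfl, rfl⟩), (hs.trans (pair_form_four ag zg hw b0 b1)).vkEquiv⟩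

end

end CrossCap

theorem theorem4p6 (k : ℕ) (hk : 2 ≤ k) :
    (∀ (q : ℕ) (h : CrossCap.Target k → Fin q → ℂ) (hh : AnalyticAt ℂ h 0), h 0 = 0 →
      CrossCap.codimVKe (CrossCap.image k) h hh = 2 → q ≤ 2) ∧
    (∀ (h : CrossCap.Target k → Fin 1 → ℂ) (hh : AnalyticAt ℂ h 0), h 0 = 0 →
      CrossCap.codimVKe (CrossCap.image k) h hh = 2 →
        ∃ g, CrossCap.IsNormalFormOne k g ∧ CrossCap.VKEquiv (CrossCap.image k) h g) ∧
    (∀ g, CrossCap.IsNormalFormOne k g → CrossCap.VKDetermined (CrossCap.image k) 2 g) ∧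
    (∀ (h : CrossCap.Target k → Fin 2 → ℂ) (hh : AnalyticAt ℂ h 0), h 0 = 0 →
      CrossCap.codimVKe (CrossCap.image k) h hh = 2 →
        ∃ g, CrossCap.IsNormalFormTwo k g ∧ CrossCap.VKEquiv (CrossCap.image k) h g) ∧
    (∀ g, CrossCap.IsNormalFormTwo k g → CrossCap.VKDetermined (CrossCap.image k) 2 g) := by
  refine ⟨fun q h hh h0 hc => CrossCap.le_of_codim h0 (hc.trans Nat.cast_ofNat.symm),
    fun h hh h0 hc => CrossCap.classify_one hk h0 hc, fun g hg => CrossCap.determined_one hk hg,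
    fun h hh h0 hc => CrossCap.classify_two hk h0 hc, fun g hg => CrossCap.determined_two hg⟩
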